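/- **Setting.** Let $d,n\ge 1$, let $\Omega\subset\mathbb R^d$ be a bounded domain with smooth boundary, and let $\Gamma_0\subset\Omega$ be a non-empty closed (compact, without boundary) smooth hypersurface such that $\Omega$ is the disjoint union of $\Gamma_0$ and of two open sets $\Omega_0^+,\Omega_0^-$ lying on the two sides of $\Gamma_0$. Let $\mathrm d_{\Gamma_0}$ be the signed distance to $\Gamma_0$ (positive in $\Omega_0^+$, negative in $\Omega_0^-$) and $B_r(\Gamma_0)=\{x\in\Omega:|\mathrm d_{\Gamma_0}(x)|<r\}$. Let $\delta_\Gamma\in(0,1)$ be such that the nearest-point projection $B_{\delta_\Gamma}(\Gamma_0)\to\Gamma_0$ is well defined and smooth and $\Gamma_0$ has distance at least $\delta_\Gamma$ from $\partial\Omega$. Let $\mathbb M_n$ be the real $n\times n$ matrices with the Frobenius norm $\|\cdot\|$ and $\mathbb O_n^\pm$ the orthogonal matrices of determinant $\pm1$. **Modulated energy.** Put $F(A)=\frac14\|AA^\top-I\|^2$, $\rho^\pm(A)=\operatorname{dist}(A,\mathbb O_n^\pm)$, $\rho=\min\{\rho^+,\rho^-\}$, $\tilde f(r)=\frac14r^2(2-r)^2$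 for $0\le r\le1$ and $\tilde f(r)=\frac14$ for $r\ge1$, $c=2\int_0^1\sqrt{2\tilde f}$, and $$\mathrm d_{\tilde F}(A)=\begin{cases}\int_0^{\rho^-(A)}\sqrt{2\tilde f(r)}\,dr,&\rho^-(A)\le1,\\ c/2,&\rho(A)\ge1,\\ c-\int_0^{\rho^+(A)}\sqrt{2\tilde f(r)}\,dr,&\rho^+(A)\le1.\end{cases}$$ Fix a smooth $\phi\ge0$ on $\mathbb M_n$ with support in the open unit ball, $\int\phi=1$ and $\phi(UAV^\top)=\phi(A)$ for all orthogonal $U,V$; let $\phi_\varepsilon(A)=\varepsilon^{-5n^2}\phi(\varepsilon^{-5}A)$ and $\mathrm d^\varepsilon_{\tilde F}=\phi_\varepsilon*\mathrm d_{\tilde F}$. Fix an even smooth $\psi:\mathbb R\to[0,\infty)$ with $\psi>0$ on $(-1,1)$, $\psi(s)=0$ for $s\ge1$, and $1-4s^2\le\psi(s)\le1-\frac12s^2$ for $|s|<\frac12$; let $\xi=\psi(\mathrm d_{\Gamma_0}/\delta_\Gamma)\nabla\mathrm d_{\Gamma_0}$. For $A\in H^1(\Omega;\mathbb M_n)\cap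 L^\infty$ let $$E_\varepsilon[A|\Gamma_0]=\int_\Omega\Big(\tfrac\varepsilon2\|\nabla A\|^2+\tfrac1\varepsilon\big(F(A)+\varepsilon^4\big)-(\xi\cdot\nabla)\,\mathrm d^\varepsilon_{\tilde F}(A)\Big)dx .$$ **Statement.** Let $0<\delta<\delta_\Gamma/2$ and let $A_\pm^{in}\in H^1(\Omega_0^\pm;\mathbb O_n^\pm)$ have traces on $\Gamma_0$ with $\|A_+^{in}-A_-^{in}\|=2$ for $\mathcal H^{d-1}$-a.e. $x\in\Gamma_0$ (equivalently, the traces form a minimal pair: they differ by a reflection $I-2\mathbf n\mathbf n^\top$, $|\mathbf n|=1$). Then there are a constant $C>0$ independent of $\varepsilon$ and initial data $A_\varepsilon^{in}$, $0<\varepsilon\le1$, such that for every $\varepsilon\in(0,1]$: 1. $A_\varepsilon^{in}\in H^1(\Omega;\mathbb M_n)\cap L^\infty(\Omega)$; 2. $A_\varepsilon^{in}=A_\pm^{in}$ a.e. in $\Omega_0^\pm\setminus B_{2\delta}(\Gamma_0)$; 3. the integrand of $E_\varepsilon[A_\varepsilon^{in}|\Gamma_0]$ is integrable and $E_\varepsilon[A_\varepsilon^{in}|\Gamma_0]\le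 C\varepsilon$. Moreover the data can be chosen of the form $$A_\varepsilon^{in}=(1-S_\varepsilon)A_0^-+S_\varepsilon A_0^+,\qquad S_\varepsilon=\eta\, s\big(\mathrm d_{\Gamma_0}/\varepsilon\big)+(1-\eta)\chi_{\Omega_0^+},\qquad s(z)=1-(1+e^{\sqrt2z})^{-1},$$ where, independently of $\varepsilon$, $A_0^\pm\in H^1(\Omega_0^\pm\cup B_\delta(\Gamma_0);\mathbb O_n^\pm)$ have the same traces on $\Gamma_0$ as $A_\pm^{in}$ (so that on $\Gamma_0$ they differ by a reflection), and $\eta\in C_c^\infty(B_\delta(\Gamma_0);[0,1])$ equals $1$ on $B_{\delta/2}(\Gamma_0)$. -/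

import Mathlib

open MeasureTheory Set Filter Topology
open scoped ContDiff Matrix.Norms.Frobenius

namespace AllenCahn

/-- The Euclidean space `ℝ^d`. -/
abbrev Euc (d : ℕ) : Type := EuclideanSpace ℝ (Fin d)

/-- Real `n × n` matrices; the norm in force is the Frobenius norm. -/
abbrev Mat (n : ℕ) : Type := Matrix (Fin n) (Fin n) ℝ

/-! ### Sobolev functions and traces -/

section Sobolev

variable {d : ℕ} {V : Type*} [NormedAddCommGroup V] [NormedSpace ℝ V]

/-- `G = (G₁, …, G_d)` is the weak (distributional) gradient of `u` on the open set `U`. -/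
def HasWeakGrad (U : Set (Euc d)) (u : Euc d → V) (G : Fin d → Euc d → V) : Prop :=
  LocallyIntegrableOn u U ∧
  (∀ i, LocallyIntegrableOn (G i) U) ∧
  ∀ (i : Fin d) (φ : Euc d → ℝ), ContDiff ℝ ∞ φ → HasCompactSupport φ → tsupport φ ⊆ U →
    ∫ x in U, (fderiv ℝ φ x (EuclideanSpace.single i 1)) • u x = - ∫ x in U, φ x • G i x

open Classical in
/-- The weak gradient of `u` on `U` (unique up to null sets; `0` if there is none). -/
noncomputable def weakGrad (U : Set (Euc d)) (u : Euc d → V) : Fin d → Euc d → V :=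
  if h : ∃ G, HasWeakGrad U u G then h.choose else 0

/-- `u ∈ H¹(U)`. -/
def MemH1 (U : Set (Euc d)) (u : Euc d → V) : Prop :=
  MemLp u 2 (volume.restrict U) ∧
  ∃ G, HasWeakGrad U u G ∧ ∀ i, MemLp (G i) 2 (volume.restrict U)

/-- `T` is the trace on `Γ` of the function `u` given on `U`: at `ℋ^{d-1}`-almost every point
`x` of `Γ` the mean of `‖u - T x‖` over `U ∩ B_r(x)` tends to `0` as `r ↓ 0`. -/
def IsTraceOn (U Γ : Set (Euc d)) (u T : Euc d → V) : Prop :=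
  ∀ᵐ x ∂((Measure.hausdorffMeasure ((d : ℝ) - 1) : Measure (Euc d)).restrict Γ),
    Tendsto (fun r : ℝ => ⨍ y in Metric.ball x r ∩ U, ‖u y - T x‖) (𝓝[>] 0) (𝓝 0)

end Sobolev

/-! ### Domain and interface -/

section Geometry

variable {d : ℕ}

/-- A bounded domain of `ℝ^d` with smooth boundary: near every boundary point, the domain is the
set where some smooth function with non-vanishing gradient is positive. -/
structure IsSmoothBoundedDomain (Ω : Set (Euc d)) : Prop where
  isOpen : IsOpen Ω
  isConnected : IsConnected Ω
  isBounded : Bornology.IsBounded Ω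
  smooth_boundary : ∀ p ∈ frontier Ω, ∃ (r : ℝ) (g : Euc d → ℝ), 0 < r ∧ ContDiff ℝ ∞ g ∧
    gradient g p ≠ 0 ∧
    ∀ x ∈ Metric.ball p r, (x ∈ Ω ↔ 0 < g x) ∧ (x ∈ frontier Ω ↔ g x = 0)

/-- `Γ` is a non-empty closed (that is, compact and without boundary) smooth hypersurface inside
`Ω`, and `Ω` is the disjoint union of `Γ` and of the open sets `Ωp` and `Ωm`, which lie on the two
sides of `Γ`. -/
structure IsSmoothInterface (Ω Ωp Ωm Γ : Set (Euc d)) : Prop where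
  isOpen_plus : IsOpen Ωp
  isOpen_minus : IsOpen Ωm
  isCompact : IsCompact Γ
  nonempty : Γ.Nonempty
  union_eq : Ωp ∪ Γ ∪ Ωm = Ω
  disjoint_plus_minus : Disjoint Ωp Ωm
  disjoint_plus : Disjoint Ωp Γ
  disjoint_minus : Disjoint Ωm Γ
  smooth : ∀ p ∈ Γ, ∃ (r : ℝ) (g : Euc d → ℝ), 0 < r ∧ ContDiff ℝ ∞ g ∧
    gradient g p ≠ 0 ∧
    ∀ x ∈ Metric.ball p r, (x ∈ Ωp ↔ 0 < g x) ∧ (x ∈ Γ ↔ g x = 0) ∧ (x ∈ Ωm ↔ g x < 0)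

open Classical in
/-- The signed distance to `Γ`: positive in `Ωp`, negative in `Ωm`. -/
noncomputable def signedDist (Ωp Γ : Set (Euc d)) (x : Euc d) : ℝ :=
  if x ∈ Ωp then Metric.infDist x Γ else - Metric.infDist x Γ

/-- The `δ`-neighbourhood of `Γ` in `Ω`. -/
def tube (Ω Ωp Γ : Set (Euc d)) (δ : ℝ) : Set (Euc d) :=
  {x ∈ Ω | |signedDist Ωp Γ x| < δ}

/-- The nearest-point projection onto `Γ` is well defined and smooth on the `δΓ`-neighbourhood of
`Γ`, and `Γ` is at least `δΓ` away from the boundary of `Ω`. -/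
structure IsTubularRadius (Ω Ωp Γ : Set (Euc d)) (δΓ : ℝ) : Prop where
  pos : 0 < δΓ
  lt_one : δΓ < 1
  smooth_projection : ∃ P : Euc d → Euc d, ContDiffOn ℝ ∞ P (tube Ω Ωp Γ δΓ) ∧
    ∀ x ∈ tube Ω Ωp Γ δΓ, P x ∈ Γ ∧ dist x (P x) = Metric.infDist x Γ ∧
      ∀ y ∈ Γ, dist x y = Metric.infDist x Γ → y = P x
  away : ∀ x ∈ Γ, ∀ y ∈ frontier Ω, δΓ ≤ dist x y

/-- The cut-off profiles that are used to extend the normal field. -/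
structure IsCutoffProfile (ψ : ℝ → ℝ) : Prop where
  smooth : ContDiff ℝ ∞ ψ
  nonneg : ∀ s, 0 ≤ ψ s
  even : ∀ s, ψ (-s) = ψ s
  pos : ∀ s, |s| < 1 → 0 < ψ s
  eq_zero : ∀ s, 1 ≤ s → ψ s = 0
  lower : ∀ s, |s| < 1 / 2 → 1 - 4 * s ^ 2 ≤ ψ s
  upper : ∀ s, |s| < 1 / 2 → ψ s ≤ 1 - s ^ 2 / 2

/-- The extended normal vector field `ξ = ψ(d_Γ / δΓ) ∇ d_Γ`. -/
noncomputable def normalField (ψ : ℝ → ℝ) (Ωp Γ : Set (Euc d)) (δΓ : ℝ) (x : Euc d) : Euc d :=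
  ψ (signedDist Ωp Γ x / δΓ) • gradient (signedDist Ωp Γ) x

end Geometry

/-! ### The potential and the quasi-distance function -/

section Potential

variable {n : ℕ}

/-- The orthogonal matrices of determinant `1`. -/
def orthPlus (n : ℕ) : Set (Mat n) :=
  {A | A ∈ Matrix.orthogonalGroup (Fin n) ℝ ∧ A.det = 1}

/-- The orthogonal matrices of determinant `-1`. -/
def orthMinus (n : ℕ) : Set (Mat n) :=
  {A | A ∈ Matrix.orthogonalGroup (Fin n) ℝ ∧ A.det = -1}

/-- The potential `F(A) = ¼ ‖A Aᵀ - I‖²`. -/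
noncomputable def potential (A : Mat n) : ℝ := 1 / 4 * ‖A * A.transpose - 1‖ ^ 2

/-- The distance `ρ⁺` to the orthogonal matrices of determinant `1`. -/
noncomputable def rhoPlus (A : Mat n) : ℝ := Metric.infDist A (orthPlus n)

/-- The distance `ρ⁻` to the orthogonal matrices of determinant `-1`. -/
noncomputable def rhoMinus (A : Mat n) : ℝ := Metric.infDist A (orthMinus n)

/-- The one-dimensional quasi-potential profile, for `ρ ≥ 0`. -/
noncomputable def quasiProfile (ρ : ℝ) : ℝ :=
  if ρ ≤ 1 then 1 / 4 * ρ ^ 2 * (2 - ρ) ^ 2 else 1 / 4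

/-- The surface tension coefficient. -/
noncomputable def surfaceTension : ℝ := 2 * ∫ ρ in (0 : ℝ)..1, Real.sqrt (2 * quasiProfile ρ)

open Classical in
/-- The quasi-distance function; its three cases agree where they overlap. -/
noncomputable def quasiDist (A : Mat n) : ℝ :=
  if rhoMinus A ≤ 1 then ∫ ρ in (0 : ℝ)..(rhoMinus A), Real.sqrt (2 * quasiProfile ρ)
  else if rhoPlus A ≤ 1 then
    surfaceTension - ∫ ρ in (0 : ℝ)..(rhoPlus A), Real.sqrt (2 * quasiProfile ρ)
  else surfaceTension / 2

/-- The mollifying kernels on the space of matrices: smooth, non-negative, supported in the unit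
ball, of unit mass, and invariant under orthogonal matrices acting on the left and the right.
The integral is the Lebesgue integral over the `n²` entries. -/
structure IsMollifier (φ : Mat n → ℝ) : Prop where
  smooth : ContDiff ℝ ∞ φ
  nonneg : ∀ A, 0 ≤ φ A
  support : tsupport φ ⊆ Metric.ball 0 1
  mass : ∫ B : Fin n → Fin n → ℝ, φ (Matrix.of B) = 1
  invariant : ∀ U ∈ Matrix.orthogonalGroup (Fin n) ℝ, ∀ W ∈ Matrix.orthogonalGroup (Fin n) ℝ,
    ∀ A : Mat n, φ (U * A * W.transpose) = φ A

/-- The rescaled kernel `φ_ε(A) = ε^{-5 n²} φ(ε^{-5} A)`. -/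
noncomputable def rescaledKernel (φ : Mat n → ℝ) (ε : ℝ) (A : Mat n) : ℝ :=
  (ε ^ (5 * n ^ 2))⁻¹ * φ ((ε ^ 5)⁻¹ • A)

/-- The mollified quasi-distance function: the convolution of the rescaled kernel with the
quasi-distance function. -/
noncomputable def mollifiedQuasiDist (φ : Mat n → ℝ) (ε : ℝ) (A : Mat n) : ℝ :=
  ∫ B : Fin n → Fin n → ℝ, rescaledKernel φ ε (A - Matrix.of B) * quasiDist (Matrix.of B : Mat n)

end Potential

/-! ### The modulated energy -/

section Energy

variable {d n : ℕ}

/-- The density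
`ε/2 ‖∇A‖² + ε⁻¹ (F(A) + ε⁴) - (ξ · ∇) ψ_ε`, `ψ_ε` being the mollified quasi-distance of `A`. -/
noncomputable def energyDensity (Ω : Set (Euc d)) (ξ : Euc d → Euc d) (φ : Mat n → ℝ) (ε : ℝ)
    (A : Euc d → Mat n) (x : Euc d) : ℝ :=
  ε / 2 * ∑ i, ‖weakGrad Ω A i x‖ ^ 2 + 1 / ε * (potential (A x) + ε ^ 4)
    - ∑ i, ξ x i * weakGrad Ω (fun y => mollifiedQuasiDist φ ε (A y)) i x

/-- The modulated energy. -/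
noncomputable def modulatedEnergy (Ω : Set (Euc d)) (ξ : Euc d → Euc d) (φ : Mat n → ℝ) (ε : ℝ)
    (A : Euc d → Mat n) : ℝ :=
  ∫ x in Ω, energyDensity Ω ξ φ ε A x

/-- The optimal profile `s(z) = 1 - (1 + e^{√2 z})⁻¹`. -/
noncomputable def profile (z : ℝ) : ℝ := 1 - (1 + Real.exp (Real.sqrt 2 * z))⁻¹

/-- The interpolation profile `S_ε = η s(d_Γ/ε) + (1 - η) χ_{Ωp}`. -/
noncomputable def interpolationProfile (Ωp Γ : Set (Euc d)) (η : Euc d → ℝ) (ε : ℝ)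
    (x : Euc d) : ℝ :=
  η x * profile (signedDist Ωp Γ x / ε) + (1 - η x) * Ωp.indicator (fun _ => 1) x

end Energy

end AllenCahn

set_option linter.unusedSectionVars false

namespace AllenCahn

/-! ### Weak gradients: test functions, algebra and uniqueness. -/

section SobolevToolkit

variable {d : ℕ} {V : Type*} [NormedAddCommGroup V] [NormedSpace ℝ V]

/-! Write `d` for the signed distance, `ν` for its gradient, `s` for the profile, `κ = s(1 - s)`
evaluated at `d/ε`. The layer carries, to leading order, exactly the energy that the flux term takes
back. All leftovers are integrals of order `ε`, because `κ` has mass `O(ε)`. That mass bound comes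
from one integration by parts: the normal derivative of `s(d/ε)` is `√2 κ/ε`, while `s` is bounded
(`TubeSetting.exists_integral_weight_le`). The same bound yields the volume `O(r)` of thin tubes.

Construction. Each limiting map is continued across the interface by even reflection along the
normals. The extension stays orthogonal-valued, stays in `H¹` (`TubeSetting.hasWeakGrad_reflExt`)
and keeps its trace (`TubeSetting.isTraceOn_reflExt`). The data are the convex combinations of the
two extensions `P`, `M` with weights `S`, `1 - S`.

Algebra. `Pᵀ M` is orthogonal of determinant `-1`, so it reverses a unit vector. Hence `f = ‖P - M‖²
- 4` (the `gap`) is nonnegative, and `Pᵀ M` is a reflection up to an error of norm `√f`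
(`exists_defect`). A tangent vector at `P` corresponds to an antisymmetric matrix, which is
orthogonal to the symmetric reflection. So derivatives of `P` and `M` pair with `P - M` only up to a
factor `√f` (`abs_trace_tangent_le_of_det`). Consequently the Dirichlet part and the potential part
in the layer are each `4κ²/ε`, up to multiples of `κ f/ε` and `ε` times the squared gradients
(`OverlapPair.exists_density_le`).

Flux. The function `profileFlux` of `d/ε` has normal derivative `8κ²/ε`, the leading energy density.
It differs from the mollified quasi-distance of the data by `O(ε⁵ + κ)`, since on each side both are
that close to the same limit value. Both are integrated by parts against the cut-off normal field,
so that only their values and never their gradients are compared (`OverlapPair.exists_flux_le`). The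
defect `1 - ψ` is quadratic in `d`, and `d² κ ≤ ε²`. Outside the support of `η` the data are
orthogonal-valued, where the mollified quasi-distance is nearly critical.

Gap. It remains to see that `κ f` has integral `O(ε²)` (`PairSetting.exists_weighted_gap_le`). The
tangency bound gives `|∇f| ≤ C g √f` with `g` square integrable. Test `∇f` with the normal field
times `s(d/ε)` minus its one-sided limits. That factor is at most `2κ`, its normal derivative is `√2
κ/ε`, and its jump on the interface meets the vanishing trace of `f`. Young's inequality absorbs the
gradient term. The trace is known only through means over balls at almost every point;
`TubeSetting.tendsto_layer_mean` turns this into vanishing means over thin tubes. -/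

theorem integrable_smul_of_locallyIntegrableOn {U : Set (Euc d)} {u : Euc d → V}
    (hu : LocallyIntegrableOn u U) {g : Euc d → ℝ} (hg : Continuous g) (hc : HasCompactSupport g)
    (hs : tsupport g ⊆ U) : Integrable (fun x => g x • u x) := by
  have h1 : IntegrableOn (fun x => g x • u x) (tsupport g) :=
    (hu.integrableOn_compact_subset hs hc).continuousOn_smul hg.continuousOn hc
  refine (integrableOn_iff_integrable_of_support_subset ?_).1 h1
  intro x hx
  exact subset_tsupport _ (fun h => hx (by simp [h]))

theorem continuous_fderiv_apply_of_contDiff {φ : Euc d → ℝ} (h : ContDiff ℝ ∞ φ) (v : Euc d) :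
    Continuous fun x => fderiv ℝ φ x v :=
  (h.continuous_fderiv (by simp)).clm_apply continuous_const

theorem hasCompactSupport_fderiv_apply {φ : Euc d → ℝ} (h : HasCompactSupport φ) (v : Euc d) :
    HasCompactSupport fun x => fderiv ℝ φ x v :=
  h.fderiv_apply (𝕜 := ℝ) v

theorem tsupport_fderiv_apply_subset' {φ : Euc d → ℝ} (v : Euc d) :
    tsupport (fun x => fderiv ℝ φ x v) ⊆ tsupport φ :=
  tsupport_fderiv_apply_subset ℝ v

theorem setIntegral_smul_of_tsupport_subset {U : Set (Euc d)} {u : Euc d → V} {g : Euc d → ℝ}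
    (hs : tsupport g ⊆ U) : ∫ x in U, g x • u x = ∫ x, g x • u x :=
  setIntegral_eq_integral_of_forall_compl_eq_zero fun x hx => by
    rw [image_eq_zero_of_notMem_tsupport (fun h => hx (hs h)), zero_smul]

/-- Test functions vanish off `U`, so the set integrals of the definition are integrals over the
whole space. This form and its converse `hasWeakGrad_of_integral_eq` do not mention `U` in the
integrals, which makes restriction and gluing painless. -/
theorem HasWeakGrad.integral_eq {U : Set (Euc d)} {u : Euc d → V} {G : Fin d → Euc d → V}
    (h : HasWeakGrad U u G) (i : Fin d) {φ : Euc d → ℝ} (hφ : ContDiff ℝ ∞ φ)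
    (hc : HasCompactSupport φ) (hs : tsupport φ ⊆ U) :
    ∫ x, (fderiv ℝ φ x (EuclideanSpace.single i 1)) • u x = - ∫ x, φ x • G i x := by
  have := h.2.2 i φ hφ hc hs
  rwa [setIntegral_smul_of_tsupport_subset ((tsupport_fderiv_apply_subset' _).trans hs),
    setIntegral_smul_of_tsupport_subset hs] at this

theorem hasWeakGrad_of_integral_eq {U : Set (Euc d)} {u : Euc d → V} {G : Fin d → Euc d → V}
    (hu : LocallyIntegrableOn u U) (hG : ∀ i, LocallyIntegrableOn (G i) U)
    (h : ∀ (i : Fin d) (φ : Euc d → ℝ), ContDiff ℝ ∞ φ → HasCompactSupport φ → tsupport φ ⊆ U →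
      ∫ x, (fderiv ℝ φ x (EuclideanSpace.single i 1)) • u x = - ∫ x, φ x • G i x) :
    HasWeakGrad U u G := by
  refine ⟨hu, hG, fun i φ hφ hc hs => ?_⟩
  rw [setIntegral_smul_of_tsupport_subset ((tsupport_fderiv_apply_subset' _).trans hs),
    setIntegral_smul_of_tsupport_subset hs]
  exact h i φ hφ hc hs

theorem HasWeakGrad.mono {U W : Set (Euc d)} {u : Euc d → V} {G : Fin d → Euc d → V}
    (h : HasWeakGrad U u G) (hW : W ⊆ U) : HasWeakGrad W u G :=
  hasWeakGrad_of_integral_eq (h.1.mono_set hW) (fun i => (h.2.1 i).mono_set hW)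
    fun i _ hφ hc hs => h.integral_eq i hφ hc (hs.trans hW)

theorem HasWeakGrad.congr {U : Set (Euc d)} {u v : Euc d → V} {G H : Fin d → Euc d → V}
    (h : HasWeakGrad U u G) (huv : u =ᵐ[volume.restrict U] v)
    (hGH : ∀ i, G i =ᵐ[volume.restrict U] H i) : HasWeakGrad U v H := by
  refine ⟨h.1.congr huv, fun i => (h.2.1 i).congr (hGH i), fun i φ hφ hc hs => ?_⟩
  have e1 : ∫ x in U, fderiv ℝ φ x (EuclideanSpace.single i 1) • u x
      = ∫ x in U, fderiv ℝ φ x (EuclideanSpace.single i 1) • v x :=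
    integral_congr_ae (huv.mono fun x hx => congrArg _ hx)
  have e2 : ∫ x in U, φ x • G i x = ∫ x in U, φ x • H i x :=
    integral_congr_ae ((hGH i).mono fun x hx => congrArg _ hx)
  rw [← e1, ← e2]
  exact h.2.2 i φ hφ hc hs

theorem HasWeakGrad.add {U : Set (Euc d)} {u v : Euc d → V} {G H : Fin d → Euc d → V}
    (h : HasWeakGrad U u G) (h' : HasWeakGrad U v H) :
    HasWeakGrad U (fun x => u x + v x) (fun i x => G i x + H i x) := by
  refine hasWeakGrad_of_integral_eq (h.1.add h'.1) (fun i => (h.2.1 i).add (h'.2.1 i))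
    fun i φ hφ hc hs => ?_
  have hs' := (tsupport_fderiv_apply_subset' (EuclideanSpace.single i 1)).trans hs
  have c1 := continuous_fderiv_apply_of_contDiff hφ (EuclideanSpace.single i 1)
  have c2 := hasCompactSupport_fderiv_apply hc (EuclideanSpace.single i 1)
  simp only [smul_add]
  rw [integral_add (integrable_smul_of_locallyIntegrableOn h.1 c1 c2 hs')
      (integrable_smul_of_locallyIntegrableOn h'.1 c1 c2 hs'),
    integral_add (integrable_smul_of_locallyIntegrableOn (h.2.1 i) hφ.continuous hc hs)
      (integrable_smul_of_locallyIntegrableOn (h'.2.1 i) hφ.continuous hc hs),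
    h.integral_eq i hφ hc hs, h'.integral_eq i hφ hc hs, neg_add]

/-- Serves to apply the chain rule to functions of two maps, in particular to the gap of a pair. -/
theorem HasWeakGrad.prodMk {W : Type*} [NormedAddCommGroup W] [NormedSpace ℝ W]
    [CompleteSpace V] [CompleteSpace W] {U : Set (Euc d)}
    {u : Euc d → V} {v : Euc d → W} {G : Fin d → Euc d → V} {H : Fin d → Euc d → W}
    (h : HasWeakGrad U u G) (h' : HasWeakGrad U v H) :
    HasWeakGrad U (fun x => (u x, v x)) (fun i x => (G i x, H i x)) := by
  have key : ∀ (f : Euc d → V) (g : Euc d → W), LocallyIntegrableOn f U → LocallyIntegrableOn g U →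
      LocallyIntegrableOn (fun x => (f x, g x)) U := by
    intro f g hf hg x hx
    obtain ⟨s, hs, hfs⟩ := hf x hx
    obtain ⟨t, ht, hgt⟩ := hg x hx
    exact ⟨s ∩ t, inter_mem hs ht, (hfs.mono_set inter_subset_left).prodMk
      (hgt.mono_set inter_subset_right)⟩
  refine hasWeakGrad_of_integral_eq (key _ _ h.1 h'.1) (fun i => key _ _ (h.2.1 i) (h'.2.1 i))
    fun i φ hφ hc hs => ?_
  have hs' := (tsupport_fderiv_apply_subset' (EuclideanSpace.single i 1)).trans hs
  have c1 := continuous_fderiv_apply_of_contDiff hφ (EuclideanSpace.single i 1)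
  have c2 := hasCompactSupport_fderiv_apply hc (EuclideanSpace.single i 1)
  simp only [Prod.smul_mk]
  rw [integral_pair (integrable_smul_of_locallyIntegrableOn h.1 c1 c2 hs')
      (integrable_smul_of_locallyIntegrableOn h'.1 c1 c2 hs'),
    integral_pair (integrable_smul_of_locallyIntegrableOn (h.2.1 i) hφ.continuous hc hs)
      (integrable_smul_of_locallyIntegrableOn (h'.2.1 i) hφ.continuous hc hs),
    h.integral_eq i hφ hc hs, h'.integral_eq i hφ hc hs]
  rfl

/-- The fundamental lemma of the calculus of variations, applied to the difference. -/
theorem HasWeakGrad.unique [CompleteSpace V] {U : Set (Euc d)} (hU : IsOpen U) {u : Euc d → V}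
    {G H : Fin d → Euc d → V} (h : HasWeakGrad U u G) (h' : HasWeakGrad U u H) (i : Fin d) :
    G i =ᵐ[volume.restrict U] H i := by
  have := hU.ae_eq_zero_of_integral_contDiff_smul_eq_zero
    (f := fun x => G i x - H i x) (μ := volume) ((h.2.1 i).sub (h'.2.1 i)) ?_
  · rw [EventuallyEq, ae_restrict_iff' hU.measurableSet]
    exact this.mono fun x hx hxU => sub_eq_zero.1 (hx hxU)
  · intro g hg hc hs
    simp only [smul_sub]
    rw [integral_sub (integrable_smul_of_locallyIntegrableOn (h.2.1 i) hg.continuous hc hs)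
      (integrable_smul_of_locallyIntegrableOn (h'.2.1 i) hg.continuous hc hs), sub_eq_zero]
    exact neg_injective ((h.integral_eq i hg hc hs).symm.trans (h'.integral_eq i hg hc hs))

/-- The energy is defined with a gradient picked by choice; uniqueness lets every computation use an
explicit one. -/
theorem HasWeakGrad.weakGrad_eq [CompleteSpace V] {U : Set (Euc d)} (hU : IsOpen U) {u : Euc d → V}
    {G : Fin d → Euc d → V} (h : HasWeakGrad U u G) (i : Fin d) :
    weakGrad U u i =ᵐ[volume.restrict U] G i := by
  have hex : ∃ G, HasWeakGrad U u G := ⟨G, h⟩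
  have : weakGrad U u = hex.choose := by rw [weakGrad, dif_pos hex]
  rw [this]
  exact hex.choose_spec.unique hU h i

/-- Integration by parts against a function which is differentiable near the support of the test
function. -/
theorem integral_fderiv_smul_eq_neg {U : Set (Euc d)} (hU : IsOpen U) {w : Euc d → V}
    (hw : ContDiffOn ℝ 1 w U) {φ : Euc d → ℝ} (hφ : ContDiff ℝ 1 φ) (hc : HasCompactSupport φ)
    (hs : tsupport φ ⊆ U) (v : Euc d) :
    ∫ x, fderiv ℝ φ x v • w x = - ∫ x, φ x • fderiv ℝ w x v := by
  have hφ' : Continuous fun x => fderiv ℝ φ x v :=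
    (hφ.continuous_fderiv (by simp)).clm_apply continuous_const
  have hw' : ContinuousOn (fun x => fderiv ℝ w x v) U :=
    (hw.continuousOn_fderiv_of_isOpen hU le_rfl).clm_apply continuousOn_const
  rw [integral_smul_fderiv_eq_neg_fderiv_smul_of_integrable, neg_neg]
  · exact integrable_smul_of_locallyIntegrableOn
      (hw.continuousOn.locallyIntegrableOn hU.measurableSet) hφ' (hc.fderiv_apply (𝕜 := ℝ) v)
      ((tsupport_fderiv_apply_subset ℝ v).trans hs)
  · exact integrable_smul_of_locallyIntegrableOn
      (hw'.locallyIntegrableOn hU.measurableSet) hφ.continuous hc hs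
  · exact integrable_smul_of_locallyIntegrableOn
      (hw.continuousOn.locallyIntegrableOn hU.measurableSet) hφ.continuous hc hs
  · exact fun x _ => (hφ.differentiable (by simp)).differentiableAt
  · exact fun x hx => ((hw.contDiffAt (hU.mem_nhds (hs hx))).differentiableAt (by simp))

theorem tendsto_integral_smul_of_eLpNorm {K : Set (Euc d)} (hK : IsCompact K) {u : Euc d → V}
    {w : ℕ → Euc d → V} (hu : IntegrableOn u K) (hw : ∀ k, IntegrableOn (w k) K)
    (h : Tendsto (fun k => eLpNorm (fun x => w k x - u x) 1 (volume.restrict K)) atTop (𝓝 0))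
    {g : Euc d → ℝ} (hg : Continuous g) (hs : tsupport g ⊆ K) :
    Tendsto (fun k => ∫ x, g x • w k x) atTop (𝓝 (∫ x, g x • u x)) := by
  obtain ⟨C, hC⟩ := hK.exists_bound_of_continuousOn hg.continuousOn
  have e : ∀ f : Euc d → V, ∫ x, g x • f x = ∫ x in K, g x • f x := fun f =>
    (setIntegral_smul_of_tsupport_subset hs).symm
  simp only [e]
  refine tendsto_integral_of_L1' (fun x => g x • u x)
    (hu.continuousOn_smul hg.continuousOn hK).aestronglyMeasurable
    (Eventually.of_forall fun k => (hw k).continuousOn_smul hg.continuousOn hK) ?_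
  have : Tendsto (fun k => ENNReal.ofReal C *
      eLpNorm (fun x => w k x - u x) 1 (volume.restrict K)) atTop (𝓝 0) := by
    simpa using ENNReal.Tendsto.const_mul h (Or.inr ENNReal.ofReal_ne_top)
  refine tendsto_of_tendsto_of_tendsto_of_le_of_le tendsto_const_nhds this (fun _ => zero_le)
    fun k => ?_
  refine eLpNorm_le_mul_eLpNorm_of_ae_le_mul ?_ 1
  filter_upwards [ae_restrict_mem hK.measurableSet] with x hx
  simp only [Pi.sub_apply, ← smul_sub, norm_smul]
  exact mul_le_mul_of_nonneg_right (hC x hx) (norm_nonneg _)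

/-- A locally `L¹` limit of `C¹` functions whose gradients converge locally in `L¹`. -/
theorem hasWeakGrad_of_approx {U : Set (Euc d)} (hU : IsOpen U) {u : Euc d → V}
    {G : Fin d → Euc d → V} (hu : LocallyIntegrableOn u U) (hG : ∀ i, LocallyIntegrableOn (G i) U)
    (h : ∀ K : Set (Euc d), IsCompact K → K ⊆ U → ∃ w : ℕ → Euc d → V,
      (∀ k, ContDiffOn ℝ 1 (w k) U) ∧
      Tendsto (fun k => eLpNorm (fun x => w k x - u x) 1 (volume.restrict K)) atTop (𝓝 0) ∧
      ∀ i, Tendsto (fun k => eLpNorm (fun x => fderiv ℝ (w k) x (EuclideanSpace.single i 1)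
        - G i x) 1 (volume.restrict K)) atTop (𝓝 0)) : HasWeakGrad U u G := by
  refine hasWeakGrad_of_integral_eq hu hG fun i φ hφ hc hs => ?_
  obtain ⟨w, hw, h1, h2⟩ := h _ hc hs
  have t1 := tendsto_integral_smul_of_eLpNorm hc (hu.integrableOn_compact_subset hs hc)
    (fun k => ((hw k).continuousOn.mono hs).integrableOn_compact hc) h1
    (continuous_fderiv_apply_of_contDiff hφ (EuclideanSpace.single i 1))
    (tsupport_fderiv_apply_subset' _)
  have t2 := tendsto_integral_smul_of_eLpNorm hc ((hG i).integrableOn_compact_subset hs hc)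
    (fun k => ((((hw k).continuousOn_fderiv_of_isOpen hU le_rfl).clm_apply
      continuousOn_const).mono hs).integrableOn_compact hc) (h2 i) hφ.continuous subset_rfl
  refine tendsto_nhds_unique t1 (t2.neg.congr fun k => ?_)
  rw [integral_fderiv_smul_eq_neg hU (hw k) (hφ.of_le (by simp)) hc hs]

end SobolevToolkit

/-! ### Approximation of weakly differentiable functions by convolution. -/

section Mollification

open scoped Convolution

variable {d : ℕ} {V : Type*} [NormedAddCommGroup V] [NormedSpace ℝ V] [FiniteDimensional ℝ V]

/-- Tonelli, translation invariance and the unit mass of the kernel: the `L¹` case of Young's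
inequality. -/
theorem eLpNorm_convolution_normed_le (φ : ContDiffBump (0 : Euc d)) {v : Euc d → V}
    (hv : Integrable v) :
    eLpNorm (φ.normed volume ⋆[ContinuousLinearMap.lsmul ℝ ℝ, volume] v) 1 volume
      ≤ eLpNorm v 1 volume := by
  have hφ : Integrable (φ.normed volume) := φ.integrable_normed
  rw [eLpNorm_one_eq_lintegral_enorm, eLpNorm_one_eq_lintegral_enorm]
  calc ∫⁻ x, ‖(φ.normed volume ⋆[ContinuousLinearMap.lsmul ℝ ℝ, volume] v) x‖ₑ
      ≤ ∫⁻ x, ∫⁻ t, ‖φ.normed volume t‖ₑ * ‖v (x - t)‖ₑ := by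
        refine lintegral_mono fun x => ?_
        rw [convolution_def]
        refine (enorm_integral_le_lintegral_enorm _).trans (le_of_eq ?_)
        simp [enorm_smul]
    _ = ∫⁻ t, ∫⁻ x, ‖φ.normed volume t‖ₑ * ‖v (x - t)‖ₑ := by
        refine lintegral_lintegral_swap ?_
        have := hφ.aestronglyMeasurable.convolution_integrand (ContinuousLinearMap.lsmul ℝ ℝ)
          hv.aestronglyMeasurable (μ := volume) (ν := volume)
        simpa [enorm_smul, Function.uncurry_def] using this.enorm
    _ = ∫⁻ t, ‖φ.normed volume t‖ₑ * ∫⁻ x, ‖v x‖ₑ := by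
        refine lintegral_congr fun t => ?_
        rw [lintegral_const_mul' _ _ (by simp), lintegral_sub_right_eq_self (fun x => ‖v x‖ₑ) t]
    _ = ∫⁻ x, ‖v x‖ₑ := by
        rw [lintegral_mul_const'' _ hφ.aestronglyMeasurable.enorm]
        have : ∫⁻ t, ‖φ.normed volume t‖ₑ = 1 := by
          rw [← ofReal_integral_norm_eq_lintegral_enorm hφ]
          have : ∀ t, ‖φ.normed volume t‖ = φ.normed volume t := fun t =>
            Real.norm_of_nonneg (φ.nonneg_normed t)
          simp [this, φ.integral_normed]
        rw [this, one_mul]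

/-- Uniform continuity settles compactly supported continuous functions; density and the contraction
property of the convolution settle the rest by a three-term splitting. -/
theorem tendsto_eLpNorm_convolution_sub {φ : ℕ → ContDiffBump (0 : Euc d)}
    (hφ : Tendsto (fun k => (φ k).rOut) atTop (𝓝 0)) {v : Euc d → V} (hv : Integrable v) :
    Tendsto (fun k => eLpNorm (fun x =>
      ((φ k).normed volume ⋆[ContinuousLinearMap.lsmul ℝ ℝ, volume] v) x - v x) 1 volume)
      atTop (𝓝 0) := by
  have cont : ∀ g : Euc d → V, Continuous g → HasCompactSupport g →
      Tendsto (fun k => eLpNorm (fun x =>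
        ((φ k).normed volume ⋆[ContinuousLinearMap.lsmul ℝ ℝ, volume] g) x - g x) 1 volume)
        atTop (𝓝 0) := by
    intro g hg hgc
    -- Once the radius of the kernel is below 1, the convolution and `g` both vanish off this fixed
    -- compact set, so a uniform bound there gives an `L¹` bound.
    set K := Metric.cthickening 1 (tsupport g) with hK
    have hKc : IsCompact K := hgc.isCompact.cthickening
    rw [ENNReal.tendsto_nhds_zero]
    intro ε hε
    have hKf : volume K ≠ ⊤ := hKc.measure_lt_top.ne
    obtain ⟨c, hc0, hc⟩ : ∃ c : ℝ, 0 < c ∧ ENNReal.ofReal c * volume K ≤ ε := by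
      have : Tendsto (fun c : ℝ => ENNReal.ofReal c * volume K) (𝓝[>] 0) (𝓝 0) := by
        have h1 : Tendsto (fun c : ℝ => ENNReal.ofReal c) (𝓝[>] 0) (𝓝 0) := by
          have := ENNReal.continuous_ofReal.tendsto 0
          rw [ENNReal.ofReal_zero] at this
          exact this.mono_left nhdsWithin_le_nhds
        simpa using ENNReal.Tendsto.mul_const h1 (Or.inr hKf)
      obtain ⟨c, h1, h2⟩ := ((ENNReal.tendsto_nhds_zero.1 this ε hε).and
        self_mem_nhdsWithin).exists
      exact ⟨c, h2, h1⟩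
    obtain ⟨δ, hδ, hδ'⟩ := Metric.uniformContinuous_iff.1
      (hgc.uniformContinuous_of_continuous hg) c hc0
    have hev : ∀ᶠ k in atTop, (φ k).rOut < min δ 1 :=
      hφ.eventually (gt_mem_nhds (by positivity))
    filter_upwards [hev] with k hk
    have b1 : ∀ x, ‖((φ k).normed volume ⋆[ContinuousLinearMap.lsmul ℝ ℝ, volume] g) x - g x‖
        ≤ c := by
      intro x
      rw [← dist_eq_norm]
      refine (φ k).dist_normed_convolution_le hg.aestronglyMeasurable fun y hy => ?_
      exact (hδ' ((Metric.mem_ball.1 hy).trans (hk.trans_le (min_le_left _ _)))).le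
    have b2 : ∀ x, x ∉ K →
        ((φ k).normed volume ⋆[ContinuousLinearMap.lsmul ℝ ℝ, volume] g) x - g x = 0 := by
      intro x hx
      rw [(φ k).normed_convolution_eq_right, sub_self]
      intro y hy
      have hx' : x ∉ tsupport g := fun h => hx (Metric.self_subset_cthickening _ h)
      have hy' : y ∉ tsupport g := by
        intro h
        refine hx (Metric.mem_cthickening_of_dist_le x y 1 _ h ?_)
        rw [dist_comm]
        exact ((Metric.mem_ball.1 hy).trans (hk.trans_le (min_le_right _ _))).le
      rw [image_eq_zero_of_notMem_tsupport hx', image_eq_zero_of_notMem_tsupport hy']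
    rw [eLpNorm_one_eq_lintegral_enorm]
    refine le_trans ?_ hc
    rw [← lintegral_indicator_const hKc.measurableSet]
    refine lintegral_mono fun x => ?_
    by_cases hx : x ∈ K
    · rw [indicator_of_mem hx, ← ofReal_norm]
      exact ENNReal.ofReal_le_ofReal (b1 x)
    · rw [b2 x hx]; simp
  rw [ENNReal.tendsto_nhds_zero]
  intro ε hε
  have hε3 : ε / 3 ≠ 0 := (ENNReal.div_pos hε.ne' (by simp)).ne'
  obtain ⟨g, hgc, hgε, hg, hgi⟩ :=
    (memLp_one_iff_integrable.2 hv).exists_hasCompactSupport_eLpNorm_sub_le (by simp) hε3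
  have hgi' : Integrable g := memLp_one_iff_integrable.1 hgi
  filter_upwards [ENNReal.tendsto_nhds_zero.1 (cont g hg hgc) (ε / 3) (pos_iff_ne_zero.2 hε3)]
    with k hk
  have hd : ∀ f : Euc d → V, Integrable f → ∀ x,
      ConvolutionExistsAt ((φ k).normed volume) f x (ContinuousLinearMap.lsmul ℝ ℝ) volume :=
    fun f hf x => ((φ k).hasCompactSupport_normed.convolutionExists_left _
      (φ k).continuous_normed hf.locallyIntegrable) x
  have key : (fun x => ((φ k).normed volume ⋆[ContinuousLinearMap.lsmul ℝ ℝ, volume] v) x - v x)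
      = (((φ k).normed volume ⋆[ContinuousLinearMap.lsmul ℝ ℝ, volume] (v - g)) +
        (fun x => ((φ k).normed volume ⋆[ContinuousLinearMap.lsmul ℝ ℝ, volume] g) x - g x))
        + (g - v) := by
    funext x
    have : ((φ k).normed volume ⋆[ContinuousLinearMap.lsmul ℝ ℝ, volume] v) x
        = ((φ k).normed volume ⋆[ContinuousLinearMap.lsmul ℝ ℝ, volume] (v - g)) x
        + ((φ k).normed volume ⋆[ContinuousLinearMap.lsmul ℝ ℝ, volume] g) x := by
      rw [← (hd (v - g) (hv.sub hgi') x).distrib_add (hd g hgi' x), sub_add_cancel]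
    simp only [Pi.add_apply, this, Pi.sub_apply]
    abel
  have cc : ∀ f : Euc d → V, Integrable f → Continuous
      ((φ k).normed volume ⋆[ContinuousLinearMap.lsmul ℝ ℝ, volume] f) := fun f hf =>
    (φ k).hasCompactSupport_normed.continuous_convolution_left _ (φ k).continuous_normed
      hf.locallyIntegrable
  rw [key]
  have m1 := (cc (v - g) (hv.sub hgi')).aestronglyMeasurable (μ := volume)
  have m2 := ((cc g hgi').sub hg).aestronglyMeasurable (μ := volume)
  refine (eLpNorm_add_le (m1.add m2) (hgi'.sub hv).aestronglyMeasurable le_rfl).trans ?_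
  refine (add_le_add_left (eLpNorm_add_le m1 m2 le_rfl) _).trans ?_
  have e1 := (eLpNorm_convolution_normed_le (φ k) (hv.sub hgi')).trans hgε
  have e2 : eLpNorm (g - v) 1 volume ≤ ε / 3 := by rw [eLpNorm_sub_comm]; exact hgε
  calc _ ≤ ε / 3 + ε / 3 + ε / 3 := add_le_add (add_le_add e1 hk) e2
    _ = ε := ENNReal.add_thirds ε

/-- Mollify `u` after cutting it to a compact neighbourhood `K'` of `K` inside `U`. The cut is
invisible on `K`, because kernels centred in `K` live in `K'`. Besides `L¹` convergence, the chain
rule needs almost everywhere convergence and preservation of sup bounds, which convolution with a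
probability density provides. -/
theorem exists_smooth_approx {U : Set (Euc d)} (hU : IsOpen U) {u : Euc d → V}
    {G : Fin d → Euc d → V} (h : HasWeakGrad U u G) {K : Set (Euc d)} (hK : IsCompact K)
    (hKU : K ⊆ U) : ∃ w : ℕ → Euc d → V, (∀ k, ContDiff ℝ ∞ (w k)) ∧
      Tendsto (fun k => eLpNorm (fun x => w k x - u x) 1 (volume.restrict K)) atTop (𝓝 0) ∧
      (∀ i, Tendsto (fun k => eLpNorm (fun x => fderiv ℝ (w k) x (EuclideanSpace.single i 1)
        - G i x) 1 (volume.restrict K)) atTop (𝓝 0)) ∧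
      (∀ᵐ x ∂(volume.restrict K), Tendsto (fun k => w k x) atTop (𝓝 (u x))) ∧
      ∀ M, 0 ≤ M → (∀ᵐ x ∂(volume.restrict U), ‖u x‖ ≤ M) → ∀ k x, ‖w k x‖ ≤ M := by
  obtain ⟨δ, hδ, hKδ⟩ := hK.exists_cthickening_subset_open hU hKU
  set K' := Metric.cthickening δ K with hK'
  have hK'c : IsCompact K' := hK.cthickening
  have hKK' : K ⊆ K' := Metric.self_subset_cthickening _
  -- Outer radius at most `δ` keeps the kernels inside `K'`. The fixed ratio 2 between outer and
  -- inner radius is what the Lebesgue differentiation argument for pointwise convergence asks for.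
  let φ : ℕ → ContDiffBump (0 : Euc d) := fun k =>
    ⟨δ / (k + 1) / 2, δ / (k + 1), by positivity, half_lt_self (by positivity)⟩
  have hφ : Tendsto (fun k => (φ k).rOut) atTop (𝓝 0) :=
    tendsto_const_div_atTop_nhds_zero_nat δ |>.comp (tendsto_add_atTop_nat 1) |>.congr
      fun k => by simp [φ]
  have hφδ : ∀ k, (φ k).rOut ≤ δ := fun k => div_le_self hδ.le (by simp)
  have hui : Integrable (K'.indicator u) :=
    (integrable_indicator_iff hK'c.measurableSet).2 (h.1.integrableOn_compact_subset hKδ hK'c)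
  have hGi : ∀ i, Integrable (K'.indicator (G i)) := fun i =>
    (integrable_indicator_iff hK'c.measurableSet).2
      ((h.2.1 i).integrableOn_compact_subset hKδ hK'c)
  let w : ℕ → Euc d → V := fun k =>
    (φ k).normed volume ⋆[ContinuousLinearMap.lsmul ℝ ℝ, volume] (K'.indicator u)
  have restr : ∀ (f : ℕ → Euc d → V) (g : Euc d → V),
      Tendsto (fun k => eLpNorm (fun x => f k x - K'.indicator g x) 1 volume) atTop (𝓝 0) →
      Tendsto (fun k => eLpNorm (fun x => f k x - g x) 1 (volume.restrict K)) atTop (𝓝 0) := by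
    intro f g hfg
    refine tendsto_of_tendsto_of_tendsto_of_le_of_le tendsto_const_nhds hfg (fun _ => zero_le)
      fun k => ?_
    have : eLpNorm (fun x => f k x - g x) 1 (volume.restrict K)
        = eLpNorm (fun x => f k x - K'.indicator g x) 1 (volume.restrict K) := by
      refine eLpNorm_congr_ae ?_
      filter_upwards [ae_restrict_mem hK.measurableSet] with x hx
      rw [indicator_of_mem (hKK' hx)]
    simp only [this]
    exact eLpNorm_mono_measure _ Measure.restrict_le_self
  -- For `x` in `K` the function `t ↦ φ_k(x - t)` is an admissible test function on `U`.
  -- Differentiating in `x` instead of `t` changes the sign, which cancels the sign in the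
  -- definition of the weak gradient.
  have hder : ∀ k i, ∀ x ∈ K, fderiv ℝ (w k) x (EuclideanSpace.single i 1) =
      ((φ k).normed volume ⋆[ContinuousLinearMap.lsmul ℝ ℝ, volume] (K'.indicator (G i))) x := by
    intro k i x hx
    have hC1 : ContDiff ℝ 1 ((φ k).normed volume) := (φ k).contDiff_normed
    have hfd := (φ k).hasCompactSupport_normed.hasFDerivAt_convolution_left
      (ContinuousLinearMap.lsmul ℝ ℝ) hC1 hui.locallyIntegrable x
    rw [hfd.fderiv]
    have hmem : ∀ t, x - t ∈ tsupport ((φ k).normed volume) → t ∈ K' := by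
      intro t ht
      rw [(φ k).tsupport_normed_eq, Metric.mem_closedBall, dist_zero_right] at ht
      refine Metric.mem_cthickening_of_dist_le t x δ _ hx ?_
      rw [dist_comm, dist_eq_norm]
      exact ht.trans (hφδ k)
    have hcd : ContDiff ℝ ∞ fun t => (φ k).normed volume (x - t) :=
      ((φ k).contDiff_normed (n := ⊤)).comp (contDiff_const.sub contDiff_id)
    have hts : tsupport (fun t => (φ k).normed volume (x - t)) ⊆ K' := by
      intro t ht
      refine hmem t ?_
      have := tsupport_comp_subset_preimage ((φ k).normed volume) (f := fun t => x - t)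
        (by fun_prop) ht
      exact this
    have hcs : HasCompactSupport fun t => (φ k).normed volume (x - t) :=
      hK'c.of_isClosed_subset (isClosed_tsupport _) hts
    have hw := h.integral_eq i hcd hcs (hts.trans hKδ)
    rw [convolution_eq_swap, convolution_eq_swap, ContinuousLinearMap.integral_apply]
    · have e1 : ∀ t, (((ContinuousLinearMap.lsmul ℝ ℝ : ℝ →L[ℝ] V →L[ℝ] V).precompL (Euc d))
          (fderiv ℝ ((φ k).normed volume) (x - t)) (K'.indicator u t)) (EuclideanSpace.single i 1)
          = - (fderiv ℝ (fun t => (φ k).normed volume (x - t)) t (EuclideanSpace.single i 1)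
            • u t) := by
        intro t
        have hd : fderiv ℝ (fun t => (φ k).normed volume (x - t)) t
            = - fderiv ℝ ((φ k).normed volume) (x - t) := by
          have h1 : HasFDerivAt (fun t : Euc d => x - t) (-ContinuousLinearMap.id ℝ (Euc d)) t :=
            (hasFDerivAt_id t).const_sub x
          have h2 := ((hC1.differentiable (by simp)) (x - t)).hasFDerivAt.comp t h1
          rw [HasFDerivAt.fderiv (f := fun t => (φ k).normed volume (x - t)) h2]
          ext v
          simp
        rw [hd]
        simp only [ContinuousLinearMap.precompL_apply, ContinuousLinearMap.lsmul_apply,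
          _root_.neg_apply, neg_smul, neg_neg]
        by_cases ht : t ∈ K'
        · rw [indicator_of_mem ht]
        · have : fderiv ℝ ((φ k).normed volume) (x - t) = 0 :=
            image_eq_zero_of_notMem_tsupport fun h' => ht (hmem t (tsupport_fderiv_subset ℝ h'))
          simp [this]
      simp only [e1]
      rw [integral_neg, hw, neg_neg]
      refine integral_congr_ae (Eventually.of_forall fun t => ?_)
      simp only [ContinuousLinearMap.lsmul_apply]
      by_cases ht : t ∈ K'
      · rw [indicator_of_mem ht]
      · have : (φ k).normed volume (x - t) = 0 :=
          image_eq_zero_of_notMem_tsupport fun h' => ht (hmem t h')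
        simp [this]
    · have hcc := ((φ k).hasCompactSupport_normed.fderiv (𝕜 := ℝ)).convolutionExists_left
        ((ContinuousLinearMap.lsmul ℝ ℝ : ℝ →L[ℝ] V →L[ℝ] V).precompL (Euc d))
        (hC1.continuous_fderiv (by simp)) hui.locallyIntegrable x
      exact hcc.integrable_swap
  refine ⟨w, fun k => ?_, ?_, fun i => ?_, ?_, fun M hM0 hM k x => ?_⟩
  · exact (φ k).hasCompactSupport_normed.contDiff_convolution_left _ (φ k).contDiff_normed
      hui.locallyIntegrable
  · exact restr _ _ (tendsto_eLpNorm_convolution_sub hφ hui)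
  · have := restr _ _ (tendsto_eLpNorm_convolution_sub hφ (hGi i))
    refine this.congr fun k => eLpNorm_congr_ae ?_
    filter_upwards [ae_restrict_mem hK.measurableSet] with x hx
    rw [hder k i x hx]
  · have := ContDiffBump.ae_convolution_tendsto_right_of_locallyIntegrable (K := 2) (μ := volume)
      hφ (Eventually.of_forall fun k => le_of_eq (by simp [φ]; ring)) hui.locallyIntegrable
    filter_upwards [ae_restrict_of_ae this, ae_restrict_mem hK.measurableSet] with x hx hxK
    rwa [indicator_of_mem (hKK' hxK)] at hx
  · have hb : ∀ᵐ t, ‖K'.indicator u t‖ ≤ M := by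
      rw [ae_restrict_iff' hU.measurableSet] at hM
      filter_upwards [hM] with t ht
      by_cases htK : t ∈ K'
      · rw [indicator_of_mem htK]; exact ht (hKδ htK)
      · simpa [indicator_of_notMem htK] using hM0
    have hint : Integrable fun t => (φ k).normed volume (x - t) :=
      (φ k).integrable_normed.comp_sub_left x
    calc ‖w k x‖ = ‖∫ t, (φ k).normed volume (x - t) • K'.indicator u t‖ := by
          simp only [w]; rw [convolution_lsmul_swap]
      _ ≤ ∫ t, (φ k).normed volume (x - t) * M := by
          refine norm_integral_le_of_norm_le (hint.mul_const M) ?_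
          filter_upwards [hb] with t ht
          rw [norm_smul, Real.norm_of_nonneg ((φ k).nonneg_normed _)]
          exact mul_le_mul_of_nonneg_left ht ((φ k).nonneg_normed _)
      _ = M := by
          rw [integral_mul_const, integral_sub_left_eq_self, (φ k).integral_normed, one_mul]

end Mollification

/-! ### Chain rule, change of variables, products and removable interfaces. -/

section WeakCalculus

variable {d : ℕ} {V : Type*} [NormedAddCommGroup V] [NormedSpace ℝ V]

theorem locallyIntegrableOn_of_bounded {U : Set (Euc d)} {f : Euc d → V} {C : ℝ}
    (hf : AEStronglyMeasurable f (volume.restrict U))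
    (hC : ∀ᵐ x ∂(volume.restrict U), ‖f x‖ ≤ C) : LocallyIntegrableOn f U := by
  intro x _
  refine ⟨U ∩ Metric.closedBall x 1, inter_mem_nhdsWithin U (Metric.closedBall_mem_nhds x one_pos),
    ?_⟩
  have hle : volume.restrict (U ∩ Metric.closedBall x 1) ≤ volume.restrict U :=
    Measure.restrict_mono inter_subset_left le_rfl
  exact Integrable.mono' (integrableOn_const (C := C)
    ((measure_mono inter_subset_right).trans_lt measure_closedBall_lt_top).ne)
    (hf.mono_measure hle) (ae_mono hle hC)

theorem locallyIntegrableOn_of_norm_le {W : Type*} [NormedAddCommGroup W] {U : Set (Euc d)}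
    {f : Euc d → V} {g : Euc d → W} {C : ℝ} (hg : LocallyIntegrableOn g U)
    (hf : AEStronglyMeasurable f (volume.restrict U))
    (hC : ∀ᵐ x ∂(volume.restrict U), ‖f x‖ ≤ C * ‖g x‖) : LocallyIntegrableOn f U := by
  intro x hx
  obtain ⟨s, hs, hgs⟩ := hg x hx
  refine ⟨U ∩ s, inter_mem self_mem_nhdsWithin hs, ?_⟩
  have hle : volume.restrict (U ∩ s) ≤ volume.restrict U :=
    Measure.restrict_mono inter_subset_left le_rfl
  exact Integrable.mono' ((hgs.mono_set inter_subset_right).norm.const_mul C)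
    (hf.mono_measure hle) (ae_mono hle hC)

/-- The chain rule for a bounded function. -/
theorem HasWeakGrad.comp_contDiff [FiniteDimensional ℝ V] {W : Type*} [NormedAddCommGroup W]
    [NormedSpace ℝ W] {U : Set (Euc d)} (hU : IsOpen U) {u : Euc d → V} {G : Fin d → Euc d → V}
    (h : HasWeakGrad U u G) {M : ℝ} (hM : ∀ᵐ x ∂(volume.restrict U), ‖u x‖ ≤ M) {F : V → W}
    (hF : ContDiff ℝ 1 F) :
    HasWeakGrad U (fun x => F (u x)) (fun i x => fderiv ℝ F (u x) (G i x)) := by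
  wlog hM0 : 0 ≤ M generalizing M
  · exact this (hM.mono fun x hx => hx.trans (le_max_left M 0)) (le_max_right M 0)
  have hum := h.1.aestronglyMeasurable
  have hGm := fun i => (h.2.1 i).aestronglyMeasurable
  have hDF : Continuous (fderiv ℝ F) := hF.continuous_fderiv (by simp)
  obtain ⟨C₀, hC₀⟩ := (isCompact_closedBall (0 : V) M).exists_bound_of_continuousOn
    hF.continuous.continuousOn
  obtain ⟨C, hC⟩ := (isCompact_closedBall (0 : V) M).exists_bound_of_continuousOn
    hDF.continuousOn
  simp only [mem_closedBall_zero_iff] at hC₀ hC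
  have hDm : AEStronglyMeasurable (fun x => fderiv ℝ F (u x)) (volume.restrict U) :=
    hDF.comp_aestronglyMeasurable hum
  have hDGm : ∀ i, AEStronglyMeasurable (fun x => fderiv ℝ F (u x) (G i x)) (volume.restrict U) :=
    fun i => (ContinuousLinearMap.apply ℝ W).flip.aestronglyMeasurable_comp₂ hDm (hGm i)
  have hLip : ∀ a b : V, ‖a‖ ≤ M → ‖b‖ ≤ M → ‖F a - F b‖ ≤ C * ‖a - b‖ := fun a b ha hb =>
    (convex_closedBall (0 : V) M).norm_image_sub_le_of_norm_fderiv_le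
      (fun x _ => (hF.differentiable (by simp)).differentiableAt)
      (fun x hx => hC x (mem_closedBall_zero_iff.1 hx)) (mem_closedBall_zero_iff.2 hb)
      (mem_closedBall_zero_iff.2 ha)
  refine hasWeakGrad_of_approx hU
    (locallyIntegrableOn_of_bounded (hF.continuous.comp_aestronglyMeasurable hum)
      (hM.mono fun x hx => hC₀ _ hx))
    (fun i => locallyIntegrableOn_of_norm_le (h.2.1 i) (hDGm i) (hM.mono fun x hx =>
      ((fderiv ℝ F (u x)).le_opNorm _).trans
        (mul_le_mul_of_nonneg_right (hC _ hx) (norm_nonneg _)))) fun K hK hKU => ?_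
  obtain ⟨w, hw, hwu, hwG, hwae, hwM⟩ := exists_smooth_approx hU h hK hKU
  replace hwM := hwM M hM0 hM
  have hle : volume.restrict K ≤ volume.restrict U := Measure.restrict_mono hKU le_rfl
  replace hM := ae_mono hle hM
  have hfd : ∀ k i x, fderiv ℝ (fun x => F (w k x)) x (EuclideanSpace.single i 1)
      = fderiv ℝ F (w k x) (fderiv ℝ (w k) x (EuclideanSpace.single i 1)) := by
    intro k i x
    have h1 := ((hF.differentiable (by simp)) (w k x)).hasFDerivAt
    have h2 := (((hw k).differentiable (by simp)) x).hasFDerivAt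
    rw [HasFDerivAt.fderiv (f := fun x => F (w k x)) (h1.comp x h2)]
    rfl
  refine ⟨fun k x => F (w k x), fun k => (hF.comp ((hw k).of_le (by simp))).contDiffOn, ?_,
    fun i => ?_⟩
  · have : Tendsto (fun k => ENNReal.ofReal C *
        eLpNorm (fun x => w k x - u x) 1 (volume.restrict K)) atTop (𝓝 0) := by
      simpa using ENNReal.Tendsto.const_mul hwu (Or.inr ENNReal.ofReal_ne_top)
    refine tendsto_of_tendsto_of_tendsto_of_le_of_le tendsto_const_nhds this (fun _ => zero_le)
      fun k => eLpNorm_le_mul_eLpNorm_of_ae_le_mul ?_ 1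
    filter_upwards [hM] with x hx using hLip _ _ (hwM k x) hx
  · have hmw : ∀ k, AEStronglyMeasurable (fun x => fderiv ℝ (w k) x (EuclideanSpace.single i 1))
        (volume.restrict K) := fun k =>
      (((hw k).continuous_fderiv (by simp)).clm_apply continuous_const).aestronglyMeasurable
    have hmF : ∀ k, AEStronglyMeasurable (fun x => fderiv ℝ F (w k x)) (volume.restrict K) :=
      fun k => (hDF.comp (hw k).continuous).aestronglyMeasurable
    have hGK := (hGm i).mono_measure hle
    have t1 : Tendsto (fun k => ENNReal.ofReal C * eLpNorm (fun x =>
        fderiv ℝ (w k) x (EuclideanSpace.single i 1) - G i x) 1 (volume.restrict K))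
        atTop (𝓝 0) := by
      simpa using ENNReal.Tendsto.const_mul (hwG i) (Or.inr ENNReal.ofReal_ne_top)
    -- Here the convergence is not uniform: the derivative of `F` converges along the mollified
    -- functions only almost everywhere. Dominated convergence applies with majorant `2C‖G i‖`,
    -- since the mollified functions respect the bound `M`.
    have t2 : Tendsto (fun k => eLpNorm (fun x =>
        (fderiv ℝ F (w k x) - fderiv ℝ F (u x)) (G i x)) 1 (volume.restrict K)) atTop (𝓝 0) := by
      simp only [eLpNorm_one_eq_lintegral_enorm]
      have hfin : ∫⁻ x in K, ENNReal.ofReal (C + C) * ‖G i x‖ₑ ≠ ⊤ := by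
        rw [lintegral_const_mul' _ _ ENNReal.ofReal_ne_top]
        exact ENNReal.mul_ne_top ENNReal.ofReal_ne_top
          ((h.2.1 i).integrableOn_compact_subset hKU hK).2.ne
      have := tendsto_lintegral_of_dominated_convergence' (μ := volume.restrict K)
        (F := fun k x => ‖(fderiv ℝ F (w k x) - fderiv ℝ F (u x)) (G i x)‖ₑ) (f := fun _ => 0)
        (fun x => ENNReal.ofReal (C + C) * ‖G i x‖ₑ)
        (fun k => ((ContinuousLinearMap.apply ℝ W).flip.aestronglyMeasurable_comp₂
          ((hmF k).sub (hDm.mono_measure hle)) hGK).enorm) ?_ hfin ?_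
      · simpa using this
      · intro k
        filter_upwards [hM] with x hx
        have hCC : 0 ≤ C + C := by
          have := (norm_nonneg _).trans (hC _ hx); linarith
        rw [← ofReal_norm, ← ofReal_norm, ← ENNReal.ofReal_mul hCC]
        refine ENNReal.ofReal_le_ofReal ((ContinuousLinearMap.le_opNorm _ _).trans ?_)
        exact mul_le_mul_of_nonneg_right ((norm_sub_le _ _).trans
          (add_le_add (hC _ (hwM k x)) (hC _ hx))) (norm_nonneg _)
      · filter_upwards [hwae] with x hx
        have h1 : Tendsto (fun k => fderiv ℝ F (w k x)) atTop (𝓝 (fderiv ℝ F (u x))) :=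
          (hDF.tendsto _).comp hx
        have h2 : Tendsto (fun k => (fderiv ℝ F (w k x) - fderiv ℝ F (u x)) (G i x)) atTop
            (𝓝 ((fderiv ℝ F (u x) - fderiv ℝ F (u x)) (G i x))) :=
          ((ContinuousLinearMap.apply ℝ W (G i x)).continuous.tendsto _).comp (h1.sub_const _)
        simpa using h2.enorm
    have t3 := t1.add t2
    rw [add_zero] at t3
    refine tendsto_of_tendsto_of_tendsto_of_le_of_le tendsto_const_nhds t3 (fun _ => zero_le)
      fun k => ?_
    have e : (fun x => fderiv ℝ (fun x => F (w k x)) x (EuclideanSpace.single i 1)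
        - fderiv ℝ F (u x) (G i x))
        = (fun x => fderiv ℝ F (w k x) (fderiv ℝ (w k) x (EuclideanSpace.single i 1) - G i x))
        + (fun x => (fderiv ℝ F (w k x) - fderiv ℝ F (u x)) (G i x)) := by
      funext x
      simp only [hfd, Pi.add_apply, map_sub, _root_.sub_apply]
      abel
    simp only [e]
    refine (eLpNorm_add_le ((ContinuousLinearMap.apply ℝ W).flip.aestronglyMeasurable_comp₂
        (hmF k) ((hmw k).sub hGK)) ((ContinuousLinearMap.apply ℝ W).flip.aestronglyMeasurable_comp₂
        ((hmF k).sub (hDm.mono_measure hle)) hGK) le_rfl).trans (add_le_add_left ?_ _)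
    refine eLpNorm_le_mul_eLpNorm_of_ae_le_mul (Eventually.of_forall fun x => ?_) 1
    exact (ContinuousLinearMap.le_opNorm _ _).trans
      (mul_le_mul_of_nonneg_right (hC _ (hwM k x)) (norm_nonneg _))

theorem map_eq_sum_single {W : Type*} [NormedAddCommGroup W] [NormedSpace ℝ W]
    (L : Euc d →L[ℝ] W) (v : Euc d) : L v = ∑ j, v j • L (EuclideanSpace.single j 1) := by
  conv_lhs => rw [← (EuclideanSpace.basisFun (Fin d) ℝ).sum_repr v]
  simp [map_sum]

/-- Change of variables; the Jacobian is continuous and nonzero, hence bounded below on the compact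
set. -/
theorem exists_lintegral_comp_le {W : Set (Euc d)} (hW : IsOpen W) {R : Euc d → Euc d}
    (hR : ContDiffOn ℝ 1 R W) (hinj : InjOn R W) (hdet : ∀ x ∈ W, (fderiv ℝ R x).det ≠ 0)
    {K : Set (Euc d)} (hK : IsCompact K) (hKW : K ⊆ W) :
    ∃ C : ENNReal, C ≠ ⊤ ∧ ∀ s ⊆ K, MeasurableSet s → ∀ f : Euc d → ENNReal,
      ∫⁻ x in s, f (R x) ≤ C * ∫⁻ y in R '' s, f y := by
  have hc : ContinuousOn (fun x => |(fderiv ℝ R x).det|⁻¹) K := by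
    have h1 : ContinuousOn (fun x => (fderiv ℝ R x).det) K :=
      (ContinuousLinearMap.continuous_det.comp_continuousOn
        (hR.continuousOn_fderiv_of_isOpen hW le_rfl)).mono hKW
    exact h1.abs.inv₀ fun x hx => abs_ne_zero.2 (hdet x (hKW hx))
  obtain ⟨c, hcb⟩ := hK.exists_bound_of_continuousOn hc
  refine ⟨ENNReal.ofReal c, ENNReal.ofReal_ne_top, fun s hsK hs f => ?_⟩
  rw [lintegral_image_eq_lintegral_abs_det_fderiv_mul volume hs
    (fun x hx => (((hR.contDiffAt (hW.mem_nhds (hKW (hsK hx)))).differentiableAt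
      (by simp)).hasFDerivAt).hasFDerivWithinAt) (hinj.mono (hsK.trans hKW)) f,
    ← lintegral_const_mul' _ _ ENNReal.ofReal_ne_top]
  refine setLIntegral_mono' hs fun x hx => ?_
  rw [← mul_assoc, ← ENNReal.ofReal_mul' (abs_nonneg _)]
  have hpos : 0 < |(fderiv ℝ R x).det| := abs_pos.2 (hdet x (hKW (hsK hx)))
  have h1 : 1 ≤ c * |(fderiv ℝ R x).det| := by
    have := hcb x (hsK hx)
    rw [Real.norm_of_nonneg (by positivity)] at this
    rwa [inv_le_iff_one_le_mul₀ hpos] at this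
  calc f (R x) = 1 * f (R x) := (one_mul _).symm
    _ ≤ _ := by
      gcongr
      rw [← ENNReal.ofReal_one]
      exact ENNReal.ofReal_le_ofReal h1

/-- Preimages of null sets are null. This transports measurability and almost everywhere statements
through `R`. -/
theorem map_restrict_absolutelyContinuous {U W : Set (Euc d)} (hW : IsOpen W)
    {R : Euc d → Euc d} (hR : ContDiffOn ℝ 1 R W) (hm : MapsTo R W U) (hinj : InjOn R W)
    (hdet : ∀ x ∈ W, (fderiv ℝ R x).det ≠ 0)
    {K s : Set (Euc d)} (hK : IsCompact K) (hKW : K ⊆ W) (hs : MeasurableSet s) (hsK : s ⊆ K) :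
    Measure.map R (volume.restrict s) ≪ volume.restrict U := by
  obtain ⟨C, hC, hle⟩ := exists_lintegral_comp_le hW hR hinj hdet hK hKW
  have hRm : AEMeasurable R (volume.restrict s) :=
    (hR.continuousOn.mono (hsK.trans hKW)).aemeasurable hs
  refine Measure.AbsolutelyContinuous.mk fun t ht h0 => ?_
  rw [Measure.map_apply_of_aemeasurable hRm ht]
  have h1 := hle s hsK hs (t.indicator fun _ => 1)
  have h2 : ∫⁻ y in R '' s, t.indicator (fun _ => (1 : ENNReal)) y ≤ volume.restrict U t := by
    rw [lintegral_indicator ht, setLIntegral_const, one_mul]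
    exact Measure.restrict_mono (image_subset_iff.2 fun x hx => hm (hKW (hsK hx))) le_rfl t
  have h3 : ∫⁻ x in s, t.indicator (fun _ => (1 : ENNReal)) (R x) = volume.restrict s (R ⁻¹' t) := by
    have h4 : ∀ x, t.indicator (fun _ => (1 : ENNReal)) (R x)
        = (R ⁻¹' t).indicator (fun _ => 1) x := fun x => by
      by_cases hx : R x ∈ t <;> simp [indicator, hx]
    simp only [h4]
    -- `R` is only almost everywhere measurable on `s`, so preimages are computed with a measurable
    -- representative.
    obtain ⟨R', hR'm, hR'e⟩ := hRm
    have h5 : volume.restrict s (R ⁻¹' t) = volume.restrict s (R' ⁻¹' t) :=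
      measure_congr (hR'e.mono fun x hx => by
        change (R x ∈ t) = (R' x ∈ t); rw [hx])
    rw [h5, ← lintegral_indicator_one (hR'm ht)]
    refine lintegral_congr_ae (hR'e.mono fun x hx => ?_)
    rw [← h4 x, hx]
    rfl
  rw [← h3]
  refine le_antisymm (h1.trans ?_) zero_le
  calc _ ≤ C * 0 := by gcongr; exact h2.trans h0.le
    _ = 0 := mul_zero _

theorem aestronglyMeasurable_comp_diffeo {U W : Set (Euc d)} (hW : IsOpen W)
    {R : Euc d → Euc d} (hR : ContDiffOn ℝ 1 R W) (hm : MapsTo R W U) (hinj : InjOn R W)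
    (hdet : ∀ x ∈ W, (fderiv ℝ R x).det ≠ 0)
    {K s : Set (Euc d)} (hK : IsCompact K) (hKW : K ⊆ W) (hs : MeasurableSet s) (hsK : s ⊆ K)
    {f : Euc d → V} (hf : AEStronglyMeasurable f (volume.restrict U)) :
    AEStronglyMeasurable (fun x => f (R x)) (volume.restrict s) :=
  (hf.mono_ac (map_restrict_absolutelyContinuous hW hR hm hinj hdet hK hKW hs hsK)).comp_aemeasurable
    ((hR.continuousOn.mono (hsK.trans hKW)).aemeasurable hs)

theorem locallyIntegrableOn_finset_sum {ι : Type*} {U : Set (Euc d)} (s : Finset ι)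
    {f : ι → Euc d → V} (h : ∀ j, LocallyIntegrableOn (f j) U) :
    LocallyIntegrableOn (fun x => ∑ j ∈ s, f j x) U := by
  classical
  induction s using Finset.induction_on with
  | empty => simpa using locallyIntegrableOn_zero
  | insert a s ha ih =>
    simp only [Finset.sum_insert ha]
    exact (h a).add ih

theorem locallyIntegrableOn_comp_diffeo {U W : Set (Euc d)} (hW : IsOpen W)
    {R : Euc d → Euc d} (hR : ContDiffOn ℝ 1 R W) (hm : MapsTo R W U) (hinj : InjOn R W)
    (hdet : ∀ x ∈ W, (fderiv ℝ R x).det ≠ 0) {f : Euc d → V} (hf : LocallyIntegrableOn f U) :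
    LocallyIntegrableOn (fun x => f (R x)) W := by
  rw [locallyIntegrableOn_iff hW.isLocallyClosed]
  intro K hKW hK
  obtain ⟨C, hC, hle⟩ := exists_lintegral_comp_le hW hR hinj hdet hK hKW
  refine ⟨aestronglyMeasurable_comp_diffeo hW hR hm hinj hdet hK hKW hK.measurableSet
    subset_rfl hf.aestronglyMeasurable, ?_⟩
  refine (hle K subset_rfl hK.measurableSet (fun y => ‖f y‖ₑ)).trans_lt ?_
  exact ENNReal.mul_lt_top hC.lt_top (hf.integrableOn_compact_subset
    (image_subset_iff.2 fun x hx => hm (hKW hx))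
    (hK.image_of_continuousOn (hR.continuousOn.mono hKW))).2

theorem tendsto_eLpNorm_comp_diffeo {W : Set (Euc d)} (hW : IsOpen W)
    {R : Euc d → Euc d} (hR : ContDiffOn ℝ 1 R W) (hinj : InjOn R W)
    (hdet : ∀ x ∈ W, (fderiv ℝ R x).det ≠ 0) {K : Set (Euc d)} (hK : IsCompact K) (hKW : K ⊆ W)
    (f : ℕ → Euc d → V)
    (hf : Tendsto (fun k => eLpNorm (f k) 1 (volume.restrict (R '' K))) atTop (𝓝 0)) :
    Tendsto (fun k => eLpNorm (fun x => f k (R x)) 1 (volume.restrict K)) atTop (𝓝 0) := by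
  obtain ⟨C, hC, hle⟩ := exists_lintegral_comp_le hW hR hinj hdet hK hKW
  have : Tendsto (fun k => C * eLpNorm (f k) 1 (volume.restrict (R '' K))) atTop (𝓝 0) := by
    simpa using ENNReal.Tendsto.const_mul hf (Or.inr hC)
  refine tendsto_of_tendsto_of_tendsto_of_le_of_le tendsto_const_nhds this (fun _ => zero_le)
    fun k => ?_
  simp only [eLpNorm_one_eq_lintegral_enorm]
  exact hle K subset_rfl hK.measurableSet (fun y => ‖f k y‖ₑ)

theorem continuousOn_fderiv_apply_coord {W : Set (Euc d)} (hW : IsOpen W)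
    {R : Euc d → Euc d} (hR : ContDiffOn ℝ 1 R W) (v : Euc d) (j : Fin d) :
    ContinuousOn (fun x => (fderiv ℝ R x v) j) W :=
  (EuclideanSpace.proj (𝕜 := ℝ) j).continuous.comp_continuousOn
    ((hR.continuousOn_fderiv_of_isOpen hW le_rfl).clm_apply continuousOn_const)

theorem tendsto_eLpNorm_sum_smul {K : Set (Euc d)} (hK : IsCompact K) {a : Fin d → Euc d → ℝ}
    (ha : ∀ j, ContinuousOn (a j) K) {f : Fin d → ℕ → Euc d → V}
    (hfm : ∀ j k, AEStronglyMeasurable (f j k) (volume.restrict K))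
    (hf : ∀ j, Tendsto (fun k => eLpNorm (f j k) 1 (volume.restrict K)) atTop (𝓝 0)) :
    Tendsto (fun k => eLpNorm (∑ j, fun x => a j x • f j k x) 1 (volume.restrict K))
      atTop (𝓝 0) := by
  choose B hB using fun j => hK.exists_bound_of_continuousOn (ha j)
  have tj : Tendsto (fun k => ∑ j, ENNReal.ofReal (B j) * eLpNorm (f j k) 1 (volume.restrict K))
      atTop (𝓝 (∑ j : Fin d, 0)) := by
    refine tendsto_finsetSum _ fun j _ => ?_
    simpa using ENNReal.Tendsto.const_mul (hf j) (Or.inr ENNReal.ofReal_ne_top)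
  rw [Finset.sum_const_zero] at tj
  refine tendsto_of_tendsto_of_tendsto_of_le_of_le tendsto_const_nhds tj (fun _ => zero_le)
    fun k => ?_
  refine (eLpNorm_sum_le (fun j _ => ?_) le_rfl).trans (Finset.sum_le_sum fun j _ => ?_)
  · exact ((ha j).aestronglyMeasurable hK.measurableSet).smul (hfm j k)
  · refine eLpNorm_le_mul_eLpNorm_of_ae_le_mul ?_ 1
    filter_upwards [ae_restrict_mem hK.measurableSet] with x hx
    rw [norm_smul]
    exact mul_le_mul_of_nonneg_right (hB j x hx) (norm_nonneg _)

/-- The classical chain rule holds for smooth approximations of `u` on the compact image of `K`; the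
change-of-variables bound carries their `L¹` convergence back to `K`. -/
theorem HasWeakGrad.comp_diffeo [FiniteDimensional ℝ V] {U W : Set (Euc d)} (hU : IsOpen U)
    (hW : IsOpen W) {R : Euc d → Euc d} (hR : ContDiffOn ℝ ∞ R W) (hm : MapsTo R W U)
    (hinj : InjOn R W) (hdet : ∀ x ∈ W, (fderiv ℝ R x).det ≠ 0) {u : Euc d → V}
    {G : Fin d → Euc d → V} (h : HasWeakGrad U u G) :
    HasWeakGrad W (fun x => u (R x))
      (fun i x => ∑ j, (fderiv ℝ R x (EuclideanSpace.single i 1)) j • G j (R x)) := by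
  have hR1 : ContDiffOn ℝ 1 R W := hR.of_le (by simp)
  refine hasWeakGrad_of_approx hW (locallyIntegrableOn_comp_diffeo hW hR1 hm hinj hdet h.1)
    (fun i => locallyIntegrableOn_finset_sum _ fun j =>
      (locallyIntegrableOn_comp_diffeo hW hR1 hm hinj hdet (h.2.1 j)).continuousOn_smul
        hW.isLocallyClosed (continuousOn_fderiv_apply_coord hW hR1 _ j)) fun K hK hKW => ?_
  have hRK : IsCompact (R '' K) := hK.image_of_continuousOn (hR.continuousOn.mono hKW)
  have hRKU : R '' K ⊆ U := image_subset_iff.2 fun x hx => hm (hKW hx)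
  obtain ⟨w, hw, hwu, hwG, -, -⟩ := exists_smooth_approx hU h hRK hRKU
  refine ⟨fun k x => w k (R x), fun k => ((hw k).of_le (by simp)).comp_contDiffOn hR1,
    tendsto_eLpNorm_comp_diffeo hW hR1 hinj hdet hK hKW (fun k x => w k x - u x) hwu,
    fun i => ?_⟩
  refine (tendsto_eLpNorm_sum_smul hK
    (fun j => (continuousOn_fderiv_apply_coord hW hR1 (EuclideanSpace.single i 1) j).mono hKW)
    (fun j k => ?_)
    (fun j => tendsto_eLpNorm_comp_diffeo hW hR1 hinj hdet hK hKW (fun k x =>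
      fderiv ℝ (w k) x (EuclideanSpace.single j 1) - G j x) (hwG j))).congr fun k => ?_
  · refine .sub ?_ ?_
    · exact ((((hw k).continuous_fderiv (by simp)).clm_apply continuous_const).comp_continuousOn
        (hR.continuousOn.mono hKW)).aestronglyMeasurable hK.measurableSet
    · exact aestronglyMeasurable_comp_diffeo hW hR1 hm hinj hdet hK hKW hK.measurableSet
        subset_rfl (h.2.1 j).aestronglyMeasurable
  · refine eLpNorm_congr_ae ?_
    filter_upwards [ae_restrict_mem hK.measurableSet] with x hx
    have h1 := (((hw k).differentiable (by simp)) (R x)).hasFDerivAt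
    have h2 := ((hR1.contDiffAt (hW.mem_nhds (hKW hx))).differentiableAt (by simp)).hasFDerivAt
    have h3 : fderiv ℝ (fun x => w k (R x)) x = (fderiv ℝ (w k) (R x)).comp (fderiv ℝ R x) :=
      HasFDerivAt.fderiv (h1.comp x h2)
    rw [h3, ContinuousLinearMap.comp_apply, map_eq_sum_single (fderiv ℝ (w k) (R x)),
      Finset.sum_apply, ← Finset.sum_sub_distrib]
    exact Finset.sum_congr rfl fun j _ => smul_sub _ _ _

theorem contDiff_mul_of_tsupport_subset {W : Set (Euc d)} (hW : IsOpen W) {S φ : Euc d → ℝ}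
    (hS : ContDiffOn ℝ ∞ S W) (hφ : ContDiff ℝ ∞ φ) (hs : tsupport φ ⊆ W) :
    ContDiff ℝ ∞ fun x => φ x * S x := by
  rw [contDiff_iff_contDiffAt]
  intro x
  by_cases hx : x ∈ tsupport φ
  · exact hφ.contDiffAt.mul (hS.contDiffAt (hW.mem_nhds (hs hx)))
  · refine contDiffAt_const (c := (0 : ℝ)) |>.congr_of_eventuallyEq ?_
    filter_upwards [(isClosed_tsupport φ).isOpen_compl.mem_nhds hx] with y hy
    rw [image_eq_zero_of_notMem_tsupport hy, zero_mul]

/-- The product of a weakly differentiable function on `U` and of a smooth function on `W` which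
vanishes near `W \ U`. -/
theorem HasWeakGrad.smooth_smul {U W : Set (Euc d)} (hU : IsOpen U) (hW : IsOpen W)
    {S : Euc d → ℝ} (hS : ContDiffOn ℝ ∞ S W) (hSU : ∀ x ∈ W, x ∈ U ∨ S =ᶠ[𝓝 x] 0)
    {u : Euc d → V} {G : Fin d → Euc d → V} (h : HasWeakGrad U u G) :
    HasWeakGrad W (fun x => S x • u x)
      (fun i x => S x • G i x + fderiv ℝ S x (EuclideanSpace.single i 1) • u x) := by
  have hS' : ∀ i, ContinuousOn (fun x => fderiv ℝ S x (EuclideanSpace.single i 1)) W := fun i =>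
    (hS.continuousOn_fderiv_of_isOpen hW (by simp)).clm_apply continuousOn_const
  -- Nothing is known about `u` in `W` outside `U`. The product is locally integrable there all the
  -- same, because near such points its smooth factor is zero.
  have hli : ∀ (f : Euc d → V) (g : Euc d → ℝ), LocallyIntegrableOn f U → ContinuousOn g W →
      (∀ x ∈ W, x ∈ U ∨ g =ᶠ[𝓝 x] 0) → LocallyIntegrableOn (fun x => g x • f x) W := by
    intro f g hf hg hgU x hx
    rcases hgU x hx with hxU | h0
    · have h1 : LocallyIntegrableOn (fun x => g x • f x) (U ∩ W) :=
        (hf.mono_set inter_subset_left).continuousOn_smul (hU.inter hW).isLocallyClosed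
          (hg.mono inter_subset_right)
      obtain ⟨t, ht, hft⟩ := h1 x ⟨hxU, hx⟩
      rw [(hU.inter hW).nhdsWithin_eq ⟨hxU, hx⟩] at ht
      exact ⟨t, mem_nhdsWithin_of_mem_nhds ht, hft⟩
    · obtain ⟨t, ht, hto, hxt⟩ := eventually_nhds_iff.1 h0
      refine ⟨t, mem_nhdsWithin_of_mem_nhds (hto.mem_nhds hxt), ?_⟩
      exact IntegrableOn.congr_fun (f := fun _ => (0 : V)) integrableOn_zero
        (fun y hy => by simp [ht y hy]) hto.measurableSet
  have hfS : ∀ i, ∀ x ∈ W, x ∈ U ∨ (fun x => fderiv ℝ S x (EuclideanSpace.single i 1)) =ᶠ[𝓝 x] 0 := by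
    intro i x hx
    refine (hSU x hx).imp id fun h0 => ?_
    filter_upwards [h0.eventuallyEq_nhds] with y hy
    rw [hy.fderiv_eq]; simp
  refine hasWeakGrad_of_integral_eq (hli u S h.1 hS.continuousOn hSU)
    (fun i => (hli _ S (h.2.1 i) hS.continuousOn hSU).add (hli u _ h.1 (hS' i) (hfS i)))
    fun i φ hφ hc hs => ?_
  -- So `φ S` is a test function for `u` on `U`, and the product rule for `φ S` is the claim.
  have hts : tsupport (fun x => φ x * S x) ⊆ U := by
    intro x hx
    have hxφ : x ∈ tsupport φ := tsupport_mul_subset_left hx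
    rcases hSU x (hs hxφ) with h' | h'
    · exact h'
    · exact absurd (tsupport_mul_subset_right hx) (notMem_tsupport_iff_eventuallyEq.2 h')
  have hcd := contDiff_mul_of_tsupport_subset hW hS hφ hs
  have hcs : HasCompactSupport fun x => φ x * S x := hc.mul_right
  have key := h.integral_eq i hcd hcs hts
  have hfd : ∀ x, fderiv ℝ (fun x => φ x * S x) x (EuclideanSpace.single i 1)
      = fderiv ℝ φ x (EuclideanSpace.single i 1) * S x
        + φ x * fderiv ℝ S x (EuclideanSpace.single i 1) := by
    intro x
    by_cases hx : x ∈ tsupport φ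
    · have h1 := ((hφ.differentiable (by simp)) x)
      have h2 := (hS.contDiffAt (hW.mem_nhds (hs hx))).differentiableAt (by simp)
      rw [fderiv_fun_mul h1 h2]
      simp [mul_comm]
      ring
    · have h1 : φ =ᶠ[𝓝 x] 0 := notMem_tsupport_iff_eventuallyEq.1 hx
      have h2 : (fun x => φ x * S x) =ᶠ[𝓝 x] 0 := by
        filter_upwards [h1] with y hy; simp [hy]
      rw [h2.fderiv_eq, h1.fderiv_eq, h1.self_of_nhds]; simp
  have hs' := (tsupport_fderiv_apply_subset' (EuclideanSpace.single i 1)).trans hs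
  have i1 := integrable_smul_of_locallyIntegrableOn (hli u S h.1 hS.continuousOn hSU)
    (continuous_fderiv_apply_of_contDiff hφ (EuclideanSpace.single i 1))
    (hasCompactSupport_fderiv_apply hc _) hs'
  have i2 := integrable_smul_of_locallyIntegrableOn (hli u _ h.1 (hS' i) (hfS i))
    hφ.continuous hc hs
  have i3 := integrable_smul_of_locallyIntegrableOn (hli _ S (h.2.1 i) hS.continuousOn hSU)
    hφ.continuous hc hs
  simp only [hfd, add_smul, mul_smul] at key
  simp only [smul_add]
  rw [integral_add i1 i2] at key
  rw [integral_add i3 i2, neg_add, ← key]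
  abel

/-- Absolute continuity of the integral, as the sets where the cut-off differs from 1 shrink in
measure. -/
theorem tendsto_integral_cutoff_smul {ζ : ℕ → Euc d → ℝ} (hζ : ∀ k, Continuous (ζ k))
    (h01 : ∀ k x, 0 ≤ ζ k x ∧ ζ k x ≤ 1)
    (hvol : Tendsto (fun k => volume {x | ζ k x ≠ 1}) atTop (𝓝 0)) {g : Euc d → V}
    (hg : Integrable g) : Tendsto (fun k => ∫ x, ζ k x • g x) atTop (𝓝 (∫ x, g x)) := by
  have hb : ∀ k x, ‖ζ k x‖ ≤ 1 := fun k x => by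
    rw [Real.norm_of_nonneg (h01 k x).1]; exact (h01 k x).2
  have hi : ∀ k, Integrable (fun x => ζ k x • g x) := fun k =>
    hg.bdd_smul 1 (hζ k).aestronglyMeasurable (Eventually.of_forall (hb k))
  refine tendsto_integral_of_L1 g hg.aestronglyMeasurable (Eventually.of_forall hi) ?_
  have t := tendsto_setLIntegral_zero (f := fun x => ‖g x‖ₑ) hg.2.ne hvol
  refine tendsto_of_tendsto_of_tendsto_of_le_of_le tendsto_const_nhds t (fun _ => zero_le)
    fun k => ?_
  have hm : MeasurableSet {x | ζ k x ≠ 1} :=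
    (isOpen_ne_fun (hζ k) continuous_const).measurableSet
  rw [← lintegral_indicator hm]
  refine lintegral_mono fun x => ?_
  by_cases hx : ζ k x = 1
  · simp [hx]
  · rw [indicator_of_mem (show x ∈ {x | ζ k x ≠ 1} from hx)]
    have : ζ k x • g x - g x = (ζ k x - 1) • g x := by rw [sub_smul, one_smul]
    rw [this, enorm_smul]
    calc ‖ζ k x - 1‖ₑ * ‖g x‖ₑ ≤ 1 * ‖g x‖ₑ := by
          gcongr
          rw [← ofReal_norm, ← ENNReal.ofReal_one]
          refine ENNReal.ofReal_le_ofReal ?_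
          rw [Real.norm_eq_abs, abs_le]
          constructor <;> linarith [(h01 k x).1, (h01 k x).2]
      _ = _ := one_mul _

/-- A weak gradient off `Γ` is a weak gradient if cut-off functions do not see `Γ`. -/
theorem hasWeakGrad_of_cutoff {U Γ : Set (Euc d)} {u : Euc d → V} {G : Fin d → Euc d → V}
    (hu : LocallyIntegrableOn u U) (hG : ∀ i, LocallyIntegrableOn (G i) U)
    (h : HasWeakGrad (U \ Γ) u G)
    (hζ : ∀ (i : Fin d) (φ : Euc d → ℝ), ContDiff ℝ ∞ φ → HasCompactSupport φ → tsupport φ ⊆ U →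
      ∃ ζ : ℕ → Euc d → ℝ, (∀ k, ContDiff ℝ ∞ (ζ k)) ∧ (∀ k x, 0 ≤ ζ k x ∧ ζ k x ≤ 1) ∧
        (∀ k, ∀ x ∈ Γ, ζ k =ᶠ[𝓝 x] 0) ∧ Tendsto (fun k => volume {x | ζ k x ≠ 1}) atTop (𝓝 0) ∧
        Tendsto (fun k => ∫ x, (φ x * fderiv ℝ (ζ k) x (EuclideanSpace.single i 1)) • u x)
          atTop (𝓝 0)) : HasWeakGrad U u G := by
  refine hasWeakGrad_of_integral_eq hu hG fun i φ hφ hc hs => ?_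
  obtain ⟨ζ, hζs, h01, hζΓ, hvol, hζu⟩ := hζ i φ hφ hc hs
  have c1 := continuous_fderiv_apply_of_contDiff hφ (EuclideanSpace.single i 1)
  have s1 := (tsupport_fderiv_apply_subset' (φ := φ) (EuclideanSpace.single i 1)).trans hs
  have i1 := integrable_smul_of_locallyIntegrableOn hu c1 (hasCompactSupport_fderiv_apply hc _) s1
  have i2 := integrable_smul_of_locallyIntegrableOn (hG i) hφ.continuous hc hs
  have t1 := tendsto_integral_cutoff_smul (fun k => (hζs k).continuous) h01 hvol i1
  have t2 := tendsto_integral_cutoff_smul (fun k => (hζs k).continuous) h01 hvol i2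
  have t3 := t1.add hζu
  rw [add_zero] at t3
  -- The identity off `Γ` is tested with `φ ζ_k`. Of the two terms of its derivative, the one with
  -- the derivative of `ζ_k` disappears in the limit by assumption.
  refine tendsto_nhds_unique (t3.congr fun k => ?_) t2.neg
  have hts : tsupport (fun x => φ x * ζ k x) ⊆ U \ Γ := by
    intro x hx
    refine ⟨hs (tsupport_mul_subset_left hx), fun hxΓ => ?_⟩
    exact absurd (tsupport_mul_subset_right hx) (notMem_tsupport_iff_eventuallyEq.2 (hζΓ k x hxΓ))
  have key := h.integral_eq i (hφ.mul (hζs k)) (hc.mul_right (f' := ζ k)) hts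
  have c3 : Continuous fun x => φ x * fderiv ℝ (ζ k) x (EuclideanSpace.single i 1) :=
    hφ.continuous.mul (continuous_fderiv_apply_of_contDiff (hζs k) _)
  have i3 := integrable_smul_of_locallyIntegrableOn hu c3
    (hc.mul_right (f' := fun x => fderiv ℝ (ζ k) x (EuclideanSpace.single i 1)))
    ((tsupport_mul_subset_left).trans hs)
  have i4 : Integrable (fun x => ζ k x • fderiv ℝ φ x (EuclideanSpace.single i 1) • u x) :=
    i1.bdd_smul 1 (hζs k).continuous.aestronglyMeasurable (Eventually.of_forall fun x => by
      rw [Real.norm_of_nonneg (h01 k x).1]; exact (h01 k x).2)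
  rw [← integral_add i4 i3]
  have e1 : ∫ x, fderiv ℝ (fun x => φ x * ζ k x) x (EuclideanSpace.single i 1) • u x
      = ∫ x, (ζ k x • fderiv ℝ φ x (EuclideanSpace.single i 1) • u x
        + (φ x * fderiv ℝ (ζ k) x (EuclideanSpace.single i 1)) • u x) := by
    refine integral_congr_ae (Eventually.of_forall fun x => ?_)
    simp only
    rw [fderiv_fun_mul (hφ.differentiable (by simp) x) ((hζs k).differentiable (by simp) x)]
    simp only [_root_.add_apply, _root_.smul_apply, smul_eq_mul]
    rw [smul_smul, ← add_smul, add_comm]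
  rw [← e1, key]
  congr 1
  refine integral_congr_ae (Eventually.of_forall fun x => ?_)
  simp only [smul_smul, mul_comm]

end WeakCalculus

/-! ### Smoothness of the signed distance near the interface. -/

section TubeGeometry

variable {d : ℕ}

open scoped RealInnerProductSpace

/-- The open `r`-neighbourhood of `Γ`. -/
def nbhd (Γ : Set (Euc d)) (r : ℝ) : Set (Euc d) := {x | Metric.infDist x Γ < r}

/-- A smooth interface together with a tubular radius. -/
structure TubeSetting (Ω Ωp Ωm Γ : Set (Euc d)) (δΓ : ℝ) : Prop where
  isOpen : IsOpen Ω
  interface : IsSmoothInterface Ω Ωp Ωm Γ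
  radius : IsTubularRadius Ω Ωp Γ δΓ

/-- The reflection across `Γ`. -/
noncomputable def refl (Γ : Set (Euc d)) (x : Euc d) : Euc d :=
  x - gradient (fun y => Metric.infDist y Γ ^ 2) x

theorem isOpen_nbhd (Γ : Set (Euc d)) (r : ℝ) : IsOpen (nbhd Γ r) :=
  isOpen_lt (Metric.continuous_infDist_pt Γ) continuous_const

theorem nbhd_mono (Γ : Set (Euc d)) {r s : ℝ} (h : r ≤ s) : nbhd Γ r ⊆ nbhd Γ s :=
  fun _ hx => lt_of_lt_of_le hx h

theorem infDist_of_mem {Γ : Set (Euc d)} {x : Euc d} (hx : x ∈ Γ) : Metric.infDist x Γ = 0 :=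
  Metric.infDist_zero_of_mem hx

theorem abs_signedDist (Ωp Γ : Set (Euc d)) (x : Euc d) :
    |signedDist Ωp Γ x| = Metric.infDist x Γ := by
  unfold signedDist
  split_ifs
  · exact abs_of_nonneg Metric.infDist_nonneg
  · rw [abs_neg]; exact abs_of_nonneg Metric.infDist_nonneg

theorem IsSmoothInterface.symm {Ω Ωp Ωm Γ : Set (Euc d)} (h : IsSmoothInterface Ω Ωp Ωm Γ) :
    IsSmoothInterface Ω Ωm Ωp Γ where
  isOpen_plus := h.isOpen_minus
  isOpen_minus := h.isOpen_plus
  isCompact := h.isCompact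
  nonempty := h.nonempty
  union_eq := by rw [← h.union_eq]; ac_rfl
  disjoint_plus_minus := h.disjoint_plus_minus.symm
  disjoint_plus := h.disjoint_minus
  disjoint_minus := h.disjoint_plus
  smooth p hp := by
    obtain ⟨r, g, hr, hg, hgp, hx⟩ := h.smooth p hp
    refine ⟨r, fun x => - g x, hr, hg.neg, ?_, fun x hxr => ?_⟩
    · rw [show gradient (fun x => - g x) p = - gradient g p by
        simp only [gradient, fderiv_fun_neg, map_neg]]
      exact neg_ne_zero.2 hgp
    · obtain ⟨h1, h2, h3⟩ := hx x hxr
      exact ⟨by rw [h3]; simp, by rw [h2]; simp, by rw [h1]; simp⟩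

theorem tube_swap (Ω Ωp Ωm Γ : Set (Euc d)) (r : ℝ) : tube Ω Ωp Γ r = tube Ω Ωm Γ r := by
  simp only [tube, abs_signedDist]

theorem TubeSetting.symm {Ω Ωp Ωm Γ : Set (Euc d)} {δΓ : ℝ} (h : TubeSetting Ω Ωp Ωm Γ δΓ) :
    TubeSetting Ω Ωm Ωp Γ δΓ where
  isOpen := h.isOpen
  interface := h.interface.symm
  radius := by
    obtain ⟨h1, h2, h3, h4⟩ := h.radius
    refine ⟨h1, h2, ?_, h4⟩
    rwa [← tube_swap Ω Ωp Ωm]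

variable {Ω Ωp Ωm Γ : Set (Euc d)} {δΓ : ℝ}

theorem TubeSetting.subset (h : TubeSetting Ω Ωp Ωm Γ δΓ) : Γ ⊆ Ω := by
  rw [← h.interface.union_eq]
  exact fun x hx => Or.inl (Or.inr hx)

/-- Otherwise the segment from a nearest point of `Γ` to `x` would meet the boundary of `Ω` at
distance less than `δΓ` from `Γ`. -/
theorem TubeSetting.nbhd_subset (h : TubeSetting Ω Ωp Ωm Γ δΓ) : nbhd Γ δΓ ⊆ Ω := by
  intro x hx
  by_contra hxΩ
  obtain ⟨p, hp, hxp⟩ := h.interface.isCompact.exists_infDist_eq_dist h.interface.nonempty x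
  obtain ⟨z, hz, hzf⟩ : ∃ z ∈ segment ℝ p x, z ∈ frontier Ω := by
    by_contra! hno
    have hcov : segment ℝ p x ⊆ Ω ∪ (closure Ω)ᶜ := by
      intro z hz
      by_cases hzΩ : z ∈ Ω
      · exact Or.inl hzΩ
      · refine Or.inr fun hzc => hno z hz ⟨hzc, ?_⟩
        rwa [h.isOpen.interior_eq]
    have hxc : x ∈ (closure Ω)ᶜ := (hcov (right_mem_segment ℝ p x)).resolve_left hxΩ
    obtain ⟨z, -, hz1, hz2⟩ := (convex_segment p x).isPreconnected Ω (closure Ω)ᶜ h.isOpen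
      isClosed_closure.isOpen_compl hcov ⟨p, left_mem_segment ℝ p x, h.subset hp⟩
      ⟨x, right_mem_segment ℝ p x, hxc⟩
    exact hz2 (subset_closure hz1)
  have h1 := h.radius.away p hp z hzf
  have h2 : dist p z ≤ dist p x := by
    have := dist_add_dist_of_mem_segment hz
    linarith [dist_nonneg (x := z) (y := x)]
  have h3 : dist x p < δΓ := by rw [← hxp]; exact hx
  rw [dist_comm] at h3
  linarith

theorem TubeSetting.tube_eq (h : TubeSetting Ω Ωp Ωm Γ δΓ) {r : ℝ} (hr : r ≤ δΓ) :
    tube Ω Ωp Γ r = nbhd Γ r := by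
  ext x
  simp only [tube, abs_signedDist, nbhd, mem_ofPred_eq]
  exact ⟨fun hx => hx.2, fun hx => ⟨h.nbhd_subset (nbhd_mono Γ hr hx), hx⟩⟩

theorem TubeSetting.mem_or (h : TubeSetting Ω Ωp Ωm Γ δΓ) {x : Euc d} (hx : x ∈ Ω) :
    x ∈ Ωp ∨ x ∈ Γ ∨ x ∈ Ωm := by
  rw [← h.interface.union_eq] at hx
  rcases hx with (h1 | h1) | h1 <;> simp [h1]

theorem TubeSetting.infDist_pos (h : TubeSetting Ω Ωp Ωm Γ δΓ) {x : Euc d} (hx : x ∉ Γ) :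
    0 < Metric.infDist x Γ :=
  (h.interface.isCompact.isClosed.notMem_iff_infDist_pos h.interface.nonempty).1 hx

theorem TubeSetting.signedDist_eq (h : TubeSetting Ω Ωp Ωm Γ δΓ) {x : Euc d} (hx : x ∈ Ω) :
    signedDist Ωm Γ x = - signedDist Ωp Γ x := by
  have d1 := h.interface.disjoint_plus_minus
  have d2 := h.interface.disjoint_plus
  have d3 := h.interface.disjoint_minus
  unfold signedDist
  rcases h.mem_or hx with h1 | h1 | h1
  · rw [if_neg (d1.notMem_of_mem_left h1), if_pos h1]
  · rw [if_neg (d3.notMem_of_mem_right h1), if_neg (d2.notMem_of_mem_right h1), infDist_of_mem h1]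
    simp
  · rw [if_pos h1, if_neg (d1.notMem_of_mem_right h1)]; simp

theorem TubeSetting.signedDist_pos_iff (h : TubeSetting Ω Ωp Ωm Γ δΓ) {x : Euc d} :
    0 < signedDist Ωp Γ x ↔ x ∈ Ωp := by
  unfold signedDist
  constructor
  · intro h0
    by_contra hx
    rw [if_neg hx] at h0
    linarith [Metric.infDist_nonneg (x := x) (s := Γ)]
  · intro hx
    rw [if_pos hx]
    exact h.infDist_pos (h.interface.disjoint_plus.notMem_of_mem_left hx)

theorem TubeSetting.signedDist_eq_zero (_h : TubeSetting Ω Ωp Ωm Γ δΓ) {x : Euc d} (hx : x ∈ Γ) :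
    signedDist Ωp Γ x = 0 := by
  rw [← abs_eq_zero, abs_signedDist, infDist_of_mem hx]

theorem TubeSetting.signedDist_neg_iff (h : TubeSetting Ω Ωp Ωm Γ δΓ) {x : Euc d} (hx : x ∈ Ω) :
    signedDist Ωp Γ x < 0 ↔ x ∈ Ωm := by
  rw [← h.symm.signedDist_pos_iff, h.signedDist_eq hx]; simp

theorem TubeSetting.signedDist_sq (_h : TubeSetting Ω Ωp Ωm Γ δΓ) (x : Euc d) :
    signedDist Ωp Γ x ^ 2 = Metric.infDist x Γ ^ 2 := by
  rw [← sq_abs, abs_signedDist]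

theorem TubeSetting.mem_nbhd (h : TubeSetting Ω Ωp Ωm Γ δΓ) {x : Euc d} (hx : x ∈ Γ) :
    x ∈ nbhd Γ δΓ := by
  change Metric.infDist x Γ < δΓ
  rw [infDist_of_mem hx]; exact h.radius.pos

/-- The nearest-point projection. -/
theorem TubeSetting.exists_projection (h : TubeSetting Ω Ωp Ωm Γ δΓ) :
    ∃ P : Euc d → Euc d, ContDiffOn ℝ ∞ P (nbhd Γ δΓ) ∧ (∀ x ∈ nbhd Γ δΓ, P x ∈ Γ ∧
      dist x (P x) = Metric.infDist x Γ ∧ ∀ y ∈ Γ, dist x y = Metric.infDist x Γ → y = P x) ∧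
      (∀ x ∈ nbhd Γ δΓ, HasGradientAt (fun y => Metric.infDist y Γ ^ 2) ((2 : ℝ) • (x - P x)) x) ∧
      (∀ x ∈ nbhd Γ δΓ, refl Γ x = (2 : ℝ) • P x - x) ∧ ∀ x ∈ Γ, P x = x := by
  obtain ⟨P, hP, hPx⟩ := h.radius.smooth_projection
  rw [h.tube_eq le_rfl] at hP hPx
  -- Envelope argument: `y ↦ ‖x - P y‖²` is minimal at `y = x`, so the variation of `P` does not
  -- contribute to the derivative of `‖y - P y‖²`. No formula for the derivative of `P` is needed.
  have hgrad : ∀ x ∈ nbhd Γ δΓ,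
      HasGradientAt (fun y => Metric.infDist y Γ ^ 2) ((2 : ℝ) • (x - P x)) x := by
    intro x hx
    have hT := (isOpen_nbhd Γ δΓ).mem_nhds hx
    have hPd := ((hP.contDiffAt hT).differentiableAt (by simp)).hasFDerivAt
    have h1 : HasFDerivAt (fun y => ‖x - P y‖ ^ 2) _ x := (hPd.const_sub x).norm_sq
    have hmin : IsLocalMin (fun y => ‖x - P y‖ ^ 2) x := by
      filter_upwards [hT] with y hy
      have e1 : ‖x - P x‖ = Metric.infDist x Γ := by rw [← dist_eq_norm, (hPx x hx).2.1]
      have e2 : Metric.infDist x Γ ≤ ‖x - P y‖ := by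
        rw [← dist_eq_norm]; exact Metric.infDist_le_dist_of_mem (hPx y hy).1
      rw [e1]
      exact pow_le_pow_left₀ Metric.infDist_nonneg e2 2
    have h2 := hmin.hasFDerivAt_eq_zero h1
    have h3 : HasFDerivAt (fun y => ‖y - P y‖ ^ 2) _ x := ((hasFDerivAt_id x).sub hPd).norm_sq
    rw [hasGradientAt_iff_hasFDerivAt]
    refine HasFDerivAt.congr_of_eventuallyEq (h3.congr_fderiv ?_) ?_
    · ext v
      have h4 := congrArg (fun L => L v) h2
      simp only [ContinuousLinearMap.comp_apply, _root_.neg_apply, innerSL_apply_apply,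
        inner_neg_right, _root_.zero_apply, two_smul, _root_.add_apply] at h4
      rw [inner_sub_left] at h4
      simp [two_smul]
      linarith
    · filter_upwards [hT] with y hy
      rw [← (hPx y hy).2.1, dist_eq_norm]
  refine ⟨P, hP, hPx, hgrad, fun x hx => ?_, fun x hx => ?_⟩
  · rw [refl, (hgrad x hx).gradient]
    simp only [two_smul]; abel
  · refine ((hPx x (h.mem_nbhd hx)).2.2 x hx ?_).symm
    rw [dist_self, infDist_of_mem hx]

theorem contDiffOn_gradient {f : Euc d → ℝ} {T : Set (Euc d)} (hT : IsOpen T)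
    (hf : ContDiffOn ℝ ∞ f T) : ContDiffOn ℝ ∞ (gradient f) T :=
  (InnerProductSpace.toDual ℝ (Euc d)).symm.toContinuousLinearEquiv.contDiff.comp_contDiffOn
    (hf.fderiv_of_isOpen hT (by simp))

/-- With a local defining function `g`, the candidate is the component `D` of `x - P x` along the
unit normal `∇g/‖∇g‖` at `P x`, which is visibly smooth. The multiplier rule makes `x - P x`
parallel to that normal, whence `|D|` is the distance. The mean value theorem for `g` between `P x`
and `x` gives `D` the sign of `g x`. -/
theorem TubeSetting.contDiffAt_signedDist_of_mem (h : TubeSetting Ω Ωp Ωm Γ δΓ) {p : Euc d}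
    (hp : p ∈ Γ) : ContDiffAt ℝ ∞ (signedDist Ωp Γ) p := by
  obtain ⟨P, hP, hPx, -, -, hPp⟩ := h.exists_projection
  obtain ⟨r, g, hr, hg, hgp, hgx⟩ := h.interface.smooth p hp
  have hT := (isOpen_nbhd Γ δΓ).mem_nhds (h.mem_nbhd hp)
  have hPc : ContDiffAt ℝ ∞ P p := hP.contDiffAt hT
  have hgg : ContDiff ℝ ∞ (gradient g) :=
    contDiffOn_univ.1 (contDiffOn_gradient isOpen_univ hg.contDiffOn)
  have hgc : Continuous (gradient g) := hgg.continuous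
  have hPcont : ContinuousAt P p := hPc.continuousAt
  -- On a small ball the gradients of `g` at any two points form an acute angle. This keeps `∇g`
  -- nonzero and later decides the sign.
  obtain ⟨ρ, hρ, hρr, hin⟩ : ∃ ρ > 0, ρ ≤ r ∧ ∀ z ∈ Metric.ball p ρ, ∀ y ∈ Metric.ball p ρ,
      0 < ⟪gradient g z, gradient g y⟫ := by
    have hc : Continuous fun q : Euc d × Euc d => ⟪gradient g q.1, gradient g q.2⟫ := by fun_prop
    have h0 : 0 < ⟪gradient g p, gradient g p⟫ := by
      rw [real_inner_self_eq_norm_sq]; exact pow_pos (norm_pos_iff.2 hgp) 2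
    have hev := (hc.tendsto (p, p)).eventually (lt_mem_nhds h0)
    obtain ⟨ρ, hρ, hb⟩ := Metric.eventually_nhds_iff.1 hev
    exact ⟨min ρ r, lt_min hρ hr, min_le_right _ _, fun z hz y hy =>
      hb (y := (z, y)) (max_lt (lt_of_lt_of_le hz (min_le_left _ _))
        (lt_of_lt_of_le hy (min_le_left _ _)))⟩
  let D : Euc d → ℝ := fun x => ⟪x - P x, (‖gradient g (P x)‖⁻¹ : ℝ) • gradient g (P x)⟫
  have hD : ContDiffAt ℝ ∞ D p := by
    have h1 : ContDiffAt ℝ ∞ (fun x => gradient g (P x)) p := hgg.contDiffAt.comp p hPc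
    have h2 : gradient g (P p) ≠ 0 := by rwa [hPp p hp]
    exact (contDiffAt_id.sub hPc).inner ℝ (((h1.norm ℝ h2).inv (norm_ne_zero_iff.2 h2)).smul h1)
  refine hD.congr_of_eventuallyEq ?_
  have hPb : ∀ᶠ x in 𝓝 p, P x ∈ Metric.ball p ρ :=
    hPcont (by rw [hPp p hp]; exact Metric.ball_mem_nhds p hρ)
  filter_upwards [hT, hPb, Metric.ball_mem_nhds p hρ] with x hxT hPxb hxb
  obtain ⟨hPΓ, hPd, -⟩ := hPx x hxT
  have hball : Metric.ball p ρ ⊆ Metric.ball p r := Metric.ball_subset_ball hρr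
  have hg0 : g (P x) = 0 := ((hgx _ (hball hPxb)).2.1).1 hPΓ
  have hgP : gradient g (P x) ≠ 0 := by
    intro h0
    have := hin _ hPxb _ hPxb
    rw [h0, inner_zero_left] at this
    exact lt_irrefl _ this
  have hgn : 0 < ‖gradient g (P x)‖ := norm_pos_iff.2 hgP
  -- the multiplier rule
  have hext : IsLocalExtrOn (fun y => ‖x - y‖ ^ 2) {y | g y = g (P x)} (P x) := by
    refine Or.inl ?_
    have hnear : ∀ᶠ y in 𝓝[{y | g y = g (P x)}] (P x), y ∈ Metric.ball p r :=
      mem_nhdsWithin_of_mem_nhds (Metric.isOpen_ball.mem_nhds (hball hPxb))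
    filter_upwards [hnear, self_mem_nhdsWithin] with y hy hgy
    have hyΓ : y ∈ Γ := ((hgx y hy).2.1).2 (Eq.trans hgy hg0)
    rw [← dist_eq_norm, ← dist_eq_norm, hPd]
    exact pow_le_pow_left₀ Metric.infDist_nonneg (Metric.infDist_le_dist_of_mem hyΓ) 2
  have hgs : HasStrictFDerivAt g (fderiv ℝ g (P x)) (P x) :=
    hg.contDiffAt.hasStrictFDerivAt (by simp)
  have hns : HasStrictFDerivAt (fun y : Euc d => ‖x - y‖ ^ 2)
      (2 • (innerSL ℝ (x - P x)).comp (-ContinuousLinearMap.id ℝ (Euc d))) (P x) :=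
    (hasStrictFDerivAt_norm_sq (x - P x)).comp (P x) ((hasStrictFDerivAt_id (P x)).const_sub x)
  obtain ⟨a, b, hab, hmul⟩ := hext.exists_multipliers_of_hasStrictFDerivAt_1d hgs hns
  have hv : ∀ v, a * ⟪gradient g (P x), v⟫ = 2 * b * ⟪x - P x, v⟫ := by
    intro v
    have := congrArg (fun L => L v) hmul
    simp only [_root_.add_apply, _root_.smul_apply, ContinuousLinearMap.comp_apply,
      _root_.neg_apply, ContinuousLinearMap.id_apply, innerSL_apply_apply, inner_neg_right,
      _root_.zero_apply, smul_eq_mul, nsmul_eq_mul, Nat.cast_ofNat] at this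
    rw [inner_gradient_left]
    linarith
  -- A vanishing multiplier of the objective would force `∇g = 0` at `P x`.
  have hb : b ≠ 0 := by
    intro hb0
    have ha : a ≠ 0 := fun ha0 => hab (by rw [ha0, hb0]; rfl)
    have := hv (gradient g (P x))
    rw [hb0, real_inner_self_eq_norm_sq] at this
    simp [ha, hgP] at this
  have hxP : x - P x = D x • ((‖gradient g (P x)‖⁻¹ : ℝ) • gradient g (P x)) := by
    have h1 : x - P x = (a / (2 * b)) • gradient g (P x) := by
      refine ext_inner_right ℝ fun v => ?_
      rw [real_inner_smul_left, div_mul_eq_mul_div, hv v]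
      field_simp
    have h2 : D x = (a / (2 * b)) * ‖gradient g (P x)‖ := by
      simp only [D]
      rw [h1, real_inner_smul_left, real_inner_smul_right, real_inner_self_eq_norm_sq]
      field_simp
    rw [h2, smul_smul, mul_assoc, mul_inv_cancel₀ hgn.ne', mul_one]
    exact h1
  have habs : |D x| = Metric.infDist x Γ := by
    rw [← hPd, dist_eq_norm]
    conv_rhs => rw [hxP]
    rw [norm_smul, norm_smul, norm_inv, norm_norm, inv_mul_cancel₀ hgn.ne', mul_one,
      Real.norm_eq_abs]
  -- the sign
  obtain ⟨z, hz, hgz⟩ := domain_mvt (f := g) (f' := fun y => fderiv ℝ g y)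
    (s := Metric.ball p ρ) (x := P x) (y := x)
    (fun y _ => (hg.differentiable (by simp) y).hasFDerivAt.hasFDerivWithinAt)
    (convex_ball p ρ) hPxb hxb
  have hzb : z ∈ Metric.ball p ρ := (convex_ball p ρ).segment_subset hPxb hxb hz
  have hgxD : g x = D x * (‖gradient g (P x)‖⁻¹ * ⟪gradient g z, gradient g (P x)⟫) := by
    have h1 : g x = ⟪gradient g z, x - P x⟫ := by
      rw [inner_gradient_left]; simpa [hg0] using hgz
    rw [hxP, real_inner_smul_right, real_inner_smul_right] at h1
    exact h1
  have hpos : 0 < ‖gradient g (P x)‖⁻¹ * ⟪gradient g z, gradient g (P x)⟫ :=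
    mul_pos (inv_pos.2 hgn) (hin _ hzb _ hPxb)
  unfold signedDist
  split_ifs with hxp
  · have hgpos : 0 < g x := ((hgx x (hball hxb)).1).1 hxp
    rw [hgxD] at hgpos
    rw [← habs]
    exact abs_of_pos (pos_of_mul_pos_left hgpos hpos.le)
  · have hgpos : ¬ 0 < g x := fun h0 => hxp (((hgx x (hball hxb)).1).2 h0)
    rw [hgxD] at hgpos
    have : D x ≤ 0 := by
      by_contra h0
      exact hgpos (mul_pos (not_le.1 h0) hpos)
    rw [← habs, abs_of_nonpos this, neg_neg]

/-- Off `Γ` the signed distance is locally `±‖x - P x‖` with nonzero argument; on `Γ` the local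
formula applies. -/
theorem TubeSetting.contDiffOn_signedDist (h : TubeSetting Ω Ωp Ωm Γ δΓ) :
    ContDiffOn ℝ ∞ (signedDist Ωp Γ) (nbhd Γ δΓ) := by
  have key : ∀ {Ωp Ωm : Set (Euc d)}, TubeSetting Ω Ωp Ωm Γ δΓ → ∀ x ∈ nbhd Γ δΓ, x ∈ Ωp →
      ContDiffAt ℝ ∞ (signedDist Ωp Γ) x := by
    intro Ωp Ωm h x hx hxp
    obtain ⟨P, hP, hPx, -, -, -⟩ := h.exists_projection
    have hT := (isOpen_nbhd Γ δΓ).mem_nhds hx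
    have hne : x - P x ≠ 0 := by
      intro h0
      have : x ∈ Γ := by rw [sub_eq_zero.1 h0]; exact (hPx x hx).1
      exact h.interface.disjoint_plus.notMem_of_mem_left hxp this
    refine ((contDiffAt_id.sub (hP.contDiffAt hT)).norm ℝ hne).congr_of_eventuallyEq ?_
    filter_upwards [hT, h.interface.isOpen_plus.mem_nhds hxp] with y hy hyp
    rw [signedDist, if_pos hyp, ← (hPx y hy).2.1, dist_eq_norm]
    rfl
  intro x hx
  refine ContDiffAt.contDiffWithinAt ?_
  rcases h.mem_or (h.nbhd_subset hx) with h1 | h1 | h1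
  · exact key h x hx h1
  · exact h.contDiffAt_signedDist_of_mem h1
  · refine (key h.symm x hx h1).neg.congr_of_eventuallyEq ?_
    filter_upwards [(isOpen_nbhd Γ δΓ).mem_nhds hx] with y hy
    rw [h.signedDist_eq (h.nbhd_subset hy), neg_neg]

theorem TubeSetting.differentiableAt_signedDist (h : TubeSetting Ω Ωp Ωm Γ δΓ) {x : Euc d}
    (hx : x ∈ nbhd Γ δΓ) : DifferentiableAt ℝ (signedDist Ωp Γ) x :=
  (h.contDiffOn_signedDist.contDiffAt ((isOpen_nbhd Γ δΓ).mem_nhds hx)).differentiableAt (by simp)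

theorem TubeSetting.contDiffOn_normal (h : TubeSetting Ω Ωp Ωm Γ δΓ) :
    ContDiffOn ℝ ∞ (gradient (signedDist Ωp Γ)) (nbhd Γ δΓ) :=
  contDiffOn_gradient (isOpen_nbhd Γ δΓ) h.contDiffOn_signedDist

/-- Compares the two expressions for the gradient of the squared distance: `2(x - P x)` and `2 d
∇d`. -/
theorem TubeSetting.sub_projection_eq (h : TubeSetting Ω Ωp Ωm Γ δΓ) {P : Euc d → Euc d}
    (hP : ∀ x ∈ nbhd Γ δΓ, HasGradientAt (fun y => Metric.infDist y Γ ^ 2)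
      ((2 : ℝ) • (x - P x)) x) {x : Euc d} (hx : x ∈ nbhd Γ δΓ) :
    x - P x = signedDist Ωp Γ x • gradient (signedDist Ωp Γ) x := by
  have h1 := hP x hx
  have h2 := (h.differentiableAt_signedDist hx).hasFDerivAt.pow 2
  have h3 : HasFDerivAt (fun y => Metric.infDist y Γ ^ 2) _ x :=
    h2.congr_of_eventuallyEq (Eventually.of_forall fun y => (h.signedDist_sq y).symm)
  have h4 := h1.hasFDerivAt.unique h3
  refine ext_inner_right ℝ fun v => ?_
  have h5 := congrArg (fun L => L v) h4
  simp only [InnerProductSpace.toDual_apply_apply, real_inner_smul_left, _root_.smul_apply,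
    smul_eq_mul, nsmul_eq_mul, Nat.cast_ofNat] at h5
  rw [real_inner_smul_left, inner_gradient_left]
  simp at h5
  linarith

/-- Off `Γ`, take norms in `sub_projection_eq`. Points of `Γ` follow by continuity, since `Γ` has
empty interior: on an open piece the defining function would vanish identically, and so would its
gradient. -/
theorem TubeSetting.norm_normal (h : TubeSetting Ω Ωp Ωm Γ δΓ) {x : Euc d}
    (hx : x ∈ nbhd Γ δΓ) : ‖gradient (signedDist Ωp Γ) x‖ = 1 := by
  obtain ⟨P, hP, hPx, hgr, -, -⟩ := h.exists_projection
  have off : ∀ y ∈ nbhd Γ δΓ, y ∉ Γ → ‖gradient (signedDist Ωp Γ) y‖ = 1 := by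
    intro y hy hyΓ
    have h1 := congrArg norm (h.sub_projection_eq hgr hy)
    rw [norm_smul, Real.norm_eq_abs, abs_signedDist, ← dist_eq_norm, (hPx y hy).2.1] at h1
    have h2 := h.infDist_pos hyΓ
    nlinarith
  by_cases hxΓ : x ∈ Γ
  · have hcl : x ∈ closure (Γᶜ) := by
      rw [closure_compl]
      intro hint
      obtain ⟨r, g, hr, hg, hgp, hgx⟩ := h.interface.smooth x hxΓ
      have : g =ᶠ[𝓝 x] fun _ => 0 := by
        filter_upwards [mem_interior_iff_mem_nhds.1 hint, Metric.ball_mem_nhds x hr] with y hy hyb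
        exact ((hgx y hyb).2.1).1 hy
      apply hgp
      rw [gradient, this.fderiv_eq]
      simp
    have hT := (isOpen_nbhd Γ δΓ).mem_nhds hx
    have hc : ContinuousAt (fun y => ‖gradient (signedDist Ωp Γ) y‖) x :=
      ((h.contDiffOn_normal.continuousOn).continuousAt hT).norm
    have hne : (𝓝[Γᶜ] x).NeBot := mem_closure_iff_nhdsWithin_neBot.1 hcl
    refine tendsto_nhds_unique (l := 𝓝[Γᶜ] x) (hc.tendsto.mono_left nhdsWithin_le_nhds) ?_
    refine tendsto_const_nhds.congr' ?_
    filter_upwards [mem_nhdsWithin_of_mem_nhds hT, self_mem_nhdsWithin] with y hy hyΓ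
    exact (off y hy hyΓ).symm
  · exact off x hx hxΓ

/-- Differentiating `‖n‖² = 1` gives `⟨(Dn) v, n⟩ = 0` for all `v`; symmetry of the second
derivative moves `n` into the other slot. -/
theorem TubeSetting.fderiv_normal_normal (h : TubeSetting Ω Ωp Ωm Γ δΓ) {x : Euc d}
    (hx : x ∈ nbhd Γ δΓ) :
    fderiv ℝ (gradient (signedDist Ωp Γ)) x (gradient (signedDist Ωp Γ) x) = 0 := by
  have hT := (isOpen_nbhd Γ δΓ).mem_nhds hx
  set n := gradient (signedDist Ωp Γ) with hn
  have hcd := h.contDiffOn_signedDist.contDiffAt hT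
  have hnd : DifferentiableAt ℝ n x := (h.contDiffOn_normal.contDiffAt hT).differentiableAt (by simp)
  have hfd : ∀ v w, ⟪fderiv ℝ n x v, w⟫ = fderiv ℝ (fderiv ℝ (signedDist Ωp Γ)) x v w := by
    intro v w
    have e : n = fun y => (InnerProductSpace.toDual ℝ (Euc d)).symm.toContinuousLinearEquiv
        (fderiv ℝ (signedDist Ωp Γ) y) := rfl
    have hd2 : DifferentiableAt ℝ (fderiv ℝ (signedDist Ωp Γ)) x :=
      (hcd.fderiv_right (m := ∞) (by simp)).differentiableAt (by simp)
    have := ((InnerProductSpace.toDual ℝ (Euc d)).symm.toContinuousLinearEquiv.toContinuousLinearMap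
      ).hasFDerivAt.comp x hd2.hasFDerivAt
    have e2 : fderiv ℝ n x = _ := HasFDerivAt.fderiv this
    rw [e2]
    simp
  have hsym : IsSymmSndFDerivAt ℝ (signedDist Ωp Γ) x :=
    hcd.isSymmSndFDerivAt (by
    rw [minSmoothness_of_isRCLikeNormedField]
    exact WithTop.coe_le_coe.2 (le_top : (2 : ℕ∞) ≤ ⊤))
  have horth : ∀ v, ⟪fderiv ℝ n x v, n x⟫ = 0 := by
    intro v
    have h1 := hnd.hasFDerivAt.norm_sq
    have h2 : HasFDerivAt (fun y => ‖n y‖ ^ 2) (0 : Euc d →L[ℝ] ℝ) x := by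
      refine (hasFDerivAt_const (1 : ℝ) x).congr_of_eventuallyEq ?_
      filter_upwards [hT] with y hy
      rw [hn, h.norm_normal hy, one_pow]
    have h3 := congrArg (fun L => L v) (h1.unique h2)
    simp only [_root_.smul_apply, ContinuousLinearMap.comp_apply, innerSL_apply_apply,
      _root_.zero_apply, nsmul_eq_mul, Nat.cast_ofNat] at h3
    rw [real_inner_comm]
    linarith
  refine ext_inner_right ℝ fun w => ?_
  rw [inner_zero_left, hfd, hsym.eq, ← hfd]
  exact horth w

end TubeGeometry

/-! ### Normal lines and the reflection across the interface. -/

section Reflection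

variable {d : ℕ} {Ω Ωp Ωm Γ : Set (Euc d)} {δΓ : ℝ}

/-- Along the line in direction `n(x)`, the difference `n - n(x)` satisfies a linear differential
inequality and vanishes at the start, so Grönwall applies. -/
theorem TubeSetting.normal_const (h : TubeSetting Ω Ωp Ωm Γ δΓ) {x : Euc d} {σ : ℝ}
    (hσ : |σ| = 1) {b : ℝ}
    (hseg : ∀ t ∈ Icc 0 b, x + (t * σ) • gradient (signedDist Ωp Γ) x ∈ nbhd Γ δΓ) :
    ∀ t ∈ Icc 0 b, gradient (signedDist Ωp Γ) (x + (t * σ) • gradient (signedDist Ωp Γ) x)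
      = gradient (signedDist Ωp Γ) x := by
  set n := gradient (signedDist Ωp Γ) with hn
  have hT := isOpen_nbhd Γ δΓ
  have hnd : ∀ y ∈ nbhd Γ δΓ, HasFDerivAt n (fderiv ℝ n y) y := fun y hy =>
    ((h.contDiffOn_normal.contDiffAt (hT.mem_nhds hy)).differentiableAt (by simp)).hasFDerivAt
  have hγ : ∀ t : ℝ, HasDerivAt (fun t : ℝ => x + (t * σ) • n x) (σ • n x) t := by
    intro t
    have h1 := (((hasDerivAt_id t).mul_const σ).smul_const (n x)).const_add x
    simpa using h1
  have hder : ∀ t ∈ Icc 0 b, HasDerivAt (fun t : ℝ => n (x + (t * σ) • n x) - n x)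
      (fderiv ℝ n (x + (t * σ) • n x) (σ • n x)) t := fun t ht =>
    ((hnd _ (hseg t ht)).comp_hasDerivAt t (hγ t)).sub_const _
  have hcf : ContinuousOn (fun t : ℝ => ‖fderiv ℝ n (x + (t * σ) • n x)‖) (Icc 0 b) := by
    refine ((h.contDiffOn_normal.continuousOn_fderiv_of_isOpen hT (by simp)).comp
      (Continuous.continuousOn (by fun_prop)) hseg).norm
  obtain ⟨K, hK⟩ := isCompact_Icc.exists_bound_of_continuousOn hcf
  intro t ht
  have hb0 : (0 : ℝ) ∈ Icc 0 b := ⟨le_rfl, ht.1.trans ht.2⟩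
  have := norm_le_gronwallBound_of_norm_deriv_right_le (δ := 0) (K := K) (ε := 0)
    (f := fun t : ℝ => n (x + (t * σ) • n x) - n x)
    (f' := fun t => fderiv ℝ n (x + (t * σ) • n x) (σ • n x))
    (fun s hs => (hder s hs).continuousAt.continuousWithinAt)
    (fun s hs => (hder s (Ico_subset_Icc_self hs)).hasDerivWithinAt) (by simp) (fun s hs => ?_) t ht
  · rw [gronwallBound_ε0_δ0] at this
    exact sub_eq_zero.1 (norm_le_zero_iff.1 this)
  · have hs' := Ico_subset_Icc_self hs
    -- The derivative of `n` in its own direction vanishes, so the direction `n(x)` may be replaced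
    -- by its difference from the current normal. This makes the right-hand side linear in the
    -- unknown.
    have e : fderiv ℝ n (x + (s * σ) • n x) (σ • n x)
        = - (σ • fderiv ℝ n (x + (s * σ) • n x) (n (x + (s * σ) • n x) - n x)) := by
      rw [map_sub, h.fderiv_normal_normal (hseg s hs'), zero_sub, smul_neg, neg_neg, map_smul]
    rw [e, norm_neg, norm_smul, Real.norm_eq_abs, hσ, one_mul, add_zero]
    refine (ContinuousLinearMap.le_opNorm _ _).trans
      (mul_le_mul_of_nonneg_right ?_ (norm_nonneg _))
    simpa using hK s hs'

theorem TubeSetting.add_smul_normal_mem (h : TubeSetting Ω Ωp Ωm Γ δΓ) {y : Euc d} (hy : y ∈ Γ)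
    {s : ℝ} (hs : |s| < δΓ) : y + s • gradient (signedDist Ωp Γ) y ∈ nbhd Γ δΓ := by
  refine (Metric.infDist_le_dist_of_mem hy).trans_lt ?_
  rw [dist_eq_norm, add_sub_cancel_left, norm_smul, h.norm_normal (h.mem_nbhd hy), mul_one]
  exact hs

theorem TubeSetting.normal_add_smul (h : TubeSetting Ω Ωp Ωm Γ δΓ) {y : Euc d} (hy : y ∈ Γ)
    {s : ℝ} (hs : |s| < δΓ) : gradient (signedDist Ωp Γ) (y + s • gradient (signedDist Ωp Γ) y)
      = gradient (signedDist Ωp Γ) y := by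
  obtain ⟨σ, hσ, hsσ⟩ : ∃ σ : ℝ, |σ| = 1 ∧ |s| * σ = s := by
    rcases le_total 0 s with h0 | h0
    · exact ⟨1, abs_one, by rw [abs_of_nonneg h0, mul_one]⟩
    · exact ⟨-1, by simp, by rw [abs_of_nonpos h0]; ring⟩
  have := h.normal_const (x := y) hσ (b := |s|) (fun t ht => h.add_smul_normal_mem hy (by
    rw [abs_mul, hσ, mul_one, abs_of_nonneg ht.1]; exact ht.2.trans_lt hs)) |s|
    ⟨abs_nonneg s, le_rfl⟩
  rwa [hsσ] at this

/-- Along the normal line the derivative of the signed distance is `‖ν‖² = 1`, because the normal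
does not turn. -/
theorem TubeSetting.signedDist_add_smul (h : TubeSetting Ω Ωp Ωm Γ δΓ) {y : Euc d} (hy : y ∈ Γ)
    {s : ℝ} (hs : |s| < δΓ) :
    signedDist Ωp Γ (y + s • gradient (signedDist Ωp Γ) y) = s := by
  set ν := gradient (signedDist Ωp Γ) y with hν
  have hder : ∀ t ∈ Ioo (-δΓ) δΓ, HasDerivAt (fun t : ℝ => signedDist Ωp Γ (y + t • ν) - t) 0 t := by
    intro t ht
    have ht' : |t| < δΓ := abs_lt.2 ht
    have h1 := (h.differentiableAt_signedDist (h.add_smul_normal_mem hy ht')).hasFDerivAt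
    have h2 : HasDerivAt (fun t : ℝ => y + t • ν) ν t := by
      simpa using ((hasDerivAt_id t).smul_const ν).const_add y
    have h3 := (h1.comp_hasDerivAt t h2).sub (hasDerivAt_id t)
    have h4 : fderiv ℝ (signedDist Ωp Γ) (y + t • ν) ν - 1 = 0 := by
      rw [← inner_gradient_left, h.normal_add_smul hy ht', real_inner_self_eq_norm_sq,
        h.norm_normal (h.mem_nbhd hy)]
      norm_num
    rw [h4] at h3
    exact h3
  have h0 : (0 : ℝ) ∈ Ioo (-δΓ) δΓ := ⟨by linarith [h.radius.pos], h.radius.pos⟩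
  have hc := isOpen_Ioo.is_const_of_deriv_eq_zero (isPreconnected_Ioo (a := -δΓ) (b := δΓ))
    (f := fun t : ℝ => signedDist Ωp Γ (y + t • ν) - t)
    (fun t ht => (hder t ht).differentiableAt.differentiableWithinAt)
    (fun t ht => (hder t ht).deriv) (abs_lt.1 hs) h0
  simp only [zero_smul, add_zero, sub_zero, h.signedDist_eq_zero hy] at hc
  linarith

theorem TubeSetting.refl_eq (h : TubeSetting Ω Ωp Ωm Γ δΓ) {x : Euc d} (hx : x ∈ nbhd Γ δΓ) :
    refl Γ x = x - (2 * signedDist Ωp Γ x) • gradient (signedDist Ωp Γ) x := by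
  obtain ⟨P, -, -, hgr, hre, -⟩ := h.exists_projection
  rw [mul_smul, ← h.sub_projection_eq hgr hx, hre x hx, two_smul, two_smul]
  abel

theorem TubeSetting.foot_spec (h : TubeSetting Ω Ωp Ωm Γ δΓ) {x : Euc d} (hx : x ∈ nbhd Γ δΓ) :
    x - signedDist Ωp Γ x • gradient (signedDist Ωp Γ) x ∈ Γ ∧
    gradient (signedDist Ωp Γ) (x - signedDist Ωp Γ x • gradient (signedDist Ωp Γ) x)
      = gradient (signedDist Ωp Γ) x := by
  obtain ⟨P, -, hPx, hgr, -, -⟩ := h.exists_projection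
  set n := gradient (signedDist Ωp Γ) with hn
  set s := signedDist Ωp Γ x with hs
  have hmem : x - s • n x ∈ Γ := by
    rw [hs, hn, ← h.sub_projection_eq hgr hx, sub_sub_cancel]
    exact (hPx x hx).1
  refine ⟨hmem, ?_⟩
  have habs : |s| < δΓ := by rw [hs, abs_signedDist]; exact hx
  -- The sign `σ` points from `x` back to the interface, so the normal is followed over a
  -- nonnegative parameter interval ending at the foot.
  obtain ⟨σ, hσ, hsσ, hσσ⟩ : ∃ σ : ℝ, |σ| = 1 ∧ |s| * σ = -s ∧ σ * σ = 1 := by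
    rcases le_total 0 s with h0 | h0
    · exact ⟨-1, by simp, by rw [abs_of_nonneg h0]; ring, by ring⟩
    · exact ⟨1, abs_one, by rw [abs_of_nonpos h0]; ring, by ring⟩
  have := h.normal_const (x := x) hσ (b := |s|) (fun t ht => ?_) |s| ⟨abs_nonneg s, le_rfl⟩
  · rwa [hsσ, neg_smul, ← sub_eq_add_neg] at this
  · refine (Metric.infDist_le_dist_of_mem hmem).trans_lt (lt_of_le_of_lt ?_ habs)
    have e : x + (t * σ) • n x - (x - s • n x) = (t * σ + s) • n x := by
      rw [add_smul]; abel
    rw [dist_eq_norm, ← hn, e, norm_smul, h.norm_normal hx, mul_one, Real.norm_eq_abs]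
    have e2 : t * σ + s = (t - |s|) * σ := by rw [sub_mul, hsσ]; ring
    rw [e2, abs_mul, hσ, mul_one, abs_sub_comm, abs_of_nonneg (by linarith [ht.2])]
    linarith [ht.1]

theorem TubeSetting.refl_spec (h : TubeSetting Ω Ωp Ωm Γ δΓ) {x : Euc d} (hx : x ∈ nbhd Γ δΓ) :
    signedDist Ωp Γ (refl Γ x) = - signedDist Ωp Γ x ∧
    gradient (signedDist Ωp Γ) (refl Γ x) = gradient (signedDist Ωp Γ) x := by
  obtain ⟨hy, hn⟩ := h.foot_spec hx
  have habs : |-signedDist Ωp Γ x| < δΓ := by rw [abs_neg, abs_signedDist]; exact hx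
  have e : refl Γ x = (x - signedDist Ωp Γ x • gradient (signedDist Ωp Γ) x)
      + (-signedDist Ωp Γ x) • gradient (signedDist Ωp Γ)
        (x - signedDist Ωp Γ x • gradient (signedDist Ωp Γ) x) := by
    rw [hn, h.refl_eq hx, mul_smul, two_smul, neg_smul]
    abel
  constructor
  · rw [e]; exact h.signedDist_add_smul hy habs
  · conv_rhs => rw [← hn]
    rw [e]; exact h.normal_add_smul hy habs

theorem TubeSetting.infDist_refl (h : TubeSetting Ω Ωp Ωm Γ δΓ) {x : Euc d}
    (hx : x ∈ nbhd Γ δΓ) : Metric.infDist (refl Γ x) Γ = Metric.infDist x Γ := by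
  rw [← abs_signedDist Ωp, (h.refl_spec hx).1, abs_neg, abs_signedDist]

theorem TubeSetting.refl_mem_nbhd (h : TubeSetting Ω Ωp Ωm Γ δΓ) {r : ℝ} (hr : r ≤ δΓ)
    {x : Euc d} (hx : x ∈ nbhd Γ r) : refl Γ x ∈ nbhd Γ r := by
  change Metric.infDist _ _ < r
  rw [h.infDist_refl (nbhd_mono Γ hr hx)]; exact hx

theorem TubeSetting.refl_refl (h : TubeSetting Ω Ωp Ωm Γ δΓ) {x : Euc d}
    (hx : x ∈ nbhd Γ δΓ) : refl Γ (refl Γ x) = x := by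
  rw [h.refl_eq (h.refl_mem_nbhd le_rfl hx), (h.refl_spec hx).1, (h.refl_spec hx).2, h.refl_eq hx,
    mul_neg, neg_smul]
  abel

theorem TubeSetting.refl_of_mem (h : TubeSetting Ω Ωp Ωm Γ δΓ) {x : Euc d}
    (hx : x ∈ Γ) : refl Γ x = x := by
  rw [h.refl_eq (h.mem_nbhd hx), h.signedDist_eq_zero hx]; simp

theorem TubeSetting.dist_refl (h : TubeSetting Ω Ωp Ωm Γ δΓ) {x : Euc d}
    (hx : x ∈ nbhd Γ δΓ) : dist x (refl Γ x) = 2 * Metric.infDist x Γ := by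
  rw [h.refl_eq hx, dist_eq_norm, sub_sub_cancel, norm_smul, h.norm_normal hx, mul_one,
    Real.norm_eq_abs, abs_mul, abs_signedDist, abs_two]

theorem TubeSetting.refl_mem_plus (h : TubeSetting Ω Ωp Ωm Γ δΓ) {x : Euc d}
    (hx : x ∈ nbhd Γ δΓ) (hxm : x ∈ Ωm) : refl Γ x ∈ Ωp := by
  rw [← h.signedDist_pos_iff, (h.refl_spec hx).1]
  have := (h.signedDist_neg_iff (h.nbhd_subset hx)).2 hxm
  linarith

theorem TubeSetting.contDiffOn_refl (h : TubeSetting Ω Ωp Ωm Γ δΓ) :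
    ContDiffOn ℝ ∞ (refl Γ) (nbhd Γ δΓ) := by
  obtain ⟨P, hP, -, -, hre, -⟩ := h.exists_projection
  exact ((contDiffOn_const (c := (2 : ℝ))).smul hP |>.sub contDiffOn_id).congr fun x hx => hre x hx

theorem TubeSetting.injOn_refl (h : TubeSetting Ω Ωp Ωm Γ δΓ) : InjOn (refl Γ) (nbhd Γ δΓ) :=
  fun x hx y hy hxy => by rw [← h.refl_refl hx, hxy, h.refl_refl hy]

theorem TubeSetting.differentiableAt_refl (h : TubeSetting Ω Ωp Ωm Γ δΓ) {x : Euc d}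
    (hx : x ∈ nbhd Γ δΓ) : DifferentiableAt ℝ (refl Γ) x :=
  (h.contDiffOn_refl.contDiffAt ((isOpen_nbhd Γ δΓ).mem_nhds hx)).differentiableAt (by simp)

/-- Chain rule for the involution `refl ∘ refl = id`. -/
theorem TubeSetting.det_mul_det (h : TubeSetting Ω Ωp Ωm Γ δΓ) {x : Euc d}
    (hx : x ∈ nbhd Γ δΓ) :
    (fderiv ℝ (refl Γ) (refl Γ x)).det * (fderiv ℝ (refl Γ) x).det = 1 := by
  have h1 := (h.differentiableAt_refl (h.refl_mem_nbhd le_rfl hx)).hasFDerivAt.comp x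
    (h.differentiableAt_refl hx).hasFDerivAt
  have h2 : HasFDerivAt (refl Γ ∘ refl Γ) (ContinuousLinearMap.id ℝ (Euc d)) x := by
    refine (hasFDerivAt_id x).congr_of_eventuallyEq ?_
    filter_upwards [(isOpen_nbhd Γ δΓ).mem_nhds hx] with y hy
    exact h.refl_refl hy
  have h3 := congrArg ContinuousLinearMap.det (h1.unique h2)
  rw [ContinuousLinearMap.det, ContinuousLinearMap.det, ← LinearMap.det_comp]
  have e : ((ContinuousLinearMap.id ℝ (Euc d)).det) = 1 := by
    simp [ContinuousLinearMap.det]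
  rw [e] at h3
  exact h3

theorem TubeSetting.det_ne_zero (h : TubeSetting Ω Ωp Ωm Γ δΓ) {x : Euc d}
    (hx : x ∈ nbhd Γ δΓ) : (fderiv ℝ (refl Γ) x).det ≠ 0 := fun h0 => by
  have := h.det_mul_det hx
  rw [h0, mul_zero] at this
  exact zero_ne_one this

/-- Points of `Γ` are fixed, so the determinant there has square 1. Reflection thus preserves volume
to leading order near `Γ`, which makes the boundary terms of the reflected function cancel. -/
theorem TubeSetting.abs_det_of_mem (h : TubeSetting Ω Ωp Ωm Γ δΓ) {x : Euc d}
    (hx : x ∈ Γ) : |(fderiv ℝ (refl Γ) x).det| = 1 := by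
  have h1 := h.det_mul_det (h.mem_nbhd hx)
  rw [h.refl_of_mem hx] at h1
  have h2 : |(fderiv ℝ (refl Γ) x).det| * |(fderiv ℝ (refl Γ) x).det| = 1 := by
    rw [← abs_mul, h1, abs_one]
  nlinarith [abs_nonneg (fderiv ℝ (refl Γ) x).det]

/-- The closed `r`-neighbourhood is compact. -/
theorem TubeSetting.isCompact_closedNbhd (h : TubeSetting Ω Ωp Ωm Γ δΓ) (r : ℝ) :
    IsCompact {x | Metric.infDist x Γ ≤ r} := by
  refine Metric.isCompact_of_isClosed_isBounded
    (isClosed_le (Metric.continuous_infDist_pt Γ) continuous_const) ?_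
  obtain ⟨R, hR⟩ := h.interface.isCompact.isBounded.subset_closedBall (0 : Euc d)
  refine (Metric.isBounded_closedBall (x := (0 : Euc d)) (r := R + r)).subset ?_
  intro x hx
  obtain ⟨p, hp, hxp⟩ := h.interface.isCompact.exists_infDist_eq_dist h.interface.nonempty x
  have h1 : dist x p ≤ r := by rw [← hxp]; exact hx
  have h2 : dist p 0 ≤ R := hR hp
  rw [Metric.mem_closedBall]
  linarith [dist_triangle x p 0]

end Reflection

/-! ### The optimal profile and its weight. -/

section Profile

theorem profile_pos (z : ℝ) : 0 < profile z := by
  unfold profile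
  have : 0 < Real.exp (Real.sqrt 2 * z) := Real.exp_pos _
  rw [sub_pos]
  exact inv_lt_one_of_one_lt₀ (by linarith)

theorem profile_lt_one (z : ℝ) : profile z < 1 := by
  unfold profile
  have : 0 < (1 + Real.exp (Real.sqrt 2 * z))⁻¹ := by positivity
  linarith

theorem profile_eq (z : ℝ) :
    profile z = Real.exp (Real.sqrt 2 * z) / (1 + Real.exp (Real.sqrt 2 * z)) := by
  unfold profile
  have : 0 < Real.exp (Real.sqrt 2 * z) := Real.exp_pos _
  field_simp
  ring

theorem one_sub_profile (z : ℝ) : 1 - profile z = (1 + Real.exp (Real.sqrt 2 * z))⁻¹ := by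
  unfold profile; ring

theorem contDiff_profile : ContDiff ℝ ∞ profile := by
  unfold profile
  refine contDiff_const.sub (ContDiff.inv (by fun_prop) fun z => ?_)
  positivity

/-- The first-order equation of the optimal profile. It turns every normal derivative of the layer
into the weight `s(1 - s)`. -/
theorem hasDerivAt_profile (z : ℝ) :
    HasDerivAt profile (Real.sqrt 2 * (profile z * (1 - profile z))) z := by
  have h1 : HasDerivAt (fun z => 1 + Real.exp (Real.sqrt 2 * z))
      (Real.exp (Real.sqrt 2 * z) * Real.sqrt 2) z := by
    have := ((hasDerivAt_id z).const_mul (Real.sqrt 2)).exp.const_add 1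
    simpa using this
  have h0 : (1 + Real.exp (Real.sqrt 2 * z)) ≠ 0 := by positivity
  have h2 := (h1.inv h0).const_sub 1
  refine h2.congr_deriv ?_
  rw [one_sub_profile, profile_eq]
  field_simp

theorem profile_mono {z w : ℝ} (h : z ≤ w) : profile z ≤ profile w := by
  unfold profile
  have h1 : Real.sqrt 2 * z ≤ Real.sqrt 2 * w := mul_le_mul_of_nonneg_left h (Real.sqrt_nonneg 2)
  have h2 := Real.exp_le_exp.2 h1
  gcongr

theorem profile_zero : profile 0 = 1 / 2 := by unfold profile; norm_num

/-- The weight `s(z)(1 - s(z))`. -/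
noncomputable def weight (z : ℝ) : ℝ := profile z * (1 - profile z)

theorem weight_pos (z : ℝ) : 0 < weight z :=
  mul_pos (profile_pos z) (sub_pos.2 (profile_lt_one z))

theorem weight_le_quarter (z : ℝ) : weight z ≤ 1 / 4 := by
  unfold weight; nlinarith [sq_nonneg (profile z - 1 / 2)]

theorem continuous_weight : Continuous weight :=
  contDiff_profile.continuous.mul (continuous_const.sub contDiff_profile.continuous)

/-- On this side the other factor `1 - s` is at least `1/2`; all tails of the profile can therefore
be measured by the weight. -/
theorem profile_le_weight {z : ℝ} (h : z ≤ 0) : profile z ≤ 2 * weight z := by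
  have h1 := profile_mono h
  rw [profile_zero] at h1
  unfold weight; nlinarith [profile_pos z]

theorem one_sub_profile_le_weight {z : ℝ} (h : 0 ≤ z) : 1 - profile z ≤ 2 * weight z := by
  have h1 := profile_mono h
  rw [profile_zero] at h1
  unfold weight; nlinarith [profile_lt_one z]

/-- Exponential decay beats `z²`. In rescaled form `d² κ ≤ ε²`, which makes quadratic defects in the
distance negligible. -/
theorem sq_mul_weight_le (z : ℝ) : z ^ 2 * weight z ≤ 1 := by
  have e2 : Real.sqrt 2 ^ 2 = 2 := Real.sq_sqrt (by norm_num)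
  have hs := Real.sqrt_nonneg 2
  have h1 : weight z = Real.exp (Real.sqrt 2 * z) / (1 + Real.exp (Real.sqrt 2 * z)) ^ 2 := by
    unfold weight; rw [one_sub_profile, profile_eq]
    field_simp
  have key : z ^ 2 * Real.exp (Real.sqrt 2 * z) ≤ (1 + Real.exp (Real.sqrt 2 * z)) ^ 2 := by
    have hp := Real.exp_pos (Real.sqrt 2 * z)
    rcases le_total 0 z with h | h
    -- With `t = √2 |z|`, the quadratic term `t²/2` of the exponential is exactly `z²`.
    · have := Real.quadratic_le_exp_of_nonneg (mul_nonneg hs h)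
      have h3 : z ^ 2 ≤ Real.exp (Real.sqrt 2 * z) := by nlinarith [mul_nonneg hs h]
      nlinarith
    · have := Real.quadratic_le_exp_of_nonneg (mul_nonneg hs (neg_nonneg.2 h))
      have h3 : z ^ 2 ≤ Real.exp (Real.sqrt 2 * -z) := by
        nlinarith [mul_nonneg hs (neg_nonneg.2 h)]
      have h4 : Real.exp (Real.sqrt 2 * -z) * Real.exp (Real.sqrt 2 * z) = 1 := by
        rw [← Real.exp_add]; simp
      have h5 : z ^ 2 * Real.exp (Real.sqrt 2 * z) ≤ 1 := by rw [← h4]; gcongr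
      nlinarith
  rw [h1, ← mul_div_assoc]
  exact div_le_one_of_le₀ key (by positivity)

theorem exists_weight_lower : ∃ c : ℝ, 0 < c ∧ ∀ z, |z| ≤ 1 → c ≤ weight z := by
  obtain ⟨z₀, -, hz₀⟩ := isCompact_Icc.exists_isMinOn (s := Icc (-1 : ℝ) 1) ⟨0, by simp⟩
    continuous_weight.continuousOn
  exact ⟨weight z₀, weight_pos _, fun z hz => hz₀ (abs_le.1 hz)⟩

end Profile

/-! ### Divergence of vector fields and integration by parts. -/

section Divergence

variable {d : ℕ}

/-- The divergence of a vector field. -/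
noncomputable def divergence (X : Euc d → Euc d) (x : Euc d) : ℝ :=
  ∑ i, fderiv ℝ X x (EuclideanSpace.single i 1) i

theorem contDiff_coord {X : Euc d → Euc d} (hX : ContDiff ℝ ∞ X) (i : Fin d) :
    ContDiff ℝ ∞ fun x => X x i :=
  (EuclideanSpace.proj (𝕜 := ℝ) i).contDiff.comp hX

theorem fderiv_coord {X : Euc d → Euc d} {x : Euc d} (hX : DifferentiableAt ℝ X x) (i : Fin d)
    (v : Euc d) : fderiv ℝ (fun x => X x i) x v = fderiv ℝ X x v i := by
  have := (EuclideanSpace.proj (𝕜 := ℝ) i).hasFDerivAt.comp x hX.hasFDerivAt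
  rw [HasFDerivAt.fderiv (f := fun x => X x i) this]
  rfl

theorem tsupport_coord_subset (X : Euc d → Euc d) (i : Fin d) :
    tsupport (fun x => X x i) ⊆ tsupport X := by
  refine closure_mono fun x hx => ?_
  intro h0
  exact hx (by simp [h0])

theorem HasWeakGrad.integral_divergence {U : Set (Euc d)} {u : Euc d → ℝ} {G : Fin d → Euc d → ℝ}
    (h : HasWeakGrad U u G) {X : Euc d → Euc d} (hX : ContDiff ℝ ∞ X) (hc : HasCompactSupport X)
    (hs : tsupport X ⊆ U) :
    ∫ x, divergence X x * u x = - ∫ x, ∑ i, X x i * G i x := by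
  have hci : ∀ i, HasCompactSupport fun x => X x i := fun i =>
    hc.of_isClosed_subset (isClosed_tsupport _) (tsupport_coord_subset X i)
  have hsi : ∀ i, tsupport (fun x => X x i) ⊆ U := fun i => (tsupport_coord_subset X i).trans hs
  have i1 : ∀ i, Integrable fun x => fderiv ℝ (fun x => X x i) x (EuclideanSpace.single i 1) • u x :=
    fun i => integrable_smul_of_locallyIntegrableOn h.1
      (continuous_fderiv_apply_of_contDiff (contDiff_coord hX i) _)
      (hasCompactSupport_fderiv_apply (hci i) _)
      ((tsupport_fderiv_apply_subset' _).trans (hsi i))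
  have i2 : ∀ i, Integrable fun x => X x i • G i x := fun i =>
    integrable_smul_of_locallyIntegrableOn (h.2.1 i) (contDiff_coord hX i).continuous (hci i) (hsi i)
  have e1 : ∀ x, divergence X x * u x
      = ∑ i, fderiv ℝ (fun x => X x i) x (EuclideanSpace.single i 1) • u x := by
    intro x
    simp only [divergence, Finset.sum_mul, smul_eq_mul]
    exact Finset.sum_congr rfl fun i _ => by rw [fderiv_coord (hX.differentiable (by simp) x)]
  simp only [e1]
  rw [integral_finsetSum _ fun i _ => i1 i]
  simp only [← smul_eq_mul]
  rw [integral_finsetSum _ fun i _ => i2 i, ← Finset.sum_neg_distrib]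
  exact Finset.sum_congr rfl fun i _ => h.integral_eq i (contDiff_coord hX i) (hci i) (hsi i)

theorem hasWeakGrad_of_contDiffOn {V : Type*} [NormedAddCommGroup V] [NormedSpace ℝ V]
    {U : Set (Euc d)} (hU : IsOpen U) {w : Euc d → V}
    (hw : ContDiffOn ℝ 1 w U) :
    HasWeakGrad U w (fun i x => fderiv ℝ w x (EuclideanSpace.single i 1)) := by
  refine hasWeakGrad_of_integral_eq (hw.continuousOn.locallyIntegrableOn hU.measurableSet)
    (fun i => (((hw.continuousOn_fderiv_of_isOpen hU le_rfl).clm_apply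
      continuousOn_const).locallyIntegrableOn hU.measurableSet)) fun i φ hφ hc hs =>
    integral_fderiv_smul_eq_neg hU hw (hφ.of_le (by simp)) hc hs _

theorem continuous_divergence {X : Euc d → Euc d} (hX : ContDiff ℝ ∞ X) :
    Continuous (divergence X) := by
  unfold divergence
  refine continuous_finsetSum _ fun i _ => ?_
  exact (EuclideanSpace.proj (𝕜 := ℝ) i).continuous.comp
    ((hX.continuous_fderiv (by simp)).clm_apply continuous_const)

theorem divergence_eq_zero {X : Euc d → Euc d} {x : Euc d} (hx : x ∉ tsupport X) :
    divergence X x = 0 := by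
  unfold divergence
  have : fderiv ℝ X x = 0 :=
    image_eq_zero_of_notMem_tsupport fun h => hx (tsupport_fderiv_subset ℝ h)
  simp [this]

theorem hasCompactSupport_divergence {X : Euc d → Euc d} (hc : HasCompactSupport X) :
    HasCompactSupport (divergence X) :=
  HasCompactSupport.intro hc fun _ hx => divergence_eq_zero hx

theorem divergence_smul {X : Euc d → Euc d} {g : Euc d → ℝ} {x : Euc d}
    (hX : DifferentiableAt ℝ X x) (hg : DifferentiableAt ℝ g x) :
    divergence (fun x => g x • X x) x = g x * divergence X x + fderiv ℝ g x (X x) := by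
  unfold divergence
  rw [fderiv_fun_smul hg hX, map_eq_sum_single (fderiv ℝ g x) (X x), Finset.mul_sum,
    ← Finset.sum_add_distrib]
  refine Finset.sum_congr rfl fun i _ => ?_
  simp [mul_comm]

end Divergence

/-! ### Mass of the layer weight and volume of thin tubes. -/

section TubeVolume

variable {d : ℕ} {Ω Ωp Ωm Γ : Set (Euc d)} {δΓ : ℝ}

theorem contDiff_of_contDiffOn_of_tsupport {V : Type*} [NormedAddCommGroup V] [NormedSpace ℝ V]
    {W : Set (Euc d)} (hW : IsOpen W) {f : Euc d → V} (hf : ContDiffOn ℝ ∞ f W)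
    (hs : tsupport f ⊆ W) : ContDiff ℝ ∞ f := by
  rw [contDiff_iff_contDiffAt]
  intro x
  by_cases hx : x ∈ tsupport f
  · exact hf.contDiffAt (hW.mem_nhds (hs hx))
  · exact contDiffAt_const.congr_of_eventuallyEq (notMem_tsupport_iff_eventuallyEq.1 hx)

theorem TubeSetting.exists_cutoff (h : TubeSetting Ω Ωp Ωm Γ δΓ) {a b : ℝ} (ha : 0 < a)
    (hab : a < b) (hb : b < δΓ) : ∃ χ : Euc d → ℝ, ContDiff ℝ ∞ χ ∧ (∀ x, 0 ≤ χ x ∧ χ x ≤ 1) ∧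
      (∀ x, Metric.infDist x Γ ≤ a → χ x = 1) ∧ (∀ x, b ≤ Metric.infDist x Γ → χ x = 0) ∧
      tsupport χ ⊆ {x | Metric.infDist x Γ ≤ b} := by
  have hab2 : 0 < b ^ 2 - a ^ 2 := by nlinarith
  -- The squared distance is used because it is smooth across `Γ`, unlike the distance.
  let χ : Euc d → ℝ := fun x =>
    Real.smoothTransition ((b ^ 2 - Metric.infDist x Γ ^ 2) / (b ^ 2 - a ^ 2))
  have hzero : ∀ x, b ≤ Metric.infDist x Γ → χ x = 0 := fun x hx =>
    Real.smoothTransition.zero_of_nonpos (div_nonpos_of_nonpos_of_nonneg (by nlinarith) hab2.le)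
  have hts : tsupport χ ⊆ {x | Metric.infDist x Γ ≤ b} := by
    refine closure_minimal (fun x hx => ?_)
      (isClosed_le (Metric.continuous_infDist_pt Γ) continuous_const)
    by_contra hx'
    exact hx (hzero x (not_le.1 hx').le)
  refine ⟨χ, ?_, fun x => ⟨Real.smoothTransition.nonneg _, Real.smoothTransition.le_one _⟩,
    fun x hx => ?_, hzero, hts⟩
  · refine contDiff_of_contDiffOn_of_tsupport (isOpen_nbhd Γ δΓ) ?_
      (hts.trans fun x hx => lt_of_le_of_lt hx hb)
    have h1 : ContDiffOn ℝ ∞ (fun x => Metric.infDist x Γ ^ 2) (nbhd Γ δΓ) :=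
      (h.contDiffOn_signedDist.pow 2).congr fun x _ => (h.signedDist_sq x).symm
    exact Real.smoothTransition.contDiff.comp_contDiffOn
      ((contDiffOn_const.sub h1).div_const _)
  · refine Real.smoothTransition.one_of_one_le ?_
    rw [one_le_div hab2]
    have := pow_le_pow_left₀ Metric.infDist_nonneg hx 2
    linarith

/-- The cut-off normal field is a smooth compactly supported vector field. -/
theorem TubeSetting.contDiff_cutoff_normal (h : TubeSetting Ω Ωp Ωm Γ δΓ) {χ : Euc d → ℝ}
    (hχ : ContDiff ℝ ∞ χ) {b : ℝ} (hb : b < δΓ)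
    (hs : tsupport χ ⊆ {x | Metric.infDist x Γ ≤ b}) :
    ContDiff ℝ ∞ (fun x => χ x • gradient (signedDist Ωp Γ) x) ∧
    HasCompactSupport (fun x => χ x • gradient (signedDist Ωp Γ) x) ∧
    tsupport (fun x => χ x • gradient (signedDist Ωp Γ) x) ⊆ {x | Metric.infDist x Γ ≤ b} := by
  have hts : tsupport (fun x => χ x • gradient (signedDist Ωp Γ) x) ⊆
      {x | Metric.infDist x Γ ≤ b} := (tsupport_smul_subset_left χ _).trans hs
  have hT : {x | Metric.infDist x Γ ≤ b} ⊆ nbhd Γ δΓ := fun x hx => lt_of_le_of_lt hx hb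
  exact ⟨contDiff_of_contDiffOn_of_tsupport (isOpen_nbhd Γ δΓ)
    (hχ.contDiffOn.smul h.contDiffOn_normal) (hts.trans hT),
    (h.isCompact_closedNbhd b).of_isClosed_subset (isClosed_tsupport _) hts, hts⟩

theorem TubeSetting.hasFDerivAt_comp_signedDist (h : TubeSetting Ω Ωp Ωm Γ δΓ) {g : ℝ → ℝ}
    {g' : ℝ} {x : Euc d} (hx : x ∈ nbhd Γ δΓ) {ε : ℝ}
    (hg : HasDerivAt g g' (signedDist Ωp Γ x / ε)) :
    HasFDerivAt (fun x => g (signedDist Ωp Γ x / ε))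
      ((g' / ε) • fderiv ℝ (signedDist Ωp Γ) x) x := by
  have h1 : HasFDerivAt (fun y => signedDist Ωp Γ y / ε) (ε⁻¹ • fderiv ℝ (signedDist Ωp Γ) x) x := by
    simpa [div_eq_mul_inv, mul_comm] using
      (h.differentiableAt_signedDist hx).hasFDerivAt.mul_const ε⁻¹
  have h2 := hg.comp_hasFDerivAt x h1
  rw [smul_smul, ← div_eq_mul_inv] at h2
  exact h2

/-- Integration by parts of a profile of the signed distance against the cut-off normal field. -/
theorem TubeSetting.integral_profile (h : TubeSetting Ω Ωp Ωm Γ δΓ) {χ : Euc d → ℝ}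
    (hχ : ContDiff ℝ ∞ χ) {b : ℝ} (hb : b < δΓ)
    (hs : tsupport χ ⊆ {x | Metric.infDist x Γ ≤ b}) {g g' : ℝ → ℝ}
    (hg : ContDiff ℝ 1 g) (hg' : ∀ z, HasDerivAt g (g' z) z) (ε : ℝ) :
    ∫ x, divergence (fun x => χ x • gradient (signedDist Ωp Γ) x) x * g (signedDist Ωp Γ x / ε)
      = - ∫ x, χ x * (g' (signedDist Ωp Γ x / ε) / ε) := by
  obtain ⟨c1, c2, c3⟩ := h.contDiff_cutoff_normal hχ hb hs
  have hT : {x | Metric.infDist x Γ ≤ b} ⊆ nbhd Γ δΓ := fun x hx => lt_of_le_of_lt hx hb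
  have hw : ContDiffOn ℝ 1 (fun x => g (signedDist Ωp Γ x / ε)) (nbhd Γ δΓ) :=
    hg.comp_contDiffOn ((h.contDiffOn_signedDist.of_le (by simp)).div_const ε)
  rw [(hasWeakGrad_of_contDiffOn (isOpen_nbhd Γ δΓ) hw).integral_divergence c1 c2 (c3.trans hT)]
  congr 1
  refine integral_congr_ae (Eventually.of_forall fun x => ?_)
  simp only
  by_cases hx : x ∈ tsupport χ
  · have hxT := hT (hs hx)
    rw [(h.hasFDerivAt_comp_signedDist hxT (hg' _)).fderiv]
    have e : ∑ i, gradient (signedDist Ωp Γ) x i * gradient (signedDist Ωp Γ) x i = 1 := by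
      have := h.norm_normal hxT
      rw [EuclideanSpace.norm_eq, Real.sqrt_eq_one] at this
      simpa [sq] using this
    have e2 : ∀ i, fderiv ℝ (signedDist Ωp Γ) x (EuclideanSpace.single i 1)
        = gradient (signedDist Ωp Γ) x i := by
      intro i
      rw [← inner_gradient_left, EuclideanSpace.inner_single_right]
      simp
    simp only [PiLp.smul_apply, smul_eq_mul, _root_.smul_apply, e2]
    calc _ = ∑ i, (χ x * (g' (signedDist Ωp Γ x / ε) / ε)) *
        (gradient (signedDist Ωp Γ) x i * gradient (signedDist Ωp Γ) x i) :=
          Finset.sum_congr rfl fun i _ => by ring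
      _ = _ := by rw [← Finset.mul_sum, e, mul_one]
  · rw [image_eq_zero_of_notMem_tsupport hx]; simp

theorem measurable_signedDist (hp : MeasurableSet Ωp) : Measurable (signedDist Ωp Γ) := by
  have hm := (Metric.continuous_infDist_pt Γ).measurable
  unfold signedDist
  exact Measurable.ite hp hm hm.neg

theorem TubeSetting.volume_nbhd_ne_top (h : TubeSetting Ω Ωp Ωm Γ δΓ) (r : ℝ) :
    volume (nbhd Γ r) ≠ ⊤ := by
  refine ((measure_mono (t := {x | Metric.infDist x Γ ≤ r}) ?_).trans_lt
    (h.isCompact_closedNbhd r).measure_lt_top).ne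
  exact fun x (hx : Metric.infDist x Γ < r) => hx.le

/-- The weight of the transition layer has mass `O(ε)`. -/
theorem TubeSetting.exists_integral_weight_le (h : TubeSetting Ω Ωp Ωm Γ δΓ) {χ : Euc d → ℝ}
    (hχ : ContDiff ℝ ∞ χ) {b : ℝ} (hb : b < δΓ)
    (hs : tsupport χ ⊆ {x | Metric.infDist x Γ ≤ b}) :
    ∃ C : ℝ, 0 ≤ C ∧ ∀ ε : ℝ, 0 < ε → ∫ x, χ x * weight (signedDist Ωp Γ x / ε) ≤ C * ε := by
  obtain ⟨c1, c2, c3⟩ := h.contDiff_cutoff_normal (Ωp := Ωp) hχ hb hs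
  set N := fun x => χ x • gradient (signedDist Ωp Γ) x with hN
  have hint : Integrable (divergence N) :=
    (continuous_divergence c1).integrable_of_hasCompactSupport (hasCompactSupport_divergence c2)
  refine ⟨∫ x, |divergence N x|, integral_nonneg fun x => abs_nonneg _, fun ε hε => ?_⟩
  -- The normal derivative of the profile is `√2/ε` times the weight, while the profile itself lies
  -- between 0 and 1. One integration by parts thus bounds the mass by `ε` times the `L¹` norm of a
  -- fixed divergence.
  have key := h.integral_profile hχ hb hs (contDiff_profile.of_le (by simp)) hasDerivAt_profile ε
  have e1 : ∫ x, χ x * (Real.sqrt 2 * (profile (signedDist Ωp Γ x / ε) *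
      (1 - profile (signedDist Ωp Γ x / ε))) / ε)
      = (Real.sqrt 2 / ε) * ∫ x, χ x * weight (signedDist Ωp Γ x / ε) := by
    rw [← integral_const_mul]
    refine integral_congr_ae (Eventually.of_forall fun x => ?_)
    simp only [weight]; ring
  rw [e1] at key
  have h2 : |∫ x, divergence N x * profile (signedDist Ωp Γ x / ε)| ≤ ∫ x, |divergence N x| := by
    rw [← Real.norm_eq_abs]
    refine norm_integral_le_of_norm_le hint.abs (Eventually.of_forall fun x => ?_)
    rw [norm_mul, Real.norm_eq_abs, Real.norm_of_nonneg (profile_pos _).le]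
    exact mul_le_of_le_one_right (abs_nonneg _) (profile_lt_one _).le
  rw [key, abs_neg, abs_mul, abs_of_pos (by positivity)] at h2
  have h3 : (1 / ε) * |∫ x, χ x * weight (signedDist Ωp Γ x / ε)| ≤ ∫ x, |divergence N x| := by
    refine le_trans ?_ h2
    gcongr
    exact Real.one_le_sqrt.2 (by norm_num)
  rw [div_mul_eq_mul_div, one_mul, div_le_iff₀ hε] at h3
  exact (le_abs_self _).trans h3

theorem TubeSetting.integrable_weight (h : TubeSetting Ω Ωp Ωm Γ δΓ) {χ : Euc d → ℝ}
    (hχ : ContDiff ℝ ∞ χ) (hc : HasCompactSupport χ) (ε : ℝ) :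
    Integrable fun x => χ x * weight (signedDist Ωp Γ x / ε) := by
  refine (hχ.continuous.integrable_of_hasCompactSupport hc).mul_bdd (c := 1 / 4)
    (continuous_weight.measurable.comp
      ((measurable_signedDist h.interface.isOpen_plus.measurableSet).div_const ε)).aestronglyMeasurable
    (Eventually.of_forall fun x => ?_)
  rw [Real.norm_of_nonneg (weight_pos _).le]
  exact weight_le_quarter _

/-- Taking the layer scale equal to `r`, the weight is bounded below by a constant on the `r`-tube,
so its mass `O(r)` controls the volume. -/
theorem TubeSetting.exists_volume_le (h : TubeSetting Ω Ωp Ωm Γ δΓ) :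
    ∃ (C r₀ : ℝ), 0 ≤ C ∧ 0 < r₀ ∧ ∀ r, 0 < r → r ≤ r₀ →
      volume (nbhd Γ r) ≤ ENNReal.ofReal (C * r) := by
  have hδ := h.radius.pos
  obtain ⟨χ, hχ, h01, h1, -, hs⟩ := h.exists_cutoff (a := δΓ / 3) (b := δΓ / 2) (by linarith)
    (by linarith) (by linarith)
  have hc : HasCompactSupport χ :=
    (h.isCompact_closedNbhd _).of_isClosed_subset (isClosed_tsupport _) hs
  obtain ⟨C, hC0, hC⟩ := h.exists_integral_weight_le hχ (by linarith) hs
  obtain ⟨c, hc0, hcw⟩ := exists_weight_lower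
  refine ⟨C / c, δΓ / 3, by positivity, by linarith, fun r hr hr0 => ?_⟩
  have hint := h.integrable_weight hχ hc r
  have hle : ∫ x in nbhd Γ r, c ≤ ∫ x, χ x * weight (signedDist Ωp Γ x / r) := by
    have hfin := h.volume_nbhd_ne_top r
    refine (setIntegral_mono_on (integrableOn_const hfin) hint.integrableOn
      (isOpen_nbhd Γ r).measurableSet fun x hx => ?_).trans
      (setIntegral_le_integral hint (Eventually.of_forall fun x =>
        mul_nonneg (h01 x).1 (weight_pos _).le))
    have hx' : Metric.infDist x Γ < r := hx
    rw [h1 x (by linarith), one_mul]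
    refine hcw _ ?_
    rw [abs_div, abs_signedDist, abs_of_pos hr]
    exact div_le_one_of_le₀ hx'.le hr.le
  rw [setIntegral_const, smul_eq_mul] at hle
  have hfin := h.volume_nbhd_ne_top r
  rw [← ENNReal.ofReal_toReal hfin]
  refine ENNReal.ofReal_le_ofReal ?_
  rw [div_mul_eq_mul_div, le_div_iff₀ hc0]
  exact hle.trans (hC r hr)

theorem TubeSetting.volume_interface (h : TubeSetting Ω Ωp Ωm Γ δΓ) : volume Γ = 0 := by
  obtain ⟨C, r₀, hC, hr₀, hle⟩ := h.exists_volume_le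
  have ht : Tendsto (fun r : ℝ => ENNReal.ofReal (C * r)) (𝓝[>] 0) (𝓝 0) := by
    have : Continuous fun r : ℝ => ENNReal.ofReal (C * r) :=
      ENNReal.continuous_ofReal.comp (continuous_const.mul continuous_id)
    have h2 := (this.tendsto 0).mono_left (nhdsWithin_le_nhds (s := Ioi 0))
    simpa using h2
  refine le_antisymm (ge_of_tendsto ht ?_) zero_le
  filter_upwards [Ioc_mem_nhdsGT hr₀] with r hr
  exact (measure_mono fun x hx => show Metric.infDist x Γ < r by
    rw [infDist_of_mem hx]; exact hr.1).trans (hle r hr.1 hr.2)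

theorem TubeSetting.tendsto_volume_nbhd (h : TubeSetting Ω Ωp Ωm Γ δΓ) {r : ℕ → ℝ}
    (hr : ∀ k, 0 < r k) (hr0 : Tendsto r atTop (𝓝 0)) :
    Tendsto (fun k => volume (nbhd Γ (r k))) atTop (𝓝 0) := by
  obtain ⟨C, r₀, hC, hr₀, hle⟩ := h.exists_volume_le
  have ht : Tendsto (fun k => ENNReal.ofReal (C * r k)) atTop (𝓝 0) := by
    have : Continuous fun r : ℝ => ENNReal.ofReal (C * r) :=
      ENNReal.continuous_ofReal.comp (continuous_const.mul continuous_id)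
    simpa [Function.comp_def] using (this.tendsto 0).comp hr0
  refine tendsto_of_tendsto_of_tendsto_of_le_of_le' tendsto_const_nhds ht
    (Eventually.of_forall fun _ => zero_le) ?_
  filter_upwards [hr0.eventually (ge_mem_nhds hr₀)] with k hk
  exact hle _ (hr k) hk

end TubeVolume

/-! ### Local integrability and weak gradients on unions. -/

section Gluing

variable {d : ℕ} {V : Type*} [NormedAddCommGroup V] [NormedSpace ℝ V]

theorem locallyIntegrableOn_of_memLp {U : Set (Euc d)} {f : Euc d → V}
    (hf : MemLp f 2 (volume.restrict U)) : LocallyIntegrableOn f U := by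
  intro x _
  refine ⟨U ∩ Metric.closedBall x 1, inter_mem_nhdsWithin U (Metric.closedBall_mem_nhds x one_pos),
    ?_⟩
  have : IsFiniteMeasure (volume.restrict (U ∩ Metric.closedBall x 1)) :=
    ⟨by rw [Measure.restrict_apply_univ]
        exact (measure_mono inter_subset_right).trans_lt measure_closedBall_lt_top⟩
  exact (hf.mono_measure (Measure.restrict_mono inter_subset_left le_rfl)).integrable (by norm_num)

theorem memLp_two_union {s t : Set (Euc d)} {f : Euc d → V}
    (hs : MemLp f 2 (volume.restrict s)) (ht : MemLp f 2 (volume.restrict t)) :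
    MemLp f 2 (volume.restrict (s ∪ t)) := by
  have hm := aestronglyMeasurable_union_iff.2 ⟨hs.1, ht.1⟩
  rw [memLp_two_iff_integrable_sq_norm hm]
  exact IntegrableOn.union ((memLp_two_iff_integrable_sq_norm hs.1).1 hs)
    ((memLp_two_iff_integrable_sq_norm ht.1).1 ht)

theorem locallyIntegrableOn_union {U W : Set (Euc d)} (hU : IsOpen U) (hW : IsOpen W)
    {f : Euc d → V} (h : LocallyIntegrableOn f U) (h' : LocallyIntegrableOn f W) :
    LocallyIntegrableOn f (U ∪ W) := by
  rintro x (hx | hx)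
  · have := h x hx
    rw [hU.nhdsWithin_eq hx] at this
    rw [(hU.union hW).nhdsWithin_eq (Or.inl hx)]; exact this
  · have := h' x hx
    rw [hW.nhdsWithin_eq hx] at this
    rw [(hU.union hW).nhdsWithin_eq (Or.inr hx)]; exact this

/-- The part of `tsupport φ` outside `W` is closed and lies in `U`, so cutting `φ` to `U` creates no
new boundary. Test functions on a disjoint union split accordingly. -/
theorem contDiff_indicator_of_disjoint {U W : Set (Euc d)} (hU : IsOpen U) (hW : IsOpen W)
    (hd : Disjoint U W) {φ : Euc d → ℝ} (hφ : ContDiff ℝ ∞ φ) (hs : tsupport φ ⊆ U ∪ W) :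
    ContDiff ℝ ∞ (U.indicator φ) ∧ tsupport (U.indicator φ) ⊆ tsupport φ ∩ U := by
  have hts : tsupport (U.indicator φ) ⊆ tsupport φ ∩ U := by
    refine (closure_minimal (t := tsupport φ \ W) (fun x hx => ?_)
      ((isClosed_tsupport φ).sdiff hW)).trans fun x hx => ⟨hx.1, (hs hx.1).resolve_right hx.2⟩
    have hxU : x ∈ U := by by_contra h0; exact hx (indicator_of_notMem h0 _)
    refine ⟨subset_tsupport φ ?_, hd.notMem_of_mem_left hxU⟩
    rw [Function.mem_support, indicator_of_mem hxU] at hx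
    exact hx
  exact ⟨contDiff_of_contDiffOn_of_tsupport hU
    (hφ.contDiffOn.congr fun x hx => indicator_of_mem hx _) fun x hx => (hts hx).2, hts⟩

theorem HasWeakGrad.union {U W : Set (Euc d)} (hU : IsOpen U) (hW : IsOpen W)
    (hd : Disjoint U W) {u : Euc d → V} {G : Fin d → Euc d → V}
    (h : HasWeakGrad U u G) (h' : HasWeakGrad W u G) : HasWeakGrad (U ∪ W) u G := by
  have hu := locallyIntegrableOn_union hU hW h.1 h'.1
  have hG := fun i => locallyIntegrableOn_union hU hW (h.2.1 i) (h'.2.1 i)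
  refine hasWeakGrad_of_integral_eq hu hG fun i φ hφ hc hs => ?_
  obtain ⟨a1, a2⟩ := contDiff_indicator_of_disjoint hU hW hd hφ hs
  obtain ⟨b1, b2⟩ := contDiff_indicator_of_disjoint hW hU hd.symm hφ (by rwa [union_comm])
  have ac : HasCompactSupport (U.indicator φ) :=
    hc.of_isClosed_subset (isClosed_tsupport _) (a2.trans inter_subset_left)
  have bc : HasCompactSupport (W.indicator φ) :=
    hc.of_isClosed_subset (isClosed_tsupport _) (b2.trans inter_subset_left)
  have e : φ = fun x => U.indicator φ x + W.indicator φ x := by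
    funext x
    by_cases hx : x ∈ tsupport φ
    · rcases hs hx with h1 | h1
      · rw [indicator_of_mem h1, indicator_of_notMem (hd.notMem_of_mem_left h1), add_zero]
      · rw [indicator_of_mem h1, indicator_of_notMem (hd.notMem_of_mem_right h1), zero_add]
    · simp [indicator, image_eq_zero_of_notMem_tsupport hx]
  have e1 := h.integral_eq i a1 ac (a2.trans inter_subset_right)
  have e2 := h'.integral_eq i b1 bc (b2.trans inter_subset_right)
  have df : ∀ x, fderiv ℝ φ x (EuclideanSpace.single i 1) =
      fderiv ℝ (U.indicator φ) x (EuclideanSpace.single i 1)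
      + fderiv ℝ (W.indicator φ) x (EuclideanSpace.single i 1) := by
    intro x
    conv_lhs => rw [e]
    rw [fderiv_fun_add (a1.differentiable (by simp) x) (b1.differentiable (by simp) x)]
    rfl
  calc ∫ x, fderiv ℝ φ x (EuclideanSpace.single i 1) • u x
      = ∫ x, (fderiv ℝ (U.indicator φ) x (EuclideanSpace.single i 1) • u x
          + fderiv ℝ (W.indicator φ) x (EuclideanSpace.single i 1) • u x) := by
        refine integral_congr_ae (Eventually.of_forall fun x => ?_)
        simp only [df x, add_smul]
    _ = - ∫ x, (U.indicator φ x • G i x + W.indicator φ x • G i x) := by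
        rw [integral_add, integral_add, e1, e2, neg_add]
        · exact integrable_smul_of_locallyIntegrableOn (h.2.1 i) a1.continuous ac
            (a2.trans inter_subset_right)
        · exact integrable_smul_of_locallyIntegrableOn (h'.2.1 i) b1.continuous bc
            (b2.trans inter_subset_right)
        · exact integrable_smul_of_locallyIntegrableOn h.1
            (continuous_fderiv_apply_of_contDiff a1 _) (hasCompactSupport_fderiv_apply ac _)
            ((tsupport_fderiv_apply_subset' _).trans (a2.trans inter_subset_right))
        · exact integrable_smul_of_locallyIntegrableOn h'.1
            (continuous_fderiv_apply_of_contDiff b1 _) (hasCompactSupport_fderiv_apply bc _)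
            ((tsupport_fderiv_apply_subset' _).trans (b2.trans inter_subset_right))
    _ = - ∫ x, φ x • G i x := by
        congr 1
        refine integral_congr_ae (Eventually.of_forall fun x => ?_)
        conv_rhs => rw [e]
        simp only [add_smul]

end Gluing

/-! ### Cut-off functions that vanish near the interface. -/

section Radial

variable {d : ℕ} {Ω Ωp Ωm Γ : Set (Euc d)} {δΓ : ℝ}

/-- An even cut-off, vanishing for `|z| ≤ 1/2` and equal to `1` for `|z| ≥ 1`. -/
noncomputable def radialCutoff (z : ℝ) : ℝ := Real.smoothTransition ((4 * z ^ 2 - 1) / 3)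

theorem contDiff_radialCutoff : ContDiff ℝ ∞ radialCutoff :=
  Real.smoothTransition.contDiff.comp (by fun_prop)

theorem radialCutoff_mem (z : ℝ) : 0 ≤ radialCutoff z ∧ radialCutoff z ≤ 1 :=
  ⟨Real.smoothTransition.nonneg _, Real.smoothTransition.le_one _⟩

theorem radialCutoff_eq_one {z : ℝ} (hz : 1 ≤ |z|) : radialCutoff z = 1 := by
  refine Real.smoothTransition.one_of_one_le ?_
  have : 1 ≤ z ^ 2 := by rw [← sq_abs]; nlinarith
  linarith

theorem radialCutoff_eq_zero {z : ℝ} (hz : |z| ≤ 1 / 2) : radialCutoff z = 0 := by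
  refine Real.smoothTransition.zero_of_nonpos ?_
  have : z ^ 2 ≤ 1 / 4 := by rw [← sq_abs]; nlinarith [abs_nonneg z]
  linarith

theorem radialCutoff_neg (z : ℝ) : radialCutoff (-z) = radialCutoff z := by
  simp [radialCutoff]

/-- Oddness is what makes the contributions of the two sides of `Γ` cancel for an even reflection.
-/
theorem deriv_radialCutoff_neg (z : ℝ) : deriv radialCutoff (-z) = - deriv radialCutoff z := by
  have h := deriv_comp_neg radialCutoff z
  rw [show (fun x => radialCutoff (-x)) = radialCutoff from funext radialCutoff_neg] at h
  linarith

theorem exists_abs_deriv_radialCutoff_le : ∃ C, 0 ≤ C ∧ ∀ z, |z| ≤ 1 →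
    |deriv radialCutoff z| ≤ C := by
  obtain ⟨C, hC⟩ := (isCompact_Icc (a := (-1 : ℝ)) (b := 1)).exists_bound_of_continuousOn
    (contDiff_radialCutoff.continuous_deriv (by simp)).continuousOn
  exact ⟨C, (norm_nonneg _).trans (hC 0 (by simp)), fun z hz => hC z (abs_le.1 hz)⟩

/-- The signed distance need not be smooth outside the tube, but there the cut-off is locally
constant since `r < δΓ`. -/
theorem TubeSetting.contDiff_radialCutoff (h : TubeSetting Ω Ωp Ωm Γ δΓ) {r : ℝ} (hr : 0 < r)
    (hrδ : r < δΓ) : ContDiff ℝ ∞ fun x => radialCutoff (signedDist Ωp Γ x / r) := by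
  rw [contDiff_iff_contDiffAt]
  intro x
  by_cases hx : x ∈ nbhd Γ δΓ
  · exact (AllenCahn.contDiff_radialCutoff.comp_contDiffOn
      (h.contDiffOn_signedDist.div_const r)).contDiffAt ((isOpen_nbhd Γ δΓ).mem_nhds hx)
  · refine (contDiffAt_const (c := (1 : ℝ))).congr_of_eventuallyEq ?_
    have hx' : r < Metric.infDist x Γ := hrδ.trans_le (not_lt.1 hx)
    filter_upwards [(Metric.continuous_infDist_pt Γ).continuousAt.eventually
      (lt_mem_nhds hx')] with y hy
    refine radialCutoff_eq_one ?_
    rw [abs_div, abs_signedDist, abs_of_pos hr, one_le_div hr]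
    exact hy.le

theorem radialCutoff_eventuallyEq_zero {r : ℝ} (hr : 0 < r) {x : Euc d} (hx : x ∈ Γ) :
    (fun x => radialCutoff (signedDist Ωp Γ x / r)) =ᶠ[𝓝 x] 0 := by
  have hx' : Metric.infDist x Γ < r / 2 := by rw [infDist_of_mem hx]; linarith
  filter_upwards [(Metric.continuous_infDist_pt Γ).continuousAt.eventually
      (gt_mem_nhds hx')] with y hy
  refine radialCutoff_eq_zero ?_
  rw [abs_div, abs_signedDist, abs_of_pos hr, div_le_iff₀ hr]
  linarith

theorem radialCutoff_signedDist_eq_one {r : ℝ} (hr : 0 < r) {x : Euc d}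
    (hx : r ≤ Metric.infDist x Γ) : radialCutoff (signedDist Ωp Γ x / r) = 1 := by
  refine radialCutoff_eq_one ?_
  rwa [abs_div, abs_signedDist, abs_of_pos hr, one_le_div hr]

/-- The cut-off attains its maximum 1 at such points. This includes distance exactly `r`, where it
need not be locally constant. -/
theorem fderiv_radialCutoff_eq_zero {r : ℝ} (hr : 0 < r) {x : Euc d}
    (hx : r ≤ Metric.infDist x Γ) :
    fderiv ℝ (fun x => radialCutoff (signedDist Ωp Γ x / r)) x = 0 := by
  refine IsLocalMax.fderiv_eq_zero (Eventually.of_forall fun y => ?_)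
  simp only
  rw [radialCutoff_signedDist_eq_one hr hx]
  exact (radialCutoff_mem _).2

theorem fderiv_eq_gradient (f : Euc d → ℝ) (x : Euc d) (i : Fin d) :
    fderiv ℝ f x (EuclideanSpace.single i 1) = gradient f x i := by
  rw [← inner_gradient_left, EuclideanSpace.inner_single_right]
  simp

theorem TubeSetting.fderiv_radialCutoff (h : TubeSetting Ω Ωp Ωm Γ δΓ) {r : ℝ}
    {x : Euc d} (hx : x ∈ nbhd Γ δΓ) (i : Fin d) :
    fderiv ℝ (fun x => radialCutoff (signedDist Ωp Γ x / r)) x (EuclideanSpace.single i 1)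
      = deriv radialCutoff (signedDist Ωp Γ x / r) / r * gradient (signedDist Ωp Γ) x i := by
  rw [(h.hasFDerivAt_comp_signedDist hx
    (AllenCahn.contDiff_radialCutoff.differentiable (by simp) _).hasDerivAt).fderiv,
    _root_.smul_apply, fderiv_eq_gradient, smul_eq_mul]

end Radial

/-! ### Integrability of the reflected functions. -/

section Reflection

variable {d : ℕ} {V : Type*} [NormedAddCommGroup V] [NormedSpace ℝ V]
  {Ω Ωp Ωm Γ : Set (Euc d)} {δΓ : ℝ}

open Classical in
/-- The extension of `u` across `Γ` by even reflection. -/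
noncomputable def reflExt (Ωp Γ : Set (Euc d)) (u : Euc d → V) (x : Euc d) : V :=
  if x ∈ Ωp then u x else u (refl Γ x)

open Classical in
/-- The weak gradient of the reflected function. -/
noncomputable def reflGrad (Ωp Γ : Set (Euc d)) (G : Fin d → Euc d → V) (i : Fin d) (x : Euc d) :
    V :=
  if x ∈ Ωp then G i x else ∑ j, (fderiv ℝ (refl Γ) x (EuclideanSpace.single i 1)) j • G j (refl Γ x)

theorem closedNbhd_subset {δ : ℝ} (hδ : δ < δΓ) : {x | Metric.infDist x Γ ≤ δ} ⊆ nbhd Γ δΓ :=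
  fun _ hx => lt_of_le_of_lt hx hδ

theorem nbhd_subset_closedNbhd {δ : ℝ} : nbhd Γ δ ⊆ {x | Metric.infDist x Γ ≤ δ} :=
  fun x (hx : Metric.infDist x Γ < δ) => hx.le

theorem TubeSetting.ae_comp_refl (h : TubeSetting Ω Ωp Ωm Γ δΓ) {δ : ℝ} (hδ : δ < δΓ)
    {p : Euc d → Prop} (hp : ∀ᵐ y, p y) : ∀ᵐ x ∂(volume.restrict (nbhd Γ δ)), p (refl Γ x) := by
  have hac := map_restrict_absolutelyContinuous (U := univ) (isOpen_nbhd Γ δΓ)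
    (h.contDiffOn_refl.of_le (by simp)) (mapsTo_univ _ _) h.injOn_refl
    (fun x hx => h.det_ne_zero hx) (h.isCompact_closedNbhd δ) (closedNbhd_subset hδ)
    (isOpen_nbhd Γ δ).measurableSet nbhd_subset_closedNbhd
  rw [Measure.restrict_univ] at hac
  exact ae_of_ae_map ((h.contDiffOn_refl.continuousOn.mono
    (nbhd_mono Γ hδ.le)).aemeasurable (isOpen_nbhd Γ δ).measurableSet) (hac.ae_le hp)

theorem TubeSetting.aestronglyMeasurable_comp_refl (h : TubeSetting Ω Ωp Ωm Γ δΓ) {δ : ℝ}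
    (hδ : δ < δΓ) {f : Euc d → V} (hf : AEStronglyMeasurable f (volume.restrict Ωp)) :
    AEStronglyMeasurable (fun x => f (refl Γ x)) (volume.restrict (Ωm ∩ nbhd Γ δ)) := by
  have hp := h.interface.isOpen_plus
  have h1 : AEStronglyMeasurable (Ωp.indicator f) (volume.restrict univ) := by
    rw [Measure.restrict_univ]
    exact (aestronglyMeasurable_indicator_iff hp.measurableSet).2 hf
  have h2 := aestronglyMeasurable_comp_diffeo (isOpen_nbhd Γ δΓ)
    (h.contDiffOn_refl.of_le (by simp)) (mapsTo_univ _ _) h.injOn_refl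
    (fun x hx => h.det_ne_zero hx) (h.isCompact_closedNbhd δ) (closedNbhd_subset hδ)
    (isOpen_nbhd Γ δ).measurableSet nbhd_subset_closedNbhd h1
  have hms : MeasurableSet (Ωm ∩ nbhd Γ δ) :=
    (h.interface.isOpen_minus.inter (isOpen_nbhd Γ δ)).measurableSet
  refine (h2.mono_measure (Measure.restrict_mono inter_subset_right le_rfl)).congr ?_
  filter_upwards [ae_restrict_mem hms] with x hx
  exact indicator_of_mem (h.refl_mem_plus (nbhd_mono Γ hδ.le hx.2) hx.1) f

theorem TubeSetting.exists_lintegral_comp_refl_le (h : TubeSetting Ω Ωp Ωm Γ δΓ) {δ : ℝ}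
    (hδ : δ < δΓ) : ∃ C : ENNReal, C ≠ ⊤ ∧ ∀ s ⊆ nbhd Γ δ, MeasurableSet s →
      ∀ f : Euc d → ENNReal, ∫⁻ x in s, f (refl Γ x) ≤ C * ∫⁻ y in refl Γ '' s, f y := by
  obtain ⟨C, hC, hle⟩ := exists_lintegral_comp_le (isOpen_nbhd Γ δΓ)
    (h.contDiffOn_refl.of_le (by simp)) h.injOn_refl
    (fun x hx => h.det_ne_zero hx) (h.isCompact_closedNbhd δ) (closedNbhd_subset hδ)
  exact ⟨C, hC, fun s hs => hle s (hs.trans nbhd_subset_closedNbhd)⟩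

theorem TubeSetting.memLp_comp_refl (h : TubeSetting Ω Ωp Ωm Γ δΓ) {δ : ℝ} (hδ : δ < δΓ)
    {f : Euc d → V} (hf : MemLp f 2 (volume.restrict Ωp)) :
    MemLp (fun x => f (refl Γ x)) 2 (volume.restrict (Ωm ∩ nbhd Γ δ)) := by
  obtain ⟨C, hC, hle⟩ := h.exists_lintegral_comp_refl_le hδ
  refine ⟨h.aestronglyMeasurable_comp_refl hδ hf.1, ?_⟩
  have h2 := hf.2
  rw [eLpNorm_lt_top_iff_lintegral_rpow_enorm_lt_top (by norm_num) (by norm_num)] at h2 ⊢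
  refine (hle _ inter_subset_right (h.interface.isOpen_minus.inter
    (isOpen_nbhd Γ δ)).measurableSet fun x => ‖f x‖ₑ ^ (2 : ENNReal).toReal).trans_lt ?_
  refine ENNReal.mul_lt_top hC.lt_top ((lintegral_mono_set ?_).trans_lt h2)
  rintro _ ⟨x, hx, rfl⟩
  exact h.refl_mem_plus (nbhd_mono Γ hδ.le hx.2) hx.1

/-- The interface is a null set, so everything about the extension may be checked on the two open
sides. -/
theorem TubeSetting.restrict_union (h : TubeSetting Ω Ωp Ωm Γ δΓ) {δ : ℝ} (hδ : δ ≤ δΓ) :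
    volume.restrict (Ωp ∪ nbhd Γ δ) = volume.restrict (Ωp ∪ Ωm ∩ nbhd Γ δ) := by
  refine Measure.restrict_congr_set ?_
  have h0 : ∀ᵐ x, x ∉ Γ := measure_eq_zero_iff_ae_notMem.1 h.volume_interface
  filter_upwards [h0] with x hx
  refine propext ⟨?_, ?_⟩
  · rintro (h1 | h1)
    · exact Or.inl h1
    · rcases h.mem_or (h.nbhd_subset (nbhd_mono Γ hδ h1)) with h2 | h2 | h2
      · exact Or.inl h2
      · exact absurd h2 hx
      · exact Or.inr ⟨h2, h1⟩
  · rintro (h1 | h1)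
    · exact Or.inl h1
    · exact Or.inr h1.2

theorem reflExt_of_mem {u : Euc d → V} {x : Euc d} (hx : x ∈ Ωp) : reflExt Ωp Γ u x = u x :=
  if_pos hx

theorem reflExt_of_notMem {u : Euc d → V} {x : Euc d} (hx : x ∉ Ωp) :
    reflExt Ωp Γ u x = u (refl Γ x) := if_neg hx

theorem TubeSetting.ae_reflExt (h : TubeSetting Ω Ωp Ωm Γ δΓ) {δ : ℝ} (hδ : δ < δΓ)
    {u : Euc d → V} {p : V → Prop} (hp : ∀ᵐ x ∂(volume.restrict Ωp), p (u x)) :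
    ∀ᵐ x ∂(volume.restrict (Ωp ∪ nbhd Γ δ)), p (reflExt Ωp Γ u x) := by
  have ho := h.interface.isOpen_plus
  rw [h.restrict_union hδ.le, ae_restrict_union_iff]
  constructor
  · filter_upwards [hp, ae_restrict_mem ho.measurableSet] with x hx hxp
    rwa [reflExt_of_mem hxp]
  · have h1 := h.ae_comp_refl hδ ((ae_restrict_iff' ho.measurableSet).1 hp)
    have hms : MeasurableSet (Ωm ∩ nbhd Γ δ) :=
      (h.interface.isOpen_minus.inter (isOpen_nbhd Γ δ)).measurableSet
    filter_upwards [ae_restrict_of_ae_restrict_of_subset inter_subset_right h1,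
      ae_restrict_mem hms] with x hx hxm
    rw [reflExt_of_notMem (h.interface.disjoint_plus_minus.notMem_of_mem_right hxm.1)]
    exact hx (h.refl_mem_plus (nbhd_mono Γ hδ.le hxm.2) hxm.1)

theorem TubeSetting.memLp_reflExt (h : TubeSetting Ω Ωp Ωm Γ δΓ) {δ : ℝ} (hδ : δ < δΓ)
    {u : Euc d → V} (hu : MemLp u 2 (volume.restrict Ωp)) :
    MemLp (reflExt Ωp Γ u) 2 (volume.restrict (Ωp ∪ nbhd Γ δ)) := by
  have hms : MeasurableSet (Ωm ∩ nbhd Γ δ) :=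
    (h.interface.isOpen_minus.inter (isOpen_nbhd Γ δ)).measurableSet
  rw [h.restrict_union hδ.le]
  refine memLp_two_union ((memLp_congr_ae ?_).1 hu) ((memLp_congr_ae ?_).1 (h.memLp_comp_refl hδ hu))
  · filter_upwards [ae_restrict_mem h.interface.isOpen_plus.measurableSet] with x hx
    rw [reflExt_of_mem hx]
  · filter_upwards [ae_restrict_mem hms] with x hx
    rw [reflExt_of_notMem (h.interface.disjoint_plus_minus.notMem_of_mem_right hx.1)]

theorem TubeSetting.memLp_reflGrad (h : TubeSetting Ω Ωp Ωm Γ δΓ) {δ : ℝ} (hδ : δ < δΓ)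
    {G : Fin d → Euc d → V} (hG : ∀ i, MemLp (G i) 2 (volume.restrict Ωp)) (i : Fin d) :
    MemLp (reflGrad Ωp Γ G i) 2 (volume.restrict (Ωp ∪ nbhd Γ δ)) := by
  have hms : MeasurableSet (Ωm ∩ nbhd Γ δ) :=
    (h.interface.isOpen_minus.inter (isOpen_nbhd Γ δ)).measurableSet
  rw [h.restrict_union hδ.le]
  refine memLp_two_union ((memLp_congr_ae ?_).1 (hG i)) ((memLp_congr_ae ?_).1
    (memLp_finsetSum Finset.univ fun j _ => ?_ :
      MemLp (fun x => ∑ j, (fderiv ℝ (refl Γ) x (EuclideanSpace.single i 1)) j • G j (refl Γ x))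
        2 _))
  · filter_upwards [ae_restrict_mem h.interface.isOpen_plus.measurableSet] with x hx
    exact (if_pos hx).symm
  · filter_upwards [ae_restrict_mem hms] with x hx
    exact (if_neg (h.interface.disjoint_plus_minus.notMem_of_mem_right hx.1)).symm
  · have hc := continuousOn_fderiv_apply_coord (isOpen_nbhd Γ δΓ)
      (h.contDiffOn_refl.of_le (by simp)) (EuclideanSpace.single i 1) j
    obtain ⟨c, hcb⟩ := (h.isCompact_closedNbhd δ).exists_bound_of_continuousOn
      (hc.mono (closedNbhd_subset hδ))
    have hsub : Ωm ∩ nbhd Γ δ ⊆ {x | Metric.infDist x Γ ≤ δ} :=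
      inter_subset_right.trans nbhd_subset_closedNbhd
    have hm := h.memLp_comp_refl hδ (hG j)
    refine MemLp.of_le_mul (c := c) hm
      (((hc.mono (hsub.trans (closedNbhd_subset hδ))).aestronglyMeasurable hms).smul hm.1) ?_
    filter_upwards [ae_restrict_mem hms] with x hx
    rw [norm_smul]
    exact mul_le_mul_of_nonneg_right (hcb x (hsub hx)) (norm_nonneg _)

end Reflection

/-! ### Weak gradient and trace of the reflected functions. -/

section Reflection

variable {d : ℕ} {V : Type*} [NormedAddCommGroup V] [NormedSpace ℝ V]
  {Ω Ωp Ωm Γ : Set (Euc d)} {δΓ : ℝ}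

theorem TubeSetting.image_refl (h : TubeSetting Ω Ωp Ωm Γ δΓ) {r : ℝ} (hr : r ≤ δΓ) :
    refl Γ '' (Ωp ∩ nbhd Γ r) = Ωm ∩ nbhd Γ r := by
  ext x
  constructor
  · rintro ⟨y, hy, rfl⟩
    exact ⟨h.symm.refl_mem_plus (nbhd_mono Γ hr hy.2) hy.1, h.refl_mem_nbhd hr hy.2⟩
  · rintro ⟨hx, hxr⟩
    exact ⟨refl Γ x, ⟨h.refl_mem_plus (nbhd_mono Γ hr hxr) hx, h.refl_mem_nbhd hr hxr⟩,
      h.refl_refl (nbhd_mono Γ hr hxr)⟩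

theorem TubeSetting.exists_nbhd_subset (h : TubeSetting Ω Ωp Ωm Γ δΓ) {O : Set (Euc d)}
    (hO : IsOpen O) (hΓO : Γ ⊆ O) : ∃ ρ, 0 < ρ ∧ nbhd Γ ρ ⊆ O := by
  obtain ⟨ρ, hρ, hsub⟩ := h.interface.isCompact.exists_thickening_subset_open hO hΓO
  exact ⟨ρ, hρ, fun x hx => hsub ((Metric.mem_thickening_iff_infDist_lt h.interface.nonempty).2 hx)⟩

/-- The mismatch of a test function under the reflection is small near `Γ`. -/
theorem TubeSetting.exists_mismatch_lt (h : TubeSetting Ω Ωp Ωm Γ δΓ) {φ : Euc d → ℝ}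
    (hφ : Continuous φ) {η : ℝ} (hη : 0 < η) : ∃ ρ, 0 < ρ ∧ ρ ≤ δΓ ∧ ∀ y ∈ nbhd Γ ρ,
      |φ y - |(fderiv ℝ (refl Γ) y).det| * φ (refl Γ y)| < η := by
  have hc : ContinuousOn (fun y => |φ y - |(fderiv ℝ (refl Γ) y).det| * φ (refl Γ y)|)
      (nbhd Γ δΓ) :=
    (hφ.continuousOn.sub ((ContinuousLinearMap.continuous_det.comp_continuousOn
      (h.contDiffOn_refl.continuousOn_fderiv_of_isOpen (isOpen_nbhd Γ δΓ) (by simp))).abs.mul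
      (hφ.comp_continuousOn h.contDiffOn_refl.continuousOn))).abs
  have hO := hc.isOpen_inter_preimage (isOpen_nbhd Γ δΓ) (isOpen_Iio (a := η))
  -- On `Γ` the mismatch is zero: points are fixed and the Jacobian has modulus 1. Continuity and
  -- compactness spread this to a tube.
  obtain ⟨ρ, hρ, hsub⟩ := h.exists_nbhd_subset hO fun x hx => ⟨h.mem_nbhd hx, by
    simp only [mem_preimage, mem_Iio]
    rw [h.refl_of_mem hx, h.abs_det_of_mem hx, one_mul, sub_self, abs_zero]
    exact hη⟩
  exact ⟨min ρ δΓ, lt_min hρ h.radius.pos, min_le_right _ _, fun y hy =>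
    (hsub (nbhd_mono Γ (min_le_left _ _) hy)).2⟩

theorem TubeSetting.norm_gradient_apply_le (h : TubeSetting Ω Ωp Ωm Γ δΓ) {x : Euc d}
    (hx : x ∈ nbhd Γ δΓ) (i : Fin d) : |gradient (signedDist Ωp Γ) x i| ≤ 1 := by
  have := PiLp.norm_apply_le (gradient (signedDist Ωp Γ) x) i
  rwa [h.norm_normal hx] at this

/-- The boundary contribution of the reflected function at scale `r`. -/
theorem TubeSetting.norm_integral_reflExt_le (h : TubeSetting Ω Ωp Ωm Γ δΓ) {δ : ℝ}
    (hδ : δ < δΓ) {u : Euc d → V} {M C : ℝ} (hM0 : 0 ≤ M)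
    (hu : MemLp u 2 (volume.restrict Ωp)) (hM : ∀ᵐ x ∂(volume.restrict Ωp), ‖u x‖ ≤ M)
    (hC0 : 0 ≤ C) (hC : ∀ z, |z| ≤ 1 → |deriv radialCutoff z| ≤ C)
    {φ : Euc d → ℝ} (hφ : ContDiff ℝ ∞ φ) (hc : HasCompactSupport φ)
    (hs : tsupport φ ⊆ Ωp ∪ nbhd Γ δ) {r q : ℝ} (hr : 0 < r) (hrδ : r < δΓ)
    (hq : ∀ y ∈ nbhd Γ r, |φ y - |(fderiv ℝ (refl Γ) y).det| * φ (refl Γ y)| ≤ q) (i : Fin d) :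
    ‖∫ x, (φ x * fderiv ℝ (fun x => radialCutoff (signedDist Ωp Γ x / r)) x
      (EuclideanSpace.single i 1)) • reflExt Ωp Γ u x‖ ≤
      C / r * q * M * (volume (nbhd Γ r)).toReal := by
  set ζ := fun x => radialCutoff (signedDist Ωp Γ x / r) with hζ
  set n := gradient (signedDist Ωp Γ) with hn
  set F := fun x => (φ x * fderiv ℝ ζ x (EuclideanSpace.single i 1)) • reflExt Ωp Γ u x with hF
  have ho := h.interface.isOpen_plus
  have hom := h.interface.isOpen_minus
  have hms : MeasurableSet (Ωp ∩ nbhd Γ r) := (ho.inter (isOpen_nbhd Γ r)).measurableSet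
  have hmm : MeasurableSet (Ωm ∩ nbhd Γ r) := (hom.inter (isOpen_nbhd Γ r)).measurableSet
  have hFi : Integrable F := by
    refine integrable_smul_of_locallyIntegrableOn
      (locallyIntegrableOn_of_memLp (h.memLp_reflExt hδ hu))
      (hφ.continuous.mul (continuous_fderiv_apply_of_contDiff (h.contDiff_radialCutoff hr hrδ) _))
      hc.mul_right ((tsupport_mul_subset_left).trans hs)
  have hF0 : ∀ x, x ∉ nbhd Γ r → F x = 0 := fun x hx => by
    simp only [hF, hζ]
    rw [fderiv_radialCutoff_eq_zero hr (not_lt.1 hx)]; simp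
  have hsplit : ∫ x, F x = (∫ x in Ωp ∩ nbhd Γ r, F x) + ∫ x in Ωm ∩ nbhd Γ r, F x := by
    rw [← setIntegral_eq_integral_of_forall_compl_eq_zero hF0, ← setIntegral_union
      (h.interface.disjoint_plus_minus.mono inter_subset_left inter_subset_left) hmm
      hFi.integrableOn hFi.integrableOn]
    refine setIntegral_congr_set ?_
    filter_upwards [measure_eq_zero_iff_ae_notMem.1 h.volume_interface] with x hx
    refine propext ⟨fun hxr => ?_, ?_⟩
    · rcases h.mem_or (h.nbhd_subset (nbhd_mono Γ hrδ.le hxr)) with h2 | h2 | h2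
      · exact Or.inl ⟨h2, hxr⟩
      · exact absurd h2 hx
      · exact Or.inr ⟨h2, hxr⟩
    · rintro (h1 | h1) <;> exact h1.2
  have hder : ∀ y ∈ Ωp ∩ nbhd Γ r,
      HasFDerivWithinAt (refl Γ) (fderiv ℝ (refl Γ) y) (Ωp ∩ nbhd Γ r) y := fun y hy =>
    (h.differentiableAt_refl (nbhd_mono Γ hrδ.le hy.2)).hasFDerivAt.hasFDerivWithinAt
  have hinj : InjOn (refl Γ) (Ωp ∩ nbhd Γ r) :=
    h.injOn_refl.mono (inter_subset_right.trans (nbhd_mono Γ hrδ.le))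
  have himg := h.image_refl hrδ.le
  have hint2 : IntegrableOn (fun y => |(fderiv ℝ (refl Γ) y).det| • F (refl Γ y))
      (Ωp ∩ nbhd Γ r) := by
    refine (integrableOn_image_iff_integrableOn_abs_det_fderiv_smul volume hms hder hinj F).1 ?_
    exact hFi.integrableOn
  -- The integral over the minus side is pulled back by the reflection, so both sides become one
  -- integral over the plus side.
  rw [hsplit, ← himg, integral_image_eq_integral_abs_det_fderiv_smul volume hms hder hinj F,
    ← integral_add hFi.integrableOn hint2]
  have hvol : volume (Ωp ∩ nbhd Γ r) ≠ ⊤ :=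
    ((measure_mono inter_subset_right).trans_lt (h.volume_nbhd_ne_top r).lt_top).ne
  have hq0 : 0 ≤ q := by
    obtain ⟨p, hp⟩ := h.interface.nonempty
    refine (abs_nonneg _).trans (hq p ?_)
    change Metric.infDist p Γ < r
    rw [infDist_of_mem hp]; exact hr
  refine (norm_setIntegral_le_of_norm_le_const_ae' (C := C / r * q * M) hvol.lt_top ?_).trans ?_
  · filter_upwards [(ae_restrict_iff' ho.measurableSet).1 hM] with y hyM hy
    have hyT := nbhd_mono Γ hrδ.le hy.2
    have hRm : refl Γ y ∈ Ωm := h.symm.refl_mem_plus hyT hy.1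
    have e1 : F y = (φ y * (deriv radialCutoff (signedDist Ωp Γ y / r) / r * n y i)) • u y := by
      simp only [hF, hζ]
      rw [h.fderiv_radialCutoff hyT, reflExt_of_mem hy.1]
    have e2 : F (refl Γ y) = (φ (refl Γ y) *
        (-(deriv radialCutoff (signedDist Ωp Γ y / r) / r) * n y i)) • u y := by
      simp only [hF, hζ]
      rw [h.fderiv_radialCutoff (h.refl_mem_nbhd le_rfl hyT), reflExt_of_notMem
        (h.interface.disjoint_plus_minus.notMem_of_mem_right hRm), h.refl_refl hyT,
        (h.refl_spec hyT).1, (h.refl_spec hyT).2, neg_div, deriv_radialCutoff_neg, neg_div]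
    rw [e1, e2, smul_smul, ← add_smul, norm_smul]
    have hz : |signedDist Ωp Γ y / r| ≤ 1 := by
      rw [abs_div, abs_signedDist, abs_of_pos hr]
      exact div_le_one_of_le₀ (le_of_lt hy.2) hr.le
    refine mul_le_mul ?_ (hyM hy.1) (norm_nonneg _) (by positivity)
    -- After pulling back, the reflected function and the normal are unchanged and the derivative of
    -- the cut-off changes sign. Only the mismatch `φ - |det| φ ∘ refl` survives, and it compensates
    -- the factor `1/r`.
    rw [show φ y * (deriv radialCutoff (signedDist Ωp Γ y / r) / r * n y i) +
        |(fderiv ℝ (refl Γ) y).det| * (φ (refl Γ y) *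
        (-(deriv radialCutoff (signedDist Ωp Γ y / r) / r) * n y i))
        = (deriv radialCutoff (signedDist Ωp Γ y / r) / r * n y i) *
          (φ y - |(fderiv ℝ (refl Γ) y).det| * φ (refl Γ y)) by ring, norm_mul, norm_mul,
        norm_div, Real.norm_of_nonneg hr.le]
    simp only [Real.norm_eq_abs]
    refine mul_le_mul ?_ (hq y hy.2) (abs_nonneg _) (by positivity)
    calc |deriv radialCutoff (signedDist Ωp Γ y / r)| / r * |n y i| ≤ C / r * 1 := by
          gcongr
          · exact hC _ hz
          · exact h.norm_gradient_apply_le hyT i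
      _ = C / r := mul_one _
  · refine mul_le_mul_of_nonneg_left ?_ (by positivity)
    exact ENNReal.toReal_mono (h.volume_nbhd_ne_top r) (measure_mono inter_subset_right)

/-- Off `Γ` this is the change of variables and gluing of disjoint pieces. Across `Γ`, cut off at
distance `r`: the boundary term is at most a multiple of `1/r` times the mismatch times the volume
`O(r)` of the tube, and the mismatch tends to zero. No trace theorem is used. -/
theorem TubeSetting.hasWeakGrad_reflExt [FiniteDimensional ℝ V] (h : TubeSetting Ω Ωp Ωm Γ δΓ)
    {δ : ℝ} (hδ : δ < δΓ) {u : Euc d → V} {G : Fin d → Euc d → V} {M : ℝ}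
    (hu : MemLp u 2 (volume.restrict Ωp)) (hG : ∀ i, MemLp (G i) 2 (volume.restrict Ωp))
    (hM : ∀ᵐ x ∂(volume.restrict Ωp), ‖u x‖ ≤ M) (hw : HasWeakGrad Ωp u G) :
    HasWeakGrad (Ωp ∪ nbhd Γ δ) (reflExt Ωp Γ u) (reflGrad Ωp Γ G) := by
  have ho := h.interface.isOpen_plus
  have hom := h.interface.isOpen_minus
  have hW : IsOpen (Ωm ∩ nbhd Γ δ) := hom.inter (isOpen_nbhd Γ δ)
  have hWT : Ωm ∩ nbhd Γ δ ⊆ nbhd Γ δΓ := inter_subset_right.trans (nbhd_mono Γ hδ.le)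
  refine hasWeakGrad_of_cutoff (Γ := Γ) (locallyIntegrableOn_of_memLp (h.memLp_reflExt hδ hu))
    (fun i => locallyIntegrableOn_of_memLp (h.memLp_reflGrad hδ hG i)) ?_ fun i φ hφ hc hs => ?_
  · have e : (Ωp ∪ nbhd Γ δ) \ Γ = Ωp ∪ Ωm ∩ nbhd Γ δ := by
      ext x
      constructor
      · rintro ⟨h1 | h1, hx⟩
        · exact Or.inl h1
        · rcases h.mem_or (h.nbhd_subset (nbhd_mono Γ hδ.le h1)) with h2 | h2 | h2
          · exact Or.inl h2
          · exact absurd h2 hx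
          · exact Or.inr ⟨h2, h1⟩
      · rintro (h1 | h1)
        · exact ⟨Or.inl h1, h.interface.disjoint_plus.notMem_of_mem_left h1⟩
        · exact ⟨Or.inr h1.2, h.interface.disjoint_minus.notMem_of_mem_left h1.1⟩
    rw [e]
    refine HasWeakGrad.union ho hW
      (h.interface.disjoint_plus_minus.mono_right inter_subset_left) ?_ ?_
    · refine hw.congr ?_ fun i => ?_
      · filter_upwards [ae_restrict_mem ho.measurableSet] with x hx
        rw [reflExt_of_mem hx]
      · filter_upwards [ae_restrict_mem ho.measurableSet] with x hx
        exact (if_pos hx).symm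
    · refine (hw.comp_diffeo ho hW (h.contDiffOn_refl.mono hWT)
        (fun x hx => h.refl_mem_plus (hWT hx) hx.1) (h.injOn_refl.mono hWT)
        fun x hx => h.det_ne_zero (hWT hx)).congr ?_ fun i => ?_
      · filter_upwards [ae_restrict_mem hW.measurableSet] with x hx
        rw [reflExt_of_notMem (h.interface.disjoint_plus_minus.notMem_of_mem_right hx.1)]
      · filter_upwards [ae_restrict_mem hW.measurableSet] with x hx
        exact (if_neg (h.interface.disjoint_plus_minus.notMem_of_mem_right hx.1)).symm
  · obtain ⟨C, hC0, hC⟩ := exists_abs_deriv_radialCutoff_le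
    obtain ⟨C₁, r₀, hC₁, hr₀, hle⟩ := h.exists_volume_le
    set r : ℕ → ℝ := fun k => min r₀ (δΓ / 2) / (k + 1) with hr
    have hmin : 0 < min r₀ (δΓ / 2) := lt_min hr₀ (half_pos h.radius.pos)
    have hrpos : ∀ k, 0 < r k := fun k => by positivity
    have hrle : ∀ k, r k ≤ min r₀ (δΓ / 2) := fun k =>
      div_le_self hmin.le (by have := Nat.cast_nonneg (α := ℝ) k; linarith)
    have hrδ : ∀ k, r k < δΓ := fun k =>
      ((hrle k).trans (min_le_right _ _)).trans_lt (half_lt_self h.radius.pos)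
    have hrt : Tendsto r atTop (𝓝 0) := by
      have := (tendsto_one_div_add_atTop_nhds_zero_nat (𝕜 := ℝ)).const_mul (min r₀ (δΓ / 2))
      simpa [hr, div_eq_mul_inv] using this
    refine ⟨fun k x => radialCutoff (signedDist Ωp Γ x / r k),
      fun k => h.contDiff_radialCutoff (hrpos k) (hrδ k), fun k x => radialCutoff_mem _,
      fun k x hx => radialCutoff_eventuallyEq_zero (hrpos k) hx, ?_, ?_⟩
    · refine tendsto_of_tendsto_of_tendsto_of_le_of_le tendsto_const_nhds
        (h.tendsto_volume_nbhd hrpos hrt) (fun _ => zero_le) fun k => measure_mono fun x hx => ?_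
      by_contra h0
      exact hx (radialCutoff_signedDist_eq_one (hrpos k) (not_lt.1 h0))
    · set M' := max M 0
      have hM' : ∀ᵐ x ∂(volume.restrict Ωp), ‖u x‖ ≤ M' := hM.mono fun x hx =>
        hx.trans (le_max_left _ _)
      have hM0 : 0 ≤ M' := le_max_right _ _
      rw [Metric.tendsto_atTop]
      intro e he
      -- The total factor multiplying the mismatch is `C M' C₁`; the summand 1 only keeps the
      -- quotient meaningful.
      set q := e / (C * M' * C₁ + 1) with hq
      have hden : 0 < C * M' * C₁ + 1 := by positivity
      have hqpos : 0 < q := by positivity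
      obtain ⟨ρ, hρ, -, hmis⟩ := h.exists_mismatch_lt hφ.continuous hqpos
      obtain ⟨N, hN⟩ := (hrt.eventually (gt_mem_nhds hρ)).exists_forall_of_atTop
      refine ⟨N, fun k hk => ?_⟩
      rw [dist_zero_right]
      refine (h.norm_integral_reflExt_le hδ hM0 hu hM' hC0 hC hφ hc hs (hrpos k) (hrδ k)
        (fun y hy => (hmis y (nbhd_mono Γ (hN k hk).le hy)).le) i).trans_lt ?_
      have hv : (volume (nbhd Γ (r k))).toReal ≤ C₁ * r k :=
        ENNReal.toReal_le_of_le_ofReal (by have := hrpos k; positivity)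
          (hle _ (hrpos k) ((hrle k).trans (min_le_left _ _)))
      calc C / r k * q * M' * (volume (nbhd Γ (r k))).toReal
          ≤ C / r k * q * M' * (C₁ * r k) := by have := hrpos k; gcongr
        _ = q * (C * M' * C₁) := by have := (hrpos k).ne'; field_simp
        _ < q * (C * M' * C₁ + 1) := by gcongr; linarith
        _ = e := by rw [hq]; field_simp

theorem TubeSetting.exists_setIntegral_comp_refl_le (h : TubeSetting Ω Ωp Ωm Γ δΓ) {δ : ℝ}
    (hδ : δ < δΓ) : ∃ C : ℝ, 0 ≤ C ∧ ∀ s ⊆ nbhd Γ δ, MeasurableSet s → ∀ t, refl Γ '' s ⊆ t →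
      ∀ f : Euc d → ℝ, (∀ x, 0 ≤ f x) → IntegrableOn f t →
      ∫ x in s, f (refl Γ x) ≤ C * ∫ y in t, f y := by
  obtain ⟨C, hC, hle⟩ := h.exists_lintegral_comp_refl_le hδ
  refine ⟨C.toReal, ENNReal.toReal_nonneg, fun s hs hsm t hst f hf hi => ?_⟩
  -- Without measurability of the composition the left integral is zero by convention.
  by_cases hm : AEStronglyMeasurable (fun x => f (refl Γ x)) (volume.restrict s)
  · rw [integral_eq_lintegral_of_nonneg_ae (Eventually.of_forall fun x => hf _) hm,
      integral_eq_lintegral_of_nonneg_ae (Eventually.of_forall hf) hi.1, ← ENNReal.toReal_mul]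
    refine ENNReal.toReal_mono (ENNReal.mul_ne_top hC ?_) ((hle s hs hsm fun y =>
      ENNReal.ofReal (f y)).trans (mul_le_mul_right (lintegral_mono_set hst) C))
    have := hi.2
    rw [hasFiniteIntegral_iff_ofReal (Eventually.of_forall hf)] at this
    exact this.ne
  · rw [integral_undef fun h0 => hm h0.1]
    exact mul_nonneg ENNReal.toReal_nonneg (integral_nonneg fun y => hf y)

/-- The reflected function has the trace of the original one. -/
theorem TubeSetting.isTraceOn_reflExt (h : TubeSetting Ω Ωp Ωm Γ δΓ) {δ : ℝ} (hδ0 : 0 < δ)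
    (hδ : δ < δΓ) {u T : Euc d → V} {M : ℝ}
    (hu : AEStronglyMeasurable u (volume.restrict Ωp))
    (hM : ∀ᵐ x ∂(volume.restrict Ωp), ‖u x‖ ≤ M) (hT : IsTraceOn Ωp Γ u T) :
    IsTraceOn (Ωp ∪ nbhd Γ δ) Γ (reflExt Ωp Γ u) T := by
  obtain ⟨C, hC0, hC⟩ := h.exists_setIntegral_comp_refl_le hδ
  have ho := h.interface.isOpen_plus
  have hom := h.interface.isOpen_minus
  unfold IsTraceOn at hT ⊢
  filter_upwards [hT, ae_restrict_mem h.interface.isCompact.measurableSet] with x hx hxΓ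
  set t : ℝ → ℝ := fun r => ⨍ y in Metric.ball x r ∩ Ωp, ‖u y - T x‖ with ht
  have hlim : Tendsto (fun r => t r + C * (3 ^ d * t (3 * r))) (𝓝[>] 0) (𝓝 0) := by
    have h3 : Tendsto (fun r : ℝ => 3 * r) (𝓝[>] 0) (𝓝[>] 0) := by
      refine tendsto_nhdsWithin_iff.2 ⟨?_, ?_⟩
      · have : Tendsto (fun r : ℝ => 3 * r) (𝓝 0) (𝓝 (3 * 0)) := tendsto_id.const_mul 3
        rw [mul_zero] at this
        exact this.mono_left nhdsWithin_le_nhds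
      · filter_upwards [self_mem_nhdsWithin] with r hr
        exact mul_pos three_pos (mem_Ioi.1 hr)
    have := hx.add (((hx.comp h3).const_mul (3 ^ d)).const_mul C)
    simpa using this
  refine tendsto_of_tendsto_of_tendsto_of_le_of_le' tendsto_const_nhds hlim
    (Eventually.of_forall fun r => ?_) ?_
  · rw [setAverage_eq]
    exact smul_nonneg (by positivity) (integral_nonneg fun y => norm_nonneg _)
  filter_upwards [Ioo_mem_nhdsGT hδ0] with r hr
  have hball : Metric.ball x r ⊆ nbhd Γ δ := fun y hy =>
    ((Metric.infDist_le_dist_of_mem hxΓ).trans_lt hy).trans hr.2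
  have hfin : ∀ ρ, volume (Metric.ball x ρ ∩ Ωp) ≠ ⊤ := fun ρ =>
    ((measure_mono inter_subset_left).trans_lt measure_ball_lt_top).ne
  have hint : ∀ ρ, IntegrableOn (fun y => ‖u y - T x‖) (Metric.ball x ρ ∩ Ωp) := fun ρ => by
    have hle : volume.restrict (Metric.ball x ρ ∩ Ωp) ≤ volume.restrict Ωp :=
      Measure.restrict_mono inter_subset_right le_rfl
    refine Integrable.mono' (integrableOn_const (C := M + ‖T x‖) (hfin ρ))
      ((hu.mono_measure hle).sub aestronglyMeasurable_const).norm ?_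
    filter_upwards [ae_mono hle hM] with y hy
    rw [norm_norm]
    exact (norm_sub_le _ _).trans (by gcongr)
  have hBm : MeasurableSet (Metric.ball x r ∩ Ωm) := (Metric.isOpen_ball.inter hom).measurableSet
  have hBp : MeasurableSet (Metric.ball x r ∩ Ωp) := (Metric.isOpen_ball.inter ho).measurableSet
  have hBΓ : Metric.ball x r ∩ Ωm ⊆ nbhd Γ δ := inter_subset_left.trans hball
  -- The reflection moves `y` by twice its distance to `Γ`, hence by at most `2 dist y x`. This
  -- explains the radius `3r` and the volume factor `3^d`.
  have himg : refl Γ '' (Metric.ball x r ∩ Ωm) ⊆ Metric.ball x (3 * r) ∩ Ωp := by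
    rintro _ ⟨y, hy, rfl⟩
    have hyT := nbhd_mono Γ hδ.le (hBΓ hy)
    refine ⟨?_, h.refl_mem_plus hyT hy.2⟩
    have h1 := h.dist_refl hyT
    have h2 : Metric.infDist y Γ ≤ dist y x := Metric.infDist_le_dist_of_mem hxΓ
    have h3 : dist y x < r := hy.1
    have h4 := dist_triangle (refl Γ y) y x
    rw [dist_comm (refl Γ y) y] at h4
    rw [Metric.mem_ball]; linarith
  have hmeas3 : volume.real (Metric.ball x (3 * r)) = 3 ^ d * volume.real (Metric.ball x r) := by
    rw [measureReal_def, measureReal_def, Measure.addHaar_ball_mul_of_pos volume x three_pos r,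
      Measure.addHaar_ball_center volume x r, ENNReal.toReal_mul,
      ENNReal.toReal_ofReal (by positivity), finrank_euclideanSpace_fin]
  have hpos : 0 < volume.real (Metric.ball x r) :=
    ENNReal.toReal_pos (Metric.measure_ball_pos volume x hr.1).ne' measure_ball_lt_top.ne
  have htnn : ∀ ρ, 0 ≤ t ρ := fun ρ => by
    rw [ht]; simp only; rw [setAverage_eq]
    exact smul_nonneg (by positivity) (integral_nonneg fun y => norm_nonneg _)
  have htint : ∀ ρ, ∫ y in Metric.ball x ρ ∩ Ωp, ‖u y - T x‖
      ≤ volume.real (Metric.ball x ρ) * t ρ := fun ρ => by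
    rw [← measure_smul_setAverage _ (hfin ρ), smul_eq_mul]
    exact mul_le_mul_of_nonneg_right (measureReal_mono inter_subset_left measure_ball_lt_top.ne)
      (htnn ρ)
  have e0 : Metric.ball x r ∩ (Ωp ∪ nbhd Γ δ) = Metric.ball x r :=
    inter_eq_left.2 (hball.trans subset_union_right)
  have hsplit : ∫ y in Metric.ball x r, ‖reflExt Ωp Γ u y - T x‖ ≤
      (∫ y in Metric.ball x r ∩ Ωp, ‖u y - T x‖)
        + C * ∫ y in Metric.ball x (3 * r) ∩ Ωp, ‖u y - T x‖ := by
    have e1 : ∫ y in Metric.ball x r, ‖reflExt Ωp Γ u y - T x‖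
        = ∫ y in (Metric.ball x r ∩ Ωp) ∪ (Metric.ball x r ∩ Ωm), ‖reflExt Ωp Γ u y - T x‖ := by
      refine setIntegral_congr_set ?_
      filter_upwards [measure_eq_zero_iff_ae_notMem.1 h.volume_interface] with y hy
      refine propext ⟨fun hyr => ?_, ?_⟩
      · rcases h.mem_or (h.nbhd_subset (nbhd_mono Γ hδ.le (hball hyr))) with h2 | h2 | h2
        · exact Or.inl ⟨hyr, h2⟩
        · exact absurd h2 hy
        · exact Or.inr ⟨hyr, h2⟩
      · rintro (h1 | h1) <;> exact h1.1
    have c1 : EqOn (fun y => ‖reflExt Ωp Γ u y - T x‖) (fun y => ‖u y - T x‖)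
        (Metric.ball x r ∩ Ωp) := fun y hy => by simp only [reflExt_of_mem hy.2]
    have c2 : EqOn (fun y => ‖reflExt Ωp Γ u y - T x‖) (fun y => ‖u (refl Γ y) - T x‖)
        (Metric.ball x r ∩ Ωm) := fun y hy => by
      simp only [reflExt_of_notMem (h.interface.disjoint_plus_minus.notMem_of_mem_right hy.2)]
    have i2 : IntegrableOn (fun y => ‖u (refl Γ y) - T x‖) (Metric.ball x r ∩ Ωm) := by
      have hm := (h.aestronglyMeasurable_comp_refl hδ hu).mono_measure
        (Measure.restrict_mono (s := Metric.ball x r ∩ Ωm) (s' := Ωm ∩ nbhd Γ δ)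
          (fun y hy => ⟨hy.2, hball hy.1⟩) le_rfl)
      refine Integrable.mono' (integrableOn_const (C := M + ‖T x‖)
        ((measure_mono inter_subset_left).trans_lt measure_ball_lt_top).ne)
        (hm.sub aestronglyMeasurable_const).norm ?_
      have h1 := h.ae_reflExt hδ hM (p := fun v => ‖v‖ ≤ M)
      have hsub : Metric.ball x r ∩ Ωm ⊆ Ωp ∪ nbhd Γ δ := hBΓ.trans subset_union_right
      filter_upwards [ae_restrict_of_ae_restrict_of_subset hsub h1, ae_restrict_mem hBm] with y hy hyB
      rw [reflExt_of_notMem (h.interface.disjoint_plus_minus.notMem_of_mem_right hyB.2)] at hy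
      rw [norm_norm]
      exact (norm_sub_le _ _).trans (by gcongr)
    rw [e1, setIntegral_union (h.interface.disjoint_plus_minus.mono inter_subset_right
      inter_subset_right) hBm ((integrableOn_congr_fun c1 hBp).2 (hint r))
      ((integrableOn_congr_fun c2 hBm).2 i2), setIntegral_congr_fun hBp c1,
      setIntegral_congr_fun hBm c2]
    exact add_le_add le_rfl (hC _ hBΓ hBm _ himg (fun y => ‖u y - T x‖) (fun y => norm_nonneg _)
      (hint (3 * r)))
  rw [e0, setAverage_eq, smul_eq_mul, inv_mul_le_iff₀ hpos]
  refine hsplit.trans ?_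
  have h1 := htint r
  have h2 := mul_le_mul_of_nonneg_left (htint (3 * r)) hC0
  rw [hmeas3] at h2
  linarith

/-- A bounded `H¹` function on one side of the interface extends across it, with values in the
same set and with the same trace. -/
theorem TubeSetting.memH1_reflExt [FiniteDimensional ℝ V] (h : TubeSetting Ω Ωp Ωm Γ δΓ)
    {δ : ℝ} (hδ : δ < δΓ) {u : Euc d → V} {M : ℝ}
    (hM : ∀ᵐ x ∂(volume.restrict Ωp), ‖u x‖ ≤ M) (hu : MemH1 Ωp u) :
    MemH1 (Ωp ∪ nbhd Γ δ) (reflExt Ωp Γ u) := by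
  obtain ⟨h1, G, h2, h3⟩ := hu
  exact ⟨h.memLp_reflExt hδ h1, reflGrad Ωp Γ G, h.hasWeakGrad_reflExt hδ h1 h3 hM h2,
    h.memLp_reflGrad hδ h3⟩

end Reflection

/-! ### From traces at almost every point to means over thin tubes. -/

section LayerMeasure

variable {d : ℕ} {Ω Ωp Ωm Γ : Set (Euc d)} {δΓ : ℝ}

/-- The foot point of `x` on the interface. -/
noncomputable def foot (Ωp Γ : Set (Euc d)) (x : Euc d) : Euc d :=
  x - signedDist Ωp Γ x • gradient (signedDist Ωp Γ) x

theorem TubeSetting.contDiffOn_foot (h : TubeSetting Ω Ωp Ωm Γ δΓ) :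
    ContDiffOn ℝ ∞ (foot Ωp Γ) (nbhd Γ δΓ) :=
  contDiffOn_id.sub (h.contDiffOn_signedDist.smul h.contDiffOn_normal)

theorem TubeSetting.foot_mem (h : TubeSetting Ω Ωp Ωm Γ δΓ) {x : Euc d} (hx : x ∈ nbhd Γ δΓ) :
    foot Ωp Γ x ∈ Γ := (h.foot_spec hx).1

theorem TubeSetting.dist_foot (h : TubeSetting Ω Ωp Ωm Γ δΓ) {x : Euc d} (hx : x ∈ nbhd Γ δΓ) :
    dist x (foot Ωp Γ x) = Metric.infDist x Γ := by
  rw [foot, dist_eq_norm, sub_sub_cancel, norm_smul, h.norm_normal hx, mul_one, Real.norm_eq_abs,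
    abs_signedDist]

theorem TubeSetting.foot_add_smul (h : TubeSetting Ω Ωp Ωm Γ δΓ) {y : Euc d} (hy : y ∈ Γ)
    {s : ℝ} (hs : |s| < δΓ) : foot Ωp Γ (y + s • gradient (signedDist Ωp Γ) y) = y := by
  rw [foot, h.signedDist_add_smul hy hs, h.normal_add_smul hy hs, add_sub_cancel_right]

theorem TubeSetting.eq_foot_add (h : TubeSetting Ω Ωp Ωm Γ δΓ) {x : Euc d}
    (hx : x ∈ nbhd Γ δΓ) :
    x = foot Ωp Γ x + signedDist Ωp Γ x • gradient (signedDist Ωp Γ) (foot Ωp Γ x) := by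
  have := (h.foot_spec hx).2
  rw [← foot] at this
  rw [this, foot, sub_add_cancel]

/-- Smooth functions are Lipschitz on convex subsets of the tube, with a uniform constant. -/
theorem TubeSetting.exists_lipschitz (h : TubeSetting Ω Ωp Ωm Γ δΓ) {W : Type*}
    [NormedAddCommGroup W] [NormedSpace ℝ W] {g : Euc d → W} (hg : ContDiffOn ℝ ∞ g (nbhd Γ δΓ))
    {δ : ℝ} (hδ : δ < δΓ) : ∃ L : ℝ, 1 ≤ L ∧ ∀ s ⊆ {x | Metric.infDist x Γ ≤ δ}, Convex ℝ s →
      ∀ x ∈ s, ∀ y ∈ s, ‖g y - g x‖ ≤ L * ‖y - x‖ := by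
  obtain ⟨L, hL⟩ := (h.isCompact_closedNbhd δ).exists_bound_of_continuousOn
    ((hg.continuousOn_fderiv_of_isOpen (isOpen_nbhd Γ δΓ) (by simp)).mono (closedNbhd_subset hδ))
  refine ⟨max L 1, le_max_right _ _, fun s hs hc x hx y hy => ?_⟩
  exact hc.norm_image_sub_le_of_norm_fderiv_le (𝕜 := ℝ)
    (fun z hz => (hg.contDiffAt ((isOpen_nbhd Γ δΓ).mem_nhds
      (closedNbhd_subset hδ (hs hz)))).differentiableAt (by simp))
    (fun z hz => (hL z (hs hz)).trans (le_max_left _ _)) hx hy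

/-- The push-forward of the volume of a tube to the interface. -/
noncomputable def layerMeasure (Ωp Γ : Set (Euc d)) (δ : ℝ) : Measure (Euc d) :=
  Measure.map (foot Ωp Γ) (volume.restrict (nbhd Γ δ))

theorem TubeSetting.aemeasurable_foot (h : TubeSetting Ω Ωp Ωm Γ δΓ) {δ : ℝ} (hδ : δ < δΓ) :
    AEMeasurable (foot Ωp Γ) (volume.restrict (nbhd Γ δ)) :=
  (h.contDiffOn_foot.continuousOn.mono (nbhd_mono Γ hδ.le)).aemeasurable
    (isOpen_nbhd Γ δ).measurableSet

theorem TubeSetting.layerMeasure_apply (h : TubeSetting Ω Ωp Ωm Γ δΓ) {δ : ℝ} (hδ : δ < δΓ)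
    {s : Set (Euc d)} (hs : MeasurableSet s) :
    layerMeasure Ωp Γ δ s = volume (foot Ωp Γ ⁻¹' s ∩ nbhd Γ δ) := by
  rw [layerMeasure, Measure.map_apply_of_aemeasurable (h.aemeasurable_foot hδ) hs,
    Measure.restrict_apply' (isOpen_nbhd Γ δ).measurableSet]

theorem TubeSetting.layerMeasure_ne_top (h : TubeSetting Ω Ωp Ωm Γ δΓ) {δ : ℝ} (hδ : δ < δΓ) :
    layerMeasure Ωp Γ δ univ ≠ ⊤ := by
  rw [h.layerMeasure_apply hδ MeasurableSet.univ]
  exact ((measure_mono inter_subset_right).trans_lt (h.volume_nbhd_ne_top δ).lt_top).ne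

theorem volume_ball_eq (x : Euc d) {ρ : ℝ} (hρ : 0 < ρ) :
    volume (Metric.ball x ρ) = ENNReal.ofReal (ρ ^ d) * volume (Metric.ball (0 : Euc d) 1) := by
  rw [Measure.addHaar_ball_of_pos volume x hρ, finrank_euclideanSpace_fin]

/-- The foot map is `L`-Lipschitz and sends the normal line through `p` to `p`. So disjoint balls of
radius `ρ = r/L`, strung along that line over a length comparable to `δ`, all lie over the ball of
radius `r`. -/
theorem TubeSetting.layerMeasure_ball_ge (h : TubeSetting Ω Ωp Ωm Γ δΓ) (hd : 1 ≤ d) {δ : ℝ}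
    (hδ0 : 0 < δ) (hδ : δ < δΓ) : ∃ c r₀ : ℝ, 0 < c ∧ 0 < r₀ ∧ ∀ r, 0 < r → r ≤ r₀ →
      ∀ p ∈ Γ, ENNReal.ofReal (c * r ^ (d - 1)) ≤ layerMeasure Ωp Γ δ (Metric.ball p r) := by
  obtain ⟨L, hL1, hL⟩ := h.exists_lipschitz (h.contDiffOn_foot (Ωp := Ωp)) hδ
  set κ := volume.real (Metric.ball (0 : Euc d) 1) with hκ
  have hκpos : 0 < κ :=
    ENNReal.toReal_pos (Metric.measure_ball_pos volume 0 one_pos).ne' measure_ball_lt_top.ne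
  have hκe : volume (Metric.ball (0 : Euc d) 1) = ENNReal.ofReal κ :=
    (ENNReal.ofReal_toReal measure_ball_lt_top.ne).symm
  have hL0 : 0 < L := by linarith
  -- There are `N` balls of volume `κ ρ^d` with `N ρ ≥ δ/4`, and one factor `ρ` is used up by this
  -- inequality.
  refine ⟨δ / 4 * κ * (L ^ (d - 1))⁻¹, δ / 4, by positivity, by positivity, fun r hr hr0 p hp => ?_⟩
  set ρ := r / L with hρ
  have hρ0 : 0 < ρ := by positivity
  have hρr : ρ ≤ δ / 4 := (div_le_self hr.le hL1).trans hr0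
  set ν := gradient (signedDist Ωp Γ) p with hν
  have hν1 : ‖ν‖ = 1 := h.norm_normal (h.mem_nbhd hp)
  set N := ⌊δ / (2 * ρ)⌋₊ with hN
  have hN1 : δ / (2 * ρ) < N + 1 := Nat.lt_floor_add_one _
  have hN2 : (N : ℝ) ≤ δ / (2 * ρ) := Nat.floor_le (by positivity)
  rw [le_div_iff₀ (by positivity)] at hN2
  rw [div_lt_iff₀ (by positivity)] at hN1
  let c : ℕ → Euc d := fun k => p + (2 * ρ * k) • ν
  have hsub : ∀ k ∈ Finset.range N, Metric.ball (c k) ρ ⊆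
      foot Ωp Γ ⁻¹' (Metric.ball p r) ∩ nbhd Γ δ := by
    intro k hk z hz
    have hkN : (k : ℝ) + 1 ≤ N := by exact_mod_cast Finset.mem_range.1 hk
    have hk0 : (0 : ℝ) ≤ k := Nat.cast_nonneg k
    have hcp : dist (c k) p = 2 * ρ * k := by
      simp only [c]
      rw [dist_eq_norm, add_sub_cancel_left, norm_smul, hν1, mul_one, Real.norm_of_nonneg
        (by positivity)]
    have hball : ∀ z ∈ Metric.ball (c k) ρ, Metric.infDist z Γ < δ := fun z hz => by
      have h1 : Metric.infDist z Γ ≤ dist z p := Metric.infDist_le_dist_of_mem hp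
      have h2 := dist_triangle z (c k) p
      have h3 : dist z (c k) < ρ := hz
      nlinarith
    refine ⟨?_, hball z hz⟩
    have h4 := hL (Metric.ball (c k) ρ) (fun z hz => (hball z hz).le) (convex_ball _ _) (c k)
      (Metric.mem_ball_self hρ0) z hz
    have h5 : foot Ωp Γ (c k) = p := h.foot_add_smul hp (by
      rw [abs_of_nonneg (by positivity)]; nlinarith)
    rw [h5, ← dist_eq_norm, ← dist_eq_norm] at h4
    have h3 : dist z (c k) < ρ := hz
    change dist (foot Ωp Γ z) p < r
    calc _ ≤ L * dist z (c k) := h4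
      _ < L * ρ := by gcongr
      _ = r := by rw [hρ]; field_simp
  have hdisj : (↑(Finset.range N) : Set ℕ).PairwiseDisjoint fun k => Metric.ball (c k) ρ := by
    intro i _ j _ hij
    refine Metric.ball_disjoint_ball ?_
    have e : c i - c j = (2 * ρ * ((i : ℝ) - j)) • ν := by
      simp only [c]
      rw [add_sub_add_left_eq_sub, ← sub_smul]; ring_nf
    have h1 : (1 : ℝ) ≤ |(i : ℝ) - j| := by
      have : (1 : ℤ) ≤ |(i : ℤ) - j| := Int.one_le_abs (sub_ne_zero.2 (by exact_mod_cast hij))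
      exact_mod_cast this
    rw [dist_eq_norm, e, norm_smul, hν1, mul_one, Real.norm_eq_abs, abs_mul,
      abs_of_pos (by positivity : (0 : ℝ) < 2 * ρ)]
    nlinarith
  rw [h.layerMeasure_apply hδ measurableSet_ball]
  refine le_trans ?_ (measure_mono (iUnion₂_subset hsub))
  rw [measure_biUnion_finset hdisj fun _ _ => measurableSet_ball]
  simp only [volume_ball_eq _ hρ0, Finset.sum_const, Finset.card_range, hκe, nsmul_eq_mul]
  rw [← ENNReal.ofReal_mul (by positivity), ← ENNReal.ofReal_natCast,
    ← ENNReal.ofReal_mul (by positivity)]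
  refine ENNReal.ofReal_le_ofReal ?_
  have h6 : δ / 4 ≤ N * ρ := by nlinarith
  have h7 : ρ ^ d = ρ * ρ ^ (d - 1) := by rw [← pow_succ', Nat.sub_add_cancel hd]
  have h8 : r ^ (d - 1) = L ^ (d - 1) * ρ ^ (d - 1) := by
    rw [← mul_pow, hρ]; congr 1; field_simp
  calc δ / 4 * κ * (L ^ (d - 1))⁻¹ * r ^ (d - 1) = δ / 4 * (κ * ρ ^ (d - 1)) := by
        rw [h8]; field_simp
    _ ≤ N * ρ * (κ * ρ ^ (d - 1)) := by gcongr
    _ = N * (ρ ^ d * κ) := by rw [h7]; ring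

/-- A set of diameter `ρ` on `Γ` has over it only points close to one normal segment. That segment
is covered by about `δ/ρ` balls of radius `(L + 3)ρ`. -/
theorem TubeSetting.exists_volume_foot_le (h : TubeSetting Ω Ωp Ωm Γ δΓ) (hd : 1 ≤ d) {δ : ℝ}
    (hδ0 : 0 < δ) (hδ : δ < δΓ) : ∃ C : ℝ, 0 < C ∧ ∀ s : Set (Euc d), ∀ ρ, 0 < ρ → ρ ≤ δ →
      (∀ x ∈ s, ∀ y ∈ s, dist x y ≤ ρ) →
      volume (foot Ωp Γ ⁻¹' s ∩ nbhd Γ δ) ≤ ENNReal.ofReal (C * ρ ^ (d - 1)) := by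
  obtain ⟨L, hL1, hL⟩ := h.exists_lipschitz (h.contDiffOn_normal (Ωp := Ωp)) hδ
  set κ := volume.real (Metric.ball (0 : Euc d) 1) with hκ
  have hκpos : 0 < κ :=
    ENNReal.toReal_pos (Metric.measure_ball_pos volume 0 one_pos).ne' measure_ball_lt_top.ne
  have hκe : volume (Metric.ball (0 : Euc d) 1) = ENNReal.ofReal κ :=
    (ENNReal.ofReal_toReal measure_ball_lt_top.ne).symm
  have hL0 : 0 < L := by linarith
  refine ⟨5 * (κ * (L + 3) ^ d), by positivity, fun s ρ hρ0 hρ hs => ?_⟩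
  have hδ1 : δ < 1 := hδ.trans h.radius.lt_one
  rcases (foot Ωp Γ ⁻¹' s ∩ nbhd Γ δ).eq_empty_or_nonempty with he | ⟨z₀, hz₀, hz₀'⟩
  · rw [he, measure_empty]; exact zero_le
  set p := foot Ωp Γ z₀ with hp
  have hpΓ : p ∈ Γ := h.foot_mem (nbhd_mono Γ hδ.le hz₀')
  set ν := gradient (signedDist Ωp Γ) p with hν
  have hν1 : ‖ν‖ = 1 := h.norm_normal (h.mem_nbhd hpΓ)
  set N : ℕ := ⌈δ / ρ⌉₊ with hN
  have hN1 : δ / ρ ≤ N := Nat.le_ceil _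
  have hN2 : (N : ℝ) < δ / ρ + 1 := Nat.ceil_lt_add_one (by positivity)
  have hcov : foot Ωp Γ ⁻¹' s ∩ nbhd Γ δ ⊆ ⋃ k ∈ Finset.Icc (-(N : ℤ)) N,
      Metric.ball (p + ((k : ℝ) * ρ) • ν) ((L + 3) * ρ) := by
    rintro z ⟨hzs, hzδ⟩
    have hzT := nbhd_mono Γ hδ.le hzδ
    set q := foot Ωp Γ z with hq
    have hqΓ : q ∈ Γ := h.foot_mem hzT
    have hqp : dist q p ≤ ρ := hs q hzs p hz₀
    set t := signedDist Ωp Γ z with ht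
    have ht' : |t| < δ := by rw [ht, abs_signedDist]; exact hzδ
    have hzq : z = q + t • gradient (signedDist Ωp Γ) q := h.eq_foot_add hzT
    have hnn : ‖gradient (signedDist Ωp Γ) q - ν‖ ≤ L * ρ := by
      refine (hL (segment ℝ p q) (fun w hw => ?_) (convex_segment p q) p (left_mem_segment ℝ p q) q
        (right_mem_segment ℝ p q)).trans ?_
      · have h1 : Metric.infDist w Γ ≤ dist w p := Metric.infDist_le_dist_of_mem hpΓ
        have h2 := dist_add_dist_of_mem_segment hw
        have h3 : Metric.infDist w Γ ≤ δ := by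
          rw [dist_comm p w, dist_comm p q] at h2
          linarith [dist_nonneg (x := w) (y := q)]
        exact h3
      · rw [← dist_eq_norm]; gcongr
    set k : ℤ := ⌊t / ρ⌋ with hk
    have hk1 : (k : ℝ) ≤ t / ρ := Int.floor_le _
    have hk2 : t / ρ < k + 1 := Int.lt_floor_add_one _
    have htN : |t / ρ| ≤ N := by
      rw [abs_div, abs_of_pos hρ0]
      exact (div_le_div_of_nonneg_right ht'.le hρ0.le).trans hN1
    have htN' := abs_le.1 htN
    have hkN : k ∈ Finset.Icc (-(N : ℤ)) N := by
      rw [Finset.mem_Icc]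
      constructor
      · rw [hk, Int.le_floor]; push_cast; exact htN'.1
      · have : (k : ℝ) ≤ (N : ℤ) := by push_cast; exact hk1.trans htN'.2
        exact_mod_cast this
    refine mem_iUnion₂.2 ⟨k, hkN, ?_⟩
    rw [Metric.mem_ball, dist_eq_norm]
    -- Three errors: the foot is displaced by at most `ρ`, the normal is tilted by at most `Lρ` over
    -- a height below 1, and the grid spacing is `ρ`.
    have e : z - (p + ((k : ℝ) * ρ) • ν) = (q - p) + t • (gradient (signedDist Ωp Γ) q - ν)
        + (t - k * ρ) • ν := by
      rw [hzq, smul_sub, sub_smul]; abel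
    rw [e]
    have n1 : ‖q - p‖ ≤ ρ := by rw [← dist_eq_norm]; exact hqp
    have n2 : ‖t • (gradient (signedDist Ωp Γ) q - ν)‖ ≤ L * ρ := by
      rw [norm_smul, Real.norm_eq_abs]
      calc |t| * ‖gradient (signedDist Ωp Γ) q - ν‖ ≤ 1 * (L * ρ) := by
            gcongr; linarith
        _ = L * ρ := one_mul _
    have n3 : ‖(t - k * ρ) • ν‖ ≤ ρ := by
      rw [norm_smul, hν1, mul_one, Real.norm_eq_abs, abs_le]
      rw [le_div_iff₀ hρ0] at hk1
      rw [div_lt_iff₀ hρ0] at hk2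
      constructor <;> nlinarith
    have n4 := norm_add_le ((q - p) + t • (gradient (signedDist Ωp Γ) q - ν)) ((t - k * ρ) • ν)
    have n5 := norm_add_le (q - p) (t • (gradient (signedDist Ωp Γ) q - ν))
    nlinarith
  refine (measure_mono hcov).trans ((measure_biUnion_finset_le _ _).trans ?_)
  have hr : 0 < (L + 3) * ρ := by positivity
  have hcard : (Finset.Icc (-(N : ℤ)) N).card = 2 * N + 1 := by
    rw [Int.card_Icc]; omega
  simp only [volume_ball_eq _ hr, Finset.sum_const, hcard, hκe, nsmul_eq_mul]
  rw [← ENNReal.ofReal_mul (by positivity), ← ENNReal.ofReal_natCast,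
    ← ENNReal.ofReal_mul (by positivity)]
  refine ENNReal.ofReal_le_ofReal ?_
  have h7 : ρ ^ d = ρ * ρ ^ (d - 1) := by rw [← pow_succ', Nat.sub_add_cancel hd]
  have h6 : (2 * (N : ℝ) + 1) * ρ ≤ 5 := by
    have : (N : ℝ) * ρ < δ + ρ := by
      have := mul_lt_mul_of_pos_right hN2 hρ0
      rwa [add_mul, div_mul_cancel₀ _ hρ0.ne', one_mul] at this
    nlinarith
  push_cast
  calc (2 * (N : ℝ) + 1) * (((L + 3) * ρ) ^ d * κ)
      = ((2 * (N : ℝ) + 1) * ρ) * (κ * (L + 3) ^ d * ρ ^ (d - 1)) := by rw [mul_pow, h7]; ring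
    _ ≤ 5 * (κ * (L + 3) ^ d * ρ ^ (d - 1)) := by gcongr
    _ = _ := by ring

/-- The layer measure is absolutely continuous with respect to the surface measure. -/
theorem TubeSetting.layerMeasure_absolutelyContinuous (h : TubeSetting Ω Ωp Ωm Γ δΓ) (hd : 1 ≤ d)
    {δ : ℝ} (hδ0 : 0 < δ) (hδ : δ < δΓ) :
    layerMeasure Ωp Γ δ ≪ Measure.hausdorffMeasure ((d : ℝ) - 1) := by
  obtain ⟨C, hC, hle⟩ := h.exists_volume_foot_le (Ωp := Ωp) hd hδ0 hδ
  have hCe : ENNReal.ofReal C ≠ 0 := by simpa using hC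
  -- It suffices to compare the layer measure of small sets with the power `d - 1` of their
  -- diameter; a multiple of it is then dominated by the Hausdorff measure.
  have key : (ENNReal.ofReal C)⁻¹ • layerMeasure Ωp Γ δ ≤
      Measure.hausdorffMeasure ((d : ℝ) - 1) := by
    refine Measure.le_hausdorffMeasure _ _ (ENNReal.ofReal (δ / 2)) (by simpa using hδ0) fun s hs => ?_
    rw [Measure.smul_apply, smul_eq_mul, ENNReal.inv_mul_le_iff hCe ENNReal.ofReal_ne_top]
    have hfin : Metric.ediam s ≠ ⊤ := (hs.trans_lt ENNReal.ofReal_lt_top).ne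
    set D := (Metric.ediam s).toReal with hD
    have hDe : Metric.ediam s = ENNReal.ofReal D := (ENNReal.ofReal_toReal hfin).symm
    have hDδ : D ≤ δ / 2 := ENNReal.toReal_le_of_le_ofReal (by positivity) hs
    have hD0 : 0 ≤ D := ENNReal.toReal_nonneg
    have hexp : ((d : ℝ) - 1) = ((d - 1 : ℕ) : ℝ) := by rw [Nat.cast_sub hd]; simp
    rw [hexp, ENNReal.rpow_natCast, hDe, ← ENNReal.ofReal_pow hD0, ← ENNReal.ofReal_mul hC.le]
    -- The volume estimate requires a positive scale, so the diameter, which may be zero, is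
    -- approached from above. Passing to the closure below supplies measurability without changing
    -- the diameter.
    have ht : Tendsto (fun ρ : ℝ => ENNReal.ofReal (C * ρ ^ (d - 1))) (𝓝[>] D)
        (𝓝 (ENNReal.ofReal (C * D ^ (d - 1)))) := by
      have : Continuous fun ρ : ℝ => ENNReal.ofReal (C * ρ ^ (d - 1)) :=
        ENNReal.continuous_ofReal.comp (by fun_prop)
      exact (this.tendsto D).mono_left nhdsWithin_le_nhds
    refine ge_of_tendsto ht ?_
    filter_upwards [Ioc_mem_nhdsGT (show D < δ by linarith)] with ρ hρ
    refine (measure_mono subset_closure).trans ?_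
    rw [h.layerMeasure_apply hδ isClosed_closure.measurableSet]
    refine hle _ ρ (hD0.trans_lt hρ.1) hρ.2 fun x hx y hy => ?_
    have h1 : edist x y ≤ Metric.ediam (closure s) := Metric.edist_le_ediam_of_mem hx hy
    rw [Metric.ediam_closure, hDe, edist_dist] at h1
    exact ((ENNReal.ofReal_le_ofReal_iff hD0).1 h1).trans hρ.1.le
  refine Measure.AbsolutelyContinuous.trans ?_ key.absolutelyContinuous
  exact Measure.absolutelyContinuous_smul (ENNReal.inv_ne_zero.2 ENNReal.ofReal_ne_top)

theorem TubeSetting.layerMeasure_compl (h : TubeSetting Ω Ωp Ωm Γ δΓ) {δ : ℝ} (hδ : δ < δΓ) :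
    layerMeasure Ωp Γ δ Γᶜ = 0 := by
  rw [h.layerMeasure_apply hδ h.interface.isCompact.measurableSet.compl]
  convert measure_empty (μ := (volume : Measure (Euc d)))
  ext x
  simp only [mem_inter_iff, mem_preimage, mem_compl_iff, mem_empty_iff_false, iff_false, not_and]
  exact fun hx hxδ => hx (h.foot_mem (nbhd_mono Γ hδ.le hxδ))

/-- A bounded function with vanishing trace has small mean over thin layers. -/
theorem TubeSetting.tendsto_layer_mean (h : TubeSetting Ω Ωp Ωm Γ δΓ) (hd : 1 ≤ d)
    {f : Euc d → ENNReal} (hf : Measurable f) {B : ENNReal} (hB : B ≠ ⊤) (hfB : ∀ x, f x ≤ B)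
    (hlim : ∀ᵐ x ∂((Measure.hausdorffMeasure ((d : ℝ) - 1) : Measure (Euc d)).restrict Γ),
      Tendsto (fun r : ℝ => (∫⁻ y in Metric.ball x r, f y) / volume (Metric.ball x r))
        (𝓝[>] 0) (𝓝 0))
    {r : ℕ → ℝ} (hr : ∀ k, 0 < r k) (hr0 : Tendsto r atTop (𝓝 0)) :
    Tendsto (fun k => (ENNReal.ofReal (r k))⁻¹ * ∫⁻ y in nbhd Γ (r k), f y) atTop (𝓝 0) := by
  have hδ0 : 0 < δΓ / 2 := half_pos h.radius.pos
  have hδ : δΓ / 2 < δΓ := half_lt_self h.radius.pos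
  set μ := layerMeasure Ωp Γ (δΓ / 2) with hμ
  have : IsFiniteMeasure μ := ⟨(h.layerMeasure_ne_top hδ).lt_top⟩
  obtain ⟨c, r₀, hc, hr₀, hball⟩ := h.layerMeasure_ball_ge (Ωp := Ωp) hd hδ0 hδ
  set A : ENNReal := volume (Metric.ball (0 : Euc d) 1) with hA
  have hA0 : A ≠ 0 := (Metric.measure_ball_pos volume 0 one_pos).ne'
  have hAt : A ≠ ⊤ := measure_ball_lt_top.ne
  set g : ℕ → Euc d → ENNReal := fun k x =>
    (∫⁻ y in Metric.ball x (2 * r k), f y) / volume (Metric.ball x (2 * r k)) with hg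
  have h2r : ∀ k, 0 < 2 * r k := fun k => by have := hr k; positivity
  have hvol : ∀ k x, volume (Metric.ball x (2 * r k)) = ENNReal.ofReal ((2 * r k) ^ d) * A :=
    fun k x => volume_ball_eq x (h2r k)
  have hind : ∀ k x, ∫⁻ y in Metric.ball x (2 * r k), f y
      = ∫⁻ y, {p : Euc d × Euc d | dist p.2 p.1 < 2 * r k}.indicator (fun p => f p.2) (x, y) := by
    intro k x
    rw [← lintegral_indicator measurableSet_ball]
    rfl
  have hmeas2 : ∀ k, Measurable
      ({p : Euc d × Euc d | dist p.2 p.1 < 2 * r k}.indicator fun p => f p.2) := fun k =>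
    (hf.comp measurable_snd).indicator
      (isOpen_lt (continuous_snd.dist continuous_fst) continuous_const).measurableSet
  have hgm : ∀ k, Measurable (g k) := fun k => by
    simp only [hg, hvol, hind]
    exact (Measurable.lintegral_prod_right' (hmeas2 k)).div_const _
  have hgB : ∀ k x, g k x ≤ B := fun k x => by
    refine ENNReal.div_le_of_le_mul ?_
    calc ∫⁻ y in Metric.ball x (2 * r k), f y ≤ ∫⁻ y in Metric.ball x (2 * r k), B :=
          lintegral_mono fun y => hfB y
      _ = _ := by rw [setLIntegral_const]
  have hglim : ∀ᵐ x ∂μ, Tendsto (fun k => g k x) atTop (𝓝 0) := by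
    have h1 := ae_iff.1 hlim
    rw [Measure.restrict_apply' h.interface.isCompact.measurableSet] at h1
    have h2 := h.layerMeasure_absolutelyContinuous (Ωp := Ωp) hd hδ0 hδ h1
    have h3 : ∀ᵐ x ∂μ, x ∈ Γ := h.layerMeasure_compl hδ
    filter_upwards [measure_eq_zero_iff_ae_notMem.1 h2, h3] with x hx hxΓ
    have h4 : Tendsto (fun r : ℝ => (∫⁻ y in Metric.ball x r, f y) / volume (Metric.ball x r))
        (𝓝[>] 0) (𝓝 0) := by
      by_contra h0; exact hx ⟨h0, hxΓ⟩
    refine h4.comp (tendsto_nhdsWithin_iff.2 ⟨?_, Eventually.of_forall fun k => h2r k⟩)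
    simpa using hr0.const_mul 2
  -- The ball means vanish in the limit almost everywhere for the surface measure on `Γ`, hence for
  -- the layer measure, and they are bounded by `B`.
  have hG : Tendsto (fun k => ∫⁻ x, g k x ∂μ) atTop (𝓝 0) := by
    have := tendsto_lintegral_of_dominated_convergence (μ := μ) (F := g) (f := fun _ => 0)
      (fun _ => B) hgm (fun k => Eventually.of_forall (hgB k))
      (by rw [lintegral_const]; exact ENNReal.mul_ne_top hB (measure_ne_top μ _)) hglim
    simpa using this
  set K : ENNReal := ENNReal.ofReal (2 ^ d / c) * A with hK
  have hKt : K ≠ ⊤ := ENNReal.mul_ne_top ENNReal.ofReal_ne_top hAt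
  have hKG : Tendsto (fun k => K * ∫⁻ x, g k x ∂μ) atTop (𝓝 0) := by
    simpa using ENNReal.Tendsto.const_mul hG (Or.inr hKt)
  refine tendsto_of_tendsto_of_tendsto_of_le_of_le' tendsto_const_nhds hKG
    (Eventually.of_forall fun _ => zero_le) ?_
  have hrm : ∀ᶠ k in atTop, r k < min r₀ δΓ := hr0.eventually (gt_mem_nhds (lt_min hr₀ h.radius.pos))
  filter_upwards [hrm] with k hk
  have hk1 : r k ≤ r₀ := hk.le.trans (min_le_left _ _)
  have hk2 : r k ≤ δΓ := hk.le.trans (min_le_right _ _)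
  have hrk := hr k
  -- The ball of radius `2r` around a point of the `r`-tube contains the ball of radius `r` around
  -- its foot.
  have hlow : ∀ y ∈ nbhd Γ (r k), ENNReal.ofReal (c * r k ^ (d - 1)) ≤
      μ (Metric.ball y (2 * r k)) := fun y hy => by
    have hyT := nbhd_mono Γ hk2 hy
    refine (hball (r k) hrk hk1 _ (h.foot_mem hyT)).trans (measure_mono fun z hz => ?_)
    have h1 := h.dist_foot (Ωp := Ωp) hyT
    have h2 := dist_triangle z (foot Ωp Γ y) y
    rw [dist_comm (foot Ωp Γ y) y, h1] at h2
    have h3 : dist z (foot Ωp Γ y) < r k := hz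
    have h4 : Metric.infDist y Γ < r k := hy
    rw [Metric.mem_ball]; linarith
  set v : ENNReal := ENNReal.ofReal ((2 * r k) ^ d) * A with hv
  have hv0 : v ≠ 0 := by
    rw [hv, ← hvol k 0]; exact (Metric.measure_ball_pos volume 0 (h2r k)).ne'
  have hvt : v ≠ ⊤ := by rw [hv, ← hvol k 0]; exact measure_ball_lt_top.ne
  -- Tonelli: integrating ball means of `f` over `x` weighs `f y` with the layer measure of the ball
  -- around `y`, which was just bounded below on the tube.
  have hswap : (∫⁻ x, g k x ∂μ) * v = ∫⁻ y, f y * μ (Metric.ball y (2 * r k)) := by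
    rw [← lintegral_mul_const _ (hgm k)]
    calc ∫⁻ x, g k x * v ∂μ = ∫⁻ x, (∫⁻ y, {p : Euc d × Euc d | dist p.2 p.1 < 2 * r k}.indicator
          (fun p => f p.2) (x, y)) ∂μ := by
          refine lintegral_congr fun x => ?_
          rw [← hind]
          simp only [hg, hvol]
          exact ENNReal.div_mul_cancel hv0 hvt
      _ = ∫⁻ y, ∫⁻ x, {p : Euc d × Euc d | dist p.2 p.1 < 2 * r k}.indicator
          (fun p => f p.2) (x, y) ∂μ := 
          lintegral_lintegral_swap (f := fun x y => {p : Euc d × Euc d |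
            dist p.2 p.1 < 2 * r k}.indicator (fun p => f p.2) (x, y)) (hmeas2 k).aemeasurable
      _ = _ := by
          refine lintegral_congr fun y => ?_
          have e : (fun x => {p : Euc d × Euc d | dist p.2 p.1 < 2 * r k}.indicator
              (fun p => f p.2) (x, y)) = (Metric.ball y (2 * r k)).indicator fun _ => f y := by
            funext x
            simp only [indicator, Metric.mem_ball, mem_ofPred_eq, dist_comm x y]
          rw [e, lintegral_indicator measurableSet_ball, setLIntegral_const]
  set a : ENNReal := ENNReal.ofReal (c * r k ^ (d - 1)) with ha
  have ha0 : a ≠ 0 := by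
    rw [ha]; simp only [ne_eq, ENNReal.ofReal_eq_zero, not_le]; positivity
  have hat : a ≠ ⊤ := ENNReal.ofReal_ne_top
  have hI : (∫⁻ y in nbhd Γ (r k), f y) * a ≤ (∫⁻ x, g k x ∂μ) * v := by
    rw [hswap, ← lintegral_mul_const _ hf]
    refine (setLIntegral_mono_ae' (isOpen_nbhd Γ (r k)).measurableSet
      (Eventually.of_forall fun y hy => ?_)).trans (setLIntegral_le_lintegral _ _)
    exact mul_le_mul_right (hlow y hy) (f y)
  -- The quotient of `(2r)^d` by `r^(d-1)` leaves precisely the factor `r` of the tube width.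
  have hav : a⁻¹ * v = ENNReal.ofReal (r k) * K := by
    rw [hv, hK, ha, ← mul_assoc, ← mul_assoc, ← ENNReal.ofReal_inv_of_pos (by positivity),
      ← ENNReal.ofReal_mul (by positivity), ← ENNReal.ofReal_mul hrk.le]
    congr 2
    have h7 : r k ^ d = r k * r k ^ (d - 1) := by rw [← pow_succ', Nat.sub_add_cancel hd]
    rw [mul_pow, h7]
    field_simp
  have hr0' : ENNReal.ofReal (r k) ≠ 0 := by simpa using hrk
  rw [ENNReal.inv_mul_le_iff hr0' ENNReal.ofReal_ne_top]
  calc ∫⁻ y in nbhd Γ (r k), f y = a⁻¹ * ((∫⁻ y in nbhd Γ (r k), f y) * a) := by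
        rw [mul_comm _ a, ← mul_assoc, ENNReal.inv_mul_cancel ha0 hat, one_mul]
    _ ≤ a⁻¹ * ((∫⁻ x, g k x ∂μ) * v) := mul_le_mul_right hI _
    _ = (a⁻¹ * v) * ∫⁻ x, g k x ∂μ := by ring
    _ = ENNReal.ofReal (r k) * (K * ∫⁻ x, g k x ∂μ) := by rw [hav]; ring

end LayerMeasure

/-! ### Minimal pairs of orthogonal matrices. -/

section MatrixAlgebra

open Matrix

variable {n : ℕ}

theorem frobenius_norm_sq (A : Mat n) : ‖A‖ ^ 2 = trace (Aᵀ * A) := by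
  have h0 : 0 ≤ ∑ i, ∑ j, ‖A i j‖ ^ (2 : ℝ) :=
    Finset.sum_nonneg fun i _ => Finset.sum_nonneg fun j _ => by positivity
  rw [frobenius_norm_def, ← Real.sqrt_eq_rpow, Real.sq_sqrt h0, Finset.sum_comm]
  simp [trace, Matrix.mul_apply, sq]

theorem trace_transpose_mul_comm (A B : Mat n) : trace (Aᵀ * B) = trace (Bᵀ * A) := by
  rw [← trace_transpose (Aᵀ * B), transpose_mul, transpose_transpose]

theorem abs_trace_mul_le (A B : Mat n) : |trace (Aᵀ * B)| ≤ ‖A‖ * ‖B‖ := by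
  have e : ∀ A B : Mat n, trace (Aᵀ * B) = ∑ p : Fin n × Fin n, A p.1 p.2 * B p.1 p.2 := by
    intro A B
    rw [Fintype.sum_prod_type, Finset.sum_comm]
    simp [trace, Matrix.mul_apply]
  refine abs_le_of_sq_le_sq ?_ (by positivity)
  rw [mul_pow, frobenius_norm_sq, frobenius_norm_sq, e, e, e]
  have := Finset.sum_mul_sq_le_sq_mul_sq Finset.univ (fun p : Fin n × Fin n => A p.1 p.2)
    fun p => B p.1 p.2
  simpa only [sq] using this

theorem norm_add_sq_matrix (A B : Mat n) :
    ‖A + B‖ ^ 2 = ‖A‖ ^ 2 + 2 * trace (Aᵀ * B) + ‖B‖ ^ 2 := by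
  simp only [frobenius_norm_sq, transpose_add, Matrix.add_mul, Matrix.mul_add, trace_add]
  rw [trace_transpose_mul_comm B A]; ring

theorem norm_orthogonal_mul {P : Mat n} (hP : Pᵀ * P = 1) (A : Mat n) : ‖P * A‖ = ‖A‖ := by
  have : ‖P * A‖ ^ 2 = ‖A‖ ^ 2 := by
    rw [frobenius_norm_sq, frobenius_norm_sq, transpose_mul, Matrix.mul_assoc,
      ← Matrix.mul_assoc Pᵀ, hP, Matrix.one_mul]
  exact (sq_eq_sq₀ (norm_nonneg _) (norm_nonneg _)).1 this

theorem orthPlus_subset {A : Mat n} (h : A ∈ orthPlus n) : A * Aᵀ = 1 ∧ Aᵀ * A = 1 := by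
  have h1 : A * star A = 1 := (mem_orthogonalGroup_iff (Fin n) ℝ).1 h.1
  rw [star_eq_conjTranspose, conjTranspose_eq_transpose_of_trivial] at h1
  exact ⟨h1, mul_eq_one_comm.1 h1⟩

theorem orthMinus_subset {A : Mat n} (h : A ∈ orthMinus n) : A * Aᵀ = 1 ∧ Aᵀ * A = 1 := by
  have h1 : A * star A = 1 := (mem_orthogonalGroup_iff (Fin n) ℝ).1 h.1
  rw [star_eq_conjTranspose, conjTranspose_eq_transpose_of_trivial] at h1
  exact ⟨h1, mul_eq_one_comm.1 h1⟩

/-- An orthogonal matrix of determinant `-1` reverses a unit vector. -/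
theorem exists_reversed_vector {Q : Mat n} (hQ : Qᵀ * Q = 1) (hdet : Q.det = -1) :
    ∃ v : Fin n → ℝ, v ⬝ᵥ v = 1 ∧ Q *ᵥ v = -v := by
  -- From `Q + 1 = Q (Q + 1)ᵀ` the determinant equals its own negative.
  have h0 : (Q + 1).det = 0 := by
    have h1 : (Q + 1).det = Q.det * (Q + 1).det := by
      conv_lhs => rw [← mul_eq_one_comm.1 hQ]
      rw [show Q + Q * Qᵀ = Q * (Q + 1)ᵀ by
        rw [transpose_add, transpose_one, Matrix.mul_add, Matrix.mul_one, add_comm], det_mul,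
        det_transpose]
    rw [hdet] at h1
    linarith
  obtain ⟨w, hw0, hw⟩ := exists_mulVec_eq_zero_iff.2 h0
  have hpos : 0 < w ⬝ᵥ w := by
    have := dotProduct_star_self_pos_iff.2 hw0
    simpa using this
  have hs : Real.sqrt (w ⬝ᵥ w) ≠ 0 := (Real.sqrt_pos.2 hpos).ne'
  refine ⟨(Real.sqrt (w ⬝ᵥ w))⁻¹ • w, ?_, ?_⟩
  · rw [smul_dotProduct, dotProduct_smul, smul_eq_mul, smul_eq_mul]
    have := Real.mul_self_sqrt hpos.le
    field_simp
    rw [sq, this]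
  · rw [add_mulVec, one_mulVec] at hw
    rw [mulVec_smul, eq_neg_of_add_eq_zero_left hw, smul_neg]

theorem det_transpose_mul_of_orth {P M : Mat n} (hP : P ∈ orthPlus n) (hM : M ∈ orthMinus n) :
    (Pᵀ * M).det = -1 := by
  rw [det_mul, det_transpose, hP.2, hM.2, one_mul]

/-- The defect of `P`, `M` being a minimal pair: after removing a reflection, the difference
has squared norm `‖P - M‖² - 4`. -/
theorem exists_defect {P M : Mat n} (hP : Pᵀ * P = 1) (hM : Mᵀ * M = 1)
    (hdet : (Pᵀ * M).det = -1) : ∃ (v : Fin n → ℝ) (E : Mat n), v ⬝ᵥ v = 1 ∧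
      Pᵀ * M = 1 - (2 : ℝ) • vecMulVec v v - E ∧ ‖E‖ ^ 2 = ‖P - M‖ ^ 2 - 4 := by
  have hPP : P * Pᵀ = 1 := mul_eq_one_comm.1 hP
  have hQ : (Pᵀ * M)ᵀ * (Pᵀ * M) = 1 := by
    rw [transpose_mul, transpose_transpose, Matrix.mul_assoc, ← Matrix.mul_assoc P, hPP,
      Matrix.one_mul, hM]
  obtain ⟨v, hv, hQv⟩ := exists_reversed_vector hQ hdet
  set Q := Pᵀ * M with hQd
  have hN : ‖vecMulVec v v‖ ^ 2 = 1 := by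
    rw [frobenius_norm_sq, transpose_vecMulVec, vecMulVec_mul_vecMulVec, hv, one_smul,
      trace_vecMulVec, hv]
  have hX : ‖P - M‖ ^ 2 = ‖1 - Q‖ ^ 2 := by
    rw [← norm_orthogonal_mul (P := Pᵀ) (by rw [transpose_transpose]; exact hPP) (P - M),
      Matrix.mul_sub, hP]
  refine ⟨v, 1 - Q - (2 : ℝ) • vecMulVec v v, hv, by abel, ?_⟩
  -- This trace is `⟨v, (1 - Q) v⟩` with `Q v = -v`. Expanding the square of `1 - Q - 2 v vᵀ` then
  -- gives `‖1 - Q‖² - 8 + 4`.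
  have h1 : trace ((1 - Q)ᵀ * vecMulVec v v) = 2 := by
    rw [mul_vecMulVec, trace_vecMulVec, transpose_sub, transpose_one, sub_mulVec, one_mulVec,
      mulVec_transpose, sub_dotProduct, ← dotProduct_mulVec, hQv, dotProduct_neg, hv]
    norm_num
  rw [sub_eq_add_neg (1 - Q), norm_add_sq_matrix, hX, norm_neg, norm_smul, mul_pow, hN, mul_neg,
    trace_neg, Matrix.mul_smul, trace_smul, h1]
  norm_num
  ring

/-- The excess over 4 is the squared norm of the defect matrix. -/
theorem four_le_norm_sub_sq {P M : Mat n} (hP : P ∈ orthPlus n) (hM : M ∈ orthMinus n) :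
    4 ≤ ‖P - M‖ ^ 2 := by
  obtain ⟨v, E, -, -, h⟩ := exists_defect (orthPlus_subset hP).2 (orthMinus_subset hM).2
    (det_transpose_mul_of_orth hP hM)
  nlinarith [sq_nonneg ‖E‖]

/-- The matrix `Pᵀ G` is antisymmetric, hence orthogonal to the symmetric matrix `1 - 2 v vᵀ`. Only
the defect of norm `√(‖P - M‖² - 4)` is seen, and Cauchy–Schwarz concludes. -/
theorem abs_trace_tangent_le_of_det {P M G : Mat n} (hP : Pᵀ * P = 1) (hM : Mᵀ * M = 1)
    (hdet : (Pᵀ * M).det = -1) (hG : Gᵀ * P + Pᵀ * G = 0) :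
    |trace (Gᵀ * M)| ≤ ‖G‖ * Real.sqrt (‖P - M‖ ^ 2 - 4) := by
  obtain ⟨v, E, hv, hQ, hE⟩ := exists_defect hP hM hdet
  have hPP : P * Pᵀ = 1 := mul_eq_one_comm.1 hP
  rw [← hE, Real.sqrt_sq (norm_nonneg _)]
  set W := Pᵀ * G with hW
  have hWt : Wᵀ = -W := by
    rw [hW, transpose_mul, transpose_transpose]; exact eq_neg_of_add_eq_zero_left hG
  have e : Gᵀ * M = Wᵀ * (Pᵀ * M) := by
    rw [hW, transpose_mul, transpose_transpose, Matrix.mul_assoc, ← Matrix.mul_assoc P, hPP,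
      Matrix.one_mul]
  have t1 : trace Wᵀ = 0 := by
    have h1 := trace_transpose W
    rw [hWt, trace_neg] at h1 ⊢; linarith
  have t2 : trace (Wᵀ * vecMulVec v v) = 0 := by
    rw [mul_vecMulVec, trace_vecMulVec]
    have h1 : Wᵀ *ᵥ v ⬝ᵥ v = -(Wᵀ *ᵥ v ⬝ᵥ v) := by
      conv_lhs => rw [mulVec_transpose, ← dotProduct_mulVec, dotProduct_comm]
      rw [hWt, neg_mulVec, neg_dotProduct, neg_neg]
    linarith
  rw [e, hQ, Matrix.mul_sub, Matrix.mul_sub, Matrix.mul_one, Matrix.mul_smul, trace_sub, trace_sub,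
    trace_smul, t1, t2, smul_zero, sub_zero, zero_sub, abs_neg]
  refine (abs_trace_mul_le W E).trans (le_of_eq ?_)
  rw [hW, norm_orthogonal_mul (by rw [transpose_transpose]; exact hPP)]

theorem abs_trace_tangent_plus_le {P M G : Mat n} (hP : P ∈ orthPlus n) (hM : M ∈ orthMinus n)
    (hG : Gᵀ * P + Pᵀ * G = 0) : |trace (Gᵀ * M)| ≤ ‖G‖ * Real.sqrt (‖P - M‖ ^ 2 - 4) :=
  abs_trace_tangent_le_of_det (orthPlus_subset hP).2 (orthMinus_subset hM).2
    (det_transpose_mul_of_orth hP hM) hG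

theorem abs_trace_tangent_minus_le {P M G : Mat n} (hP : P ∈ orthPlus n) (hM : M ∈ orthMinus n)
    (hG : Gᵀ * M + Mᵀ * G = 0) : |trace (Gᵀ * P)| ≤ ‖G‖ * Real.sqrt (‖P - M‖ ^ 2 - 4) := by
  rw [norm_sub_rev]
  refine abs_trace_tangent_le_of_det (orthMinus_subset hM).2 (orthPlus_subset hP).2 ?_ hG
  rw [det_mul, det_transpose, hP.2, hM.2, mul_one]

theorem trace_tangent_self {P G : Mat n} (hG : Gᵀ * P + Pᵀ * G = 0) : trace (Gᵀ * P) = 0 := by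
  have := congrArg trace hG
  rw [trace_add, trace_zero, trace_transpose_mul_comm P G] at this
  linarith

theorem norm_orth_sq {P : Mat n} (hP : Pᵀ * P = 1) : ‖P‖ ^ 2 = n := by
  rw [frobenius_norm_sq, hP, trace_one, Fintype.card_fin]

theorem norm_orth_le {P : Mat n} (hP : Pᵀ * P = 1) : ‖P‖ ≤ Real.sqrt n :=
  (Real.le_sqrt (norm_nonneg _) (Nat.cast_nonneg n)).2 (norm_orth_sq hP).le

/-- The potential on the segment between two orthogonal matrices. -/
theorem potential_segment_le {P M : Mat n} (hP : P * Pᵀ = 1) (hM : M * Mᵀ = 1) (S : ℝ) :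
    potential ((1 - S) • M + S • P) ≤ 1 / 4 * (S * (1 - S)) ^ 2 * (‖P - M‖ ^ 2) ^ 2 := by
  -- Because `P Pᵀ = M Mᵀ = 1`, the deviation from orthogonality is exactly `-S(1 - S)` times the
  -- Gram matrix of the difference.
  have e : ((1 - S) • M + S • P) * ((1 - S) • M + S • P)ᵀ - 1
      = -((S * (1 - S)) • ((P - M) * (P - M)ᵀ)) := by
    simp only [transpose_add, transpose_smul, transpose_sub, Matrix.add_mul, Matrix.mul_add,
      Matrix.sub_mul, Matrix.mul_sub, Matrix.smul_mul, Matrix.mul_smul, hP, hM]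
    module
  unfold potential
  rw [e, norm_neg, norm_smul, mul_pow, Real.norm_eq_abs, sq_abs]
  have h1 : ‖(P - M) * (P - M)ᵀ‖ ≤ ‖P - M‖ ^ 2 := by
    refine (norm_mul_le _ _).trans (le_of_eq ?_)
    rw [frobenius_norm_transpose, sq]
  rw [mul_assoc]
  gcongr

end MatrixAlgebra

/-! ### The quasi-distance function and its Lipschitz constants. -/

section QuasiDist

variable {n : ℕ}

/-- The primitive of the quasi-potential profile on `[0, 1]`. -/
noncomputable def quasiPrimitive (r : ℝ) : ℝ := (r ^ 2 - r ^ 3 / 3) / Real.sqrt 2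

theorem sqrt_quasiProfile {r : ℝ} (h0 : 0 ≤ r) (h1 : r ≤ 1) :
    Real.sqrt (2 * quasiProfile r) = r * (2 - r) / Real.sqrt 2 := by
  have hs : Real.sqrt 2 ≠ 0 := by positivity
  have e2 : Real.sqrt 2 ^ 2 = 2 := Real.sq_sqrt (by norm_num)
  rw [quasiProfile, if_pos h1, show 2 * (1 / 4 * r ^ 2 * (2 - r) ^ 2)
    = (r * (2 - r) / Real.sqrt 2) ^ 2 by rw [div_pow, e2]; ring]
  exact Real.sqrt_sq (div_nonneg (mul_nonneg h0 (by linarith)) (Real.sqrt_nonneg 2))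

theorem hasDerivAt_quasiPrimitive (r : ℝ) :
    HasDerivAt quasiPrimitive (r * (2 - r) / Real.sqrt 2) r := by
  have := (((hasDerivAt_id r).pow 2).sub (((hasDerivAt_id r).pow 3).div_const 3)).div_const
    (Real.sqrt 2)
  refine this.congr_deriv ?_
  simp; ring

theorem integral_sqrt_quasiProfile {r : ℝ} (h0 : 0 ≤ r) (h1 : r ≤ 1) :
    ∫ ρ in (0 : ℝ)..r, Real.sqrt (2 * quasiProfile ρ) = quasiPrimitive r := by
  have e : ∫ ρ in (0 : ℝ)..r, Real.sqrt (2 * quasiProfile ρ)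
      = ∫ ρ in (0 : ℝ)..r, ρ * (2 - ρ) / Real.sqrt 2 := by
    refine intervalIntegral.integral_congr fun ρ hρ => ?_
    rw [uIcc_of_le h0] at hρ
    exact sqrt_quasiProfile hρ.1 (hρ.2.trans h1)
  rw [e, intervalIntegral.integral_eq_sub_of_hasDerivAt (fun x _ => hasDerivAt_quasiPrimitive x)
    (Continuous.intervalIntegrable (by fun_prop) _ _)]
  simp [quasiPrimitive]

theorem surfaceTension_eq : surfaceTension = 2 * quasiPrimitive 1 := by
  rw [surfaceTension, integral_sqrt_quasiProfile zero_le_one le_rfl]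

/-- The primitive is Lipschitz on `[0, a]`, with a small constant if `a` is small. -/
theorem abs_quasiPrimitive_sub_le {a r t : ℝ} (ha : a ≤ 1) (hr : r ∈ Icc 0 a) (ht : t ∈ Icc 0 a) :
    |quasiPrimitive r - quasiPrimitive t| ≤ 2 * a * |r - t| := by
  have hs : 1 ≤ Real.sqrt 2 := Real.one_le_sqrt.2 (by norm_num)
  have key : ∀ {r t : ℝ}, t ∈ Icc 0 a → r ∈ Icc 0 a → t ≤ r →
      |quasiPrimitive r - quasiPrimitive t| ≤ 2 * a * |r - t| := by
    intro r t ht hr h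
    have e : quasiPrimitive r - quasiPrimitive t
        = ((r - t) * (r + t - (r ^ 2 + r * t + t ^ 2) / 3)) / Real.sqrt 2 := by
      unfold quasiPrimitive; ring
    have h1 : 0 ≤ r + t - (r ^ 2 + r * t + t ^ 2) / 3 := by nlinarith [hr.1, hr.2, ht.1, ht.2]
    have h2 : r + t - (r ^ 2 + r * t + t ^ 2) / 3 ≤ 2 * a := by
      nlinarith [hr.1, hr.2, ht.1, ht.2, mul_nonneg hr.1 ht.1]
    rw [e, abs_div, abs_of_pos (by linarith : 0 < Real.sqrt 2), abs_mul, abs_of_nonneg h1,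
      div_le_iff₀ (by linarith)]
    have h3 := abs_nonneg (r - t)
    have h4 : 0 ≤ a := hr.1.trans hr.2
    calc |r - t| * (r + t - (r ^ 2 + r * t + t ^ 2) / 3) ≤ |r - t| * (2 * a) := by gcongr
      _ = 2 * a * |r - t| * 1 := by ring
      _ ≤ 2 * a * |r - t| * Real.sqrt 2 := by gcongr
  rcases le_total t r with h | h
  · exact key ht hr h
  · rw [abs_sub_comm, abs_sub_comm r]; exact key hr ht h

theorem exists_orthMinus (hn : 1 ≤ n) : (orthMinus n).Nonempty := by
  classical
  let v : Fin n → ℝ := Function.update 1 ⟨0, hn⟩ (-1)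
  have hv : ∀ i, v i * v i = 1 := fun i => by
    by_cases h : i = ⟨0, hn⟩
    · subst h; simp [v]
    · simp [v, h]
  refine ⟨Matrix.diagonal v, ?_, ?_⟩
  · rw [Matrix.mem_orthogonalGroup_iff]
    change Matrix.diagonal v * (Matrix.diagonal v).transpose = 1
    rw [Matrix.diagonal_transpose,
      Matrix.diagonal_mul_diagonal]
    simp only [hv]
    exact Matrix.diagonal_one
  · rw [Matrix.det_diagonal, Finset.prod_update_of_mem (Finset.mem_univ _)]
    simp

theorem exists_orthPlus : (orthPlus n).Nonempty :=
  ⟨1, one_mem _, Matrix.det_one⟩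

/-- The two components of the orthogonal group are at distance at least 2, so at most one of the
distances can lie below 1. -/
theorem two_le_rho_add (hn : 1 ≤ n) (A : Mat n) : 2 ≤ rhoPlus A + rhoMinus A := by
  refine le_of_forall_pos_lt_add fun e he => ?_
  obtain ⟨P, hP, h1⟩ := (Metric.infDist_lt_iff (x := A) exists_orthPlus).1
    (show Metric.infDist A (orthPlus n) < rhoPlus A + e / 2 by unfold rhoPlus; linarith)
  obtain ⟨M, hM, h2⟩ := (Metric.infDist_lt_iff (x := A) (exists_orthMinus hn)).1
    (show Metric.infDist A (orthMinus n) < rhoMinus A + e / 2 by unfold rhoMinus; linarith)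
  have h3 := four_le_norm_sub_sq hP hM
  have h4 : 2 ≤ ‖P - M‖ := by nlinarith [norm_nonneg (P - M)]
  rw [← dist_eq_norm] at h4
  have h5 := dist_triangle_left P M A
  linarith

/-- The truncated primitive. -/
noncomputable def quasiTrunc (r : ℝ) : ℝ := quasiPrimitive (min r 1)

/-- Since the distances add up to at least 2, one of the truncated terms is always saturated. The
three cases merge into one formula, from which Lipschitz bounds are immediate. -/
theorem quasiDist_eq (hn : 1 ≤ n) (A : Mat n) :
    quasiDist A = quasiTrunc (rhoMinus A) + quasiPrimitive 1 - quasiTrunc (rhoPlus A) := by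
  have hp : 0 ≤ rhoPlus A := Metric.infDist_nonneg
  have hm : 0 ≤ rhoMinus A := Metric.infDist_nonneg
  have h2 := two_le_rho_add hn A
  unfold quasiDist quasiTrunc
  split_ifs with h h'
  · rw [integral_sqrt_quasiProfile hm h, min_eq_left h, min_eq_right (by linarith)]; ring
  · rw [integral_sqrt_quasiProfile hp h', min_eq_left h', min_eq_right (by linarith),
      surfaceTension_eq]; ring
  · rw [min_eq_right (by linarith), min_eq_right (by linarith), surfaceTension_eq]; ring

theorem abs_quasiTrunc_sub_le {r t : ℝ} (hr : 0 ≤ r) (ht : 0 ≤ t) :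
    |quasiTrunc r - quasiTrunc t| ≤ 2 * |r - t| := by
  have := abs_quasiPrimitive_sub_le le_rfl (r := min r 1) (t := min t 1)
    ⟨le_min hr zero_le_one, min_le_right _ _⟩ ⟨le_min ht zero_le_one, min_le_right _ _⟩
  refine this.trans ?_
  have h1 : |min r 1 - min t 1| ≤ |r - t| := by
    have := abs_min_sub_min_le_max r 1 t 1
    simpa using this
  linarith

theorem abs_quasiTrunc_sub_le_of_le {a r t : ℝ} (ha : a ≤ 1) (hr : r ∈ Icc 0 a)
    (ht : t ∈ Icc 0 a) : |quasiTrunc r - quasiTrunc t| ≤ 2 * a * |r - t| := by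
  unfold quasiTrunc
  rw [min_eq_left (hr.2.trans ha), min_eq_left (ht.2.trans ha)]
  exact abs_quasiPrimitive_sub_le ha hr ht

theorem quasiTrunc_of_one_le {r : ℝ} (h : 1 ≤ r) : quasiTrunc r = quasiPrimitive 1 := by
  rw [quasiTrunc, min_eq_right h]

theorem abs_rhoPlus_sub_le (A B : Mat n) : |rhoPlus A - rhoPlus B| ≤ ‖A - B‖ := by
  rw [← dist_eq_norm, ← Real.dist_eq]
  exact (Metric.lipschitz_infDist_pt (orthPlus n)).dist_le_mul A B |>.trans (by simp)

theorem abs_rhoMinus_sub_le (A B : Mat n) : |rhoMinus A - rhoMinus B| ≤ ‖A - B‖ := by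
  rw [← dist_eq_norm, ← Real.dist_eq]
  exact (Metric.lipschitz_infDist_pt (orthMinus n)).dist_le_mul A B |>.trans (by simp)

theorem abs_quasiDist_sub_le (hn : 1 ≤ n) (A B : Mat n) :
    |quasiDist A - quasiDist B| ≤ 4 * ‖A - B‖ := by
  have hp : ∀ A : Mat n, 0 ≤ rhoPlus A := fun A => Metric.infDist_nonneg
  have hm : ∀ A : Mat n, 0 ≤ rhoMinus A := fun A => Metric.infDist_nonneg
  rw [quasiDist_eq hn, quasiDist_eq hn]
  have h1 := abs_quasiTrunc_sub_le (hp A) (hp B)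
  have h2 := abs_quasiTrunc_sub_le (hm A) (hm B)
  have h3 := abs_rhoPlus_sub_le A B
  have h4 := abs_rhoMinus_sub_le A B
  rw [abs_le] at h1 h2 ⊢
  constructor <;> linarith

/-- Near an orthogonal matrix the quasi-distance has a small Lipschitz constant. -/
theorem abs_quasiDist_sub_le_of_near (hn : 1 ≤ n) {M A B : Mat n}
    (hM : M ∈ orthPlus n ∨ M ∈ orthMinus n) {a : ℝ} (ha : a ≤ 1) (hA : ‖A - M‖ ≤ a)
    (hB : ‖B - M‖ ≤ a) : |quasiDist A - quasiDist B| ≤ 2 * a * ‖A - B‖ := by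
  have h2A := two_le_rho_add hn A
  have h2B := two_le_rho_add hn B
  have ha0 : 0 ≤ a := (norm_nonneg _).trans hA
  rw [← dist_eq_norm] at hA hB
  rcases hM with hM | hM
  · have hpos : ∀ A : Mat n, 0 ≤ rhoPlus A := fun A => Metric.infDist_nonneg
    have h1 : rhoPlus A ≤ a := (Metric.infDist_le_dist_of_mem hM).trans hA
    have h2 : rhoPlus B ≤ a := (Metric.infDist_le_dist_of_mem hM).trans hB
    rw [quasiDist_eq hn, quasiDist_eq hn, quasiTrunc_of_one_le (r := rhoMinus A) (by linarith),
      quasiTrunc_of_one_le (r := rhoMinus B) (by linarith)]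
    have h3 := abs_quasiTrunc_sub_le_of_le ha ⟨hpos A, h1⟩ ⟨hpos B, h2⟩
    have h4 := mul_le_mul_of_nonneg_left (abs_rhoPlus_sub_le A B) (by positivity : 0 ≤ 2 * a)
    have h5 := h3.trans h4
    rw [abs_le] at h5 ⊢
    constructor <;> linarith
  · have hpos : ∀ A : Mat n, 0 ≤ rhoMinus A := fun A => Metric.infDist_nonneg
    have h1 : rhoMinus A ≤ a := (Metric.infDist_le_dist_of_mem hM).trans hA
    have h2 : rhoMinus B ≤ a := (Metric.infDist_le_dist_of_mem hM).trans hB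
    rw [quasiDist_eq hn, quasiDist_eq hn, quasiTrunc_of_one_le (r := rhoPlus A) (by linarith),
      quasiTrunc_of_one_le (r := rhoPlus B) (by linarith)]
    have h3 := abs_quasiTrunc_sub_le_of_le ha ⟨hpos A, h1⟩ ⟨hpos B, h2⟩
    have h4 := mul_le_mul_of_nonneg_left (abs_rhoMinus_sub_le A B) (by positivity : 0 ≤ 2 * a)
    have h5 := h3.trans h4
    rw [abs_le] at h5 ⊢
    constructor <;> linarith

theorem quasiDist_orthMinus (hn : 1 ≤ n) {M : Mat n} (hM : M ∈ orthMinus n) : quasiDist M = 0 := by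
  have h0 : rhoMinus M = 0 := Metric.infDist_zero_of_mem hM
  have h2 := two_le_rho_add hn M
  rw [quasiDist_eq hn, quasiTrunc_of_one_le (r := rhoPlus M) (by linarith), h0]
  simp [quasiTrunc, quasiPrimitive]

theorem quasiDist_orthPlus (hn : 1 ≤ n) {P : Mat n} (hP : P ∈ orthPlus n) :
    quasiDist P = 2 * quasiPrimitive 1 := by
  have h0 : rhoPlus P = 0 := Metric.infDist_zero_of_mem hP
  have h2 := two_le_rho_add hn P
  rw [quasiDist_eq hn, quasiTrunc_of_one_le (r := rhoMinus P) (by linarith), h0]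
  simp [quasiTrunc, quasiPrimitive]; ring

end QuasiDist

/-! ### The mollified quasi-distance. -/

section Mollified

variable {n : ℕ}

theorem contDiff_of {f : Mat n → ℝ} {m : ℕ∞} (hf : ContDiff ℝ m f) :
    ContDiff ℝ m fun B : Fin n → Fin n → ℝ => f (Matrix.of B) :=
  hf.comp ((Matrix.ofLinearEquiv ℝ).toContinuousLinearEquiv :
    (Fin n → Fin n → ℝ) ≃L[ℝ] Mat n).contDiff

theorem continuous_of {f : Mat n → ℝ} (hf : Continuous f) :
    Continuous fun B : Fin n → Fin n → ℝ => f (Matrix.of B) := hf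

theorem continuous_quasiDist (hn : 1 ≤ n) : Continuous (quasiDist : Mat n → ℝ) := by
  refine (LipschitzWith.of_dist_le_mul (K := 4) fun A B => ?_).continuous
  rw [Real.dist_eq, dist_eq_norm]
  exact abs_quasiDist_sub_le hn A B

variable {φ : Mat n → ℝ} {ε : ℝ}

theorem contDiff_rescaledKernel (hφ : IsMollifier φ) : ContDiff ℝ ∞ (rescaledKernel φ ε) :=
  contDiff_const.mul (hφ.smooth.comp (contDiff_const_smul _))

theorem rescaledKernel_nonneg (hφ : IsMollifier φ) (hε : 0 < ε) (A : Mat n) :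
    0 ≤ rescaledKernel φ ε A :=
  mul_nonneg (by positivity) (hφ.nonneg _)

theorem rescaledKernel_eq_zero (hφ : IsMollifier φ) (hε : 0 < ε) {A : Mat n} (hA : ε ^ 5 ≤ ‖A‖) :
    rescaledKernel φ ε A = 0 := by
  rw [rescaledKernel, image_eq_zero_of_notMem_tsupport (f := φ), mul_zero]
  intro h
  have := hφ.support h
  rw [mem_ball_zero_iff, norm_smul, norm_inv, Real.norm_of_nonneg (by positivity),
    inv_mul_lt_iff₀ (by positivity), mul_one] at this
  linarith

theorem integral_rescaledKernel (hφ : IsMollifier φ) (hε : 0 < ε) :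
    ∫ B : Fin n → Fin n → ℝ, rescaledKernel φ ε (Matrix.of B) = 1 := by
  have h1 := Measure.integral_comp_smul (volume : Measure (Fin n → Fin n → ℝ))
    (fun B => φ (Matrix.of B)) (ε ^ 5)⁻¹
  rw [hφ.mass] at h1
  have h2 : Module.finrank ℝ (Fin n → Fin n → ℝ) = n ^ 2 := by
    simp [Module.finrank_pi_fintype, sq]
  have h3 : ∀ B : Fin n → Fin n → ℝ, rescaledKernel φ ε (Matrix.of B)
      = (ε ^ (5 * n ^ 2))⁻¹ * φ (Matrix.of ((ε ^ 5)⁻¹ • B)) := fun B => rfl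
  simp only [h3]
  rw [integral_const_mul, h1, h2, inv_pow, inv_inv, ← pow_mul, abs_of_pos (by positivity),
    smul_eq_mul, mul_one, inv_mul_cancel₀ (by positivity)]

theorem hasCompactSupport_rescaledKernel (hφ : IsMollifier φ) (hε : 0 < ε) :
    HasCompactSupport fun B : Fin n → Fin n → ℝ => rescaledKernel φ ε (Matrix.of B) := by
  let e : (Fin n → Fin n → ℝ) ≃L[ℝ] Mat n := (Matrix.ofLinearEquiv ℝ).toContinuousLinearEquiv
  have h : HasCompactSupport (rescaledKernel φ ε) := by
    refine HasCompactSupport.intro (isCompact_closedBall (0 : Mat n) (ε ^ 5)) fun A hA => ?_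
    refine rescaledKernel_eq_zero hφ hε ?_
    rw [mem_closedBall_zero_iff, not_le] at hA
    exact hA.le
  exact h.comp_homeomorph e.toHomeomorph

theorem mollifiedQuasiDist_eq (A : Mat n) : mollifiedQuasiDist φ ε A
    = ∫ B : Fin n → Fin n → ℝ, rescaledKernel φ ε (Matrix.of B) * quasiDist (A - Matrix.of B) := by
  have := integral_sub_left_eq_self (fun B : Fin n → Fin n → ℝ =>
    rescaledKernel φ ε (Matrix.of B) * quasiDist (A - Matrix.of B)) volume (Matrix.of.symm A)
  rw [← this]
  refine integral_congr_ae (Eventually.of_forall fun B => ?_)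
  simp only
  have e : A - (Matrix.of (Matrix.of.symm A - B) : Mat n) = Matrix.of B := sub_sub_cancel A _
  rw [e]
  rfl

theorem integrable_mollified (hn : 1 ≤ n) (hφ : IsMollifier φ) (hε : 0 < ε) (A : Mat n) :
    Integrable fun B : Fin n → Fin n → ℝ =>
      rescaledKernel φ ε (Matrix.of B) * quasiDist (A - Matrix.of B) := by
  refine Continuous.integrable_of_hasCompactSupport ?_
    (hasCompactSupport_rescaledKernel hφ hε).mul_right
  exact (continuous_of (contDiff_rescaledKernel hφ).continuous).mul
    (continuous_of ((continuous_quasiDist hn).comp (continuous_const.sub continuous_id)))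

theorem integrable_rescaledKernel (hφ : IsMollifier φ) (hε : 0 < ε) :
    Integrable fun B : Fin n → Fin n → ℝ => rescaledKernel φ ε (Matrix.of B) :=
  (continuous_of (contDiff_rescaledKernel hφ).continuous).integrable_of_hasCompactSupport
    (hasCompactSupport_rescaledKernel hφ hε)

/-- Averages of the quasi-distance inherit bounds from the ball of radius `ε⁵`. -/
theorem abs_integral_rescaledKernel_le (hφ : IsMollifier φ) (hε : 0 < ε)
    {g : Mat n → ℝ} {K : ℝ} (hK : ∀ B, ‖B‖ < ε ^ 5 → |g B| ≤ K) :
    |∫ B : Fin n → Fin n → ℝ, rescaledKernel φ ε (Matrix.of B) * g (Matrix.of B)| ≤ K := by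
  rw [← Real.norm_eq_abs]
  refine (norm_integral_le_of_norm_le ((integrable_rescaledKernel hφ hε).mul_const K)
    (Eventually.of_forall fun B => ?_)).trans (le_of_eq ?_)
  · rw [norm_mul, Real.norm_of_nonneg (rescaledKernel_nonneg hφ hε _)]
    by_cases h : ‖(Matrix.of B : Mat n)‖ < ε ^ 5
    · exact mul_le_mul_of_nonneg_left (hK _ h) (rescaledKernel_nonneg hφ hε _)
    · rw [rescaledKernel_eq_zero hφ hε (not_lt.1 h)]; simp
  · rw [integral_mul_const, integral_rescaledKernel hφ hε, one_mul]

theorem abs_mollified_sub_quasiDist_le (hn : 1 ≤ n) (hφ : IsMollifier φ) (hε : 0 < ε) (A : Mat n) :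
    |mollifiedQuasiDist φ ε A - quasiDist A| ≤ 4 * ε ^ 5 := by
  have e : mollifiedQuasiDist φ ε A - quasiDist A = ∫ B : Fin n → Fin n → ℝ,
      rescaledKernel φ ε (Matrix.of B) * (quasiDist (A - Matrix.of B) - quasiDist A) := by
    simp only [mul_sub]
    rw [integral_sub (integrable_mollified hn hφ hε A)
      ((integrable_rescaledKernel hφ hε).mul_const _), integral_mul_const,
      integral_rescaledKernel hφ hε, one_mul, mollifiedQuasiDist_eq]
  rw [e]
  refine abs_integral_rescaledKernel_le (g := fun B => quasiDist (A - B) - quasiDist A) hφ hε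
    fun B hB => ?_
  refine (abs_quasiDist_sub_le hn _ _).trans ?_
  rw [sub_sub_cancel_left, norm_neg]
  linarith

/-- The kernel is a probability density supported in a ball of radius `ε⁵`, so a Lipschitz bound
valid for all shifts of that size survives averaging. -/
theorem abs_mollified_sub_le (hn : 1 ≤ n) (hφ : IsMollifier φ) (hε : 0 < ε) {A A' : Mat n} {L : ℝ}
    (hL : ∀ B : Mat n, ‖B‖ < ε ^ 5 → |quasiDist (A - B) - quasiDist (A' - B)| ≤ L * ‖A - A'‖) :
    |mollifiedQuasiDist φ ε A - mollifiedQuasiDist φ ε A'| ≤ L * ‖A - A'‖ := by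
  have e : mollifiedQuasiDist φ ε A - mollifiedQuasiDist φ ε A' = ∫ B : Fin n → Fin n → ℝ,
      rescaledKernel φ ε (Matrix.of B) *
        (quasiDist (A - Matrix.of B) - quasiDist (A' - Matrix.of B)) := by
    simp only [mul_sub]
    rw [integral_sub (integrable_mollified hn hφ hε A) (integrable_mollified hn hφ hε A'),
      mollifiedQuasiDist_eq, mollifiedQuasiDist_eq]
  rw [e]
  exact abs_integral_rescaledKernel_le (g := fun B => quasiDist (A - B) - quasiDist (A' - B)) hφ hε hL

theorem contDiff_mollified (hn : 1 ≤ n) (hφ : IsMollifier φ) (hε : 0 < ε) :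
    ContDiff ℝ 1 (mollifiedQuasiDist φ ε) := by
  have hc : ContDiff ℝ ((1 : ℕ∞) : WithTop ℕ∞) (convolution
      (fun B : Fin n → Fin n → ℝ => rescaledKernel φ ε (Matrix.of B))
      (fun B : Fin n → Fin n → ℝ => (quasiDist (Matrix.of B) : ℝ))
      (ContinuousLinearMap.mul ℝ ℝ) volume) :=
    (hasCompactSupport_rescaledKernel hφ hε).contDiff_convolution_left _
      (contDiff_of ((contDiff_rescaledKernel hφ).of_le (by simp)))
      (continuous_of (continuous_quasiDist hn)).locallyIntegrable
  have e : mollifiedQuasiDist φ ε = (convolution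
      (fun B : Fin n → Fin n → ℝ => rescaledKernel φ ε (Matrix.of B))
      (fun B : Fin n → Fin n → ℝ => (quasiDist (Matrix.of B) : ℝ))
      (ContinuousLinearMap.mul ℝ ℝ) volume) ∘
      ((Matrix.ofLinearEquiv ℝ).symm.toContinuousLinearEquiv : Mat n ≃L[ℝ] Fin n → Fin n → ℝ) := by
    funext A
    rw [mollifiedQuasiDist_eq]
    rfl
  rw [e]
  exact hc.comp (ContinuousLinearEquiv.contDiff _)

theorem abs_fderiv_apply_le_of_lip {E : Type*} [NormedAddCommGroup E] [NormedSpace ℝ E]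
    {f : E → ℝ} {x : E} {C : ℝ} (hC : 0 ≤ C) (h : ∀ᶠ y in 𝓝 x, |f y - f x| ≤ C * ‖y - x‖) (v : E) :
    |fderiv ℝ f x v| ≤ C * ‖v‖ := by
  have h1 : ‖fderiv ℝ f x‖ ≤ C := norm_fderiv_le_of_lip' ℝ hC h
  exact (ContinuousLinearMap.le_opNorm (fderiv ℝ f x) v).trans
    (mul_le_mul_of_nonneg_right h1 (norm_nonneg v))

theorem abs_fderiv_mollified_le (hn : 1 ≤ n) (hφ : IsMollifier φ) (hε : 0 < ε) (A V : Mat n) :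
    |fderiv ℝ (mollifiedQuasiDist φ ε) A V| ≤ 4 * ‖V‖ := by
  refine abs_fderiv_apply_le_of_lip (by norm_num) (Eventually.of_forall fun B => ?_) V
  refine abs_mollified_sub_le hn hφ hε fun C _ => (abs_quasiDist_sub_le hn _ _).trans ?_
  rw [sub_sub_sub_cancel_right]

/-- The mollified quasi-distance is nearly critical on the orthogonal matrices. -/
theorem abs_fderiv_mollified_orth_le (hn : 1 ≤ n) (hφ : IsMollifier φ) (hε : 0 < ε) {M : Mat n}
    (hM : M ∈ orthPlus n ∨ M ∈ orthMinus n) (V : Mat n) :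
    |fderiv ℝ (mollifiedQuasiDist φ ε) M V| ≤ 8 * ε ^ 5 * ‖V‖ := by
  have h5 : 0 < ε ^ 5 := by positivity
  -- All shifted points stay within `2ε⁵` of `M`, where the quasi-distance has Lipschitz constant
  -- `4ε⁵`; this needs `2ε⁵ ≤ 1`. Otherwise the global constant 4 is already below `8ε⁵`.
  rcases le_total (2 * ε ^ 5) 1 with h | h
  · refine abs_fderiv_apply_le_of_lip (by positivity) ?_ V
    filter_upwards [Metric.ball_mem_nhds M h5] with A hA
    rw [Metric.mem_ball, dist_eq_norm] at hA
    refine (abs_mollified_sub_le (L := 2 * (2 * ε ^ 5)) hn hφ hε fun B hB => ?_).trans ?_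
    · refine (abs_quasiDist_sub_le_of_near hn hM h ?_ ?_).trans ?_
      · calc ‖A - B - M‖ = ‖(A - M) - B‖ := by congr 1; abel
          _ ≤ ‖A - M‖ + ‖B‖ := norm_sub_le _ _
          _ ≤ 2 * ε ^ 5 := by linarith
      · rw [sub_sub_cancel_left, norm_neg]; linarith
      · rw [sub_sub_sub_cancel_right]
    · have := norm_nonneg (A - M)
      nlinarith
  · refine (abs_fderiv_mollified_le hn hφ hε M V).trans ?_
    have := norm_nonneg V
    nlinarith

end Mollified

/-! ### Derivatives of quadratic matrix functions. -/

section Calculus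

open Matrix in
theorem contDiff_transpose_mul_self {n : ℕ} : ContDiff ℝ 1 fun A : Mat n => Aᵀ * A := by
  have h1 : ContDiff ℝ 1 fun A : Mat n => Aᵀ :=
    ((Matrix.transposeLinearEquiv (Fin n) (Fin n) ℝ ℝ : Mat n ≃ₗ[ℝ] Mat n)  : Mat n →ₗ[ℝ] Mat n).toContinuousLinearMap.contDiff
  exact h1.mul contDiff_id

theorem fderiv_apply_of_line {E F : Type*} [NormedAddCommGroup E] [NormedSpace ℝ E]
    [NormedAddCommGroup F] [NormedSpace ℝ F] {f : E → F} {x v : E} {c : F}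
    (hf : DifferentiableAt ℝ f x) (h : HasDerivAt (fun t : ℝ => f (x + t • v)) c 0) :
    fderiv ℝ f x v = c := by
  rw [← hf.lineDeriv_eq_fderiv]
  exact h.deriv

theorem hasDerivAt_quadratic {F : Type*} [NormedAddCommGroup F] [NormedSpace ℝ F] (a b c : F) :
    HasDerivAt (fun t : ℝ => a + t • b + t ^ 2 • c) b 0 := by
  have h1 := ((hasDerivAt_id (0 : ℝ)).smul_const b).const_add a
  have h2 := ((hasDerivAt_id (0 : ℝ)).pow 2).smul_const c
  exact (h1.add h2).congr_deriv (by simp)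

open Matrix in
theorem fderiv_transpose_mul_self {n : ℕ} (B G : Mat n) :
    fderiv ℝ (fun A : Mat n => Aᵀ * A) B G = Gᵀ * B + Bᵀ * G := by
  refine fderiv_apply_of_line (contDiff_transpose_mul_self.differentiable (by simp) B) ?_
  convert hasDerivAt_quadratic (Bᵀ * B) (Gᵀ * B + Bᵀ * G) (Gᵀ * G) using 2 with t
  simp only [transpose_add, transpose_smul, Matrix.add_mul, Matrix.mul_add, Matrix.smul_mul, Matrix.mul_smul]
  module

theorem contDiff_entry {n : ℕ} (i j : Fin n) : ContDiff ℝ 1 fun A : Mat n => A i j :=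
  (Matrix.entryLinearMap ℝ ℝ i j).toContinuousLinearMap.contDiff

theorem contDiff_norm_sub_sq {n : ℕ} : ContDiff ℝ 1 fun p : Mat n × Mat n => ‖p.1 - p.2‖ ^ 2 - 4 := by
  have e : (fun p : Mat n × Mat n => ‖p.1 - p.2‖ ^ 2 - 4)
      = fun p => (∑ i, ∑ j, (p.1 j i - p.2 j i) ^ 2) - 4 := by
    funext p
    rw [frobenius_norm_sq]
    simp [Matrix.trace, Matrix.mul_apply, sq]
  rw [e]
  refine ContDiff.sub (ContDiff.sum fun i _ => ContDiff.sum fun j _ => ?_) contDiff_const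
  exact (((contDiff_entry j i).comp contDiff_fst).sub ((contDiff_entry j i).comp contDiff_snd)).pow 2

open Matrix in
theorem fderiv_norm_sub_sq {n : ℕ} (P M G H : Mat n) :
    fderiv ℝ (fun p : Mat n × Mat n => ‖p.1 - p.2‖ ^ 2 - 4) (P, M) (G, H)
      = 2 * trace ((P - M)ᵀ * (G - H)) := by
  refine fderiv_apply_of_line (contDiff_norm_sub_sq.differentiable (by simp) _) ?_
  convert hasDerivAt_quadratic (‖P - M‖ ^ 2 - 4) (2 * trace ((P - M)ᵀ * (G - H))) (‖G - H‖ ^ 2) using 2 with t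
  have : P + t • G - (M + t • H) = (P - M) + t • (G - H) := by module
  simp only [Prod.smul_mk, Prod.mk_add_mk, this]
  rw [norm_add_sq_matrix, Matrix.mul_smul, trace_smul, norm_smul, mul_pow, Real.norm_eq_abs, sq_abs]
  simp only [smul_eq_mul]; ring

end Calculus

/-! ### Gradient and trace of the gap of a pair. -/

section Pair

variable {d n : ℕ} {Ω Ωp Ωm Γ : Set (Euc d)} {δΓ : ℝ}

open Matrix in
/-- Weak derivatives of an orthogonal-valued map are tangent to the orthogonal group. -/
theorem HasWeakGrad.tangent {U : Set (Euc d)} (hU : IsOpen U) {B : Euc d → Mat n}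
    {G : Fin d → Euc d → Mat n} (h : HasWeakGrad U B G)
    (hB : ∀ᵐ x ∂(volume.restrict U), (B x)ᵀ * B x = 1) (i : Fin d) :
    ∀ᵐ x ∂(volume.restrict U), (G i x)ᵀ * B x + (B x)ᵀ * G i x = 0 := by
  have h1 := h.comp_contDiff hU (hB.mono fun x hx => norm_orth_le hx) contDiff_transpose_mul_self
  have h2 : HasWeakGrad U (fun _ => (1 : Mat n)) (fun _ _ => (0 : Mat n)) := by
    have := hasWeakGrad_of_contDiffOn hU (contDiffOn_const (c := (1 : Mat n)))
    simpa using this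
  -- The product `Bᵀ B` is constant, so its weak gradient is zero; uniqueness compares it with the
  -- chain rule.
  have h3 : HasWeakGrad U (fun x => (B x)ᵀ * B x) (fun _ _ => (0 : Mat n)) :=
    h2.congr (hB.mono fun x hx => hx.symm) fun i => ae_eq_rfl
  filter_upwards [h1.unique hU h3 i] with x hx
  rw [← fderiv_transpose_mul_self]
  exact hx

/-- The gap `‖P - M‖² - 4` of a pair of matrices, which vanishes for minimal pairs. -/
noncomputable def gap (Bp Bm : Euc d → Mat n) (x : Euc d) : ℝ := ‖Bp x - Bm x‖ ^ 2 - 4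

/-- The size of the gradients of a pair of maps. -/
noncomputable def slope (Gp Gm : Fin d → Euc d → Mat n) (x : Euc d) : ℝ :=
  ∑ i, (‖Gp i x‖ + ‖Gm i x‖)

/-- A pair of `H¹` maps on a tube, with values in the two components of the orthogonal group,
whose gap has zero trace on `Γ`. -/
structure PairSetting (Γ : Set (Euc d)) (δ : ℝ) (Bp Bm : Euc d → Mat n)
    (Gp Gm : Fin d → Euc d → Mat n) : Prop where
  grad_plus : HasWeakGrad (nbhd Γ δ) Bp Gp
  grad_minus : HasWeakGrad (nbhd Γ δ) Bm Gm
  memLp_plus : ∀ i, MemLp (Gp i) 2 (volume.restrict (nbhd Γ δ))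
  memLp_minus : ∀ i, MemLp (Gm i) 2 (volume.restrict (nbhd Γ δ))
  orth_plus : ∀ᵐ x ∂(volume.restrict (nbhd Γ δ)), Bp x ∈ orthPlus n
  orth_minus : ∀ᵐ x ∂(volume.restrict (nbhd Γ δ)), Bm x ∈ orthMinus n
  gap_trace : ∀ᵐ x ∂((Measure.hausdorffMeasure ((d : ℝ) - 1) : Measure (Euc d)).restrict Γ),
    Tendsto (fun r : ℝ => ⨍ y in Metric.ball x r, gap Bp Bm y) (𝓝[>] 0) (𝓝 0)

variable {δ : ℝ} {Bp Bm : Euc d → Mat n} {Gp Gm : Fin d → Euc d → Mat n}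

/-- Orthogonal matrices have norm `√n`, so the squared distance is at most `4n`. -/
theorem PairSetting.gap_mem (hB : PairSetting Γ δ Bp Bm Gp Gm) :
    ∀ᵐ x ∂(volume.restrict (nbhd Γ δ)), 0 ≤ gap Bp Bm x ∧ gap Bp Bm x ≤ 4 * n := by
  filter_upwards [hB.orth_plus, hB.orth_minus] with x hp hm
  refine ⟨sub_nonneg.2 (four_le_norm_sub_sq hp hm), ?_⟩
  have h1 := norm_orth_sq (orthPlus_subset hp).2
  have h2 := norm_orth_sq (orthMinus_subset hm).2
  have h3 := norm_sub_le (Bp x) (Bm x)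
  unfold gap
  nlinarith [norm_nonneg (Bp x), norm_nonneg (Bm x), norm_nonneg (Bp x - Bm x),
    sq_nonneg (‖Bp x‖ - ‖Bm x‖)]

theorem PairSetting.norm_le (hB : PairSetting Γ δ Bp Bm Gp Gm) :
    ∀ᵐ x ∂(volume.restrict (nbhd Γ δ)), ‖(Bp x, Bm x)‖ ≤ Real.sqrt n := by
  filter_upwards [hB.orth_plus, hB.orth_minus] with x hp hm
  exact max_le (norm_orth_le (orthPlus_subset hp).2) (norm_orth_le (orthMinus_subset hm).2)

open Matrix in
theorem PairSetting.tangent (hB : PairSetting Γ δ Bp Bm Gp Gm) :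
    ∀ᵐ x ∂(volume.restrict (nbhd Γ δ)), ∀ i, (Gp i x)ᵀ * Bp x + (Bp x)ᵀ * Gp i x = 0 ∧
      (Gm i x)ᵀ * Bm x + (Bm x)ᵀ * Gm i x = 0 := by
  rw [ae_all_iff]
  intro i
  exact (hB.grad_plus.tangent (isOpen_nbhd Γ δ)
    (hB.orth_plus.mono fun x hx => (orthPlus_subset hx).2) i).and
    (hB.grad_minus.tangent (isOpen_nbhd Γ δ)
    (hB.orth_minus.mono fun x hx => (orthMinus_subset hx).2) i)

open Matrix in
/-- Products of tangent vectors with the difference of the pair are controlled by the gap. -/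
theorem PairSetting.abs_trace_le (hB : PairSetting Γ δ Bp Bm Gp Gm) :
    ∀ᵐ x ∂(volume.restrict (nbhd Γ δ)), ∀ i,
      |trace ((Gp i x)ᵀ * (Bp x - Bm x))| ≤ ‖Gp i x‖ * Real.sqrt (gap Bp Bm x) ∧
      |trace ((Gm i x)ᵀ * (Bp x - Bm x))| ≤ ‖Gm i x‖ * Real.sqrt (gap Bp Bm x) := by
  filter_upwards [hB.orth_plus, hB.orth_minus, hB.tangent] with x hp hm ht i
  constructor
  · rw [Matrix.mul_sub, trace_sub, trace_tangent_self (ht i).1, zero_sub, abs_neg]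
    exact abs_trace_tangent_plus_le hp hm (ht i).1
  · rw [Matrix.mul_sub, trace_sub, trace_tangent_self (ht i).2, sub_zero]
    exact abs_trace_tangent_minus_le hp hm (ht i).2

/-- By the chain rule the derivative is twice the product of `Gp - Gm` with the difference of the
pair, and tangency supplies the factor `√gap`. This factor is what allows the gradient term to be
absorbed later. -/
theorem PairSetting.exists_grad_gap (hB : PairSetting Γ δ Bp Bm Gp Gm) :
    ∃ G : Fin d → Euc d → ℝ, HasWeakGrad (nbhd Γ δ) (gap Bp Bm) G ∧
      ∀ᵐ x ∂(volume.restrict (nbhd Γ δ)), ∀ i,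
        |G i x| ≤ 2 * (‖Gp i x‖ + ‖Gm i x‖) * Real.sqrt (gap Bp Bm x) := by
  have h1 := (hB.grad_plus.prodMk hB.grad_minus).comp_contDiff (isOpen_nbhd Γ δ) hB.norm_le
    contDiff_norm_sub_sq
  refine ⟨_, h1, ?_⟩
  filter_upwards [hB.abs_trace_le] with x hx i
  refine (congrArg abs (fderiv_norm_sub_sq (Bp x) (Bm x) (Gp i x) (Gm i x))).trans_le ?_
  rw [trace_transpose_mul_comm, Matrix.transpose_sub, Matrix.sub_mul,
    Matrix.trace_sub]
  obtain ⟨h2, h3⟩ := hx i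
  rw [abs_le] at h2 h3 ⊢
  constructor <;> nlinarith

theorem PairSetting.memLp_slope (hB : PairSetting Γ δ Bp Bm Gp Gm) :
    MemLp (slope Gp Gm) 2 (volume.restrict (nbhd Γ δ)) :=
  memLp_finsetSum Finset.univ fun i _ => (hB.memLp_plus i).norm.add (hB.memLp_minus i).norm

theorem PairSetting.integrable_slope_sq (hB : PairSetting Γ δ Bp Bm Gp Gm) :
    IntegrableOn (fun x => slope Gp Gm x ^ 2) (nbhd Γ δ) :=
  hB.memLp_slope.integrable_sq

theorem PairSetting.aestronglyMeasurable_gap (hB : PairSetting Γ δ Bp Bm Gp Gm) :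
    AEStronglyMeasurable (gap Bp Bm) (volume.restrict (nbhd Γ δ)) :=
  ((hB.grad_plus.1.aestronglyMeasurable.sub hB.grad_minus.1.aestronglyMeasurable).norm.pow 2).sub
    aestronglyMeasurable_const

/-- The gap has small mean over thin layers. -/
theorem PairSetting.tendsto_layer_mean (hB : PairSetting Γ δ Bp Bm Gp Gm)
    (h : TubeSetting Ω Ωp Ωm Γ δΓ) (hd : 1 ≤ d) (hδ0 : 0 < δ) {r : ℕ → ℝ} (hr : ∀ k, 0 < r k)
    (hrδ : ∀ k, r k ≤ δ) (hr0 : Tendsto r atTop (𝓝 0)) :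
    Tendsto (fun k => (r k)⁻¹ * ∫ y in nbhd Γ (r k), gap Bp Bm y) atTop (𝓝 0) := by
  have hm := hB.aestronglyMeasurable_gap
  set T := nbhd Γ δ with hT
  have hTm : MeasurableSet T := (isOpen_nbhd Γ δ).measurableSet
  -- A globally bounded measurable function that agrees with the gap almost everywhere in the tube.
  set f : Euc d → ENNReal := fun x => min (ENNReal.ofReal (hm.mk _ x)) (ENNReal.ofReal (4 * n))
    with hf
  have hfm : Measurable f :=
    (ENNReal.measurable_ofReal.comp hm.stronglyMeasurable_mk.measurable).min measurable_const
  have hfe : ∀ s ⊆ T, MeasurableSet s →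
      ∫⁻ y in s, f y = ∫⁻ y in s, ENNReal.ofReal (gap Bp Bm y) := by
    intro s hs _
    refine lintegral_congr_ae (ae_restrict_of_ae_restrict_of_subset hs ?_)
    filter_upwards [hm.ae_eq_mk, hB.gap_mem] with x hx hx2
    simp only [hf, ← hx]
    exact min_eq_left (ENNReal.ofReal_le_ofReal hx2.2)
  have hint : ∀ s ⊆ T, volume s ≠ ⊤ → IntegrableOn (gap Bp Bm) s := fun s hs hfin =>
    Integrable.mono' (integrableOn_const (C := (4 * n : ℝ)) hfin)
      (hm.mono_measure (Measure.restrict_mono hs le_rfl))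
      (ae_restrict_of_ae_restrict_of_subset hs (hB.gap_mem.mono fun x hx => by
        rw [Real.norm_of_nonneg hx.1]; exact hx.2))
  have hnn : ∀ s ⊆ T, ∀ᵐ y ∂(volume.restrict s), 0 ≤ gap Bp Bm y := fun s hs =>
    ae_restrict_of_ae_restrict_of_subset hs (hB.gap_mem.mono fun x hx => hx.1)
  have key := h.tendsto_layer_mean hd hfm (B := ENNReal.ofReal (4 * n)) ENNReal.ofReal_ne_top
    (fun x => min_le_right _ _) (by
      filter_upwards [hB.gap_trace, ae_restrict_mem h.interface.isCompact.measurableSet] with x hx hxΓ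
      have h1 := ENNReal.tendsto_ofReal hx
      rw [ENNReal.ofReal_zero] at h1
      refine h1.congr' ?_
      filter_upwards [Ioo_mem_nhdsGT hδ0] with ρ hρ
      have hball : Metric.ball x ρ ⊆ T := fun y hy =>
        ((Metric.infDist_le_dist_of_mem hxΓ).trans_lt hy).trans hρ.2
      rw [hfe _ hball measurableSet_ball, ofReal_setAverage
        (hint _ hball measure_ball_lt_top.ne) (hnn _ hball)]) hr hr0
  have key2 := (ENNReal.tendsto_toReal ENNReal.zero_ne_top).comp key
  rw [ENNReal.toReal_zero] at key2
  refine key2.congr fun k => ?_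
  have hsub : nbhd Γ (r k) ⊆ T := nbhd_mono Γ (hrδ k)
  simp only [Function.comp_apply]
  rw [ENNReal.toReal_mul, ENNReal.toReal_inv, ENNReal.toReal_ofReal (hr k).le,
    hfe _ hsub (isOpen_nbhd Γ _).measurableSet, integral_eq_lintegral_of_nonneg_ae (hnn _ hsub)
    (hm.mono_measure (Measure.restrict_mono hsub le_rfl))]

end Pair

/-! ### The truncated layer profile as a multiplier of the normal field. -/

section LayerField

variable {d : ℕ} {Ω Ωp Ωm Γ : Set (Euc d)} {δΓ : ℝ}

/-- The profile minus its limits on both sides. -/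
noncomputable def defect (Ωp Γ : Set (Euc d)) (ε : ℝ) (x : Euc d) : ℝ :=
  profile (signedDist Ωp Γ x / ε) - Ωp.indicator (fun _ => 1) x

theorem TubeSetting.abs_defect_le (h : TubeSetting Ω Ωp Ωm Γ δΓ) {ε : ℝ} (hε : 0 < ε)
    {x : Euc d} (hx : x ∈ Ωp ∨ x ∈ Ωm) :
    |defect Ωp Γ ε x| ≤ 2 * weight (signedDist Ωp Γ x / ε) := by
  rcases hx with hx | hx
  · have h1 := h.signedDist_pos_iff.2 hx
    rw [defect, indicator_of_mem hx, abs_sub_comm, abs_of_pos (sub_pos.2 (profile_lt_one _))]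
    exact one_sub_profile_le_weight (div_pos h1 hε).le
  · have hxΩ : x ∈ Ω := by rw [← h.interface.union_eq]; exact Or.inr hx
    have h1 := (h.signedDist_neg_iff hxΩ).2 hx
    rw [defect, indicator_of_notMem (h.interface.disjoint_plus_minus.notMem_of_mem_right hx),
      sub_zero, abs_of_pos (profile_pos _)]
    exact profile_le_weight (div_nonpos_of_nonpos_of_nonneg h1.le hε.le)

/-- The truncated defect of the profile, which vanishes near `Γ`. -/
noncomputable def layerCutoff (Ωp Γ : Set (Euc d)) (ε r : ℝ) (x : Euc d) : ℝ :=
  radialCutoff (signedDist Ωp Γ x / r) * defect Ωp Γ ε x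

/-- Off `Γ` the indicator is locally constant, so derivatives of the defect are those of the
profile. -/
theorem TubeSetting.exists_defect_eq (h : TubeSetting Ω Ωp Ωm Γ δΓ) {x : Euc d}
    (hx : x ∈ nbhd Γ δΓ) (hxΓ : x ∉ Γ) : ∃ c : ℝ, ∀ᶠ y in 𝓝 x, ∀ ε,
      defect Ωp Γ ε y = profile (signedDist Ωp Γ y / ε) - c := by
  rcases h.mem_or (h.nbhd_subset hx) with h1 | h1 | h1
  · refine ⟨1, ?_⟩
    filter_upwards [h.interface.isOpen_plus.mem_nhds h1] with y hy ε
    rw [defect, indicator_of_mem hy]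
  · exact absurd h1 hxΓ
  · refine ⟨0, ?_⟩
    filter_upwards [h.interface.isOpen_minus.mem_nhds h1] with y hy ε
    rw [defect, indicator_of_notMem (h.interface.disjoint_plus_minus.notMem_of_mem_right hy)]

theorem TubeSetting.contDiffOn_layerCutoff (h : TubeSetting Ω Ωp Ωm Γ δΓ) {ε r : ℝ} (hr : 0 < r) :
    ContDiffOn ℝ ∞ (layerCutoff Ωp Γ ε r) (nbhd Γ δΓ) := by
  intro x hx
  refine ContDiffAt.contDiffWithinAt ?_
  have hd := h.contDiffOn_signedDist.contDiffAt ((isOpen_nbhd Γ δΓ).mem_nhds hx)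
  by_cases hxΓ : x ∈ Γ
  · refine (contDiffAt_const (c := (0 : ℝ))).congr_of_eventuallyEq ?_
    filter_upwards [radialCutoff_eventuallyEq_zero (Ωp := Ωp) hr hxΓ] with y hy
    simp only [layerCutoff]
    rw [hy]; simp
  · obtain ⟨c, hc⟩ := h.exists_defect_eq hx hxΓ
    refine ContDiffAt.congr_of_eventuallyEq (f := fun y =>
      radialCutoff (signedDist Ωp Γ y / r) * (profile (signedDist Ωp Γ y / ε) - c)) ?_ ?_
    · exact (AllenCahn.contDiff_radialCutoff.contDiffAt.comp x (hd.div_const r)).mul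
        ((contDiff_profile.contDiffAt.comp x (hd.div_const ε)).sub contDiffAt_const)
    · filter_upwards [hc] with y hy
      rw [layerCutoff, hy]

theorem TubeSetting.fderiv_signedDist_normal (h : TubeSetting Ω Ωp Ωm Γ δΓ) {x : Euc d}
    (hx : x ∈ nbhd Γ δΓ) : fderiv ℝ (signedDist Ωp Γ) x (gradient (signedDist Ωp Γ) x) = 1 := by
  rw [← inner_gradient_left, real_inner_self_eq_norm_sq, h.norm_normal hx, one_pow]

/-- The second term is the weight to be estimated; the first replaces the jump of the defect across
`Γ` and lives in the `r`-tube. -/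
theorem TubeSetting.fderiv_layerCutoff (h : TubeSetting Ω Ωp Ωm Γ δΓ) {ε r : ℝ}
    {x : Euc d} (hx : x ∈ nbhd Γ δΓ) (hxΓ : x ∉ Γ) :
    fderiv ℝ (layerCutoff Ωp Γ ε r) x (gradient (signedDist Ωp Γ) x) =
      deriv radialCutoff (signedDist Ωp Γ x / r) / r * defect Ωp Γ ε x +
      radialCutoff (signedDist Ωp Γ x / r) *
        (Real.sqrt 2 * weight (signedDist Ωp Γ x / ε) / ε) := by
  obtain ⟨c, hc⟩ := h.exists_defect_eq hx hxΓ
  have h1 := h.hasFDerivAt_comp_signedDist (ε := r) hx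
    (AllenCahn.contDiff_radialCutoff.differentiable (by simp) _).hasDerivAt
  have h2 := (h.hasFDerivAt_comp_signedDist (ε := ε) hx (hasDerivAt_profile _)).sub_const c
  have h3 := (h1.mul h2).congr_of_eventuallyEq (f₁ := layerCutoff Ωp Γ ε r) (by
    filter_upwards [hc] with y hy
    rw [layerCutoff, hy]
    rfl)
  rw [h3.fderiv, hc.self_of_nhds ε]
  simp only [_root_.add_apply, _root_.smul_apply, h.fderiv_signedDist_normal hx, smul_eq_mul,
    weight]
  ring

end LayerField

/-! ### Weighted estimate of the gap. -/

section Poincare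

variable {d n : ℕ} {Ω Ωp Ωm Γ : Set (Euc d)} {δΓ δ : ℝ}
  {Bp Bm : Euc d → Mat n} {Gp Gm : Fin d → Euc d → Mat n}

theorem deriv_radialCutoff_eq_zero {z : ℝ} (hz : 1 ≤ |z|) : deriv radialCutoff z = 0 := by
  refine IsLocalMax.deriv_eq_zero (Eventually.of_forall fun y => ?_)
  rw [radialCutoff_eq_one hz]
  exact (radialCutoff_mem _).2

/-- The weight of the transition layer at scale `ε`. -/
noncomputable def layerWeight (Ωp Γ : Set (Euc d)) (ε : ℝ) (x : Euc d) : ℝ :=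
  weight (signedDist Ωp Γ x / ε)

theorem layerWeight_pos (Ωp Γ : Set (Euc d)) (ε : ℝ) (x : Euc d) : 0 < layerWeight Ωp Γ ε x :=
  weight_pos _

theorem layerWeight_le (Ωp Γ : Set (Euc d)) (ε : ℝ) (x : Euc d) :
    layerWeight Ωp Γ ε x ≤ 1 / 4 := weight_le_quarter _

theorem TubeSetting.measurable_layerWeight (h : TubeSetting Ω Ωp Ωm Γ δΓ) (ε : ℝ) :
    Measurable (layerWeight Ωp Γ ε) :=
  continuous_weight.measurable.comp
    ((measurable_signedDist h.interface.isOpen_plus.measurableSet).div_const ε)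

theorem PairSetting.integrableOn_gap (hB : PairSetting Γ δ Bp Bm Gp Gm)
    (h : TubeSetting Ω Ωp Ωm Γ δΓ) : IntegrableOn (gap Bp Bm) (nbhd Γ δ) :=
  Integrable.mono' (integrableOn_const (C := (4 * n : ℝ)) (h.volume_nbhd_ne_top δ))
    hB.aestronglyMeasurable_gap (hB.gap_mem.mono fun x hx => by
      rw [Real.norm_of_nonneg hx.1]; exact hx.2)

theorem PairSetting.integrable_cutoff_gap (hB : PairSetting Γ δ Bp Bm Gp Gm)
    (h : TubeSetting Ω Ωp Ωm Γ δΓ) {χ : Euc d → ℝ}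
    (hχ : ContDiff ℝ ∞ χ) (h01 : ∀ x, 0 ≤ χ x ∧ χ x ≤ 1) {b : ℝ} (hb : b < δ)
    (hs : tsupport χ ⊆ {x | Metric.infDist x Γ ≤ b}) (ε : ℝ) :
    Integrable fun x => χ x * layerWeight Ωp Γ ε x * gap Bp Bm x := by
  have h1 : IntegrableOn (fun x => χ x * layerWeight Ωp Γ ε x * gap Bp Bm x) (nbhd Γ δ) := by
    refine (hB.integrableOn_gap h).bdd_mul (c := 1)
      (hχ.continuous.measurable.mul (h.measurable_layerWeight ε)).aestronglyMeasurable
      (Eventually.of_forall fun x => ?_)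
    have h2 := layerWeight_pos Ωp Γ ε x
    have h3 := layerWeight_le Ωp Γ ε x
    rw [Real.norm_of_nonneg (mul_nonneg (h01 x).1 h2.le)]
    nlinarith [(h01 x).1, (h01 x).2]
  refine (integrableOn_iff_integrable_of_support_subset fun x hx => ?_).1 h1
  refine lt_of_le_of_lt (hs (subset_tsupport χ ?_)) hb
  intro h0
  exact hx (by simp [h0])

theorem sum_abs_normal_mul_le {X G : Fin d → ℝ} (hX : ∀ i, |X i| ≤ 1) :
    |∑ i, X i * G i| ≤ ∑ i, |G i| := by
  refine (Finset.abs_sum_le_sum_abs _ _).trans (Finset.sum_le_sum fun i _ => ?_)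
  rw [abs_mul]
  exact mul_le_of_le_one_left (abs_nonneg _) (hX i)

/-- The integrated inequality behind the weighted estimate of the gap, at a fixed inner scale. -/
theorem PairSetting.layer_inequality (hB : PairSetting Γ δ Bp Bm Gp Gm)
    (h : TubeSetting Ω Ωp Ωm Γ δΓ) (hδ : δ < δΓ) {χ : Euc d → ℝ}
    (hχ : ContDiff ℝ ∞ χ) (h01 : ∀ x, 0 ≤ χ x ∧ χ x ≤ 1) {b : ℝ} (hb : b < δ)
    (hs : tsupport χ ⊆ {x | Metric.infDist x Γ ≤ b}) {C : ℝ} (hC0 : 0 ≤ C)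
    (hC : ∀ z, |z| ≤ 1 → |deriv radialCutoff z| ≤ C) {ε r : ℝ} (hε : 0 < ε)
    (hr : 0 < r) (hrδ : r ≤ δ) :
    1 / (2 * ε) * ∫ x, radialCutoff (signedDist Ωp Γ x / r) •
        (χ x * layerWeight Ωp Γ ε x * gap Bp Bm x) ≤
      8 * n * (∫ x, layerWeight Ωp Γ ε x *
        |divergence (fun x => χ x • gradient (signedDist Ωp Γ) x) x|) +
      C * (r⁻¹ * ∫ x in nbhd Γ r, gap Bp Bm x) +
      2 * ε * ∫ x in nbhd Γ δ, slope Gp Gm x ^ 2 := by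
  obtain ⟨c1, c2, c3⟩ := h.contDiff_cutoff_normal (Ωp := Ωp) hχ (hb.trans hδ) hs
  set N := fun x => χ x • gradient (signedDist Ωp Γ) x with hN
  obtain ⟨G, hG, hGb⟩ := hB.exists_grad_gap
  set T := nbhd Γ δ with hT
  have hTm : MeasurableSet T := (isOpen_nbhd Γ δ).measurableSet
  have hTT : T ⊆ nbhd Γ δΓ := nbhd_mono Γ hδ.le
  set g := layerCutoff Ωp Γ ε r with hg
  -- Integrating the gap by parts against this field produces `√2 κ/ε` times the gap, plus terms in
  -- which the field has size at most `2κ`, plus the replacement of the jump at scale `r`.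
  set X : Euc d → Euc d := fun x => g x • N x with hX
  have hXts : tsupport X ⊆ {x | Metric.infDist x Γ ≤ b} :=
    (tsupport_smul_subset_right g N).trans c3
  have hbT : {x | Metric.infDist x Γ ≤ b} ⊆ T := fun x hx => lt_of_le_of_lt hx hb
  have hXc : ContDiff ℝ ∞ X := contDiff_of_contDiffOn_of_tsupport (isOpen_nbhd Γ δΓ)
    ((h.contDiffOn_layerCutoff hr).smul c1.contDiffOn) ((hXts.trans hbT).trans hTT)
  have hXcs : HasCompactSupport X :=
    (h.isCompact_closedNbhd b).of_isClosed_subset (isClosed_tsupport _) hXts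
  have hibp := hG.integral_divergence hXc hXcs (hXts.trans hbT)
  set Y : Euc d → ℝ := fun x => divergence X x * gap Bp Bm x + ∑ i, X x i * G i x with hY
  have hdts : tsupport (divergence X) ⊆ T := by
    refine (closure_minimal (fun x hx => ?_) (isClosed_tsupport X)).trans (hXts.trans hbT)
    by_contra h0
    exact hx (divergence_eq_zero h0)
  have i1 : Integrable fun x => divergence X x * gap Bp Bm x :=
    integrable_smul_of_locallyIntegrableOn hG.1 (continuous_divergence hXc)
      (hasCompactSupport_divergence hXcs) hdts
  have i2 : Integrable fun x => ∑ i, X x i * G i x :=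
    integrable_finsetSum _ fun i _ => integrable_smul_of_locallyIntegrableOn (hG.2.1 i)
      (contDiff_coord hXc i).continuous
      (hXcs.of_isClosed_subset (isClosed_tsupport _) (tsupport_coord_subset X i))
      ((tsupport_coord_subset X i).trans (hXts.trans hbT))
  have hYi : Integrable Y := i1.add i2
  have hY0 : ∫ x, Y x = 0 := by
    rw [hY, integral_add i1 i2, hibp]; ring
  have hYT : ∫ x in T, Y x = 0 := by
    rw [← hY0]
    refine setIntegral_eq_integral_of_forall_compl_eq_zero fun x hx => ?_
    have h1 : x ∉ tsupport X := fun h0 => hx (hbT (hXts h0))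
    simp only [hY]
    rw [divergence_eq_zero h1, image_eq_zero_of_notMem_tsupport h1]; simp
  have hLint : Integrable fun x => radialCutoff (signedDist Ωp Γ x / r) •
      (χ x * layerWeight Ωp Γ ε x * gap Bp Bm x) := by
    refine (hB.integrable_cutoff_gap h hχ h01 hb hs ε).bdd_smul 1
      (AllenCahn.contDiff_radialCutoff.continuous.measurable.comp
        ((measurable_signedDist h.interface.isOpen_plus.measurableSet).div_const r)).aestronglyMeasurable
      (Eventually.of_forall fun x => ?_)
    rw [Function.comp_apply, Real.norm_of_nonneg (radialCutoff_mem _).1]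
    exact (radialCutoff_mem _).2
  have hDint : Integrable fun x => layerWeight Ωp Γ ε x * |divergence N x| := by
    refine ((continuous_divergence c1).integrable_of_hasCompactSupport
      (hasCompactSupport_divergence c2)).abs.bdd_mul (c := 1 / 4)
      (h.measurable_layerWeight ε).aestronglyMeasurable (Eventually.of_forall fun x => ?_)
    rw [Real.norm_of_nonneg (layerWeight_pos _ _ _ _).le]
    exact layerWeight_le _ _ _ _
  have hrT : nbhd Γ r ⊆ T := nbhd_mono Γ hrδ
  have hrm : MeasurableSet (nbhd Γ r) := (isOpen_nbhd Γ r).measurableSet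
  have hfi : IntegrableOn (fun x => (nbhd Γ r).indicator (gap Bp Bm) x) T :=
    (hB.integrableOn_gap h).indicator hrm
  have hfe : ∫ x in T, (nbhd Γ r).indicator (gap Bp Bm) x = ∫ x in nbhd Γ r, gap Bp Bm x := by
    rw [setIntegral_indicator hrm, inter_eq_right.2 hrT]
  have hLT : ∫ x, radialCutoff (signedDist Ωp Γ x / r) •
      (χ x * layerWeight Ωp Γ ε x * gap Bp Bm x) = ∫ x in T, radialCutoff (signedDist Ωp Γ x / r) •
      (χ x * layerWeight Ωp Γ ε x * gap Bp Bm x) := by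
    refine (setIntegral_eq_integral_of_forall_compl_eq_zero fun x hx => ?_).symm
    rw [image_eq_zero_of_notMem_tsupport fun h0 => hx (hbT (hs h0))]; simp
  have hpt : ∀ᵐ x ∂(volume.restrict T), 1 / (2 * ε) * (radialCutoff (signedDist Ωp Γ x / r) •
      (χ x * layerWeight Ωp Γ ε x * gap Bp Bm x)) ≤
      Y x + (8 * n * (layerWeight Ωp Γ ε x * |divergence N x|) +
        C * r⁻¹ * (nbhd Γ r).indicator (gap Bp Bm) x + 2 * ε * slope Gp Gm x ^ 2) := by
    have hΓ0 : ∀ᵐ x ∂(volume.restrict T), x ∉ Γ :=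
      ae_restrict_of_ae (measure_eq_zero_iff_ae_notMem.1 h.volume_interface)
    filter_upwards [hGb, hB.gap_mem, hΓ0, ae_restrict_mem hTm] with x hGx hfx hxΓ hxT
    have hxTT := hTT hxT
    have hside : x ∈ Ωp ∨ x ∈ Ωm := by
      rcases h.mem_or (h.nbhd_subset hxTT) with h1 | h1 | h1
      · exact Or.inl h1
      · exact absurd h1 hxΓ
      · exact Or.inr h1
    set f := gap Bp Bm x with hf
    set κ := layerWeight Ωp Γ ε x with hκ
    set z := radialCutoff (signedDist Ωp Γ x / r) with hz
    have hκ0 : 0 < κ := layerWeight_pos _ _ _ _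
    have hκ1 : κ ≤ 1 / 4 := layerWeight_le _ _ _ _
    have hz01 : 0 ≤ z ∧ z ≤ 1 := radialCutoff_mem _
    have hχ01 := h01 x
    have hdef := h.abs_defect_le hε hside
    change |defect Ωp Γ ε x| ≤ 2 * κ at hdef
    have hgx : g x = z * defect Ωp Γ ε x := rfl
    have hgabs : |g x| ≤ z * (2 * κ) := by
      rw [hgx, abs_mul, abs_of_nonneg hz01.1]
      exact mul_le_mul_of_nonneg_left hdef hz01.1
    have hdiv : divergence X x = g x * divergence N x + χ x *
        (deriv radialCutoff (signedDist Ωp Γ x / r) / r * defect Ωp Γ ε x +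
          z * (Real.sqrt 2 * κ / ε)) := by
      rw [hX, divergence_smul (c1.differentiable (by simp) x)
        (((h.contDiffOn_layerCutoff hr).contDiffAt ((isOpen_nbhd Γ δΓ).mem_nhds hxTT)
          ).differentiableAt (by simp))]
      congr 1
      simp only [hN]
      rw [map_smul, h.fderiv_layerCutoff hxTT hxΓ, smul_eq_mul]
      rfl
    -- The constant is `2κ` for the layer factor times `4n` for the gap.
    have t1 : |g x * divergence N x * f| ≤ 8 * n * (κ * |divergence N x|) := by
      rw [abs_mul, abs_mul, abs_of_nonneg hfx.1]
      calc |g x| * |divergence N x| * f ≤ (1 * (2 * κ)) * |divergence N x| * (4 * n) := by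
            gcongr
            · exact hfx.1
            · exact hgabs.trans (mul_le_mul_of_nonneg_right hz01.2 (by positivity))
            · exact hfx.2
        _ = 8 * n * (κ * |divergence N x|) := by ring
    have t2 : |χ x * (deriv radialCutoff (signedDist Ωp Γ x / r) / r * defect Ωp Γ ε x) * f| ≤
        C * r⁻¹ * (nbhd Γ r).indicator (gap Bp Bm) x := by
      by_cases hxr : x ∈ nbhd Γ r
      · rw [indicator_of_mem hxr, abs_mul, abs_of_nonneg hfx.1]
        refine mul_le_mul_of_nonneg_right ?_ hfx.1
        have hzr : |signedDist Ωp Γ x / r| ≤ 1 := by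
          rw [abs_div, abs_signedDist, abs_of_pos hr]
          exact div_le_one_of_le₀ (le_of_lt hxr) hr.le
        rw [abs_mul, abs_mul, abs_div, abs_of_pos hr, abs_of_nonneg hχ01.1]
        calc χ x * (|deriv radialCutoff (signedDist Ωp Γ x / r)| / r * |defect Ωp Γ ε x|)
            ≤ 1 * (C / r * 1) := by
              gcongr
              · exact hχ01.2
              · exact hC _ hzr
              · linarith
          _ = C * r⁻¹ := by ring
      · have h1 : 1 ≤ |signedDist Ωp Γ x / r| := by
          rw [abs_div, abs_signedDist, abs_of_pos hr, one_le_div hr]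
          exact not_lt.1 hxr
        rw [indicator_of_notMem hxr, deriv_radialCutoff_eq_zero h1]; simp
    have t3 : |∑ i, X x i * G i x| ≤ z * κ * χ x * (f / (2 * ε)) + 2 * ε * slope Gp Gm x ^ 2 := by
      have e : ∑ i, X x i * G i x
          = (g x * χ x) * ∑ i, gradient (signedDist Ωp Γ) x i * G i x := by
        rw [Finset.mul_sum]
        refine Finset.sum_congr rfl fun i _ => ?_
        simp only [hX, hN, PiLp.smul_apply, smul_eq_mul]; ring
      have hsum : |∑ i, gradient (signedDist Ωp Γ) x i * G i x| ≤
          2 * slope Gp Gm x * Real.sqrt f := by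
        refine (sum_abs_normal_mul_le (h.norm_gradient_apply_le hxTT)).trans ?_
        rw [slope, Finset.mul_sum, Finset.sum_mul]
        exact Finset.sum_le_sum fun i _ => hGx i
      rw [e, abs_mul, abs_mul, abs_of_nonneg hχ01.1]
      have hsl : 0 ≤ slope Gp Gm x :=
        Finset.sum_nonneg fun i _ => add_nonneg (norm_nonneg _) (norm_nonneg _)
      -- Young's inequality weighted so that the gap comes back with the factor `1/(2ε)`, half of
      -- the coefficient available on the left.
      have hamgm : 4 * slope Gp Gm x * Real.sqrt f ≤ f / (2 * ε) + 8 * ε * slope Gp Gm x ^ 2 := by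
        have e1 : f / (2 * ε) = (Real.sqrt f) ^ 2 / (2 * ε) := by rw [Real.sq_sqrt hfx.1]
        rw [e1, ← sub_nonneg]
        have e2 : Real.sqrt f ^ 2 / (2 * ε) + 8 * ε * slope Gp Gm x ^ 2
            - 4 * slope Gp Gm x * Real.sqrt f
            = (Real.sqrt f - 4 * ε * slope Gp Gm x) ^ 2 / (2 * ε) := by
          field_simp; ring
        rw [e2]; positivity
      calc |g x| * χ x * |∑ i, gradient (signedDist Ωp Γ) x i * G i x|
          ≤ (z * (2 * κ)) * χ x * (2 * slope Gp Gm x * Real.sqrt f) := by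
            gcongr
            · exact mul_nonneg (mul_nonneg hz01.1 (by positivity)) hχ01.1
            · exact hχ01.1
        _ = z * κ * χ x * (4 * slope Gp Gm x * Real.sqrt f) := by ring
        _ ≤ z * κ * χ x * (f / (2 * ε) + 8 * ε * slope Gp Gm x ^ 2) :=
            mul_le_mul_of_nonneg_left hamgm
              (mul_nonneg (mul_nonneg hz01.1 hκ0.le) hχ01.1)
        _ = z * κ * χ x * (f / (2 * ε)) + (z * χ x) * κ * (8 * ε * slope Gp Gm x ^ 2) := by ring
        _ ≤ z * κ * χ x * (f / (2 * ε)) + 1 * (1 / 4) * (8 * ε * slope Gp Gm x ^ 2) := by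
            gcongr
            exact mul_le_one₀ hz01.2 hχ01.1 hχ01.2
        _ = _ := by ring
    have hs2 : 1 ≤ Real.sqrt 2 := Real.one_le_sqrt.2 (by norm_num)
    have hmain : χ x * (z * (κ / ε)) * f ≤ χ x * (z * (Real.sqrt 2 * κ / ε)) * f := by
      have h3 : κ / ε ≤ Real.sqrt 2 * κ / ε := by
        gcongr
        nlinarith
      have h4 := hfx.1
      have h5 := hχ01.1
      have h6 := hz01.1
      gcongr
    have hYx : Y x = g x * divergence N x * f
        + χ x * (deriv radialCutoff (signedDist Ωp Γ x / r) / r * defect Ωp Γ ε x) * f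
        + χ x * (z * (Real.sqrt 2 * κ / ε)) * f + ∑ i, X x i * G i x := by
      simp only [hY]; rw [hdiv]; ring
    rw [hYx, smul_eq_mul]
    -- The coefficient `√2 ≥ 1` leaves `1/ε`, of which half is spent on absorbing the gradient term.
    have e3 : 1 / (2 * ε) * (z * (χ x * κ * f)) = χ x * (z * (κ / ε)) * f
        - z * κ * χ x * (f / (2 * ε)) := by field_simp; ring
    rw [e3]
    rw [abs_le] at t1 t2 t3
    linarith [t1.1, t2.1, t3.1]
  have hE1 : IntegrableOn (fun x => 8 * n * (layerWeight Ωp Γ ε x * |divergence N x|) +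
        C * r⁻¹ * (nbhd Γ r).indicator (gap Bp Bm) x) T :=
    (hDint.integrableOn.const_mul _).add (hfi.const_mul _)
  have hE2 : IntegrableOn (fun x => 2 * ε * slope Gp Gm x ^ 2) T :=
    hB.integrable_slope_sq.const_mul _
  have hE12 : IntegrableOn (fun x => 8 * n * (layerWeight Ωp Γ ε x * |divergence N x|) +
        C * r⁻¹ * (nbhd Γ r).indicator (gap Bp Bm) x + 2 * ε * slope Gp Gm x ^ 2) T :=
    hE1.add hE2
  have hE0 : IntegrableOn (fun x => 8 * n * (layerWeight Ωp Γ ε x * |divergence N x|)) T :=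
    hDint.integrableOn.const_mul _
  have hEf : IntegrableOn (fun x => C * r⁻¹ * (nbhd Γ r).indicator (gap Bp Bm) x) T :=
    hfi.const_mul _
  have hmono := integral_mono_ae (hLint.integrableOn.const_mul (1 / (2 * ε)))
    (hYi.integrableOn.add hE12) hpt
  rw [integral_const_mul] at hmono
  rw [hLT]
  refine hmono.trans ?_
  have e5 : ∫ x in T, Y x + (8 * n * (layerWeight Ωp Γ ε x * |divergence N x|) +
        C * r⁻¹ * (nbhd Γ r).indicator (gap Bp Bm) x + 2 * ε * slope Gp Gm x ^ 2)
      = (∫ x in T, Y x) + ((8 * n * (∫ x in T, layerWeight Ωp Γ ε x * |divergence N x|) +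
        C * r⁻¹ * (∫ x in nbhd Γ r, gap Bp Bm x)) + 2 * ε * ∫ x in T, slope Gp Gm x ^ 2) := by
    rw [integral_add (μ := volume.restrict T) hYi.integrableOn hE12,
      integral_add (μ := volume.restrict T) hE1 hE2,
      integral_add (μ := volume.restrict T) hE0 hEf, integral_const_mul,
      integral_const_mul, integral_const_mul, hfe]
  refine (le_of_eq e5).trans ?_
  rw [hYT, zero_add, mul_assoc C]
  gcongr
  · exact Eventually.of_forall fun x => mul_nonneg (layerWeight_pos _ _ _ _).le (abs_nonneg _)
  · exact Measure.restrict_le_self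

/-- The weighted gap of the pair in the transition layer is `O(ε²)`. -/
theorem PairSetting.exists_weighted_gap_le (hB : PairSetting Γ δ Bp Bm Gp Gm)
    (h : TubeSetting Ω Ωp Ωm Γ δΓ) (hd : 1 ≤ d) (hδ0 : 0 < δ) (hδ : δ < δΓ) {χ : Euc d → ℝ}
    (hχ : ContDiff ℝ ∞ χ) (h01 : ∀ x, 0 ≤ χ x ∧ χ x ≤ 1) {b : ℝ} (hb0 : 0 < b) (hb : b < δ)
    (hs : tsupport χ ⊆ {x | Metric.infDist x Γ ≤ b}) :
    ∃ C : ℝ, 0 ≤ C ∧ ∀ ε : ℝ, 0 < ε →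
      ∫ x, χ x * layerWeight Ωp Γ ε x * gap Bp Bm x ≤ C * ε ^ 2 := by
  obtain ⟨c1, c2, c3⟩ := h.contDiff_cutoff_normal (Ωp := Ωp) hχ (hb.trans hδ) hs
  set N := fun x => χ x • gradient (signedDist Ωp Γ) x with hN
  -- A second cut-off, equal to 1 on the support of the field, bounds the weighted divergence by the
  -- mass of the weight.
  obtain ⟨χ', hχ', h01', h1', -, hs'⟩ := h.exists_cutoff hb0 hb hδ
  have hc' : HasCompactSupport χ' :=
    (h.isCompact_closedNbhd _).of_isClosed_subset (isClosed_tsupport _) hs'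
  obtain ⟨C₂, hC₂, hw⟩ := h.exists_integral_weight_le hχ' hδ hs'
  obtain ⟨K, hK⟩ := (h.isCompact_closedNbhd b).exists_bound_of_continuousOn
    (continuous_divergence c1).continuousOn
  obtain ⟨C₁, hC₁, hC₁'⟩ := exists_abs_deriv_radialCutoff_le
  have hK0 : 0 ≤ K := by
    obtain ⟨p, hp⟩ := h.interface.nonempty
    refine (norm_nonneg _).trans (hK p ?_)
    change Metric.infDist p Γ ≤ b
    rw [infDist_of_mem hp]; exact hb0.le
  have hI0 : 0 ≤ ∫ x in nbhd Γ δ, slope Gp Gm x ^ 2 := integral_nonneg fun x => sq_nonneg _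
  refine ⟨2 * (8 * n * (K * C₂) + 2 * ∫ x in nbhd Γ δ, slope Gp Gm x ^ 2), by positivity,
    fun ε hε => ?_⟩
  have hdiv : ∫ x, layerWeight Ωp Γ ε x * |divergence N x| ≤ K * C₂ * ε := by
    have hi := h.integrable_weight hχ' hc' ε
    calc ∫ x, layerWeight Ωp Γ ε x * |divergence N x|
        ≤ ∫ x, K * (χ' x * weight (signedDist Ωp Γ x / ε)) := by
          refine integral_mono_of_nonneg (Eventually.of_forall fun x =>
            mul_nonneg (layerWeight_pos _ _ _ _).le (abs_nonneg _)) (hi.const_mul K)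
            (Eventually.of_forall fun x => ?_)
          have hw0 := layerWeight_pos Ωp Γ ε x
          simp only
          by_cases hx : Metric.infDist x Γ ≤ b
          · rw [h1' x hx, one_mul, mul_comm]
            exact mul_le_mul_of_nonneg_right (hK x hx) hw0.le
          · rw [divergence_eq_zero fun h0 => hx (c3 h0), abs_zero, mul_zero]
            exact mul_nonneg hK0 (mul_nonneg (h01' x).1 hw0.le)
      _ = K * ∫ x, χ' x * weight (signedDist Ωp Γ x / ε) := integral_const_mul _ _
      _ ≤ K * (C₂ * ε) := mul_le_mul_of_nonneg_left (hw ε hε) hK0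
      _ = K * C₂ * ε := by ring
  set r : ℕ → ℝ := fun k => δ / (k + 1) with hr
  have hrpos : ∀ k, 0 < r k := fun k => by positivity
  have hrle : ∀ k, r k ≤ δ := fun k =>
    div_le_self hδ0.le (by have := Nat.cast_nonneg (α := ℝ) k; linarith)
  have hrt : Tendsto r atTop (𝓝 0) := by
    have := (tendsto_one_div_add_atTop_nhds_zero_nat (𝕜 := ℝ)).const_mul δ
    simpa [hr, div_eq_mul_inv] using this
  have hineq := fun k => hB.layer_inequality h hδ hχ h01 hb hs hC₁ hC₁' hε (hrpos k) (hrle k)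
  have hlim1 := tendsto_integral_cutoff_smul (fun k =>
      (h.contDiff_radialCutoff (hrpos k) ((hrle k).trans_lt hδ)).continuous)
    (fun k x => radialCutoff_mem _) (by
      refine tendsto_of_tendsto_of_tendsto_of_le_of_le tendsto_const_nhds
        (h.tendsto_volume_nbhd hrpos hrt) (fun _ => zero_le) fun k => measure_mono fun x hx => ?_
      by_contra h0
      exact hx (radialCutoff_signedDist_eq_one (hrpos k) (not_lt.1 h0)))
    (hB.integrable_cutoff_gap h hχ h01 hb hs ε)
  have hlim2 := (((hB.tendsto_layer_mean h hd hδ0 hrpos hrle hrt).const_mul C₁).const_add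
    (8 * n * (∫ x, layerWeight Ωp Γ ε x * |divergence N x|))).add_const
    (2 * ε * ∫ x in nbhd Γ δ, slope Gp Gm x ^ 2)
  -- As the inner scale tends to zero the jump term vanishes by the zero trace of the gap. What
  -- remains has order `ε` on the right against `1/(2ε)` on the left.
  have hfin := le_of_tendsto_of_tendsto' (hlim1.const_mul (1 / (2 * ε))) hlim2 hineq
  rw [mul_zero, add_zero, one_div, inv_mul_le_iff₀ (by positivity)] at hfin
  refine hfin.trans ?_
  have h8 : 8 * (n : ℝ) * (∫ x, layerWeight Ωp Γ ε x * |divergence N x|) ≤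
      8 * n * (K * C₂ * ε) := by gcongr
  calc _ ≤ 2 * ε * (8 * n * (K * C₂ * ε) + 2 * ε * ∫ x in nbhd Γ δ, slope Gp Gm x ^ 2) := by
        gcongr
    _ = _ := by ring

end Poincare

/-! ### The interpolation profile. -/

section Interpolation

variable {d : ℕ} {Ω Ωp Ωm Γ : Set (Euc d)} {δΓ : ℝ} {η : Euc d → ℝ} {a b : ℝ}

theorem interpolationProfile_eq (Ωp Γ : Set (Euc d)) (η : Euc d → ℝ) (ε : ℝ) (x : Euc d) :
    interpolationProfile Ωp Γ η ε x
      = Ωp.indicator (fun _ => 1) x + η x * defect Ωp Γ ε x := by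
  rw [interpolationProfile, defect]; ring

theorem interpolationProfile_mem (h01 : ∀ x, 0 ≤ η x ∧ η x ≤ 1) (ε : ℝ) (x : Euc d) :
    0 ≤ interpolationProfile Ωp Γ η ε x ∧ interpolationProfile Ωp Γ η ε x ≤ 1 := by
  have h1 := (profile_pos (signedDist Ωp Γ x / ε)).le
  have h2 := (profile_lt_one (signedDist Ωp Γ x / ε)).le
  obtain ⟨h3, h4⟩ := h01 x
  have h5 : 0 ≤ Ωp.indicator (fun _ => (1 : ℝ)) x ∧ Ωp.indicator (fun _ => (1 : ℝ)) x ≤ 1 := by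
    by_cases hx : x ∈ Ωp <;> simp [hx]
  rw [interpolationProfile]
  constructor
  · exact add_nonneg (mul_nonneg h3 h1) (mul_nonneg (by linarith) h5.1)
  · nlinarith [mul_le_mul_of_nonneg_left h2 h3,
      mul_le_mul_of_nonneg_left h5.2 (sub_nonneg.2 h4)]

theorem interpolationProfile_of_eq_one {x : Euc d} (hx : η x = 1) (ε : ℝ) :
    interpolationProfile Ωp Γ η ε x = profile (signedDist Ωp Γ x / ε) := by
  rw [interpolationProfile, hx]; ring

theorem interpolationProfile_of_eq_zero {x : Euc d} (hx : η x = 0) (ε : ℝ) :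
    interpolationProfile Ωp Γ η ε x = Ωp.indicator (fun _ => 1) x := by
  rw [interpolationProfile, hx]; ring

theorem TubeSetting.contDiff_mul_profile (h : TubeSetting Ω Ωp Ωm Γ δΓ)
    (hη : ContDiff ℝ ∞ η) (hb : b < δΓ) (hs : tsupport η ⊆ {x | Metric.infDist x Γ ≤ b})
    {g : ℝ → ℝ} (hg : ContDiff ℝ ∞ g) (ε : ℝ) :
    ContDiff ℝ ∞ fun x => η x * g (signedDist Ωp Γ x / ε) := by
  refine contDiff_of_contDiffOn_of_tsupport (isOpen_nbhd Γ δΓ) ?_ ?_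
  · exact hη.contDiffOn.mul (hg.comp_contDiffOn (h.contDiffOn_signedDist.div_const ε))
  · exact (tsupport_mul_subset_left).trans (hs.trans (closedNbhd_subset hb))

/-- The interpolation profile is smooth in the domain. -/
theorem TubeSetting.contDiffOn_interpolationProfile (h : TubeSetting Ω Ωp Ωm Γ δΓ)
    (hη : ContDiff ℝ ∞ η) (hb : b < δΓ) (hs : tsupport η ⊆ {x | Metric.infDist x Γ ≤ b})
    (ha : 0 < a) (h1 : ∀ x ∈ nbhd Γ a, η x = 1) (ε : ℝ) :
    ContDiffOn ℝ ∞ (interpolationProfile Ωp Γ η ε) Ω := by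
  intro x hx
  refine ContDiffAt.contDiffWithinAt ?_
  have hg := h.contDiff_mul_profile (Ωp := Ωp) hη hb hs contDiff_profile ε
  rcases h.mem_or hx with hx | hx | hx
  · refine (hg.add (contDiff_const (c := (1 : ℝ)).sub hη)).contDiffAt.congr_of_eventuallyEq ?_
    filter_upwards [h.interface.isOpen_plus.mem_nhds hx] with y hy
    simp [interpolationProfile, hy]
  -- Near the interface `η = 1`, so the discontinuous indicator does not enter.
  · refine hg.contDiffAt.congr_of_eventuallyEq ?_
    have hxa : x ∈ nbhd Γ a := by
      change Metric.infDist x Γ < a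
      rw [infDist_of_mem hx]; exact ha
    filter_upwards [(isOpen_nbhd Γ a).mem_nhds hxa] with y hy
    simp [interpolationProfile, h1 y hy]
  · refine hg.contDiffAt.congr_of_eventuallyEq ?_
    filter_upwards [h.interface.isOpen_minus.mem_nhds hx] with y hy
    simp [interpolationProfile, h.interface.disjoint_plus_minus.notMem_of_mem_right hy]

theorem TubeSetting.fderiv_interpolationProfile (h : TubeSetting Ω Ωp Ωm Γ δΓ)
    (hη : ContDiff ℝ ∞ η) {x : Euc d} (hx : x ∈ nbhd Γ δΓ) (hxΓ : x ∉ Γ) (ε : ℝ) (i : Fin d) :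
    fderiv ℝ (interpolationProfile Ωp Γ η ε) x (EuclideanSpace.single i 1) =
      fderiv ℝ η x (EuclideanSpace.single i 1) * defect Ωp Γ ε x +
        η x * (Real.sqrt 2 * layerWeight Ωp Γ ε x / ε * gradient (signedDist Ωp Γ) x i) := by
  obtain ⟨c, hc⟩ := h.exists_defect_eq hx hxΓ
  have h1 := (h.hasFDerivAt_comp_signedDist (ε := ε) hx (hasDerivAt_profile _)).sub_const c
  have h2 := (hη.differentiable (by simp) x).hasFDerivAt
  have h3 : ∀ᶠ y in 𝓝 x, Ωp.indicator (fun _ => (1 : ℝ)) y = c := by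
    filter_upwards [hc] with y hy
    have := hy ε
    rw [defect] at this
    linarith
  have h4 := ((h2.mul h1).const_add c).congr_of_eventuallyEq
    (f₁ := interpolationProfile Ωp Γ η ε) (by
      filter_upwards [hc, h3] with y hy hy3
      rw [interpolationProfile_eq, hy, hy3]
      rfl)
  rw [h4.fderiv, hc.self_of_nhds ε]
  simp only [_root_.add_apply, _root_.smul_apply, smul_eq_mul, fderiv_eq_gradient (signedDist Ωp Γ),
    layerWeight, weight]
  ring

theorem TubeSetting.interpolationProfile_eventuallyEq (h : TubeSetting Ω Ωp Ωm Γ δΓ)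
    {x : Euc d} (hx : x ∈ Ωp ∨ x ∈ Ωm) (hxη : x ∉ tsupport η) (ε : ℝ) :
    interpolationProfile Ωp Γ η ε =ᶠ[𝓝 x] fun _ => Ωp.indicator (fun _ => 1) x := by
  have h0 := notMem_tsupport_iff_eventuallyEq.1 hxη
  rcases hx with hx | hx
  · filter_upwards [h0, h.interface.isOpen_plus.mem_nhds hx] with y hy hy2
    rw [interpolationProfile_of_eq_zero hy]; simp [hx, hy2]
  · filter_upwards [h0, h.interface.isOpen_minus.mem_nhds hx] with y hy hy2
    rw [interpolationProfile_of_eq_zero hy]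
    simp [h.interface.disjoint_plus_minus.notMem_of_mem_right hx,
      h.interface.disjoint_plus_minus.notMem_of_mem_right hy2]

theorem TubeSetting.fderiv_interpolationProfile_eq_zero (h : TubeSetting Ω Ωp Ωm Γ δΓ)
    {x : Euc d} (hx : x ∈ Ωp ∨ x ∈ Ωm) (hxη : x ∉ tsupport η) (ε : ℝ) :
    fderiv ℝ (interpolationProfile Ωp Γ η ε) x = 0 := by
  rw [(h.interpolationProfile_eventuallyEq hx hxη ε).fderiv_eq, fderiv_fun_const]; rfl

/-- Away from the interface the weight of the layer is of order `ε²`. -/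
theorem layerWeight_le_sq {ε r : ℝ} (hε : 0 < ε) (hr : 0 < r) {x : Euc d}
    (hx : r ≤ Metric.infDist x Γ) : layerWeight Ωp Γ ε x ≤ ε ^ 2 / r ^ 2 := by
  have h1 := sq_mul_weight_le (signedDist Ωp Γ x / ε)
  have h2 : r ^ 2 ≤ signedDist Ωp Γ x ^ 2 := by
    rw [← sq_abs (signedDist Ωp Γ x), abs_signedDist]
    exact pow_le_pow_left₀ hr.le hx 2
  have h3 := (layerWeight_pos Ωp Γ ε x).le
  rw [div_pow, div_mul_eq_mul_div, div_le_one (by positivity)] at h1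
  change signedDist Ωp Γ x ^ 2 * layerWeight Ωp Γ ε x ≤ ε ^ 2 at h1
  rw [le_div_iff₀ (by positivity)]
  nlinarith [mul_le_mul_of_nonneg_right h2 h3]

end Interpolation

/-! ### Pointwise bounds of the Dirichlet density. -/

section Algebra

variable {d n : ℕ}

theorem sum_norm_sq_le_slope_sq (Tp Tm : Fin d → Mat n) {S : ℝ} (h0 : 0 ≤ S) (h1 : S ≤ 1) :
    ∑ i, ‖S • Tp i + (1 - S) • Tm i‖ ^ 2 ≤ (∑ i, (‖Tp i‖ + ‖Tm i‖)) ^ 2 := by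
  refine (Finset.sum_le_sum fun i _ => ?_).trans
    (Finset.sum_sq_le_sq_sum_of_nonneg (f := fun i => ‖Tp i‖ + ‖Tm i‖) fun i _ => by positivity)
  refine pow_le_pow_left₀ (norm_nonneg _) ?_ 2
  refine (norm_add_le _ _).trans ?_
  rw [norm_smul, norm_smul, Real.norm_of_nonneg h0, Real.norm_of_nonneg (sub_nonneg.2 h1)]
  have := norm_nonneg (Tp i)
  have := norm_nonneg (Tm i)
  nlinarith

open Matrix in
/-- The Dirichlet energy density inside the transition layer. -/
theorem dirichlet_layer_le (Tp Tm : Fin d → Mat n) (D : Mat n) {ν : Fin d → ℝ} {S ε f : ℝ}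
    (hε : 0 < ε) (h0 : 0 ≤ S) (h1 : S ≤ 1) (hf : 0 ≤ f) (hD : ‖D‖ ^ 2 = 4 + f)
    (hν : ∑ i, ν i ^ 2 = 1) (hν1 : ∀ i, |ν i| ≤ 1)
    (hp : ∀ i, |trace ((Tp i)ᵀ * D)| ≤ ‖Tp i‖ * Real.sqrt f)
    (hm : ∀ i, |trace ((Tm i)ᵀ * D)| ≤ ‖Tm i‖ * Real.sqrt f) :
    ε / 2 * ∑ i, ‖S • Tp i + (1 - S) • Tm i +
        (Real.sqrt 2 * (S * (1 - S)) / ε * ν i) • D‖ ^ 2 ≤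
      4 * (S * (1 - S)) ^ 2 / ε + 2 * (S * (1 - S)) * f / ε +
        ε * (∑ i, (‖Tp i‖ + ‖Tm i‖)) ^ 2 := by
  set κ := S * (1 - S) with hκ
  set σ := ∑ i, (‖Tp i‖ + ‖Tm i‖) with hσ
  have hS1 : 0 ≤ 1 - S := sub_nonneg.2 h1
  have hκ0 : 0 ≤ κ := mul_nonneg h0 hS1
  have hκ1 : κ ≤ 1 / 4 := by rw [hκ]; nlinarith [sq_nonneg (S - 1 / 2)]
  have hσ0 : 0 ≤ σ := Finset.sum_nonneg fun i _ => by positivity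
  have hs2 : Real.sqrt 2 ^ 2 = 2 := Real.sq_sqrt (by norm_num)
  -- The decisive use of tangency. Without the factor `√f`, the cross term `κ` times the gradients
  -- would by Cauchy–Schwarz be bounded only by order `√ε`.
  have hcross : ∀ i, Real.sqrt 2 * κ / ε * ν i * trace ((S • Tp i + (1 - S) • Tm i)ᵀ * D) ≤
      Real.sqrt 2 * κ / ε * Real.sqrt f * (‖Tp i‖ + ‖Tm i‖) := by
    intro i
    have e : trace ((S • Tp i + (1 - S) • Tm i)ᵀ * D)
        = S * trace ((Tp i)ᵀ * D) + (1 - S) * trace ((Tm i)ᵀ * D) := by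
      rw [transpose_add, transpose_smul, transpose_smul, Matrix.add_mul, Matrix.smul_mul,
        Matrix.smul_mul, trace_add, trace_smul, trace_smul, smul_eq_mul, smul_eq_mul]
    have e1 : |trace ((S • Tp i + (1 - S) • Tm i)ᵀ * D)| ≤
        Real.sqrt f * (‖Tp i‖ + ‖Tm i‖) := by
      rw [e]
      refine (abs_add_le _ _).trans ?_
      rw [abs_mul, abs_mul, abs_of_nonneg h0, abs_of_nonneg hS1]
      have t1 := mul_le_of_le_one_left (abs_nonneg (trace ((Tp i)ᵀ * D))) h1
      have t2 := mul_le_of_le_one_left (abs_nonneg (trace ((Tm i)ᵀ * D)))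
        (show 1 - S ≤ 1 by linarith)
      linarith [hp i, hm i]
    rw [mul_assoc, mul_assoc (Real.sqrt 2 * κ / ε) (Real.sqrt f)]
    refine mul_le_mul_of_nonneg_left ((le_abs_self _).trans ?_) (by positivity)
    rw [abs_mul]
    exact (mul_le_of_le_one_left (abs_nonneg _) (hν1 i)).trans e1
  have hterm : ∀ i, ‖S • Tp i + (1 - S) • Tm i + (Real.sqrt 2 * κ / ε * ν i) • D‖ ^ 2 ≤
      ‖S • Tp i + (1 - S) • Tm i‖ ^ 2 +
        2 * (Real.sqrt 2 * κ / ε * Real.sqrt f) * (‖Tp i‖ + ‖Tm i‖) +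
        2 * κ ^ 2 / ε ^ 2 * (4 + f) * ν i ^ 2 := by
    intro i
    rw [norm_add_sq_matrix, Matrix.mul_smul, trace_smul, smul_eq_mul, norm_smul, mul_pow, hD,
      Real.norm_eq_abs, sq_abs]
    have e2 : (Real.sqrt 2 * κ / ε * ν i) ^ 2 * (4 + f)
        = 2 * κ ^ 2 / ε ^ 2 * (4 + f) * ν i ^ 2 := by
      rw [mul_pow, div_pow, mul_pow, hs2]; ring
    rw [e2]
    linarith [hcross i]
  have hsum : ∑ i, ‖S • Tp i + (1 - S) • Tm i + (Real.sqrt 2 * κ / ε * ν i) • D‖ ^ 2 ≤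
      σ ^ 2 + 2 * (Real.sqrt 2 * κ / ε * Real.sqrt f) * σ + 2 * κ ^ 2 / ε ^ 2 * (4 + f) := by
    refine (Finset.sum_le_sum fun i _ => hterm i).trans ?_
    rw [Finset.sum_add_distrib, Finset.sum_add_distrib, ← Finset.mul_sum, ← Finset.mul_sum, hν,
      mul_one]
    have := sum_norm_sq_le_slope_sq Tp Tm h0 h1
    linarith
  -- Splits the cross term into the weighted gap over `ε` and `ε` times the squared gradients, the
  -- two quantities already under control.
  have hamgm : Real.sqrt 2 * Real.sqrt f * σ ≤ f / ε + ε * σ ^ 2 / 2 := by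
    have e : f / ε + ε * σ ^ 2 / 2 - Real.sqrt 2 * Real.sqrt f * σ
        = (Real.sqrt 2 * Real.sqrt f - ε * σ) ^ 2 / (2 * ε) := by
      have : (Real.sqrt 2 * Real.sqrt f - ε * σ) ^ 2
          = 2 * f - 2 * ε * (Real.sqrt 2 * Real.sqrt f * σ) + ε ^ 2 * σ ^ 2 := by
        rw [sub_sq, mul_pow, hs2, Real.sq_sqrt hf]; ring
      rw [this]; field_simp; ring
    have e2 : 0 ≤ (Real.sqrt 2 * Real.sqrt f - ε * σ) ^ 2 / (2 * ε) := by positivity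
    linarith
  calc ε / 2 * ∑ i, ‖S • Tp i + (1 - S) • Tm i + (Real.sqrt 2 * κ / ε * ν i) • D‖ ^ 2
      ≤ ε / 2 * (σ ^ 2 + 2 * (Real.sqrt 2 * κ / ε * Real.sqrt f) * σ +
        2 * κ ^ 2 / ε ^ 2 * (4 + f)) := by gcongr
    _ = ε / 2 * σ ^ 2 + κ * (Real.sqrt 2 * Real.sqrt f * σ) + 4 * κ ^ 2 / ε
        + κ * κ * f / ε := by field_simp; ring
    _ ≤ ε / 2 * σ ^ 2 + κ * (f / ε + ε * σ ^ 2 / 2) + 4 * κ ^ 2 / ε + κ * (1 / 4) * f / ε := by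
        gcongr
    _ = 4 * κ ^ 2 / ε + (5 / 4) * κ * f / ε + (1 / 2 + κ / 2) * (ε * σ ^ 2) := by ring
    _ ≤ 4 * κ ^ 2 / ε + 2 * κ * f / ε + 1 * (ε * σ ^ 2) := by
        gcongr
        · norm_num
        · linarith
    _ = _ := by rw [one_mul]

/-- The Dirichlet energy density away from the transition layer. -/
theorem dirichlet_far_le (Tp Tm : Fin d → Mat n) (D : Mat n) {τ : Fin d → ℝ} {S ε c M : ℝ}
    (hε : 0 < ε) (hε1 : ε ≤ 1) (h0 : 0 ≤ S) (h1 : S ≤ 1) (hD : ‖D‖ ^ 2 ≤ M)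
    (hτ : ∀ i, |τ i| ≤ c * ε) (hc : 0 ≤ c) :
    ε / 2 * ∑ i, ‖S • Tp i + (1 - S) • Tm i + τ i • D‖ ^ 2 ≤
      ε * (∑ i, (‖Tp i‖ + ‖Tm i‖)) ^ 2 + d * c ^ 2 * M * ε := by
  have hterm : ∀ i, ‖S • Tp i + (1 - S) • Tm i + τ i • D‖ ^ 2 ≤
      2 * ‖S • Tp i + (1 - S) • Tm i‖ ^ 2 + 2 * (c ^ 2 * M) := by
    intro i
    have e1 := norm_add_le (S • Tp i + (1 - S) • Tm i) (τ i • D)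
    have e2 : ‖τ i • D‖ ^ 2 ≤ c ^ 2 * M := by
      rw [norm_smul, mul_pow, Real.norm_eq_abs]
      have : |τ i| ≤ c := (hτ i).trans (mul_le_of_le_one_right hc hε1)
      gcongr
    have e3 := pow_le_pow_left₀ (norm_nonneg _) e1 2
    nlinarith [sq_nonneg (‖S • Tp i + (1 - S) • Tm i‖ - ‖τ i • D‖)]
  have hsum := Finset.sum_le_sum (s := Finset.univ) fun i _ => hterm i
  rw [Finset.sum_add_distrib, ← Finset.mul_sum, Finset.sum_const, Finset.card_univ,
    Fintype.card_fin, nsmul_eq_mul] at hsum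
  have := sum_norm_sq_le_slope_sq Tp Tm h0 h1
  calc ε / 2 * ∑ i, ‖S • Tp i + (1 - S) • Tm i + τ i • D‖ ^ 2
      ≤ ε / 2 * (2 * (∑ i, (‖Tp i‖ + ‖Tm i‖)) ^ 2 + d * (2 * (c ^ 2 * M))) := by
        gcongr; linarith
    _ = _ := by ring

end Algebra

/-! ### The interpolation of a pair and its energy density. -/

section Interpolant

variable {d n : ℕ} {Ω Ωp Ωm Γ : Set (Euc d)} {δΓ δ : ℝ} {η : Euc d → ℝ}
  {Bp Bm : Euc d → Mat n} {Gp Gm : Fin d → Euc d → Mat n}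

/-- Cut-off functions that equal `1` near `Γ` and live in a tube of radius `3δ/4`. -/
structure IsLayerCutoff (Γ : Set (Euc d)) (δ : ℝ) (η : Euc d → ℝ) : Prop where
  smooth : ContDiff ℝ ∞ η
  mem : ∀ x, 0 ≤ η x ∧ η x ≤ 1
  eq_one : ∀ x ∈ nbhd Γ (δ / 2), η x = 1
  support : tsupport η ⊆ {x | Metric.infDist x Γ ≤ 3 * δ / 4}

/-- Two `H¹` maps into the two components of the orthogonal group, each defined on one side of
`Γ` and on a tube around `Γ`, which form a minimal pair on `Γ`. -/
structure OverlapPair (Ωp Ωm Γ : Set (Euc d)) (δ : ℝ) (Bp Bm : Euc d → Mat n)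
    (Gp Gm : Fin d → Euc d → Mat n) : Prop where
  grad_plus : HasWeakGrad (Ωp ∪ nbhd Γ δ) Bp Gp
  grad_minus : HasWeakGrad (Ωm ∪ nbhd Γ δ) Bm Gm
  memLp_plus : ∀ i, MemLp (Gp i) 2 volume
  memLp_minus : ∀ i, MemLp (Gm i) 2 volume
  orth_plus : ∀ᵐ x ∂(volume.restrict (Ωp ∪ nbhd Γ δ)), Bp x ∈ orthPlus n
  orth_minus : ∀ᵐ x ∂(volume.restrict (Ωm ∪ nbhd Γ δ)), Bm x ∈ orthMinus n
  gap_trace : ∀ᵐ x ∂((Measure.hausdorffMeasure ((d : ℝ) - 1) : Measure (Euc d)).restrict Γ),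
    Tendsto (fun r : ℝ => ⨍ y in Metric.ball x r, gap Bp Bm y) (𝓝[>] 0) (𝓝 0)

theorem memLp_two_restrict {V : Type*} [NormedAddCommGroup V] {f : Euc d → V}
    (hf : MemLp f 2 volume) (U : Set (Euc d)) : MemLp f 2 (volume.restrict U) := hf.restrict U

theorem OverlapPair.pairSetting (hB : OverlapPair Ωp Ωm Γ δ Bp Bm Gp Gm) :
    PairSetting Γ δ Bp Bm Gp Gm where
  grad_plus := hB.grad_plus.mono subset_union_right
  grad_minus := hB.grad_minus.mono subset_union_right
  memLp_plus i := memLp_two_restrict (hB.memLp_plus i) _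
  memLp_minus i := memLp_two_restrict (hB.memLp_minus i) _
  orth_plus := ae_restrict_of_ae_restrict_of_subset subset_union_right hB.orth_plus
  orth_minus := ae_restrict_of_ae_restrict_of_subset subset_union_right hB.orth_minus
  gap_trace := hB.gap_trace

/-- The interpolation between the two maps of a pair. -/
noncomputable def interpolant (Ωp Γ : Set (Euc d)) (η : Euc d → ℝ) (Bp Bm : Euc d → Mat n)
    (ε : ℝ) (x : Euc d) : Mat n :=
  (1 - interpolationProfile Ωp Γ η ε x) • Bm x + interpolationProfile Ωp Γ η ε x • Bp x

/-- The gradient of the interpolation. -/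
noncomputable def interpolantGrad (Ωp Γ : Set (Euc d)) (η : Euc d → ℝ) (Bp Bm : Euc d → Mat n)
    (Gp Gm : Fin d → Euc d → Mat n) (ε : ℝ) (i : Fin d) (x : Euc d) : Mat n :=
  interpolationProfile Ωp Γ η ε x • Gp i x + (1 - interpolationProfile Ωp Γ η ε x) • Gm i x +
    fderiv ℝ (interpolationProfile Ωp Γ η ε) x (EuclideanSpace.single i 1) • (Bp x - Bm x)

theorem IsLayerCutoff.mem_nbhd (hη : IsLayerCutoff Γ δ η) (hδ0 : 0 < δ) {x : Euc d}
    (hx : x ∈ tsupport η) : x ∈ nbhd Γ δ := by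
  have h1 : Metric.infDist x Γ ≤ 3 * δ / 4 := hη.support hx
  change Metric.infDist x Γ < δ
  linarith

/-- Each map is known only on its side and in the tube. Its coefficient vanishes near every
remaining point of `Ω`, so both products are weakly differentiable in all of `Ω`. -/
theorem TubeSetting.hasWeakGrad_interpolant (h : TubeSetting Ω Ωp Ωm Γ δΓ) (hδ0 : 0 < δ)
    (hδ : δ < δΓ) (hη : IsLayerCutoff Γ δ η) (hB : OverlapPair Ωp Ωm Γ δ Bp Bm Gp Gm) (ε : ℝ) :
    HasWeakGrad Ω (interpolant Ωp Γ η Bp Bm ε) (interpolantGrad Ωp Γ η Bp Bm Gp Gm ε) := by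
  have hS := h.contDiffOn_interpolationProfile (Ωp := Ωp) hη.smooth (show 3 * δ / 4 < δΓ by linarith)
    hη.support (half_pos hδ0) hη.eq_one ε
  have hmem : ∀ x ∈ Ω, x ∈ nbhd Γ δ ∨ ((x ∈ Ωp ∨ x ∈ Ωm) ∧ x ∉ tsupport η) := by
    intro x hx
    by_cases hxδ : x ∈ nbhd Γ δ
    · exact Or.inl hxδ
    · refine Or.inr ⟨?_, fun h0 => hxδ (hη.mem_nbhd hδ0 h0)⟩
      rcases h.mem_or hx with h1 | h1 | h1
      · exact Or.inl h1
      · refine absurd ?_ hxδ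
        change Metric.infDist x Γ < δ
        rw [infDist_of_mem h1]; exact hδ0
      · exact Or.inr h1
  have h1 := HasWeakGrad.smooth_smul (h.interface.isOpen_plus.union (isOpen_nbhd Γ δ)) h.isOpen hS
    (fun x hx => by
      rcases hmem x hx with h1 | ⟨h1 | h1, h2⟩
      · exact Or.inl (Or.inr h1)
      · exact Or.inl (Or.inl h1)
      · right
        refine (h.interpolationProfile_eventuallyEq (Or.inr h1) h2 ε).trans ?_
        simp [h.interface.disjoint_plus_minus.notMem_of_mem_right h1]
        rfl) hB.grad_plus
  have h2 := HasWeakGrad.smooth_smul (h.interface.isOpen_minus.union (isOpen_nbhd Γ δ)) h.isOpen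
    (S := fun x => 1 - interpolationProfile Ωp Γ η ε x) (contDiffOn_const.sub hS)
    (fun x hx => by
      rcases hmem x hx with h1 | ⟨h1 | h1, h2⟩
      · exact Or.inl (Or.inr h1)
      · right
        filter_upwards [h.interpolationProfile_eventuallyEq (Or.inl h1) h2 ε] with y hy
        rw [hy]; simp [h1]
      · exact Or.inl (Or.inl h1)) hB.grad_minus
  refine (h2.add h1).congr ae_eq_rfl fun i => Eventually.of_forall fun x => ?_
  simp only [interpolantGrad]
  rw [fderiv_const_sub, _root_.neg_apply, neg_smul, smul_sub]
  abel

/-- Outside the tube the interpolation agrees with the given maps. -/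
theorem interpolant_of_mem_plus (h : TubeSetting Ω Ωp Ωm Γ δΓ) {x : Euc d} (hx : x ∈ Ωp)
    (hxη : x ∉ tsupport η) (ε : ℝ) :
    interpolant Ωp Γ η Bp Bm ε x = Bp x ∧
      ∀ i, interpolantGrad Ωp Γ η Bp Bm Gp Gm ε i x = Gp i x := by
  have h1 : interpolationProfile Ωp Γ η ε x = 1 := by
    rw [interpolationProfile_of_eq_zero (image_eq_zero_of_notMem_tsupport hxη)]; simp [hx]
  refine ⟨by simp [interpolant, h1], fun i => ?_⟩
  rw [interpolantGrad, h1, h.fderiv_interpolationProfile_eq_zero (Or.inl hx) hxη]; simp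

theorem interpolant_of_mem_minus (h : TubeSetting Ω Ωp Ωm Γ δΓ) {x : Euc d} (hx : x ∈ Ωm)
    (hxη : x ∉ tsupport η) (ε : ℝ) :
    interpolant Ωp Γ η Bp Bm ε x = Bm x ∧
      ∀ i, interpolantGrad Ωp Γ η Bp Bm Gp Gm ε i x = Gm i x := by
  have h1 : interpolationProfile Ωp Γ η ε x = 0 := by
    rw [interpolationProfile_of_eq_zero (image_eq_zero_of_notMem_tsupport hxη)]
    simp [h.interface.disjoint_plus_minus.notMem_of_mem_right hx]
  refine ⟨by simp [interpolant, h1], fun i => ?_⟩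
  rw [interpolantGrad, h1, h.fderiv_interpolationProfile_eq_zero (Or.inr hx) hxη]; simp

theorem OverlapPair.ae_side (hB : OverlapPair Ωp Ωm Γ δ Bp Bm Gp Gm)
    (h : TubeSetting Ω Ωp Ωm Γ δΓ) : ∀ᵐ x ∂(volume.restrict Ω),
      x ∉ Γ ∧ ((x ∈ Ωp ∧ Bp x ∈ orthPlus n) ∨ (x ∈ Ωm ∧ Bm x ∈ orthMinus n)) := by
  have h1 := (ae_restrict_iff' (h.interface.isOpen_plus.union (isOpen_nbhd Γ δ)).measurableSet).1
    hB.orth_plus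
  have h2 := (ae_restrict_iff' (h.interface.isOpen_minus.union (isOpen_nbhd Γ δ)).measurableSet).1
    hB.orth_minus
  filter_upwards [ae_restrict_of_ae h1, ae_restrict_of_ae h2, ae_restrict_mem h.isOpen.measurableSet,
    ae_restrict_of_ae (measure_eq_zero_iff_ae_notMem.1 h.volume_interface)] with x h1 h2 hx hΓ
  refine ⟨hΓ, ?_⟩
  rcases h.mem_or hx with h3 | h3 | h3
  · exact Or.inl ⟨h3, h1 (Or.inl h3)⟩
  · exact absurd h3 hΓ
  · exact Or.inr ⟨h3, h2 (Or.inl h3)⟩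

open Matrix in
theorem OverlapPair.ae_tube (hB : OverlapPair Ωp Ωm Γ δ Bp Bm Gp Gm) (U : Set (Euc d)) :
    ∀ᵐ x ∂(volume.restrict U), x ∈ nbhd Γ δ → (Bp x ∈ orthPlus n ∧ Bm x ∈ orthMinus n) ∧
      (0 ≤ gap Bp Bm x ∧ gap Bp Bm x ≤ 4 * n) ∧
      ∀ i, |trace ((Gp i x)ᵀ * (Bp x - Bm x))| ≤ ‖Gp i x‖ * Real.sqrt (gap Bp Bm x) ∧
        |trace ((Gm i x)ᵀ * (Bp x - Bm x))| ≤ ‖Gm i x‖ * Real.sqrt (gap Bp Bm x) := by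
  have hP := hB.pairSetting
  refine ae_restrict_of_ae ((ae_restrict_iff' (isOpen_nbhd Γ δ).measurableSet).1 ?_)
  filter_upwards [hP.orth_plus, hP.orth_minus, hP.gap_mem, hP.abs_trace_le] with x h1 h2 h3 h4
  exact ⟨⟨h1, h2⟩, h3, h4⟩

theorem potential_of_orth {P : Mat n} (hP : P * Matrix.transpose P = 1) : potential P = 0 := by
  rw [potential, hP]; simp

theorem OverlapPair.ae_norm_interpolant_le (hB : OverlapPair Ωp Ωm Γ δ Bp Bm Gp Gm)
    (h : TubeSetting Ω Ωp Ωm Γ δΓ) (hδ0 : 0 < δ) (hη : IsLayerCutoff Γ δ η) (ε : ℝ) :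
    ∀ᵐ x ∂(volume.restrict Ω), ‖interpolant Ωp Γ η Bp Bm ε x‖ ≤ Real.sqrt n := by
  filter_upwards [hB.ae_side h, hB.ae_tube Ω] with x hx hxt
  by_cases hxη : x ∈ tsupport η
  · obtain ⟨⟨hp, hm⟩, -⟩ := hxt (hη.mem_nbhd hδ0 hxη)
    obtain ⟨h0, h1⟩ := interpolationProfile_mem (Ωp := Ωp) (Γ := Γ) hη.mem ε x
    refine (norm_add_le _ _).trans ?_
    rw [norm_smul, norm_smul, Real.norm_of_nonneg h0, Real.norm_of_nonneg (sub_nonneg.2 h1)]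
    have e1 := mul_le_mul_of_nonneg_left (norm_orth_le (orthPlus_subset hp).2) h0
    have e2 := mul_le_mul_of_nonneg_left (norm_orth_le (orthMinus_subset hm).2) (sub_nonneg.2 h1)
    linarith
  · rcases hx.2 with ⟨h1, h2⟩ | ⟨h1, h2⟩
    · rw [(interpolant_of_mem_plus (Gp := Gp) (Gm := Gm) h h1 hxη ε).1]
      exact norm_orth_le (orthPlus_subset h2).2
    · rw [(interpolant_of_mem_minus (Gp := Gp) (Gm := Gm) h h1 hxη ε).1]
      exact norm_orth_le (orthMinus_subset h2).2

theorem IsLayerCutoff.exists_fderiv_le (h : TubeSetting Ω Ωp Ωm Γ δΓ)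
    (hη : IsLayerCutoff Γ δ η) :
    ∃ C : ℝ, 0 ≤ C ∧ ∀ x i, |fderiv ℝ η x (EuclideanSpace.single i 1)| ≤ C := by
  have hc : HasCompactSupport η :=
    (h.isCompact_closedNbhd _).of_isClosed_subset (isClosed_tsupport _) hη.support
  obtain ⟨C, hC⟩ := (hc.fderiv (𝕜 := ℝ)).exists_bound_of_continuous
    (hη.smooth.continuous_fderiv (by simp))
  refine ⟨C, (norm_nonneg _).trans (hC 0), fun x i => ?_⟩
  have := (fderiv ℝ η x).le_opNorm (EuclideanSpace.single i 1)
  rw [PiLp.norm_single, norm_one, mul_one] at this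
  exact this.trans (hC x)

/-- The derivatives of the interpolation profile are controlled by the weight of the layer. -/
theorem TubeSetting.abs_fderiv_interpolationProfile_le (h : TubeSetting Ω Ωp Ωm Γ δΓ)
    (hη : IsLayerCutoff Γ δ η) {C : ℝ} (hC : ∀ x i, |fderiv ℝ η x (EuclideanSpace.single i 1)| ≤ C)
    {ε : ℝ} (hε : 0 < ε) {x : Euc d} (hx : x ∈ nbhd Γ δΓ) (hx2 : x ∈ Ωp ∨ x ∈ Ωm) (i : Fin d) :
    |fderiv ℝ (interpolationProfile Ωp Γ η ε) x (EuclideanSpace.single i 1)| ≤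
      (2 * C + 2 / ε) * layerWeight Ωp Γ ε x := by
  have hxΓ : x ∉ Γ := fun h0 => hx2.elim
    (fun h1 => h.interface.disjoint_plus.notMem_of_mem_left h1 h0)
    (fun h1 => h.interface.disjoint_minus.notMem_of_mem_left h1 h0)
  rw [h.fderiv_interpolationProfile hη.smooth hx hxΓ]
  have hκ := (layerWeight_pos Ωp Γ ε x).le
  have h1 : |fderiv ℝ η x (EuclideanSpace.single i 1) * defect Ωp Γ ε x| ≤
      C * (2 * layerWeight Ωp Γ ε x) := by
    rw [abs_mul]
    exact mul_le_mul (hC x i) (h.abs_defect_le hε hx2) (abs_nonneg _)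
      ((abs_nonneg _).trans (hC x i))
  have hs2 : Real.sqrt 2 ≤ 2 := Real.sqrt_le_iff.2 ⟨by norm_num, by norm_num⟩
  have h2 : |η x * (Real.sqrt 2 * layerWeight Ωp Γ ε x / ε * gradient (signedDist Ωp Γ) x i)| ≤
      1 * (2 * layerWeight Ωp Γ ε x / ε * 1) := by
    rw [abs_mul, abs_mul, abs_of_nonneg (hη.mem x).1,
      abs_of_nonneg (show 0 ≤ Real.sqrt 2 * layerWeight Ωp Γ ε x / ε by positivity)]
    have h3 := h.norm_gradient_apply_le hx i
    have h4 := (hη.mem x).2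
    gcongr
  refine (abs_add_le _ _).trans ((add_le_add h1 h2).trans (le_of_eq ?_))
  ring

theorem OverlapPair.norm_sub_sq_eq (x : Euc d) : ‖Bp x - Bm x‖ ^ 2 = 4 + gap Bp Bm x := by
  rw [gap]; ring

theorem OverlapPair.memLp_slope (hB : OverlapPair Ωp Ωm Γ δ Bp Bm Gp Gm) :
    MemLp (slope Gp Gm) 2 volume :=
  memLp_finsetSum Finset.univ fun i _ => (hB.memLp_plus i).norm.add (hB.memLp_minus i).norm

theorem slope_nonneg (Gp Gm : Fin d → Euc d → Mat n) (x : Euc d) : 0 ≤ slope Gp Gm x :=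
  Finset.sum_nonneg fun _ _ => by positivity

theorem norm_add_norm_le_slope (Gp Gm : Fin d → Euc d → Mat n) (i : Fin d) (x : Euc d) :
    ‖Gp i x‖ + ‖Gm i x‖ ≤ slope Gp Gm x :=
  Finset.single_le_sum (f := fun i => ‖Gp i x‖ + ‖Gm i x‖) (fun _ _ => by positivity)
    (Finset.mem_univ i)

theorem OverlapPair.memLp_interpolantGrad (hB : OverlapPair Ωp Ωm Γ δ Bp Bm Gp Gm)
    (h : TubeSetting Ω Ωp Ωm Γ δΓ) (hΩ : volume Ω ≠ ⊤) (hδ0 : 0 < δ) (hδ : δ < δΓ)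
    (hη : IsLayerCutoff Γ δ η) {ε : ℝ} (hε : 0 < ε) (i : Fin d) :
    MemLp (interpolantGrad Ωp Γ η Bp Bm Gp Gm ε i) 2 (volume.restrict Ω) := by
  obtain ⟨C, hC0, hC⟩ := hη.exists_fderiv_le h
  have : IsFiniteMeasure (volume.restrict Ω) := ⟨by
    rw [Measure.restrict_apply_univ]; exact hΩ.lt_top⟩
  have hm := ((h.hasWeakGrad_interpolant hδ0 hδ hη hB ε).2.1 i).aestronglyMeasurable
  set K := (2 * C + 2 / ε) * (2 * Real.sqrt n) with hK
  refine MemLp.mono (g := fun x => slope Gp Gm x + K)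
    ((hB.memLp_slope.restrict Ω).add (memLp_const K)) hm ?_
  filter_upwards [hB.ae_side h, hB.ae_tube Ω] with x hx hxt
  have hK0 : 0 ≤ K := by positivity
  have hsl := slope_nonneg Gp Gm x
  rw [Real.norm_of_nonneg (add_nonneg hsl hK0)]
  have hi := norm_add_norm_le_slope Gp Gm i x
  have hp0 := norm_nonneg (Gp i x)
  have hm0 := norm_nonneg (Gm i x)
  by_cases hxη : x ∈ tsupport η
  · have hxδ := hη.mem_nbhd hδ0 hxη
    obtain ⟨⟨hp, hm⟩, -⟩ := hxt hxδ
    obtain ⟨h0, h1⟩ := interpolationProfile_mem (Ωp := Ωp) (Γ := Γ) hη.mem ε x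
    have hside : x ∈ Ωp ∨ x ∈ Ωm := hx.2.imp And.left And.left
    have hf := h.abs_fderiv_interpolationProfile_le hη hC hε (nbhd_mono Γ hδ.le hxδ) hside i
    have hκ1 := layerWeight_le Ωp Γ ε x
    have e3 : ‖fderiv ℝ (interpolationProfile Ωp Γ η ε) x (EuclideanSpace.single i 1) •
        (Bp x - Bm x)‖ ≤ K := by
      rw [norm_smul, Real.norm_eq_abs, hK]
      refine mul_le_mul (hf.trans ?_) ?_ (norm_nonneg _) (by positivity)
      · exact mul_le_of_le_one_right (by positivity) (hκ1.trans (by norm_num))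
      · refine (norm_sub_le _ _).trans ?_
        linarith [norm_orth_le (orthPlus_subset hp).2, norm_orth_le (orthMinus_subset hm).2]
    refine (norm_add_le _ _).trans (add_le_add ((norm_add_le _ _).trans ?_) e3)
    rw [norm_smul, norm_smul, Real.norm_of_nonneg h0, Real.norm_of_nonneg (sub_nonneg.2 h1)]
    nlinarith
  · rcases hx.2 with ⟨h1, h2⟩ | ⟨h1, h2⟩
    · rw [(interpolant_of_mem_plus (Bp := Bp) (Bm := Bm) h h1 hxη ε).2 i]; linarith
    · rw [(interpolant_of_mem_minus (Bp := Bp) (Bm := Bm) h h1 hxη ε).2 i]; linarith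

set_option maxHeartbeats 1000000 in
/-- The energy density without the flux term is, up to terms of order `ε` and the weighted gap,
bounded by twice the optimal profile energy. -/
theorem OverlapPair.exists_density_le (hB : OverlapPair Ωp Ωm Γ δ Bp Bm Gp Gm)
    (h : TubeSetting Ω Ωp Ωm Γ δΓ) (hδ0 : 0 < δ) (hδ : δ < δΓ) (hη : IsLayerCutoff Γ δ η) :
    ∃ C : ℝ, 0 ≤ C ∧ ∀ ε : ℝ, 0 < ε → ε ≤ 1 → ∀ᵐ x ∂(volume.restrict Ω),
      ε / 2 * ∑ i, ‖interpolantGrad Ωp Γ η Bp Bm Gp Gm ε i x‖ ^ 2 +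
        1 / ε * potential (interpolant Ωp Γ η Bp Bm ε x) ≤
      (nbhd Γ (δ / 2)).indicator
        (fun x => 8 * layerWeight Ωp Γ ε x ^ 2 / ε +
          C * (layerWeight Ωp Γ ε x * gap Bp Bm x / ε)) x +
        C * ε * (1 + slope Gp Gm x ^ 2) := by
  obtain ⟨C₀, hC₀, hC⟩ := hη.exists_fderiv_le h
  -- For `ε ≤ 1` the factor `2C₀ + 2/ε` is at most `2(C₀ + 1)/ε`, and outside the half tube the
  -- weight is at most `4ε²/δ²`; the product is `c ε`.
  set c := 8 * (C₀ + 1) / δ ^ 2 * 1 with hc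
  set M : ℝ := 4 + 4 * n with hM
  have hc0 : 0 ≤ c := by positivity
  have hM0 : 0 ≤ M := by positivity
  refine ⟨3 + n + d * c ^ 2 * M + 16 * M ^ 2 / δ ^ 4, by positivity, fun ε hε hε1 => ?_⟩
  set C := 3 + n + d * c ^ 2 * M + 16 * M ^ 2 / δ ^ 4 with hCdef
  have hCn : (3 : ℝ) + n ≤ C := by
    have : 0 ≤ d * c ^ 2 * M + 16 * M ^ 2 / δ ^ 4 := by positivity
    linarith
  have hn0 : (0 : ℝ) ≤ n := Nat.cast_nonneg n
  filter_upwards [hB.ae_side h, hB.ae_tube Ω] with x hx hxt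
  have hside : x ∈ Ωp ∨ x ∈ Ωm := hx.2.imp And.left And.left
  obtain ⟨h0, h1⟩ := interpolationProfile_mem (Ωp := Ωp) (Γ := Γ) hη.mem ε x
  have hκ0 := layerWeight_pos Ωp Γ ε x
  have hκ1 := layerWeight_le Ωp Γ ε x
  have hq : 0 ≤ ε * slope Gp Gm x ^ 2 := by positivity
  by_cases hxδ : x ∈ nbhd Γ δ
  · obtain ⟨⟨hp, hm⟩, ⟨hf0, hf1⟩, htr⟩ := hxt hxδ
    have hxδΓ := nbhd_mono Γ hδ.le hxδ
    have hpot := potential_segment_le (orthPlus_subset hp).1 (orthMinus_subset hm).1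
      (interpolationProfile Ωp Γ η ε x)
    rw [OverlapPair.norm_sub_sq_eq] at hpot
    -- Where `η = 1` the gradient of the profile is purely normal and the sharp layer bound applies.
    -- In the rest of the tube the weight is `O(ε²)` and crude bounds suffice.
    by_cases hxh : x ∈ nbhd Γ (δ / 2)
    · rw [indicator_of_mem hxh]
      have hη1 := hη.eq_one x hxh
      have hS : interpolationProfile Ωp Γ η ε x * (1 - interpolationProfile Ωp Γ η ε x)
          = layerWeight Ωp Γ ε x := by
        rw [interpolationProfile_of_eq_one hη1]; rfl
      have hgrad : ∀ i, fderiv ℝ (interpolationProfile Ωp Γ η ε) x (EuclideanSpace.single i 1) =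
          Real.sqrt 2 * (interpolationProfile Ωp Γ η ε x *
            (1 - interpolationProfile Ωp Γ η ε x)) / ε * gradient (signedDist Ωp Γ) x i := by
        intro i
        have hη0 : fderiv ℝ η x = 0 := by
          have : η =ᶠ[𝓝 x] fun _ => 1 := by
            filter_upwards [(isOpen_nbhd Γ (δ / 2)).mem_nhds hxh] with y hy
            exact hη.eq_one y hy
          rw [this.fderiv_eq, fderiv_fun_const]; rfl
        rw [h.fderiv_interpolationProfile hη.smooth hxδΓ hx.1, hη0, hη1, hS]
        simp
      have hν : ∑ i, gradient (signedDist Ωp Γ) x i ^ 2 = 1 := by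
        have := EuclideanSpace.real_norm_sq_eq (gradient (signedDist Ωp Γ) x)
        rw [h.norm_normal hxδΓ, one_pow] at this
        exact this.symm
      have hdir := dirichlet_layer_le (fun i => Gp i x) (fun i => Gm i x) (Bp x - Bm x) hε h0 h1 hf0
        (OverlapPair.norm_sub_sq_eq x) hν (h.norm_gradient_apply_le hxδΓ) (fun i => (htr i).1)
        (fun i => (htr i).2)
      simp only [interpolantGrad, hgrad]
      refine (add_le_add hdir (mul_le_mul_of_nonneg_left hpot (by positivity))).trans ?_
      rw [hS]
      change _ + ε * slope Gp Gm x ^ 2 + _ ≤ _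
      set κ := layerWeight Ωp Γ ε x
      set f := gap Bp Bm x
      -- The square of `4 + f` produces the sharp term `4κ²`; the remainder is linear in `κ f`
      -- because `κ ≤ 1/4` and `f ≤ 4n`.
      have e1 : 1 / ε * (1 / 4 * κ ^ 2 * (4 + f) ^ 2) ≤ 4 * κ ^ 2 / ε + (1 + n) * (κ * f / ε) := by
        have e2 : 1 / 4 * κ ^ 2 * (4 + f) ^ 2 ≤ 4 * κ ^ 2 + (1 + n) * (κ * f) := by
          have a1 : 0 ≤ κ * f := by positivity
          have a2 : κ * (κ * f) ≤ 1 / 4 * (κ * f) := mul_le_mul_of_nonneg_right hκ1 a1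
          have a3 : f * (κ * (κ * f)) ≤ 4 * n * (1 / 4 * (κ * f)) :=
            mul_le_mul hf1 a2 (by positivity) (by positivity)
          nlinarith
        calc _ = (1 / 4 * κ ^ 2 * (4 + f) ^ 2) / ε := by ring
          _ ≤ (4 * κ ^ 2 + (1 + n) * (κ * f)) / ε := by gcongr
          _ = _ := by ring
      have e3 : 2 * κ * f / ε = 2 * (κ * f / ε) := by ring
      have e4 : (3 + n) * (κ * f / ε) ≤ C * (κ * f / ε) :=
        mul_le_mul_of_nonneg_right hCn (by positivity)
      have e5 : 1 * (ε * slope Gp Gm x ^ 2) ≤ C * (ε * slope Gp Gm x ^ 2) :=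
        mul_le_mul_of_nonneg_right (by linarith) hq
      have e6 : 0 ≤ C * ε := by positivity
      have e7 : 8 * κ ^ 2 / ε = 4 * κ ^ 2 / ε + 4 * κ ^ 2 / ε := by ring
      rw [e3, e7]
      linarith
    · rw [indicator_of_notMem hxh, zero_add]
      have hκ2 : layerWeight Ωp Γ ε x ≤ 4 * ε ^ 2 / δ ^ 2 := by
        refine (layerWeight_le_sq hε (half_pos hδ0) (not_lt.1 hxh)).trans (le_of_eq ?_)
        field_simp; ring
      have hτ : ∀ i, |fderiv ℝ (interpolationProfile Ωp Γ η ε) x (EuclideanSpace.single i 1)| ≤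
          c * ε := by
        intro i
        refine (h.abs_fderiv_interpolationProfile_le hη hC hε hxδΓ hside i).trans ?_
        calc (2 * C₀ + 2 / ε) * layerWeight Ωp Γ ε x ≤ (2 * C₀ / ε + 2 / ε) * (4 * ε ^ 2 / δ ^ 2) := by
              gcongr
              exact le_div_self (by positivity) hε hε1
          _ = c * ε := by rw [hc]; field_simp; ring
      have hdir := dirichlet_far_le (fun i => Gp i x) (fun i => Gm i x) (Bp x - Bm x) hε hε1 h0 h1
        (M := M) (by rw [OverlapPair.norm_sub_sq_eq]; linarith) hτ hc0
      -- Here `S` is within `2κ = O(ε²)` of 0 or 1, so the potential is `O(ε⁴)`, more than enough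
      -- after division by `ε`.
      have hSS : interpolationProfile Ωp Γ η ε x * (1 - interpolationProfile Ωp Γ η ε x) ≤
          8 * ε ^ 2 / δ ^ 2 := by
        have hdef := h.abs_defect_le hε hside
        change |defect Ωp Γ ε x| ≤ 2 * layerWeight Ωp Γ ε x at hdef
        have hηd : |η x * defect Ωp Γ ε x| ≤ 2 * layerWeight Ωp Γ ε x := by
          rw [abs_mul, abs_of_nonneg (hη.mem x).1]
          exact (mul_le_of_le_one_left (abs_nonneg _) (hη.mem x).2).trans hdef
        have e8 : 8 * ε ^ 2 / δ ^ 2 = 2 * (4 * ε ^ 2 / δ ^ 2) := by ring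
        rw [abs_le] at hηd
        have e9 := interpolationProfile_eq Ωp Γ η ε x
        by_cases hxp : x ∈ Ωp
        · rw [indicator_of_mem hxp] at e9
          have : 1 - interpolationProfile Ωp Γ η ε x ≤ 8 * ε ^ 2 / δ ^ 2 := by linarith [hηd.1]
          exact (mul_le_of_le_one_left (by linarith) h1).trans this
        · rw [indicator_of_notMem hxp] at e9
          have : interpolationProfile Ωp Γ η ε x ≤ 8 * ε ^ 2 / δ ^ 2 := by linarith [hηd.2]
          exact (mul_le_of_le_one_right h0 (by linarith)).trans this
      have hpot2 : 1 / ε * potential (interpolant Ωp Γ η Bp Bm ε x) ≤ 16 * M ^ 2 / δ ^ 4 * ε := by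
        have hS0 : 0 ≤ interpolationProfile Ωp Γ η ε x * (1 - interpolationProfile Ωp Γ η ε x) :=
          mul_nonneg h0 (sub_nonneg.2 h1)
        calc _ ≤ 1 / ε * (1 / 4 * (8 * ε ^ 2 / δ ^ 2) ^ 2 * M ^ 2) := by
              refine mul_le_mul_of_nonneg_left (hpot.trans ?_) (by positivity)
              gcongr
              linarith
          _ = 16 * M ^ 2 / δ ^ 4 * ε * ε ^ 2 := by field_simp; ring
          _ ≤ 16 * M ^ 2 / δ ^ 4 * ε * 1 := by
              gcongr
              exact pow_le_one₀ hε.le hε1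
          _ = _ := mul_one _
      refine (add_le_add hdir hpot2).trans ?_
      change ε * slope Gp Gm x ^ 2 + _ + _ ≤ _
      have e5 : 1 * (ε * slope Gp Gm x ^ 2) ≤ C * (ε * slope Gp Gm x ^ 2) :=
        mul_le_mul_of_nonneg_right (by linarith) hq
      have e6 : d * c ^ 2 * M * ε + 16 * M ^ 2 / δ ^ 4 * ε ≤ C * ε := by
        rw [← add_mul]
        refine mul_le_mul_of_nonneg_right ?_ hε.le
        rw [hCdef]; linarith
      linarith
  -- Off the tube the interpolation is one of the given orthogonal-valued maps, so the potential
  -- vanishes.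
  · have hxη : x ∉ tsupport η := fun h2 => hxδ (hη.mem_nbhd hδ0 h2)
    rw [indicator_of_notMem (fun h2 => hxδ (nbhd_mono Γ (by linarith) h2)), zero_add]
    have e5 : 1 * (ε * slope Gp Gm x ^ 2) ≤ C * (ε * slope Gp Gm x ^ 2) :=
      mul_le_mul_of_nonneg_right (by linarith) hq
    have e6 : 0 ≤ C * ε := by positivity
    have hs0 := sum_norm_sq_le_slope_sq (fun i => Gp i x) (fun i => Gm i x) (S := 1) (by norm_num)
      le_rfl
    have hs1 := sum_norm_sq_le_slope_sq (fun i => Gp i x) (fun i => Gm i x) (S := 0) le_rfl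
      (by norm_num)
    change _ ≤ slope Gp Gm x ^ 2 at hs0 hs1
    simp only [one_smul, zero_smul, sub_self, sub_zero, add_zero, zero_add] at hs0 hs1
    rcases hx.2 with ⟨h3, h4⟩ | ⟨h3, h4⟩
    · obtain ⟨e7, e8⟩ := interpolant_of_mem_plus (Bp := Bp) (Bm := Bm) (Gp := Gp) (Gm := Gm)
        h h3 hxη ε
      rw [e7, potential_of_orth (orthPlus_subset h4).1]
      simp only [e8]
      have e9 := mul_le_mul_of_nonneg_left hs0 (half_pos hε).le
      linarith
    · obtain ⟨e7, e8⟩ := interpolant_of_mem_minus (Bp := Bp) (Bm := Bm) (Gp := Gp) (Gm := Gm)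
        h h3 hxη ε
      rw [e7, potential_of_orth (orthMinus_subset h4).1]
      simp only [e8]
      have e9 := mul_le_mul_of_nonneg_left hs1 (half_pos hε).le
      linarith

end Interpolant

/-! ### The flux term: comparison with the optimal profile. -/

section Flux

variable {d n : ℕ} {Ω Ωp Ωm Γ : Set (Euc d)} {δΓ δ : ℝ} {η : Euc d → ℝ}
  {Bp Bm : Euc d → Mat n} {Gp Gm : Fin d → Euc d → Mat n} {φ : Mat n → ℝ} {ψ : ℝ → ℝ}

/-- The quasi-distance along the optimal profile of a minimal pair. -/
noncomputable def profileFlux (z : ℝ) : ℝ :=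
  4 * Real.sqrt 2 * (profile z ^ 2 / 2 - profile z ^ 3 / 3)

theorem contDiff_profileFlux : ContDiff ℝ ∞ profileFlux :=
  contDiff_const.mul (((contDiff_profile.pow 2).div_const 2).sub
    ((contDiff_profile.pow 3).div_const 3))

/-- After rescaling, the derivative `8κ²/ε` is the sum of the equal leading parts `4κ²/ε` of the
Dirichlet and the potential density. -/
theorem hasDerivAt_profileFlux (z : ℝ) : HasDerivAt profileFlux (8 * weight z ^ 2) z := by
  have h := hasDerivAt_profile z
  have h1 := (((h.pow 2).div_const 2).sub ((h.pow 3).div_const 3)).const_mul (4 * Real.sqrt 2)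
  refine h1.congr_deriv ?_
  have hs : Real.sqrt 2 * Real.sqrt 2 = 2 := Real.mul_self_sqrt (by norm_num)
  simp only [weight]
  set s := profile z
  push_cast
  linear_combination (4 * s ^ 2 * (1 - s) ^ 2) * hs

/-- The limits 0 and `2 * quasiPrimitive 1` are the values of the quasi-distance on the two
components. Closeness to them that is linear in the tails of the profile is all that the comparison
needs. -/
theorem profileFlux_mem (z : ℝ) : 0 ≤ profileFlux z ∧ profileFlux z ≤ 3 * profile z ∧
    |profileFlux z - 2 * quasiPrimitive 1| ≤ 3 * (1 - profile z) := by
  have h0 := profile_pos z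
  have h1 := profile_lt_one z
  have hs0 : 0 < Real.sqrt 2 := Real.sqrt_pos.2 (by norm_num)
  have hs1 : Real.sqrt 2 ≤ 3 / 2 := Real.sqrt_le_iff.2 ⟨by norm_num, by norm_num⟩
  have hs : Real.sqrt 2 ^ 2 = 2 := Real.sq_sqrt (by norm_num)
  have hq : 2 * quasiPrimitive 1 = 4 * Real.sqrt 2 * (1 / 6) := by
    rw [quasiPrimitive]; field_simp; rw [hs]; norm_num
  rw [profileFlux, hq]
  set s := profile z
  have e1 : 0 ≤ s ^ 2 / 2 - s ^ 3 / 3 := by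
    have : 0 ≤ s ^ 2 * (1 - s) := by have := sub_pos.2 h1; positivity
    nlinarith [sq_nonneg s]
  have e2 : s ^ 2 / 2 - s ^ 3 / 3 ≤ s / 2 := by nlinarith [pow_pos h0 3, pow_pos h0 2]
  have e3 : s ^ 2 / 2 - s ^ 3 / 3 - 1 / 6 = -((1 - s) ^ 2 * (1 + 2 * s) / 6) := by ring
  have e4 : (1 - s) ^ 2 * (1 + 2 * s) / 6 ≤ (1 - s) / 2 := by
    have h2 := sub_pos.2 h1
    have : (1 - s) * ((1 - s) * (1 + 2 * s)) ≤ (1 - s) * 3 := by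
      refine mul_le_mul_of_nonneg_left ?_ h2.le
      nlinarith
    nlinarith
  refine ⟨by positivity, ?_, ?_⟩
  · calc 4 * Real.sqrt 2 * (s ^ 2 / 2 - s ^ 3 / 3) ≤ 4 * (3 / 2) * (s / 2) := by gcongr
      _ = 3 * s := by ring
  · have h2 := sub_pos.2 h1
    rw [← mul_sub, e3, mul_neg, abs_neg, abs_of_nonneg (by positivity)]
    calc 4 * Real.sqrt 2 * ((1 - s) ^ 2 * (1 + 2 * s) / 6) ≤ 4 * (3 / 2) * ((1 - s) / 2) := by
          gcongr
      _ = 3 * (1 - s) := by ring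

/-- In the tube, the mollified quasi-distance of the interpolation is close to that of the
optimal profile. -/
theorem OverlapPair.ae_abs_mollified_sub_le (hB : OverlapPair Ωp Ωm Γ δ Bp Bm Gp Gm)
    (h : TubeSetting Ω Ωp Ωm Γ δΓ) (hη : IsLayerCutoff Γ δ η) (hn : 1 ≤ n)
    (hφ : IsMollifier φ) {ε : ℝ} (hε : 0 < ε) :
    ∀ᵐ x ∂(volume.restrict Ω), x ∈ nbhd Γ δ →
      |mollifiedQuasiDist φ ε (interpolant Ωp Γ η Bp Bm ε x)
        - profileFlux (signedDist Ωp Γ x / ε)| ≤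
      4 * ε ^ 5 + (16 * Real.sqrt n + 6) * layerWeight Ωp Γ ε x := by
  filter_upwards [hB.ae_side h, hB.ae_tube Ω] with x hx hxt hxδ
  obtain ⟨⟨hp, hm⟩, -⟩ := hxt hxδ
  obtain ⟨h0, h1⟩ := interpolationProfile_mem (Ωp := Ωp) (Γ := Γ) hη.mem ε x
  have hside : x ∈ Ωp ∨ x ∈ Ωm := hx.2.imp And.left And.left
  have hdef := h.abs_defect_le hε hside
  have hηd : |η x * defect Ωp Γ ε x| ≤ 2 * layerWeight Ωp Γ ε x := by
    rw [abs_mul, abs_of_nonneg (hη.mem x).1]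
    exact (mul_le_of_le_one_left (abs_nonneg _) (hη.mem x).2).trans hdef
  have hmol := abs_mollified_sub_quasiDist_le hn hφ hε (interpolant Ωp Γ η Bp Bm ε x)
  have hD : ‖Bp x - Bm x‖ ≤ 2 * Real.sqrt n := by
    refine (norm_sub_le _ _).trans ?_
    linarith [norm_orth_le (orthPlus_subset hp).2, norm_orth_le (orthMinus_subset hm).2]
  have hκ := (layerWeight_pos Ωp Γ ε x).le
  have e9 := interpolationProfile_eq Ωp Γ η ε x
  obtain ⟨hf0, hf1, hf2⟩ := profileFlux_mem (signedDist Ωp Γ x / ε)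
  rw [abs_le] at hηd
  -- On either side the data are within `O(κ)` of the map of that side, on which the quasi-distance
  -- equals the limit of `profileFlux`; both functions are compared through this common value.
  by_cases hxp : x ∈ Ωp
  · rw [indicator_of_mem hxp] at e9
    have hdist : ‖interpolant Ωp Γ η Bp Bm ε x - Bp x‖ ≤
        2 * layerWeight Ωp Γ ε x * (2 * Real.sqrt n) := by
      have e : interpolant Ωp Γ η Bp Bm ε x - Bp x
          = (interpolationProfile Ωp Γ η ε x - 1) • (Bp x - Bm x) := by
        rw [interpolant]; module
      rw [e, norm_smul]
      refine mul_le_mul ?_ hD (norm_nonneg _) (by positivity)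
      rw [Real.norm_eq_abs, abs_le]
      constructor <;> linarith [hηd.1, hηd.2]
    have hq := abs_quasiDist_sub_le hn (interpolant Ωp Γ η Bp Bm ε x) (Bp x)
    rw [quasiDist_orthPlus hn hp] at hq
    have h2 : 1 - profile (signedDist Ωp Γ x / ε) ≤ 2 * layerWeight Ωp Γ ε x :=
      one_sub_profile_le_weight (div_pos (h.signedDist_pos_iff.2 hxp) hε).le
    rw [abs_le] at hmol hq hf2 ⊢
    constructor <;> linarith [hmol.1, hmol.2, hq.1, hq.2, hf2.1, hf2.2]
  · have hxm : x ∈ Ωm := hside.resolve_left hxp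
    rw [indicator_of_notMem hxp] at e9
    have hdist : ‖interpolant Ωp Γ η Bp Bm ε x - Bm x‖ ≤
        2 * layerWeight Ωp Γ ε x * (2 * Real.sqrt n) := by
      have e : interpolant Ωp Γ η Bp Bm ε x - Bm x
          = interpolationProfile Ωp Γ η ε x • (Bp x - Bm x) := by
        rw [interpolant]; module
      rw [e, norm_smul]
      refine mul_le_mul ?_ hD (norm_nonneg _) (by positivity)
      rw [Real.norm_eq_abs, abs_le]
      constructor <;> linarith [hηd.1, hηd.2]
    have hq := abs_quasiDist_sub_le hn (interpolant Ωp Γ η Bp Bm ε x) (Bm x)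
    rw [quasiDist_orthMinus hn hm] at hq
    have hxΩ : x ∈ Ω := by rw [← h.interface.union_eq]; exact Or.inr hxm
    have h2 : profile (signedDist Ωp Γ x / ε) ≤ 2 * layerWeight Ωp Γ ε x :=
      profile_le_weight (div_nonpos_of_nonpos_of_nonneg
        ((h.signedDist_neg_iff hxΩ).2 hxm).le hε.le)
    rw [abs_le] at hmol hq ⊢
    constructor <;> linarith [hmol.1, hmol.2, hq.1, hq.2]

theorem IsCutoffProfile.exists_le (hψ : IsCutoffProfile ψ) : ∃ M : ℝ, 0 ≤ M ∧ ∀ s, |ψ s| ≤ M := by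
  obtain ⟨M, hM⟩ := (isCompact_Icc (a := (-1 : ℝ)) (b := 1)).exists_bound_of_continuousOn
    hψ.smooth.continuous.continuousOn
  have hM0 : 0 ≤ M := (norm_nonneg _).trans (hM 0 (by simp))
  refine ⟨M, hM0, fun s => ?_⟩
  by_cases hs : s ∈ Icc (-1 : ℝ) 1
  · exact hM s hs
  · have h0 : ψ s = 0 := by
      rcases lt_or_ge s (-1) with h1 | h1
      · rw [← hψ.even]; exact hψ.eq_zero _ (by linarith)
      · exact hψ.eq_zero _ (by
          by_contra h2
          exact hs ⟨h1, (not_le.1 h2).le⟩)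
    rw [h0, abs_zero]; exact hM0

/-- The cut-off normal field. -/
noncomputable def fluxCutoff (ψ : ℝ → ℝ) (Ωp Γ : Set (Euc d)) (δΓ : ℝ) (χ : Euc d → ℝ)
    (x : Euc d) : ℝ := χ x * ψ (signedDist Ωp Γ x / δΓ)

variable {χ : Euc d → ℝ}

/-- Beyond the tube, where nothing is known about the gradient of the distance, `ψ` vanishes. -/
theorem IsCutoffProfile.abs_normalField_sub_le (hψ : IsCutoffProfile ψ)
    (h : TubeSetting Ω Ωp Ωm Γ δΓ) {M : ℝ} (hM0 : 0 ≤ M) (hM : ∀ s, |ψ s| ≤ M)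
    (h01 : ∀ x, 0 ≤ χ x ∧ χ x ≤ 1) (x : Euc d) (i : Fin d) :
    |normalField ψ Ωp Γ δΓ x i
      - (fluxCutoff ψ Ωp Γ δΓ χ x • gradient (signedDist Ωp Γ) x) i| ≤ M := by
  have e : normalField ψ Ωp Γ δΓ x i
      - (fluxCutoff ψ Ωp Γ δΓ χ x • gradient (signedDist Ωp Γ) x) i
      = (1 - χ x) * (ψ (signedDist Ωp Γ x / δΓ) * gradient (signedDist Ωp Γ) x i) := by
    simp only [normalField, fluxCutoff, PiLp.smul_apply, smul_eq_mul]; ring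
  rw [e]
  by_cases hx : x ∈ nbhd Γ δΓ
  · rw [abs_mul, abs_mul, abs_of_nonneg (sub_nonneg.2 (h01 x).2)]
    have h1 := h.norm_gradient_apply_le hx i
    calc _ ≤ 1 * (M * 1) := by
          gcongr
          · linarith [(h01 x).1]
          · exact hM _
      _ = M := by ring
  · have h1 : 1 ≤ |signedDist Ωp Γ x / δΓ| := by
      rw [abs_div, abs_signedDist, abs_of_pos h.radius.pos, one_le_div h.radius.pos]
      exact not_lt.1 hx
    have h2 : ψ (signedDist Ωp Γ x / δΓ) = 0 := by
      rcases abs_cases (signedDist Ωp Γ x / δΓ) with ⟨h3, -⟩ | ⟨h3, -⟩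
      · exact hψ.eq_zero _ (h3 ▸ h1)
      · rw [← hψ.even]; exact hψ.eq_zero _ (h3 ▸ h1)
    rw [h2]; simpa using hM0

theorem normalField_eq_of_cutoff_eq_one {x : Euc d} (hx : χ x = 1) :
    normalField ψ Ωp Γ δΓ x = fluxCutoff ψ Ωp Γ δΓ χ x • gradient (signedDist Ωp Γ) x := by
  rw [normalField, fluxCutoff, hx, one_mul]

/-- Replacing the normal field by its cut-off changes the flux by terms of order `ε` only. -/
theorem OverlapPair.ae_flux_le (hB : OverlapPair Ωp Ωm Γ δ Bp Bm Gp Gm)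
    (h : TubeSetting Ω Ωp Ωm Γ δΓ) (hη : IsLayerCutoff Γ δ η) (hn : 1 ≤ n)
    (hφ : IsMollifier φ) (hψ : IsCutoffProfile ψ) {M : ℝ} (hM0 : 0 ≤ M) (hM : ∀ s, |ψ s| ≤ M)
    (h01 : ∀ x, 0 ≤ χ x ∧ χ x ≤ 1) (hχ1 : ∀ x, Metric.infDist x Γ ≤ 3 * δ / 4 → χ x = 1)
    {ε : ℝ} (hε : 0 < ε) (hε1 : ε ≤ 1) :
    ∀ᵐ x ∂(volume.restrict Ω),
      -∑ i, normalField ψ Ωp Γ δΓ x i *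
          fderiv ℝ (mollifiedQuasiDist φ ε) (interpolant Ωp Γ η Bp Bm ε x)
            (interpolantGrad Ωp Γ η Bp Bm Gp Gm ε i x) ≤
      -∑ i, (fluxCutoff ψ Ωp Γ δΓ χ x • gradient (signedDist Ωp Γ) x) i *
          fderiv ℝ (mollifiedQuasiDist φ ε) (interpolant Ωp Γ η Bp Bm ε x)
            (interpolantGrad Ωp Γ η Bp Bm Gp Gm ε i x) +
        8 * M * ε * (1 + slope Gp Gm x ^ 2) := by
  filter_upwards [hB.ae_side h] with x hx
  by_cases hx34 : Metric.infDist x Γ ≤ 3 * δ / 4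
  · rw [normalField_eq_of_cutoff_eq_one (hχ1 x hx34)]
    have : 0 ≤ 8 * M * ε * (1 + slope Gp Gm x ^ 2) := by positivity
    linarith
  · have hxη : x ∉ tsupport η := fun h0 => hx34 (hη.support h0)
    -- Away from the layer the data take orthogonal values, where the mollified quasi-distance has
    -- derivative of order `ε⁵`.
    have hv : ∀ i, |fderiv ℝ (mollifiedQuasiDist φ ε) (interpolant Ωp Γ η Bp Bm ε x)
        (interpolantGrad Ωp Γ η Bp Bm Gp Gm ε i x)| ≤ 8 * ε * (‖Gp i x‖ + ‖Gm i x‖) := by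
      intro i
      have e5 : ε ^ 5 ≤ ε := pow_le_of_le_one hε.le hε1 (by norm_num)
      rcases hx.2 with ⟨h1, h2⟩ | ⟨h1, h2⟩
      · obtain ⟨e1, e2⟩ := interpolant_of_mem_plus (Bp := Bp) (Bm := Bm) (Gp := Gp) (Gm := Gm)
          h h1 hxη ε
        rw [e1, e2]
        refine (abs_fderiv_mollified_orth_le hn hφ hε (Or.inl h2) _).trans ?_
        gcongr
        linarith [norm_nonneg (Gm i x)]
      · obtain ⟨e1, e2⟩ := interpolant_of_mem_minus (Bp := Bp) (Bm := Bm) (Gp := Gp) (Gm := Gm)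
          h h1 hxη ε
        rw [e1, e2]
        refine (abs_fderiv_mollified_orth_le hn hφ hε (Or.inr h2) _).trans ?_
        gcongr
        linarith [norm_nonneg (Gp i x)]
    set v : Fin d → ℝ := fun i => fderiv ℝ (mollifiedQuasiDist φ ε)
      (interpolant Ωp Γ η Bp Bm ε x) (interpolantGrad Ωp Γ η Bp Bm Gp Gm ε i x)
    have hdiff : |∑ i, (normalField ψ Ωp Γ δΓ x i
        - (fluxCutoff ψ Ωp Γ δΓ χ x • gradient (signedDist Ωp Γ) x) i) * v i| ≤
        M * (8 * ε * slope Gp Gm x) := by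
      refine (Finset.abs_sum_le_sum_abs _ _).trans ?_
      rw [slope, Finset.mul_sum, Finset.mul_sum]
      refine Finset.sum_le_sum fun i _ => ?_
      rw [abs_mul]
      exact mul_le_mul (hψ.abs_normalField_sub_le h hM0 hM h01 x i) (hv i) (abs_nonneg _) hM0
    simp only [sub_mul, Finset.sum_sub_distrib] at hdiff
    have h1 := neg_abs_le (∑ i, normalField ψ Ωp Γ δΓ x i * v i
      - ∑ i, (fluxCutoff ψ Ωp Γ δΓ χ x • gradient (signedDist Ωp Γ) x) i * v i)
    have h2 : M * (8 * ε * slope Gp Gm x) ≤ 8 * M * ε * (1 + slope Gp Gm x ^ 2) := by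
      have : slope Gp Gm x ≤ 1 + slope Gp Gm x ^ 2 := by nlinarith [sq_nonneg (slope Gp Gm x - 1)]
      calc _ = 8 * M * ε * slope Gp Gm x := by ring
        _ ≤ _ := by gcongr
    change -∑ i, _ * v i ≤ -∑ i, _ * v i + _
    linarith

/-- The defect of the cut-off normal field from unit length is negligible in the layer. -/
theorem IsCutoffProfile.layer_le (hψ : IsCutoffProfile ψ) (h : TubeSetting Ω Ωp Ωm Γ δΓ)
    (hδ2 : δ < δΓ / 2) {ε : ℝ} (hε : 0 < ε) {x : Euc d} (hx : x ∈ nbhd Γ δ) (hχ : χ x = 1) :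
    8 * layerWeight Ωp Γ ε x ^ 2 / ε ≤
      fluxCutoff ψ Ωp Γ δΓ χ x * (8 * layerWeight Ωp Γ ε x ^ 2 / ε) + 8 / δΓ ^ 2 * ε := by
  have hδΓ := h.radius.pos
  -- The requirement `δ < δΓ/2` places the tube in the range of the quadratic lower bound for `ψ`.
  have hs : |signedDist Ωp Γ x / δΓ| < 1 / 2 := by
    rw [abs_div, abs_signedDist, abs_of_pos hδΓ, div_lt_iff₀ hδΓ]
    have : Metric.infDist x Γ < δ := hx
    linarith
  have h1 := hψ.lower _ hs
  have h2 : signedDist Ωp Γ x ^ 2 * layerWeight Ωp Γ ε x ≤ ε ^ 2 := by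
    have := sq_mul_weight_le (signedDist Ωp Γ x / ε)
    rw [div_pow, div_mul_eq_mul_div, div_le_one (by positivity)] at this
    exact this
  have hκ := (layerWeight_pos Ωp Γ ε x).le
  have hκ1 := layerWeight_le Ωp Γ ε x
  rw [fluxCutoff, hχ, one_mul]
  set κ := layerWeight Ωp Γ ε x
  -- One factor `κ` absorbs `d²` into `ε²`, the other is at most `1/4`.
  have h3 : 4 * (signedDist Ωp Γ x / δΓ) ^ 2 * (8 * κ ^ 2 / ε) ≤ 8 / δΓ ^ 2 * ε := by
    calc 4 * (signedDist Ωp Γ x / δΓ) ^ 2 * (8 * κ ^ 2 / ε)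
        = 32 / δΓ ^ 2 / ε * (κ * (signedDist Ωp Γ x ^ 2 * κ)) := by field_simp; ring
      _ ≤ 32 / δΓ ^ 2 / ε * (1 / 4 * ε ^ 2) := by gcongr
      _ = 8 / δΓ ^ 2 * ε := by field_simp; ring
  have h4 : (1 - 4 * (signedDist Ωp Γ x / δΓ) ^ 2) * (8 * κ ^ 2 / ε) ≤
      ψ (signedDist Ωp Γ x / δΓ) * (8 * κ ^ 2 / ε) :=
    mul_le_mul_of_nonneg_right h1 (by positivity)
  linarith

end Flux

/-! ### Integration of the estimates. -/

section EnergyBound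

variable {d n : ℕ} {Ω Ωp Ωm Γ : Set (Euc d)} {δΓ δ : ℝ} {η : Euc d → ℝ}
  {Bp Bm : Euc d → Mat n} {Gp Gm : Fin d → Euc d → Mat n} {φ : Mat n → ℝ} {ψ : ℝ → ℝ}
  {χ : Euc d → ℝ}

/-- The energy density of the interpolation, written with its explicit gradient. -/
noncomputable def interpolantDensity (ψ : ℝ → ℝ) (Ωp Γ : Set (Euc d)) (δΓ : ℝ) (φ : Mat n → ℝ)
    (η : Euc d → ℝ) (Bp Bm : Euc d → Mat n) (Gp Gm : Fin d → Euc d → Mat n) (ε : ℝ)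
    (x : Euc d) : ℝ :=
  ε / 2 * ∑ i, ‖interpolantGrad Ωp Γ η Bp Bm Gp Gm ε i x‖ ^ 2 +
    1 / ε * (potential (interpolant Ωp Γ η Bp Bm ε x) + ε ^ 4) -
    ∑ i, normalField ψ Ωp Γ δΓ x i *
      fderiv ℝ (mollifiedQuasiDist φ ε) (interpolant Ωp Γ η Bp Bm ε x)
        (interpolantGrad Ωp Γ η Bp Bm Gp Gm ε i x)

theorem OverlapPair.hasWeakGrad_mollified (hB : OverlapPair Ωp Ωm Γ δ Bp Bm Gp Gm)
    (h : TubeSetting Ω Ωp Ωm Γ δΓ) (hδ0 : 0 < δ) (hδ : δ < δΓ) (hη : IsLayerCutoff Γ δ η)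
    (hn : 1 ≤ n) (hφ : IsMollifier φ) {ε : ℝ} (hε : 0 < ε) :
    HasWeakGrad Ω (fun x => mollifiedQuasiDist φ ε (interpolant Ωp Γ η Bp Bm ε x))
      (fun i x => fderiv ℝ (mollifiedQuasiDist φ ε) (interpolant Ωp Γ η Bp Bm ε x)
        (interpolantGrad Ωp Γ η Bp Bm Gp Gm ε i x)) :=
  (h.hasWeakGrad_interpolant hδ0 hδ hη hB ε).comp_contDiff h.isOpen
    (hB.ae_norm_interpolant_le h hδ0 hη ε) (contDiff_mollified hn hφ hε)

/-- Trades both chosen weak gradients for explicit ones: that of the data, and that of the mollified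
quasi-distance by the chain rule. -/
theorem OverlapPair.energyDensity_ae_eq (hB : OverlapPair Ωp Ωm Γ δ Bp Bm Gp Gm)
    (h : TubeSetting Ω Ωp Ωm Γ δΓ) (hδ0 : 0 < δ) (hδ : δ < δΓ) (hη : IsLayerCutoff Γ δ η)
    (hn : 1 ≤ n) (hφ : IsMollifier φ) {ε : ℝ} (hε : 0 < ε) :
    energyDensity Ω (normalField ψ Ωp Γ δΓ) φ ε (interpolant Ωp Γ η Bp Bm ε)
      =ᵐ[volume.restrict Ω] interpolantDensity ψ Ωp Γ δΓ φ η Bp Bm Gp Gm ε := by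
  have h1 := ae_all_iff.2 fun i =>
    (h.hasWeakGrad_interpolant hδ0 hδ hη hB ε).weakGrad_eq h.isOpen i
  have h2 := ae_all_iff.2 fun i =>
    (hB.hasWeakGrad_mollified h hδ0 hδ hη hn hφ hε).weakGrad_eq h.isOpen i
  filter_upwards [h1, h2] with x h1 h2
  simp only [energyDensity, interpolantDensity, h1, h2]

theorem continuous_potential : Continuous (potential : Mat n → ℝ) := by
  have h1 : Continuous fun A : Mat n => A * A.transpose - 1 := by fun_prop
  exact continuous_const.mul (h1.norm.pow 2)

theorem TubeSetting.measurable_normalField (h : TubeSetting Ω Ωp Ωm Γ δΓ)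
    (hψ : IsCutoffProfile ψ) (i : Fin d) : Measurable fun x => normalField ψ Ωp Γ δΓ x i := by
  have hd : Measurable (signedDist Ωp Γ) :=
    measurable_signedDist h.interface.isOpen_plus.measurableSet
  have h1 : Measurable fun x => gradient (signedDist Ωp Γ) x i := by
    simp only [← fderiv_eq_gradient]
    exact measurable_fderiv_apply_const ℝ _ _
  exact (hψ.smooth.continuous.measurable.comp (hd.div_const δΓ)).mul h1

theorem OverlapPair.integrable_interpolantDensity (hB : OverlapPair Ωp Ωm Γ δ Bp Bm Gp Gm)
    (h : TubeSetting Ω Ωp Ωm Γ δΓ) (hΩ : volume Ω ≠ ⊤) (hδ0 : 0 < δ) (hδ : δ < δΓ)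
    (hη : IsLayerCutoff Γ δ η) (hn : 1 ≤ n) (hφ : IsMollifier φ) (hψ : IsCutoffProfile ψ) {ε : ℝ}
    (hε : 0 < ε) :
    IntegrableOn (interpolantDensity ψ Ωp Γ δΓ φ η Bp Bm Gp Gm ε) Ω := by
  have : IsFiniteMeasure (volume.restrict Ω) := ⟨by
    rw [Measure.restrict_apply_univ]; exact hΩ.lt_top⟩
  have hG := fun i => hB.memLp_interpolantGrad h hΩ hδ0 hδ hη hε i
  have hA := (h.hasWeakGrad_interpolant hδ0 hδ hη hB ε).1.aestronglyMeasurable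
  obtain ⟨M, hM0, hM⟩ := hψ.exists_le
  refine (((integrable_finsetSum _ fun i _ => (hG i).norm.integrable_sq).const_mul (ε / 2)).add
    (Integrable.const_mul ?_ (1 / ε))).sub (integrable_finsetSum _ fun i _ => ?_)
  · refine Integrable.add ?_ (integrable_const _)
    obtain ⟨K, hK⟩ := (isCompact_closedBall (0 : Mat n) (Real.sqrt n)).exists_bound_of_continuousOn
      continuous_potential.continuousOn
    refine Integrable.mono' (integrable_const K)
      (continuous_potential.comp_aestronglyMeasurable hA) ?_
    filter_upwards [hB.ae_norm_interpolant_le h hδ0 hη ε] with x hx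
    exact hK _ (mem_closedBall_zero_iff.2 hx)
  · refine Integrable.bdd_mul (c := M) ?_ (h.measurable_normalField hψ i).aestronglyMeasurable ?_
    · refine Integrable.mono' (g := fun x =>
        4 * ‖interpolantGrad Ωp Γ η Bp Bm Gp Gm ε i x‖)
        (((hG i).norm.integrable (by norm_num)).const_mul 4)
        ((hB.hasWeakGrad_mollified h hδ0 hδ hη hn hφ hε).2.1 i).aestronglyMeasurable
        (Eventually.of_forall fun x => abs_fderiv_mollified_le hn hφ hε _ _)
    · refine Eventually.of_forall fun x => ?_
      have := hψ.abs_normalField_sub_le h hM0 hM (χ := fun _ => 0) (fun _ => by simp) x i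
      simpa [fluxCutoff] using this

/-- The flux of the interpolation through the cut-off normal field compensates twice the energy
of the optimal profile. -/
theorem OverlapPair.exists_flux_le (hB : OverlapPair Ωp Ωm Γ δ Bp Bm Gp Gm)
    (h : TubeSetting Ω Ωp Ωm Γ δΓ) (hδ0 : 0 < δ) (hδ : δ < δΓ) (hη : IsLayerCutoff Γ δ η)
    (hn : 1 ≤ n) (hφ : IsMollifier φ) {β : Euc d → ℝ} (hβ : ContDiff ℝ ∞ β)
    (hs : tsupport β ⊆ {x | Metric.infDist x Γ ≤ 7 * δ / 8}) :
    ∃ C : ℝ, 0 ≤ C ∧ ∀ ε : ℝ, 0 < ε → ε ≤ 1 →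
      IntegrableOn (fun x => β x * (8 * layerWeight Ωp Γ ε x ^ 2 / ε)) Ω ∧
      IntegrableOn (fun x => ∑ i, (β x • gradient (signedDist Ωp Γ) x) i *
          fderiv ℝ (mollifiedQuasiDist φ ε) (interpolant Ωp Γ η Bp Bm ε x)
            (interpolantGrad Ωp Γ η Bp Bm Gp Gm ε i x)) Ω ∧
      (∫ x in Ω, β x * (8 * layerWeight Ωp Γ ε x ^ 2 / ε)) -
        (∫ x in Ω, ∑ i, (β x • gradient (signedDist Ωp Γ) x) i *
          fderiv ℝ (mollifiedQuasiDist φ ε) (interpolant Ωp Γ η Bp Bm ε x)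
            (interpolantGrad Ωp Γ η Bp Bm Gp Gm ε i x)) ≤ C * ε := by
  have hbδ : 7 * δ / 8 < δΓ := by linarith
  obtain ⟨c1, c2, c3⟩ := h.contDiff_cutoff_normal (Ωp := Ωp) hβ hbδ hs
  set X := fun x => β x • gradient (signedDist Ωp Γ) x with hX
  have hβc : HasCompactSupport β :=
    (h.isCompact_closedNbhd _).of_isClosed_subset (isClosed_tsupport _) hs
  have hsub : {x | Metric.infDist x Γ ≤ 7 * δ / 8} ⊆ Ω :=
    (closedNbhd_subset hbδ).trans h.nbhd_subset
  have hsubδ : ∀ x, Metric.infDist x Γ ≤ 7 * δ / 8 → x ∈ nbhd Γ δ := fun x hx =>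
    lt_of_le_of_lt hx (by linarith)
  obtain ⟨χ', hχ', h01', h1', -, hs'⟩ := h.exists_cutoff (show 0 < 7 * δ / 8 by linarith)
    (show 7 * δ / 8 < δ by linarith) hδ
  have hc' : HasCompactSupport χ' :=
    (h.isCompact_closedNbhd _).of_isClosed_subset (isClosed_tsupport _) hs'
  obtain ⟨C₂, hC₂, hw⟩ := h.exists_integral_weight_le (Ωp := Ωp) hχ' hδ hs'
  obtain ⟨K, hK⟩ := (hasCompactSupport_divergence c2).exists_bound_of_continuous
    (continuous_divergence c1)
  have hK0 : 0 ≤ K := (norm_nonneg _).trans (hK 0)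
  have hI : 0 ≤ ∫ x, χ' x := integral_nonneg fun x => (h01' x).1
  set c := 16 * Real.sqrt n + 6 with hc
  refine ⟨K * (4 * (∫ x, χ' x) + c * C₂), by positivity, fun ε hε hε1 => ?_⟩
  have hv := hB.hasWeakGrad_mollified h hδ0 hδ hη hn hφ hε
  have hibp := hv.integral_divergence c1 c2 (c3.trans hsub)
  have hprof := h.integral_profile hβ hbδ hs (contDiff_profileFlux.of_le (by simp))
    hasDerivAt_profileFlux ε
  have hdts : tsupport (divergence X) ⊆ {x | Metric.infDist x Γ ≤ 7 * δ / 8} := by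
    refine (closure_minimal (fun x hx => ?_) (isClosed_tsupport X)).trans c3
    by_contra h0
    exact hx (divergence_eq_zero h0)
  set v : Euc d → ℝ := fun x => mollifiedQuasiDist φ ε (interpolant Ωp Γ η Bp Bm ε x) with hvdef
  set W : Fin d → Euc d → ℝ := fun i x => fderiv ℝ (mollifiedQuasiDist φ ε)
    (interpolant Ωp Γ η Bp Bm ε x) (interpolantGrad Ωp Γ η Bp Bm Gp Gm ε i x) with hW
  have i1 : Integrable fun x => divergence X x * v x :=
    integrable_smul_of_locallyIntegrableOn hv.1 (continuous_divergence c1)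
      (hasCompactSupport_divergence c2) (hdts.trans hsub)
  have i2 : Integrable fun x => ∑ i, X x i * W i x :=
    integrable_finsetSum _ fun i _ => integrable_smul_of_locallyIntegrableOn (hv.2.1 i)
      (contDiff_coord c1 i).continuous
      (c2.of_isClosed_subset (isClosed_tsupport _) (tsupport_coord_subset X i))
      ((tsupport_coord_subset X i).trans (c3.trans hsub))
  have hmd : Measurable (signedDist Ωp Γ) :=
    measurable_signedDist h.interface.isOpen_plus.measurableSet
  have i3 : Integrable fun x => divergence X x * profileFlux (signedDist Ωp Γ x / ε) := by
    refine ((continuous_divergence c1).integrable_of_hasCompactSupport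
      (hasCompactSupport_divergence c2)).mul_bdd (c := 3)
      (contDiff_profileFlux.continuous.measurable.comp (hmd.div_const ε)).aestronglyMeasurable
      (Eventually.of_forall fun x => ?_)
    obtain ⟨f0, f1, -⟩ := profileFlux_mem (signedDist Ωp Γ x / ε)
    rw [Real.norm_of_nonneg f0]
    linarith [profile_lt_one (signedDist Ωp Γ x / ε)]
  have i4 : Integrable fun x => β x * (8 * layerWeight Ωp Γ ε x ^ 2 / ε) := by
    refine (hβ.continuous.integrable_of_hasCompactSupport hβc).mul_bdd (c := 8 / ε)
      ((((h.measurable_layerWeight ε).pow_const 2).const_mul 8).div_const ε).aestronglyMeasurable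
      (Eventually.of_forall fun x => ?_)
    have h0 := (layerWeight_pos Ωp Γ ε x).le
    have h1 := layerWeight_le Ωp Γ ε x
    rw [Real.norm_of_nonneg (by positivity)]
    have h2 : layerWeight Ωp Γ ε x ^ 2 ≤ 1 := pow_le_one₀ h0 (by linarith)
    gcongr
    linarith
  refine ⟨i4.integrableOn, i2.integrableOn, ?_⟩
  have hoff : ∀ x, x ∉ Ω → β x = 0 := fun x hx =>
    image_eq_zero_of_notMem_tsupport fun h0 => hx (hsub (hs h0))
  have e4 : ∫ x in Ω, β x * (8 * layerWeight Ωp Γ ε x ^ 2 / ε)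
      = ∫ x, β x * (8 * layerWeight Ωp Γ ε x ^ 2 / ε) :=
    setIntegral_eq_integral_of_forall_compl_eq_zero fun x hx => by rw [hoff x hx, zero_mul]
  have e2 : ∫ x in Ω, ∑ i, X x i * W i x = ∫ x, ∑ i, X x i * W i x :=
    setIntegral_eq_integral_of_forall_compl_eq_zero fun x hx => by
      simp [hX, hoff x hx]
  change (∫ x in Ω, β x * (8 * layerWeight Ωp Γ ε x ^ 2 / ε)) -
    (∫ x in Ω, ∑ i, X x i * W i x) ≤ _
  rw [e4, e2]
  -- Both integrals are integrated by parts against the same field. The singular factor `1/ε`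
  -- disappears and only a difference of function values is left.
  have e5 : (∫ x, β x * (8 * layerWeight Ωp Γ ε x ^ 2 / ε)) - (∫ x, ∑ i, X x i * W i x)
      = ∫ x, (divergence X x * v x - divergence X x * profileFlux (signedDist Ωp Γ x / ε)) := by
    rw [integral_sub i1 i3, hibp, hprof]
    simp only [layerWeight]
    ring
  rw [e5]
  have i5 : Integrable χ' := hχ'.continuous.integrable_of_hasCompactSupport hc'
  have i6 : Integrable fun x => χ' x * layerWeight Ωp Γ ε x := h.integrable_weight hχ' hc' ε
  -- The difference is `O(ε⁵ + κ)`, and `κ` integrates to `O(ε)` over the tube.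
  have hpt : ∀ᵐ x, divergence X x * v x
      - divergence X x * profileFlux (signedDist Ωp Γ x / ε) ≤
      K * (4 * ε * χ' x + c * (χ' x * layerWeight Ωp Γ ε x)) := by
    have hae := (ae_restrict_iff' h.isOpen.measurableSet).1
      (hB.ae_abs_mollified_sub_le h hη hn hφ hε)
    filter_upwards [hae] with x hx
    have hκ := (layerWeight_pos Ωp Γ ε x).le
    by_cases hxb : Metric.infDist x Γ ≤ 7 * δ / 8
    · rw [h1' x hxb, ← mul_sub, mul_one, one_mul]
      refine (le_abs_self _).trans ?_
      rw [abs_mul]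
      refine mul_le_mul (hK x) ((hx (hsub hxb) (hsubδ x hxb)).trans ?_) (abs_nonneg _) hK0
      have e6 : ε ^ 5 ≤ ε := pow_le_of_le_one hε.le hε1 (by norm_num)
      linarith
    · rw [divergence_eq_zero fun h0 => hxb (c3 h0), zero_mul, zero_mul, sub_zero]
      have := (h01' x).1
      positivity
  calc _ ≤ ∫ x, K * (4 * ε * χ' x + c * (χ' x * layerWeight Ωp Γ ε x)) :=
        integral_mono_ae (i1.sub i3) (((i5.const_mul _).add (i6.const_mul _)).const_mul K) hpt
    _ = K * (4 * ε * (∫ x, χ' x) + c * ∫ x, χ' x * layerWeight Ωp Γ ε x) := by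
        rw [integral_const_mul, integral_add (i5.const_mul _) (i6.const_mul _),
          integral_const_mul, integral_const_mul]
    _ ≤ K * (4 * ε * (∫ x, χ' x) + c * (C₂ * ε)) := by
        gcongr
        exact hw ε hε
    _ = _ := by ring

/-- The modulated energy of the interpolation is of order `ε`. -/
theorem OverlapPair.exists_energy_le (hB : OverlapPair Ωp Ωm Γ δ Bp Bm Gp Gm)
    (h : TubeSetting Ω Ωp Ωm Γ δΓ) (hd : 1 ≤ d) (hΩ : volume Ω ≠ ⊤) (hδ0 : 0 < δ)
    (hδ2 : δ < δΓ / 2) (hη : IsLayerCutoff Γ δ η) (hn : 1 ≤ n) (hφ : IsMollifier φ)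
    (hψ : IsCutoffProfile ψ) :
    ∃ C : ℝ, 0 < C ∧ ∀ ε : ℝ, 0 < ε → ε ≤ 1 →
      IntegrableOn (energyDensity Ω (normalField ψ Ωp Γ δΓ) φ ε
        (interpolant Ωp Γ η Bp Bm ε)) Ω ∧
      modulatedEnergy Ω (normalField ψ Ωp Γ δΓ) φ ε (interpolant Ωp Γ η Bp Bm ε) ≤ C * ε := by
  have hδΓ0 := h.radius.pos
  have hδ : δ < δΓ := by linarith
  have : IsFiniteMeasure (volume.restrict Ω) := ⟨by
    rw [Measure.restrict_apply_univ]; exact hΩ.lt_top⟩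
  -- The nested radii `3δ/4 < 7δ/8 < δ`: the cut-off `χ` is 1 on the support of `η`, and its own
  -- support leaves room inside the tube where the pair lives.
  obtain ⟨χ, hχ, h01, hχ1, hχ0, hs⟩ := h.exists_cutoff (show 0 < 3 * δ / 4 by linarith)
    (show 3 * δ / 4 < 7 * δ / 8 by linarith) (show 7 * δ / 8 < δΓ by linarith)
  obtain ⟨M, hM0, hM⟩ := hψ.exists_le
  set β := fluxCutoff ψ Ωp Γ δΓ χ with hβdef
  have hβ : ContDiff ℝ ∞ β :=
    h.contDiff_mul_profile hχ (show 7 * δ / 8 < δΓ by linarith) hs hψ.smooth δΓ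
  have hβs : tsupport β ⊆ {x | Metric.infDist x Γ ≤ 7 * δ / 8} :=
    (tsupport_mul_subset_left).trans hs
  have hβ0 : ∀ x, 0 ≤ β x := fun x => mul_nonneg (h01 x).1 (hψ.nonneg _)
  obtain ⟨C₁, hC₁, hdens⟩ := hB.exists_density_le h hδ0 hδ hη
  obtain ⟨C₂, hC₂, hflux⟩ := hB.exists_flux_le h hδ0 hδ hη hn hφ hβ hβs
  obtain ⟨C₃, hC₃, hgap⟩ := hB.pairSetting.exists_weighted_gap_le h hd hδ0 hδ hχ h01
    (show 0 < 7 * δ / 8 by linarith) (show 7 * δ / 8 < δ by linarith) hs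
  set C₄ := C₁ + 8 * M + 8 / δΓ ^ 2 + 1 with hC₄
  have hsl : Integrable (fun x => 1 + slope Gp Gm x ^ 2) (volume.restrict Ω) :=
    (integrable_const 1).add (hB.memLp_slope.restrict Ω).integrable_sq
  have hsl0 : 0 ≤ ∫ x in Ω, (1 + slope Gp Gm x ^ 2) := integral_nonneg fun x => by positivity
  refine ⟨C₂ + C₁ * C₃ + C₄ * (∫ x in Ω, (1 + slope Gp Gm x ^ 2)) + 1, by positivity,
    fun ε hε hε1 => ?_⟩
  have heq := hB.energyDensity_ae_eq (ψ := ψ) h hδ0 hδ hη hn hφ hε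
  have hint := hB.integrable_interpolantDensity (ψ := ψ) h hΩ hδ0 hδ hη hn hφ hψ hε
  refine ⟨hint.congr heq.symm, ?_⟩
  rw [modulatedEnergy, integral_congr_ae heq]
  obtain ⟨i1, i2, hle⟩ := hflux ε hε hε1
  set F := fun x => ∑ i, (β x • gradient (signedDist Ωp Γ) x) i *
    fderiv ℝ (mollifiedQuasiDist φ ε) (interpolant Ωp Γ η Bp Bm ε x)
      (interpolantGrad Ωp Γ η Bp Bm Gp Gm ε i x) with hF
  have i3 := hB.pairSetting.integrable_cutoff_gap h hχ h01 (show 7 * δ / 8 < δ by linarith) hs ε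
  -- Pointwise, the density is split into the leading part minus the flux, whose integral nearly
  -- cancels, the weighted gap over `ε`, and `ε` times an integrable function.
  have hpt : ∀ᵐ x ∂(volume.restrict Ω), interpolantDensity ψ Ωp Γ δΓ φ η Bp Bm Gp Gm ε x ≤
      (β x * (8 * layerWeight Ωp Γ ε x ^ 2 / ε) - F x) +
      (C₁ / ε * (χ x * layerWeight Ωp Γ ε x * gap Bp Bm x) +
        C₄ * ε * (1 + slope Gp Gm x ^ 2)) := by
    filter_upwards [hdens ε hε hε1, hB.ae_tube Ω,
      hB.ae_flux_le h hη hn hφ hψ hM0 hM h01 hχ1 hε hε1] with x h1 h2 h3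
    change -∑ i, _ ≤ -F x + _ at h3
    have hκ := (layerWeight_pos Ωp Γ ε x).le
    have hq : 0 ≤ slope Gp Gm x ^ 2 := sq_nonneg _
    have hgap0 : 0 ≤ χ x * layerWeight Ωp Γ ε x * gap Bp Bm x := by
      by_cases hx : x ∈ nbhd Γ δ
      · exact mul_nonneg (mul_nonneg (h01 x).1 hκ) (h2 hx).2.1.1
      · have : χ x = 0 := hχ0 x (by
          have : δ ≤ Metric.infDist x Γ := not_lt.1 hx
          linarith)
        rw [this]; simp
    have hlayer : (nbhd Γ (δ / 2)).indicator (fun x => 8 * layerWeight Ωp Γ ε x ^ 2 / ε +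
        C₁ * (layerWeight Ωp Γ ε x * gap Bp Bm x / ε)) x ≤
        β x * (8 * layerWeight Ωp Γ ε x ^ 2 / ε) +
        C₁ / ε * (χ x * layerWeight Ωp Γ ε x * gap Bp Bm x) + 8 / δΓ ^ 2 * ε := by
      by_cases hx : x ∈ nbhd Γ (δ / 2)
      · have hx' : Metric.infDist x Γ < δ / 2 := hx
        have hχx := hχ1 x (by linarith)
        rw [indicator_of_mem hx]
        have e1 := hψ.layer_le h hδ2 hε (nbhd_mono Γ (by linarith) hx) hχx
        have e2 : C₁ / ε * (χ x * layerWeight Ωp Γ ε x * gap Bp Bm x)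
            = C₁ * (layerWeight Ωp Γ ε x * gap Bp Bm x / ε) := by rw [hχx]; ring
        rw [e2]
        linarith
      · rw [indicator_of_notMem hx]
        have := hβ0 x
        positivity
    -- The added constant `ε⁴` in the potential contributes only `ε³`.
    have e4 : 1 / ε * ε ^ 4 ≤ ε := by
      calc 1 / ε * ε ^ 4 = ε ^ 3 := by field_simp
        _ ≤ ε := pow_le_of_le_one hε.le hε1 (by norm_num)
    have e5 : 8 / δΓ ^ 2 * ε + ε ≤ (8 / δΓ ^ 2 + 1) * ε * (1 + slope Gp Gm x ^ 2) := by
      have : 0 ≤ (8 / δΓ ^ 2 + 1) * ε * slope Gp Gm x ^ 2 := by positivity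
      linarith
    have e6 : C₄ * ε * (1 + slope Gp Gm x ^ 2) = C₁ * ε * (1 + slope Gp Gm x ^ 2) +
        8 * M * ε * (1 + slope Gp Gm x ^ 2) +
        (8 / δΓ ^ 2 + 1) * ε * (1 + slope Gp Gm x ^ 2) := by rw [hC₄]; ring
    rw [interpolantDensity, mul_add (1 / ε), e6]
    linarith
  have i4 : Integrable (fun x => C₁ / ε * (χ x * layerWeight Ωp Γ ε x * gap Bp Bm x))
      (volume.restrict Ω) := i3.integrableOn.const_mul _
  have i5 : Integrable (fun x => C₄ * ε * (1 + slope Gp Gm x ^ 2)) (volume.restrict Ω) :=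
    hsl.const_mul _
  have i45 : Integrable (fun x => C₁ / ε * (χ x * layerWeight Ωp Γ ε x * gap Bp Bm x) +
      C₄ * ε * (1 + slope Gp Gm x ^ 2)) (volume.restrict Ω) := i4.add i5
  have i12 : Integrable (fun x => β x * (8 * layerWeight Ωp Γ ε x ^ 2 / ε) - F x)
      (volume.restrict Ω) := Integrable.sub i1 i2
  have hgapΩ : ∫ x in Ω, χ x * layerWeight Ωp Γ ε x * gap Bp Bm x
      = ∫ x, χ x * layerWeight Ωp Γ ε x * gap Bp Bm x := by
    refine setIntegral_eq_integral_of_forall_compl_eq_zero fun x hx => ?_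
    have : χ x = 0 := image_eq_zero_of_notMem_tsupport fun h0 =>
      hx (h.nbhd_subset (closedNbhd_subset (show 7 * δ / 8 < δΓ by linarith) (hs h0)))
    rw [this]; simp
  calc _ ≤ ∫ x in Ω, ((β x * (8 * layerWeight Ωp Γ ε x ^ 2 / ε) - F x) +
        (C₁ / ε * (χ x * layerWeight Ωp Γ ε x * gap Bp Bm x) +
          C₄ * ε * (1 + slope Gp Gm x ^ 2))) := integral_mono_ae hint (i12.add i45) hpt
    _ = ((∫ x in Ω, β x * (8 * layerWeight Ωp Γ ε x ^ 2 / ε)) - (∫ x in Ω, F x)) +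
        (C₁ / ε * (∫ x, χ x * layerWeight Ωp Γ ε x * gap Bp Bm x) +
          C₄ * ε * ∫ x in Ω, (1 + slope Gp Gm x ^ 2)) := by
        rw [integral_add i12 i45, integral_sub i1 i2, integral_add i4 i5, integral_const_mul,
          integral_const_mul, hgapΩ]
    _ ≤ C₂ * ε + (C₁ / ε * (C₃ * ε ^ 2) + C₄ * ε * ∫ x in Ω, (1 + slope Gp Gm x ^ 2)) := by
        gcongr
        exact hgap ε hε
    _ = (C₂ + C₁ * C₃ + C₄ * ∫ x in Ω, (1 + slope Gp Gm x ^ 2)) * ε := by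
        field_simp; ring
    _ ≤ _ := mul_le_mul_of_nonneg_right (by linarith) hε.le

end EnergyBound

/-! ### Reflected extensions of the limiting maps as a pair. -/

section Construction

variable {d n : ℕ} {Ω Ωp Ωm Γ : Set (Euc d)} {δΓ δ : ℝ} {Bp Bm Tp Tm : Euc d → Mat n}

/-- Factor the gap as `(‖P - M‖ + 2)(‖P - M‖ - 2)`. The second factor is bounded by the distances to
the minimal pair, the first by the size of orthogonal matrices. Thus the traces control the means of
the gap. -/
theorem gap_le_norm_sub_add {P M P₀ M₀ : Mat n} (hP : ‖P‖ ≤ Real.sqrt n)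
    (hM : ‖M‖ ≤ Real.sqrt n) (h0 : ‖P₀ - M₀‖ = 2) :
    ‖P - M‖ ^ 2 - 4 ≤ (2 * Real.sqrt n + 2) * (‖P - P₀‖ + ‖M - M₀‖) := by
  have h1 : ‖P - M‖ ≤ 2 * Real.sqrt n := (norm_sub_le _ _).trans (by linarith)
  have h2 : ‖P - M‖ ≤ 2 + (‖P - P₀‖ + ‖M - M₀‖) := by
    have e : P - M = (P₀ - M₀) + ((P - P₀) - (M - M₀)) := by abel
    rw [e, ← h0]
    exact (norm_add_le _ _).trans (by gcongr; exact norm_sub_le _ _)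
  have h3 := norm_nonneg (P - M)
  have h4 : 0 ≤ ‖P - P₀‖ + ‖M - M₀‖ := by positivity
  calc ‖P - M‖ ^ 2 - 4 = (‖P - M‖ + 2) * (‖P - M‖ - 2) := by ring
    _ ≤ (‖P - M‖ + 2) * (‖P - P₀‖ + ‖M - M₀‖) :=
        mul_le_mul_of_nonneg_left (by linarith) (by linarith)
    _ ≤ _ := mul_le_mul_of_nonneg_right (by linarith) h4

/-- The gap of a pair with minimal traces has zero trace. -/
theorem ae_tendsto_gap_mean {Up Um : Set (Euc d)} (hΓ : IsCompact Γ) (hδ0 : 0 < δ)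
    (hUp : nbhd Γ δ ⊆ Up) (hUm : nbhd Γ δ ⊆ Um)
    (hBp : AEStronglyMeasurable Bp (volume.restrict (nbhd Γ δ)))
    (hBm : AEStronglyMeasurable Bm (volume.restrict (nbhd Γ δ)))
    (hp : ∀ᵐ x ∂(volume.restrict (nbhd Γ δ)), Bp x ∈ orthPlus n)
    (hm : ∀ᵐ x ∂(volume.restrict (nbhd Γ δ)), Bm x ∈ orthMinus n)
    (hTp : IsTraceOn Up Γ Bp Tp) (hTm : IsTraceOn Um Γ Bm Tm)
    (hmin : ∀ᵐ x ∂((Measure.hausdorffMeasure ((d : ℝ) - 1) : Measure (Euc d)).restrict Γ),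
      ‖Tp x - Tm x‖ = 2) :
    ∀ᵐ x ∂((Measure.hausdorffMeasure ((d : ℝ) - 1) : Measure (Euc d)).restrict Γ),
      Tendsto (fun r : ℝ => ⨍ y in Metric.ball x r, gap Bp Bm y) (𝓝[>] 0) (𝓝 0) := by
  filter_upwards [hTp, hTm, hmin, ae_restrict_mem hΓ.measurableSet] with x h1 h2 h3 hx
  have hball : ∀ ρ ∈ Ioo 0 δ, Metric.ball x ρ ⊆ nbhd Γ δ := fun ρ hρ y hy =>
    ((Metric.infDist_le_dist_of_mem hx).trans_lt hy).trans hρ.2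
  have hlim := (h1.add h2).const_mul (2 * Real.sqrt n + 2)
  rw [add_zero, mul_zero] at hlim
  refine tendsto_of_tendsto_of_tendsto_of_le_of_le' tendsto_const_nhds hlim ?_ ?_
  · filter_upwards [Ioo_mem_nhdsGT hδ0] with ρ hρ
    rw [setAverage_eq]
    refine smul_nonneg (by positivity) (integral_nonneg_of_ae ?_)
    filter_upwards [ae_restrict_of_ae_restrict_of_subset (hball ρ hρ) hp,
      ae_restrict_of_ae_restrict_of_subset (hball ρ hρ) hm] with y hy1 hy2
    exact sub_nonneg.2 (four_le_norm_sub_sq hy1 hy2)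
  · filter_upwards [Ioo_mem_nhdsGT hδ0] with ρ hρ
    have hsub := hball ρ hρ
    rw [inter_eq_left.2 (hsub.trans hUp), inter_eq_left.2 (hsub.trans hUm)]
    have hp' := ae_restrict_of_ae_restrict_of_subset hsub hp
    have hm' := ae_restrict_of_ae_restrict_of_subset hsub hm
    have m1 := hBp.mono_measure (Measure.restrict_mono hsub le_rfl)
    have m2 := hBm.mono_measure (Measure.restrict_mono hsub le_rfl)
    have : IsFiniteMeasure (volume.restrict (Metric.ball x ρ)) := ⟨by
      rw [Measure.restrict_apply_univ]; exact measure_ball_lt_top⟩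
    have i1 : IntegrableOn (fun y => ‖Bp y - Tp x‖) (Metric.ball x ρ) := by
      refine Integrable.mono' (integrable_const (Real.sqrt n + ‖Tp x‖))
        (m1.sub aestronglyMeasurable_const).norm ?_
      filter_upwards [hp'] with y hy
      rw [norm_norm]
      exact (norm_sub_le _ _).trans (by gcongr; exact norm_orth_le (orthPlus_subset hy).2)
    have i2 : IntegrableOn (fun y => ‖Bm y - Tm x‖) (Metric.ball x ρ) := by
      refine Integrable.mono' (integrable_const (Real.sqrt n + ‖Tm x‖))
        (m2.sub aestronglyMeasurable_const).norm ?_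
      filter_upwards [hm'] with y hy
      rw [norm_norm]
      exact (norm_sub_le _ _).trans (by gcongr; exact norm_orth_le (orthMinus_subset hy).2)
    have hle : ∀ᵐ y ∂(volume.restrict (Metric.ball x ρ)), gap Bp Bm y ≤
        (2 * Real.sqrt n + 2) * (‖Bp y - Tp x‖ + ‖Bm y - Tm x‖) := by
      filter_upwards [hp', hm'] with y hy1 hy2
      exact gap_le_norm_sub_add (norm_orth_le (orthPlus_subset hy1).2)
        (norm_orth_le (orthMinus_subset hy2).2) h3
    have i12 : IntegrableOn (fun y => (2 * Real.sqrt n + 2) *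
        (‖Bp y - Tp x‖ + ‖Bm y - Tm x‖)) (Metric.ball x ρ) := (i1.add i2).const_mul _
    have hint : ∫ y in Metric.ball x ρ, gap Bp Bm y ≤
        (2 * Real.sqrt n + 2) * ((∫ y in Metric.ball x ρ, ‖Bp y - Tp x‖) +
          ∫ y in Metric.ball x ρ, ‖Bm y - Tm x‖) := by
      rw [← integral_add i1 i2, ← integral_const_mul]
      refine integral_mono_of_nonneg ?_ i12 hle
      filter_upwards [hp', hm'] with y hy1 hy2
      exact sub_nonneg.2 (four_le_norm_sub_sq hy1 hy2)
    rw [setAverage_eq, setAverage_eq, setAverage_eq, smul_eq_mul, smul_eq_mul, smul_eq_mul,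
      ← mul_add, mul_left_comm]
    exact mul_le_mul_of_nonneg_left hint (by positivity)

theorem TubeSetting.exists_isLayerCutoff (h : TubeSetting Ω Ωp Ωm Γ δΓ) (hδ0 : 0 < δ)
    (hδ : δ < δΓ) : ∃ η : Euc d → ℝ, IsLayerCutoff Γ δ η := by
  obtain ⟨η, h1, h2, h3, -, h5⟩ := h.exists_cutoff (half_pos hδ0)
    (show δ / 2 < 3 * δ / 4 by linarith) (show 3 * δ / 4 < δΓ by linarith)
  exact ⟨η, h1, h2, fun x hx => h3 x (le_of_lt hx), h5⟩

theorem memLp_indicator_of_restrict {V : Type*} [NormedAddCommGroup V] {U : Set (Euc d)}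
    (hU : IsOpen U) {f : Euc d → V} (hf : MemLp f 2 (volume.restrict U)) :
    MemLp (U.indicator f) 2 volume :=
  (memLp_indicator_iff_restrict hU.measurableSet).2 hf

/-- A gradient set to zero outside its domain remains a gradient there and becomes square integrable
on the whole space, as `OverlapPair` demands. -/
theorem HasWeakGrad.indicator {V : Type*} [NormedAddCommGroup V] [NormedSpace ℝ V]
    {U : Set (Euc d)} (hU : IsOpen U) {u : Euc d → V} {G : Fin d → Euc d → V}
    (h : HasWeakGrad U u G) : HasWeakGrad U u fun i => U.indicator (G i) :=
  h.congr ae_eq_rfl fun i => by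
    filter_upwards [ae_restrict_mem hU.measurableSet] with x hx
    rw [indicator_of_mem hx]

/-- The reflected extensions of two maps with minimal traces form a pair. -/
theorem TubeSetting.exists_overlapPair (h : TubeSetting Ω Ωp Ωm Γ δΓ) (hδ0 : 0 < δ) (hδ : δ < δΓ)
    {Ap Am : Euc d → Mat n} (hAp : MemH1 Ωp Ap) (hAm : MemH1 Ωm Am)
    (hp : ∀ᵐ x ∂(volume.restrict Ωp), Ap x ∈ orthPlus n)
    (hm : ∀ᵐ x ∂(volume.restrict Ωm), Am x ∈ orthMinus n)
    (hTp : IsTraceOn Ωp Γ Ap Tp) (hTm : IsTraceOn Ωm Γ Am Tm)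
    (hmin : ∀ᵐ x ∂((Measure.hausdorffMeasure ((d : ℝ) - 1) : Measure (Euc d)).restrict Γ),
      ‖Tp x - Tm x‖ = 2) :
    ∃ Gp Gm : Fin d → Euc d → Mat n,
      OverlapPair Ωp Ωm Γ δ (reflExt Ωp Γ Ap) (reflExt Ωm Γ Am) Gp Gm := by
  obtain ⟨hLp, Gp, hGp, hGp2⟩ := hAp
  obtain ⟨hLm, Gm, hGm, hGm2⟩ := hAm
  have hnp := hp.mono fun x hx => norm_orth_le (orthPlus_subset hx).2
  have hnm := hm.mono fun x hx => norm_orth_le (orthMinus_subset hx).2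
  have hUp := h.interface.isOpen_plus.union (isOpen_nbhd Γ δ)
  have hUm := h.interface.isOpen_minus.union (isOpen_nbhd Γ δ)
  have gp := h.hasWeakGrad_reflExt hδ hLp hGp2 hnp hGp
  have gm := h.symm.hasWeakGrad_reflExt hδ hLm hGm2 hnm hGm
  have op := h.ae_reflExt hδ hp
  have om := h.symm.ae_reflExt hδ hm
  exact ⟨_, _, {
    grad_plus := gp.indicator hUp
    grad_minus := gm.indicator hUm
    memLp_plus := fun i => memLp_indicator_of_restrict hUp (h.memLp_reflGrad hδ hGp2 i)
    memLp_minus := fun i => memLp_indicator_of_restrict hUm (h.symm.memLp_reflGrad hδ hGm2 i)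
    orth_plus := op
    orth_minus := om
    gap_trace := ae_tendsto_gap_mean h.interface.isCompact hδ0 subset_union_right
      subset_union_right
      ((gp.mono subset_union_right).1.aestronglyMeasurable)
      ((gm.mono subset_union_right).1.aestronglyMeasurable)
      (ae_restrict_of_ae_restrict_of_subset subset_union_right op)
      (ae_restrict_of_ae_restrict_of_subset subset_union_right om)
      (h.isTraceOn_reflExt hδ0 hδ hLp.1 hnp hTp)
      (h.symm.isTraceOn_reflExt hδ0 hδ hLm.1 hnm hTm) hmin }⟩

end Construction

end AllenCahn

/-! ### Assembly of the well-prepared initial data. -/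

theorem mainTheorem6 {d n : ℕ} (hd : 1 ≤ d) (hn : 1 ≤ n)
    -- the domain, the initial interface and its two sides
    (Ω Ωp Ωm Γ : Set (AllenCahn.Euc d)) (δΓ : ℝ)
    (hΩ : AllenCahn.IsSmoothBoundedDomain Ω)
    (hΓ : AllenCahn.IsSmoothInterface Ω Ωp Ωm Γ)
    (hδΓ : AllenCahn.IsTubularRadius Ω Ωp Γ δΓ)
    -- the cut-off profile and the mollifier in the modulated energy
    (ψ : ℝ → ℝ) (hψ : AllenCahn.IsCutoffProfile ψ)
    (φ : AllenCahn.Mat n → ℝ) (hφ : AllenCahn.IsMollifier φ)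
    (δ : ℝ) (hδ : 0 < δ) (hδ2 : δ < δΓ / 2)
    -- the limiting maps, with their traces on the interface
    (Ap Am Tp Tm : AllenCahn.Euc d → AllenCahn.Mat n)
    (hAp : AllenCahn.MemH1 Ωp Ap) (hAm : AllenCahn.MemH1 Ωm Am)
    (hAp_orth : ∀ᵐ x ∂(volume.restrict Ωp), Ap x ∈ AllenCahn.orthPlus n)
    (hAm_orth : ∀ᵐ x ∂(volume.restrict Ωm), Am x ∈ AllenCahn.orthMinus n)
    (hTp : AllenCahn.IsTraceOn Ωp Γ Ap Tp) (hTm : AllenCahn.IsTraceOn Ωm Γ Am Tm)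
    (hmin : ∀ᵐ x ∂((Measure.hausdorffMeasure ((d : ℝ) - 1) :
      Measure (AllenCahn.Euc d)).restrict Γ), ‖Tp x - Tm x‖ = 2) :
    ∃ (C : ℝ) (A : ℝ → AllenCahn.Euc d → AllenCahn.Mat n), 0 < C ∧
      (∀ ε : ℝ, 0 < ε → ε ≤ 1 →
        AllenCahn.MemH1 Ω (A ε) ∧
        MemLp (A ε) ⊤ (volume.restrict Ω) ∧
        (∀ᵐ x ∂(volume.restrict (Ωp \ AllenCahn.tube Ω Ωp Γ (2 * δ))), A ε x = Ap x) ∧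
        (∀ᵐ x ∂(volume.restrict (Ωm \ AllenCahn.tube Ω Ωp Γ (2 * δ))), A ε x = Am x) ∧
        IntegrableOn (AllenCahn.energyDensity Ω (AllenCahn.normalField ψ Ωp Γ δΓ) φ ε (A ε)) Ω ∧
        AllenCahn.modulatedEnergy Ω (AllenCahn.normalField ψ Ωp Γ δΓ) φ ε (A ε) ≤ C * ε) ∧
      -- `A ε` interpolates between extensions `Bp`, `Bm` of the limiting maps across the interface
      ∃ (Bp Bm : AllenCahn.Euc d → AllenCahn.Mat n) (η : AllenCahn.Euc d → ℝ),
        AllenCahn.MemH1 (Ωp ∪ AllenCahn.tube Ω Ωp Γ δ) Bp ∧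
        AllenCahn.MemH1 (Ωm ∪ AllenCahn.tube Ω Ωp Γ δ) Bm ∧
        (∀ᵐ x ∂(volume.restrict (Ωp ∪ AllenCahn.tube Ω Ωp Γ δ)), Bp x ∈ AllenCahn.orthPlus n) ∧
        (∀ᵐ x ∂(volume.restrict (Ωm ∪ AllenCahn.tube Ω Ωp Γ δ)), Bm x ∈ AllenCahn.orthMinus n) ∧
        AllenCahn.IsTraceOn (Ωp ∪ AllenCahn.tube Ω Ωp Γ δ) Γ Bp Tp ∧
        AllenCahn.IsTraceOn (Ωm ∪ AllenCahn.tube Ω Ωp Γ δ) Γ Bm Tm ∧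
        ContDiff ℝ ∞ η ∧ (∀ x, 0 ≤ η x ∧ η x ≤ 1) ∧
        tsupport η ⊆ AllenCahn.tube Ω Ωp Γ δ ∧
        (∀ x ∈ AllenCahn.tube Ω Ωp Γ (δ / 2), η x = 1) ∧
        ∀ ε : ℝ, 0 < ε → ε ≤ 1 → ∀ᵐ x ∂(volume.restrict Ω),
          A ε x = (1 - AllenCahn.interpolationProfile Ωp Γ η ε x) • Bm x
            + AllenCahn.interpolationProfile Ωp Γ η ε x • Bp x := by
  have h : AllenCahn.TubeSetting Ω Ωp Ωm Γ δΓ := ⟨hΩ.isOpen, hΓ, hδΓ⟩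
  have hδΓ0 := hδΓ.pos
  have hδ1 : δ < δΓ := by linarith
  have hvol : volume Ω ≠ ⊤ := hΩ.isBounded.measure_lt_top.ne
  have : IsFiniteMeasure (volume.restrict Ω) := ⟨by
    rw [Measure.restrict_apply_univ]; exact hvol.lt_top⟩
  obtain ⟨η, hη⟩ := h.exists_isLayerCutoff hδ hδ1
  obtain ⟨Gp, Gm, hB⟩ := h.exists_overlapPair hδ hδ1 hAp hAm hAp_orth hAm_orth hTp hTm hmin
  obtain ⟨C, hC, hE⟩ := hB.exists_energy_le h hd hvol hδ hδ2 hη hn hφ hψ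
  have hnp := hAp_orth.mono fun x hx => AllenCahn.norm_orth_le (AllenCahn.orthPlus_subset hx).2
  have hnm := hAm_orth.mono fun x hx => AllenCahn.norm_orth_le (AllenCahn.orthMinus_subset hx).2
  have htube : AllenCahn.tube Ω Ωp Γ δ = AllenCahn.nbhd Γ δ := h.tube_eq hδ1.le
  -- The modification happens inside the support of `η`, hence inside the smaller tube of radius
  -- `δ`.
  have hout : ∀ x, x ∈ Ω → x ∉ AllenCahn.tube Ω Ωp Γ (2 * δ) → x ∉ tsupport η := by
    intro x _ hx hxη
    rw [h.tube_eq (by linarith)] at hx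
    exact hx (AllenCahn.nbhd_mono Γ (by linarith) (hη.mem_nbhd hδ hxη))
  have hΩp : Ωp ⊆ Ω := by
    rw [← hΓ.union_eq]; exact fun x hx => Or.inl (Or.inl hx)
  have hΩm : Ωm ⊆ Ω := by
    rw [← hΓ.union_eq]; exact fun x hx => Or.inr hx
  have htm : MeasurableSet (AllenCahn.tube Ω Ωp Γ (2 * δ)) := by
    rw [h.tube_eq (by linarith)]; exact (AllenCahn.isOpen_nbhd Γ _).measurableSet
  refine ⟨C, AllenCahn.interpolant Ωp Γ η (AllenCahn.reflExt Ωp Γ Ap)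
    (AllenCahn.reflExt Ωm Γ Am), hC, fun ε hε hε1 => ?_, AllenCahn.reflExt Ωp Γ Ap,
    AllenCahn.reflExt Ωm Γ Am, η, ?_, ?_, ?_, ?_, ?_, ?_, hη.smooth, hη.mem, ?_, ?_, ?_⟩
  · have hG := h.hasWeakGrad_interpolant hδ hδ1 hη hB ε
    have hbd := hB.ae_norm_interpolant_le h hδ hη ε
    have htop := memLp_top_of_bound hG.1.aestronglyMeasurable _ hbd
    obtain ⟨hE1, hE2⟩ := hE ε hε hε1
    refine ⟨⟨htop.mono_exponent le_top, _, hG, fun i =>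
      hB.memLp_interpolantGrad h hvol hδ hδ1 hη hε i⟩, htop, ?_, ?_, hE1, hE2⟩
    · filter_upwards [ae_restrict_mem (hΓ.isOpen_plus.measurableSet.diff htm)] with x hx
      rw [(AllenCahn.interpolant_of_mem_plus (Gp := Gp) (Gm := Gm) h hx.1
        (hout x (hΩp hx.1) hx.2) ε).1, AllenCahn.reflExt_of_mem hx.1]
    · filter_upwards [ae_restrict_mem (hΓ.isOpen_minus.measurableSet.diff htm)] with x hx
      rw [(AllenCahn.interpolant_of_mem_minus (Gp := Gp) (Gm := Gm) h hx.1
        (hout x (hΩm hx.1) hx.2) ε).1, AllenCahn.reflExt_of_mem hx.1]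
  · rw [htube]; exact h.memH1_reflExt hδ1 hnp hAp
  · rw [htube]; exact h.symm.memH1_reflExt hδ1 hnm hAm
  · rw [htube]; exact hB.orth_plus
  · rw [htube]; exact hB.orth_minus
  · rw [htube]; exact h.isTraceOn_reflExt hδ hδ1 hAp.1.1 hnp hTp
  · rw [htube]; exact h.symm.isTraceOn_reflExt hδ hδ1 hAm.1.1 hnm hTm
  · rw [htube]; exact fun x hx => hη.mem_nbhd hδ hx
  · intro x hx
    rw [h.tube_eq (by linarith)] at hx
    exact hη.eq_one x hx
  · exact fun ε _ _ => Eventually.of_forall fun x => rfl
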